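/- All graphs are finite and simple. A graph is $k$-connected if it has more than $k$ vertices and remains connected after the deletion of any set of fewer than $k$ vertices. For positive integers $i,k$ let $\overline{C^i_k}$ (respectively $\overline{P^i_k}$) be the smallest order (number of vertices) of a planar $k$-connected graph in which every set of $i$ vertices is disjoint from some longest cycle (respectively some longest path); the value is $\infty$ if no such graph exists. Then $$\overline{C^1_3}\leq 40,\qquad \overline{C^2_3}\leq 2625,\qquad \overline{P^1_3}\leq 156,\qquad \overline{P^2_3}\leq 10350.$$ -/

import Mathlib

/-- A drawing of a simple graph in the plane without crossings: vertices are distinct points, every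
edge is a simple (injectively parametrised) arc joining its two ends, an arc contains no vertex
other than its ends, and two distinct arcs meet only in common ends.  The values of `arc` on
unordered pairs that are not edges play no role. -/
structure PlaneDrawing {V : Type*} (G : SimpleGraph V) where
  pos : V → ℝ × ℝ
  arc : Sym2 V → Set (ℝ × ℝ)
  pos_injective : Function.Injective pos
  arc_simple : ∀ u v : V, G.Adj u v →
    ∃ γ : Path (pos u) (pos v), Function.Injective γ ∧ Set.range γ = arc s(u, v)
  arc_vertex : ∀ e ∈ G.edgeSet, ∀ w : V, pos w ∈ arc e → w ∈ e
  arc_inter : ∀ e ∈ G.edgeSet, ∀ f ∈ G.edgeSet, e ≠ f →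
    ∀ p ∈ arc e ∩ arc f, ∃ w : V, w ∈ e ∧ w ∈ f ∧ pos w = p

/-- A graph is planar if it can be drawn in the plane without crossings. -/
def IsPlanarGraph {V : Type*} (G : SimpleGraph V) : Prop :=
  Nonempty (PlaneDrawing G)

/-- `k`-(vertex-)connectedness: more than `k` vertices, and the deletion of fewer than `k` vertices
always leaves a connected graph. -/
def IsKConnected {V : Type*} [Fintype V] (k : ℕ) (G : SimpleGraph V) : Prop :=
  k < Fintype.card V ∧
    ∀ S : Finset V, S.card < k → (G.induce {v : V | v ∉ S}).Connected

/-- `c` is a cycle of maximum length in `G`. -/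
def IsLongestCycle {V : Type*} (G : SimpleGraph V) {v : V} (c : G.Walk v v) : Prop :=
  c.IsCycle ∧ ∀ (w : V) (d : G.Walk w w), d.IsCycle → d.length ≤ c.length

/-- `p` is a path of maximum length in `G`. -/
def IsLongestPath {V : Type*} (G : SimpleGraph V) {u v : V} (p : G.Walk u v) : Prop :=
  p.IsPath ∧ ∀ (x y : V) (q : G.Walk x y), q.IsPath → q.length ≤ p.length

/-- Every set of `i` vertices is disjoint from some longest cycle. -/
def LongestCyclesAvoid {V : Type*} (i : ℕ) (G : SimpleGraph V) : Prop :=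
  ∀ S : Finset V, S.card = i →
    ∃ (v : V) (c : G.Walk v v), IsLongestCycle G c ∧ ∀ x ∈ S, x ∉ c.support

/-- Every set of `i` vertices is disjoint from some longest path. -/
def LongestPathsAvoid {V : Type*} (i : ℕ) (G : SimpleGraph V) : Prop :=
  ∀ S : Finset V, S.card = i →
    ∃ (u v : V) (p : G.Walk u v), IsLongestPath G p ∧ ∀ x ∈ S, x ∉ p.support

/-- The smallest order of a planar `k`-connected graph in which every set of `i` vertices is
disjoint from some longest cycle; it is `⊤` if there is no such graph. -/
noncomputable def planarCycleOrder (i k : ℕ) : ℕ∞ :=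
  ⨅ (n : ℕ) (_ : ∃ G : SimpleGraph (Fin n),
    IsPlanarGraph G ∧ IsKConnected k G ∧ LongestCyclesAvoid i G), (n : ℕ∞)

/-- The smallest order of a planar `k`-connected graph in which every set of `i` vertices is
disjoint from some longest path; it is `⊤` if there is no such graph. -/
noncomputable def planarPathOrder (i k : ℕ) : ℕ∞ :=
  ⨅ (n : ℕ) (_ : ∃ G : SimpleGraph (Fin n),
    IsPlanarGraph G ∧ IsKConnected k G ∧ LongestPathsAvoid i G), (n : ℕ∞)

/-! All four graphs are assembled from two explicit planar graphs that are hypohamiltonian: they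
have no Hamiltonian cycle, but every vertex-deleted subgraph has one. The first has 40 vertices and
gives the bound 40 by itself. Removing one of its cubic vertices leaves the gadget, with 39
vertices, three of which (the neighbours of the removed vertex) are its terminals. The second is a
cubic graph with 70 vertices and 105 edges.

The other graphs arise by substitution. Replacing each vertex of the cubic graph by a gadget, and
identifying two terminals for each edge, gives 105 + 70 * 36 = 2625 vertices. Four gadgets linked
like the vertices of the complete graph on four vertices give 4 * 39 = 156. Four copies of the cubic
graph minus a vertex, linked in the same pattern, form a cubic graph with 276 vertices and 414
edges, and its blow-up has 414 + 276 * 36 = 10350 vertices.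

Upper bounds on lengths. Both small graphs are non-Hamiltonian by Grinberg's criterion modulo three
(`grinberg`, `IsRing.card_lt`): five faces, one in the middle of the other four, are the only ones
whose size is not 2 modulo 3, and a Hamiltonian cycle would have to separate one of these five from
the other four, which the ring around the middle face forbids. Hence a path of the gadget between
two terminals has at most 37 edges (`card_le_of_even_internal`). A cycle of the blow-up lies in a
single gadget or follows a cycle of the cubic graph, so it has at most 69 * 37 edges
(`card_circuit_blow_le`). For four linked copies, a copy containing no end of the path cannot be
traversed completely, and the path has only two ends; this gives `card_path_linked_le` and
`card_path_four_le`. Cycles and paths are treated as edge sets, through parities of degrees and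
minimality.

Long cycles and paths that avoid given vertices. The gadget has paths with 37 edges between
terminals that miss the third terminal, and others of the same length that use the third terminal
and miss a prescribed internal vertex (`HasGadgetPaths`). The cubic graph has a recorded list of
69-cycles such that any two targets, each an edge or a vertex, can be avoided (`avoidable_cubic`); a
target vertex is either missed or traversed by a special gadget path. Gluing these gives cycles of
maximum length (`exists_choice_avoiding`, `exists_isCycle_of_choice`) and, cut open at the removed
vertex and joined through four copies, paths of maximum length (`exists_four_path_avoiding`,
`exists_linked_path`).

Three-connectedness follows from the recorded cycles through vertex-deleted subgraphs, and is
inherited by the substitutions (`connOff_blow`, `connOff_linked`, `cubicConn_termFour`). Planarity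
comes from straight line drawings: the gadget is drawn in a triangle, and affine copies of it are
placed in pairwise non-overlapping triangles (`IsComplex.blow`). All finite data are checked by
kernel evaluation. -/

set_option linter.unusedSectionVars false

section PlanarLongestCycles

open Finset

/-! ### Parity and degrees of edge sets: circuits and acyclic sets -/

namespace EdgeSet

variable {V E : Type*} [Fintype E] [DecidableEq E]

/-- The number of edges of `D` at `v`, where `inc v` is the set of edges at `v`. -/
def deg (inc : V → Finset E) (D : Finset E) (v : V) : ℕ := (D ∩ inc v).card

/-- All degrees are even. -/
def IsEven (inc : V → Finset E) (D : Finset E) : Prop := ∀ v, Even (deg inc D v)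

/-- A minimal nonempty even set of edges with all degrees at most two. -/
structure IsCircuit (inc : V → Finset E) (D : Finset E) : Prop where
  nonempty : D.Nonempty
  even : IsEven inc D
  deg_le : ∀ v, deg inc D v ≤ 2
  minimal : ∀ X ⊆ D, X.Nonempty → IsEven inc X → X = D

/-- The only even subset is the empty one. -/
def IsAcyclic (inc : V → Finset E) (D : Finset E) : Prop := ∀ X ⊆ D, IsEven inc X → X = ∅

theorem deg_sdiff_add (inc : V → Finset E) {X D : Finset E} (h : X ⊆ D) (v : V) :
    deg inc (D \ X) v + deg inc X v = deg inc D v := by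
  unfold deg
  rw [← card_union_of_disjoint]
  · congr 1
    rw [← union_inter_distrib_right, sdiff_union_of_subset h]
  · exact (disjoint_sdiff_self_left.mono inter_subset_left inter_subset_left)

theorem deg_union (inc : V → Finset E) {X Y : Finset E} (h : Disjoint X Y) (v : V) :
    deg inc (X ∪ Y) v = deg inc X v + deg inc Y v := by
  unfold deg
  rw [union_inter_distrib_right, card_union_of_disjoint]
  exact h.mono inter_subset_left inter_subset_left

theorem deg_mono (inc : V → Finset E) {X D : Finset E} (h : X ⊆ D) (v : V) :
    deg inc X v ≤ deg inc D v :=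
  card_le_card (inter_subset_inter_right h)

theorem IsEven.sdiff {inc : V → Finset E} {X D : Finset E} (h : X ⊆ D)
    (hX : IsEven inc X) (hD : IsEven inc D) : IsEven inc (D \ X) := by
  intro v
  have h1 := deg_sdiff_add inc h v
  have h2 := hX v
  have h3 := hD v
  rw [← h1] at h3
  exact (Nat.even_add.1 h3).2 h2

theorem isEven_empty (inc : V → Finset E) : IsEven inc ∅ := by
  intro v; simp [deg]

variable [Fintype V]

/-- The vertices of odd degree. -/
def oddVerts (inc : V → Finset E) (D : Finset E) : Finset V := univ.filter fun v => Odd (deg inc D v)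

theorem isEven_iff_oddVerts (inc : V → Finset E) (D : Finset E) :
    IsEven inc D ↔ oddVerts inc D = ∅ := by
  simp [IsEven, oddVerts, filter_eq_empty_iff]

theorem sum_deg {inc : V → Finset E} (h2 : ∀ e, (univ.filter fun v => e ∈ inc v).card = 2)
    (D : Finset E) : ∑ v, deg inc D v = 2 * D.card := by
  classical
  unfold deg
  have h : ∀ v, (D ∩ inc v).card = ∑ e ∈ D, if e ∈ inc v then 1 else 0 := by
    intro v
    rw [← filter_mem_eq_inter, card_filter]
  simp_rw [h]
  rw [sum_comm]
  have h' : ∀ e ∈ D, (∑ v, if e ∈ inc v then 1 else 0) = 2 := by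
    intro e _
    rw [← card_filter]; exact h2 e
  rw [sum_congr rfl h', sum_const, smul_eq_mul, mul_comm]

theorem even_card_oddVerts {inc : V → Finset E}
    (h2 : ∀ e, (univ.filter fun v => e ∈ inc v).card = 2) (D : Finset E) :
    Even (oddVerts inc D).card := by
  have h := sum_deg h2 D
  have h3 : Even (∑ v, deg inc D v) := by rw [h]; exact even_two_mul _
  rw [Finset.even_sum_iff_even_card_odd] at h3
  exact h3

/-- Degrees at most two bound the number of edges in terms of the number of odd vertices. -/
theorem two_mul_card_add_oddVerts_le {inc : V → Finset E}
    (h2 : ∀ e, (univ.filter fun v => e ∈ inc v).card = 2) {D : Finset E}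
    (hD : ∀ v, deg inc D v ≤ 2) :
    2 * D.card + (oddVerts inc D).card ≤ 2 * Fintype.card V := by
  rw [← sum_deg h2 D, oddVerts, card_filter, ← sum_add_distrib, mul_comm, ← smul_eq_mul,
    ← card_univ, ← sum_const]
  refine sum_le_sum fun v _ => ?_
  have := hD v
  split_ifs with h
  · rcases h with ⟨k, hk⟩; omega
  · omega

theorem IsCircuit.card_le {inc : V → Finset E}
    (h2 : ∀ e, (univ.filter fun v => e ∈ inc v).card = 2) {D : Finset E}
    (hD : IsCircuit inc D) : D.card ≤ Fintype.card V := by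
  have := two_mul_card_add_oddVerts_le h2 hD.deg_le
  omega

theorem IsCircuit.deg_eq_two {inc : V → Finset E}
    (h2 : ∀ e, (univ.filter fun v => e ∈ inc v).card = 2) {D : Finset E}
    (hD : IsCircuit inc D) (hc : D.card = Fintype.card V) (v : V) : deg inc D v = 2 := by
  have h := sum_deg h2 D
  rw [hc, mul_comm, ← smul_eq_mul, ← card_univ, ← sum_const] at h
  exact (sum_eq_sum_iff_of_le fun v _ => hD.deg_le v).1 h v (mem_univ v)

/-- The number of vertices on a circuit equals the number of its edges. -/
theorem IsCircuit.card_touched {inc : V → Finset E}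
    (h2 : ∀ e, (univ.filter fun v => e ∈ inc v).card = 2) {D : Finset E}
    (hD : IsCircuit inc D) : (univ.filter fun v => deg inc D v ≠ 0).card = D.card := by
  have h := sum_deg h2 D
  have h' : ∀ v, deg inc D v = 2 * if deg inc D v ≠ 0 then 1 else 0 := by
    intro v
    have h1 := hD.deg_le v
    have h3 := hD.even v
    split_ifs with h0
    · rcases h3 with ⟨k, hk⟩; omega
    · simpa using h0
  rw [sum_congr rfl fun v _ => h' v, ← mul_sum, ← card_filter] at h
  omega

end EdgeSet

/-! ### Graphs from edge lists, and the edge sets of walks -/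

section EdgeGraph

variable {V E : Type*}

/-- The graph with a given list of edges. -/
def edgeGraph (en : E → V × V) : SimpleGraph V :=
  SimpleGraph.fromRel fun a b => ∃ e, en e = (a, b)

/-- The ends of an edge, as an unordered pair. -/
def edgePair (en : E → V × V) (e : E) : Sym2 V := s((en e).1, (en e).2)

/-- An edge list without loops and repetitions. -/
structure IsSimpleList (en : E → V × V) : Prop where
  ne : ∀ e, (en e).1 ≠ (en e).2
  inj : Function.Injective (edgePair en)

theorem edgeGraph_adj {en : E → V × V} (hen : IsSimpleList en) {a b : V} :
    (edgeGraph en).Adj a b ↔ ∃ e, edgePair en e = s(a, b) := by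
  unfold edgeGraph edgePair
  rw [SimpleGraph.fromRel_adj]
  constructor
  · rintro ⟨-, ⟨e, he⟩ | ⟨e, he⟩⟩
    · exact ⟨e, by rw [he]⟩
    · exact ⟨e, by rw [he, Sym2.eq_swap]⟩
  · rintro ⟨e, he⟩
    have := hen.ne e
    rcases Sym2.eq_iff.1 he with ⟨h1, h2⟩ | ⟨h1, h2⟩
    · exact ⟨by rwa [h1, h2] at this, Or.inl ⟨e, Prod.ext h1 h2⟩⟩
    · exact ⟨by rw [h1, h2] at this; exact this.symm, Or.inr ⟨e, Prod.ext h1 h2⟩⟩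

variable [Fintype E] [DecidableEq V] [DecidableEq E]

/-- The edges at a vertex. -/
def incEdges (en : E → V × V) (v : V) : Finset E :=
  univ.filter fun e => v = (en e).1 ∨ v = (en e).2

theorem mem_incEdges {en : E → V × V} {v : V} {e : E} : e ∈ incEdges en v ↔ v ∈ edgePair en e := by
  simp [incEdges, edgePair]

theorem card_ends [Fintype V] {en : E → V × V} (hen : IsSimpleList en) (e : E) :
    (univ.filter fun v => e ∈ incEdges en v).card = 2 := by
  have : (univ.filter fun v => e ∈ incEdges en v) = {(en e).1, (en e).2} := by
    ext v; simp [incEdges]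
  rw [this, card_pair (hen.ne e)]

/-- The edges of a walk, as a set of indices in the edge list. -/
def walkEdges (en : E → V × V) {u v : V} (p : (edgeGraph en).Walk u v) : Finset E :=
  univ.filter fun e => edgePair en e ∈ p.edges

open EdgeSet SimpleGraph

theorem card_walkEdges {en : E → V × V} (hen : IsSimpleList en) {u v : V}
    {p : (edgeGraph en).Walk u v} (hp : p.IsTrail) : (walkEdges en p).card = p.length := by
  rw [← Walk.length_edges, ← List.toFinset_card_of_nodup hp.edges_nodup,
    ← card_image_of_injective _ hen.inj]
  congr 1
  ext s
  simp only [walkEdges, mem_image, mem_filter, mem_univ, true_and, List.mem_toFinset]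
  constructor
  · rintro ⟨e, he, rfl⟩; exact he
  · intro hs
    induction s using Sym2.ind with
    | h a b =>
      obtain ⟨e, he⟩ := (edgeGraph_adj hen).1 (p.adj_of_mem_edges hs)
      exact ⟨e, by rwa [he], he⟩

theorem deg_insert {en : E → V × V} {D : Finset E} {e : E} (he : e ∉ D) (x : V) :
    deg (incEdges en) (insert e D) x = deg (incEdges en) D x + if x ∈ edgePair en e then 1 else 0 := by
  unfold deg
  split_ifs with h
  · rw [insert_inter_of_mem (mem_incEdges.2 h), card_insert_of_notMem (by simp [he])]
  · rw [insert_inter_of_notMem (by rwa [mem_incEdges]), add_zero]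

theorem exists_walkEdges_cons {en : E → V × V} (hen : IsSimpleList en) {u v w : V}
    (h : (edgeGraph en).Adj u v) (p : (edgeGraph en).Walk v w) (hnot : s(u, v) ∉ p.edges) :
    ∃ e, edgePair en e = s(u, v) ∧ e ∉ walkEdges en p ∧
      walkEdges en (Walk.cons h p) = insert e (walkEdges en p) := by
  obtain ⟨e, he⟩ := (edgeGraph_adj hen).1 h
  refine ⟨e, he, by simp [walkEdges, he, hnot], ?_⟩
  ext e'
  simp only [walkEdges, Walk.edges_cons, List.mem_cons, mem_filter, mem_univ, true_and, mem_insert]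
  rw [← he]
  exact or_congr_left hen.inj.eq_iff

theorem not_mem_edges_of_not_mem_support {G : SimpleGraph V} {u v w : V} (p : G.Walk v w)
    (hu : u ∉ p.support) : s(u, v) ∉ p.edges :=
  fun h => hu (p.fst_mem_support_of_mem_edges h)

/-- Adding one at each end makes all vertices of a path have degree two. The form also covers the
trivial path, whose only vertex is both ends and gets 0 + 1 + 1, so that the induction needs no
special case. -/
theorem deg_walkEdges {en : E → V × V} (hen : IsSimpleList en) {u v : V}
    {p : (edgeGraph en).Walk u v} (hp : p.IsPath) (x : V) :
    deg (incEdges en) (walkEdges en p) x + (if x = u then 1 else 0) + (if x = v then 1 else 0) =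
      if x ∈ p.support then 2 else 0 := by
  induction p with
  | nil =>
    simp only [walkEdges, deg, Walk.edges_nil, List.not_mem_nil, filter_false, empty_inter,
      card_empty, Walk.support_nil, List.mem_singleton]
    split_ifs <;> rfl
  | @cons u v w h p ih =>
    rw [Walk.cons_isPath_iff] at hp
    obtain ⟨e, he, hne, hins⟩ := exists_walkEdges_cons hen h p (not_mem_edges_of_not_mem_support p hp.2)
    have ih := ih hp.1
    rw [hins, deg_insert hne, he, Walk.support_cons]
    have huv := h.ne
    have huw : u ≠ w := by rintro rfl; exact hp.2 p.end_mem_support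
    simp only [Sym2.mem_iff, List.mem_cons]
    by_cases hxu : x = u
    · subst hxu
      simp only [hp.2, huv, huw, if_false, if_true, true_or] at ih ⊢
      omega
    · simp only [hxu, false_or, if_false] at ih ⊢
      omega

/-- The first edge of a path is the only one at its first vertex, so an even subset cannot contain
it and lies in the rest of the path, which is acyclic by induction. -/
theorem isAcyclic_walkEdges {en : E → V × V} (hen : IsSimpleList en) {u v : V}
    {p : (edgeGraph en).Walk u v} (hp : p.IsPath) :
    IsAcyclic (incEdges en) (walkEdges en p) := by
  induction p with
  | nil =>
    intro X hX _
    simpa [walkEdges] using hX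
  | @cons u v w h p ih =>
    rw [Walk.cons_isPath_iff] at hp
    obtain ⟨e, he, hne, hins⟩ := exists_walkEdges_cons hen h p (not_mem_edges_of_not_mem_support p hp.2)
    intro X hX hE
    rw [hins] at hX
    refine ih hp.1 X ?_ hE
    by_cases heX : e ∈ X
    · exfalso
      have h1 := deg_walkEdges hen hp.1 u
      have h2 : u ≠ w := by rintro rfl; exact hp.2 p.end_mem_support
      simp only [hp.2, if_false] at h1
      have h3 : deg (incEdges en) X u ≤ 1 := by
        refine (deg_mono _ hX u).trans ?_
        rw [deg_insert hne]
        split_ifs <;> omega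
      have h4 : 1 ≤ deg (incEdges en) X u := by
        refine card_pos.2 ⟨e, ?_⟩
        rw [mem_inter, mem_incEdges, he]
        exact ⟨heX, by simp⟩
      have h5 := hE u
      rw [show deg (incEdges en) X u = 1 by omega] at h5
      exact absurd h5 (by decide)
    · exact (subset_insert_iff_of_notMem heX).1 hX

/-- A cycle is an edge followed by a path. An even subset without that edge lies in the path and is
empty; for an even subset with that edge, the complement in the cycle is even and lies in the path,
so it is empty. -/
theorem isCircuit_walkEdges {en : E → V × V} (hen : IsSimpleList en) {u : V}
    {c : (edgeGraph en).Walk u u} (hc : c.IsCycle) : IsCircuit (incEdges en) (walkEdges en c) := by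
  cases c with
  | nil => exact absurd hc (by simp)
  | @cons _ v _ h p =>
    rw [Walk.cons_isCycle_iff] at hc
    obtain ⟨e, he, hne, hins⟩ := exists_walkEdges_cons hen h p hc.2
    have hdeg : ∀ x, deg (incEdges en) (walkEdges en (Walk.cons h p)) x =
        if x ∈ p.support then 2 else 0 := by
      intro x
      rw [hins, deg_insert hne, he, ← deg_walkEdges hen hc.1 x]
      have := h.ne
      simp only [Sym2.mem_iff]
      by_cases h1 : x = u
      · subst h1; simp [this]
      · simp [h1]
    have heven : IsEven (incEdges en) (walkEdges en (Walk.cons h p)) := by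
      intro x; rw [hdeg]; split_ifs <;> decide
    refine ⟨⟨e, by rw [hins]; simp⟩, heven, ?_, ?_⟩
    · intro x; rw [hdeg]; split_ifs <;> omega
    · intro X hX hne' hE
      have hA := isAcyclic_walkEdges hen hc.1
      by_cases heX : e ∈ X
      · have h1 := hA (walkEdges en (Walk.cons h p) \ X) (by
          rw [hins]; intro e' he'
          simp only [mem_sdiff, mem_insert] at he'
          rcases he' with ⟨rfl | h', h''⟩
          · exact absurd heX h''
          · exact h') (hE.sdiff hX heven)
        exact subset_antisymm hX (sdiff_eq_empty_iff_subset.1 h1)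
      · exfalso
        have h1 := hA X (by rw [hins] at hX; exact (subset_insert_iff_of_notMem heX).1 hX) hE
        exact hne'.ne_empty h1

end EdgeGraph

/-! ### Grinberg's criterion and the obstruction modulo three -/

section Grinberg

open EdgeSet

variable {V E Φ : Type*} [Fintype V] [Fintype E] [Fintype Φ] [DecidableEq V] [DecidableEq E]
  [DecidableEq Φ]

/-- The combinatorial data of a connected plane graph: every edge has two ends and separates two
faces, the boundary of every face is even, and Euler's formula holds. -/
structure IsPlaneMap (inc : V → Finset E) (l r : E → Φ) : Prop where
  ends : ∀ e, (univ.filter fun v => e ∈ inc v).card = 2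
  connected : ∀ f : V → ZMod 2, (∀ e u v, e ∈ inc u → e ∈ inc v → f u = f v) → ∀ u v, f u = f v
  dual_connected : ∀ g : Φ → ZMod 2, (∀ e, g (l e) = g (r e)) → ∀ a b, g a = g b
  face_even : ∀ v φ, Even (((inc v).filter fun e => l e = φ).card +
    ((inc v).filter fun e => r e = φ).card)
  euler : Fintype.card V + Fintype.card Φ = Fintype.card E + 2

/-- The edges with exactly one side in `X`. -/
def faceBoundary (l r : E → Φ) (X : Finset Φ) : Finset E :=
  univ.filter fun e => ¬(l e ∈ X ↔ r e ∈ X)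

/-- The number of sides of a face. -/
def faceSize (l r : E → Φ) (φ : Φ) : ℕ :=
  (univ.filter fun e => l e = φ).card + (univ.filter fun e => r e = φ).card

variable {inc : V → Finset E} {l r : E → Φ}

theorem mem_faceBoundary {X : Finset Φ} {e : E} :
    e ∈ faceBoundary l r X ↔ ¬(l e ∈ X ↔ r e ∈ X) := by simp [faceBoundary]

theorem faceBoundary_compl (X : Finset Φ) : faceBoundary l r Xᶜ = faceBoundary l r X := by
  ext e; simp only [mem_faceBoundary, mem_compl]; tauto

theorem sum_filter_eq_mem (s : Finset E) (f : E → Φ) (X : Finset Φ) :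
    ∑ φ ∈ X, (s.filter fun e => f e = φ).card = (s.filter fun e => f e ∈ X).card := by
  rw [← card_biUnion]
  · congr 1; ext e; simp; tauto
  · intro a _ b _ hab
    rw [Function.onFun, disjoint_filter]
    rintro e _ rfl h; exact hab h

/-- Summing over the faces in `X` the even numbers of their sides at a vertex counts an edge once if
it has one side in `X`, and twice if it has both. -/
theorem isEven_faceBoundary (h : IsPlaneMap inc l r) (X : Finset Φ) :
    IsEven inc (faceBoundary l r X) := by
  intro v
  have h1 : Even (∑ φ ∈ X, (((inc v).filter fun e => l e = φ).card +
      ((inc v).filter fun e => r e = φ).card)) := Finset.even_sum _ fun φ _ => h.face_even v φ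
  rw [sum_add_distrib, sum_filter_eq_mem, sum_filter_eq_mem, card_filter, card_filter,
    ← sum_add_distrib] at h1
  have h2 : deg inc (faceBoundary l r X) v =
      ∑ e ∈ inc v, if ¬(l e ∈ X ↔ r e ∈ X) then 1 else 0 := by
    rw [← card_filter, deg, faceBoundary, filter_inter, univ_inter]
  rw [h2]
  have h3 : ∀ e ∈ inc v, ((if l e ∈ X then 1 else 0) + if r e ∈ X then 1 else 0) =
      (if ¬(l e ∈ X ↔ r e ∈ X) then 1 else 0) + 2 * if l e ∈ X ∧ r e ∈ X then 1 else 0 := by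
    intro e _
    by_cases h1 : l e ∈ X <;> by_cases h2 : r e ∈ X <;> simp [h1, h2]
  rw [sum_congr rfl h3, sum_add_distrib, ← mul_sum] at h1
  exact (Nat.even_add.1 h1).2 (even_two_mul _)

theorem eq_empty_or_univ (h : IsPlaneMap inc l r) {X : Finset Φ}
    (hX : faceBoundary l r X = ∅) : X = ∅ ∨ X = univ := by
  have hconst := h.dual_connected (fun φ => if φ ∈ X then 1 else 0) (by
    intro e
    have : e ∉ faceBoundary l r X := by simp [hX]
    rw [mem_faceBoundary, not_not] at this
    simp only [this])
  by_cases hne : X.Nonempty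
  · right
    obtain ⟨a, ha⟩ := hne
    ext b
    have := hconst a b
    simp only [ha, if_true] at this
    by_contra hb
    simp only [mem_univ, iff_true] at hb
    simp [hb] at this
  · left; exact not_nonempty_iff_eq_empty.1 hne

/-- Planar duality by counting dimensions over the field with two elements. Face boundaries are
even, so the image of the face-edge matrix `N` lies in the kernel of the vertex-edge matrix `M`.
Connectedness of the dual bounds the kernel of `N`, connectedness of the graph that of the transpose
of `M`, and Euler's formula makes the dimensions agree. -/
theorem exists_faceBoundary (h : IsPlaneMap inc l r) (hV : 0 < Fintype.card V) {D : Finset E}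
    (hD : IsEven inc D) : ∃ X : Finset Φ, faceBoundary l r X = D := by
  classical
  let M : Matrix V E (ZMod 2) := fun v e => if e ∈ inc v then 1 else 0
  let N : Matrix E Φ (ZMod 2) := fun e φ => (if l e = φ then 1 else 0) + if r e = φ then 1 else 0
  have hNmul : ∀ (g : Φ → ZMod 2) e, N.mulVec g e = g (l e) + g (r e) := by
    intro g e
    simp [N, Matrix.mulVec, dotProduct, add_mul, sum_add_distrib]
  have hadd : ∀ x y : ZMod 2, x + y = 0 → x = y := by decide
  have hMN : LinearMap.range N.mulVecLin ≤ LinearMap.ker M.mulVecLin := by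
    have hz : M * N = 0 := by
      ext v φ
      have h1 := (ZMod.natCast_eq_zero_iff_even).2 (h.face_even v φ)
      rw [Matrix.mul_apply, Matrix.zero_apply, ← h1, Nat.cast_add, ← sum_boole, ← sum_boole,
        ← sum_add_distrib]
      simp only [M, N, ite_mul, one_mul, zero_mul]
      rw [← sum_filter, filter_mem_eq_inter, univ_inter]
    rintro _ ⟨g, rfl⟩
    simp [hz]
  have hkN : Module.finrank (ZMod 2) (LinearMap.ker N.mulVecLin) ≤ 1 := by
    by_cases hΦ : Nonempty Φ
    · obtain ⟨a⟩ := hΦ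
      refine finrank_le_one (⟨fun _ => 1, ?_⟩ : LinearMap.ker N.mulVecLin) ?_
      · ext e
        show N.mulVec _ e = 0
        rw [hNmul]; decide
      · rintro ⟨g, hg⟩
        refine ⟨g a, ?_⟩
        ext b
        have := h.dual_connected g (fun e => hadd _ _ (by
          have := congrFun (show N.mulVec g = 0 from hg) e
          rwa [hNmul] at this)) a b
        simp [this]
    · rw [not_nonempty_iff] at hΦ
      rw [Module.finrank_zero_of_subsingleton]
      exact Nat.zero_le 1
  have hkM : Module.finrank (ZMod 2) (LinearMap.ker M.transpose.mulVecLin) ≤ 1 := by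
    obtain ⟨a⟩ := Fintype.card_pos_iff.1 hV
    have hmul : ∀ (f : V → ZMod 2) e, M.transpose.mulVec f e =
        ∑ v ∈ univ.filter (fun v => e ∈ inc v), f v := by
      intro f e
      simp [M, Matrix.mulVec, dotProduct, Matrix.transpose, sum_filter]
    have hpair : ∀ (f : V → ZMod 2) e u v, u ≠ v → e ∈ inc u → e ∈ inc v →
        M.transpose.mulVec f e = f u + f v := by
      intro f e u v huv hu hv
      have : univ.filter (fun v => e ∈ inc v) = {u, v} := by
        symm
        apply eq_of_subset_of_card_le
        · intro x; simp only [mem_insert, mem_singleton, mem_filter, mem_univ, true_and]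
          rintro (rfl | rfl) <;> assumption
        · rw [h.ends e, card_pair huv]
      rw [hmul, this, sum_pair huv]
    refine finrank_le_one (⟨fun _ => 1, ?_⟩ : LinearMap.ker M.transpose.mulVecLin) ?_
    · ext e
      have := h.ends e
      show M.transpose.mulVec _ e = 0
      rw [hmul, sum_const, this]; decide
    · rintro ⟨g, hg⟩
      refine ⟨g a, ?_⟩
      ext b
      have := h.connected g (fun e u v hu hv => by
        by_cases huv : u = v
        · rw [huv]
        · refine hadd _ _ ?_
          rw [← hpair g e u v huv hu hv]
          exact congrFun (show M.transpose.mulVec g = 0 from hg) e) a b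
      simp [this]
  have hrM := M.transpose.mulVecLin.finrank_range_add_finrank_ker
  have hrM' := M.mulVecLin.finrank_range_add_finrank_ker
  have hrN := N.mulVecLin.finrank_range_add_finrank_ker
  have hT := Matrix.rank_transpose M
  unfold Matrix.rank at hT
  simp only [Module.finrank_fintype_fun_eq_card] at hrM hrM' hrN
  have heu := h.euler
  -- The kernel bounds give rank at least |V| - 1 for `M` and at least |Φ| - 1 for `N`; so ker `M`
  -- has dimension at most |E| - |V| + 1 = |Φ| - 1.
  have heq := Submodule.eq_of_le_of_finrank_le hMN (by omega)
  have hmem : (fun e => if e ∈ D then 1 else 0 : E → ZMod 2) ∈ LinearMap.ker M.mulVecLin := by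
    ext v
    have := hD v
    have h1 : M.mulVec (fun e => if e ∈ D then 1 else 0) v = ((D ∩ inc v).card : ZMod 2) := by
      simp only [Matrix.mulVec, dotProduct, M]
      simp only [mul_ite, mul_one, mul_zero, ← ite_and, sum_boole]
      congr 2; ext e; simp
    show M.mulVec _ v = 0
    rw [h1]
    exact (ZMod.natCast_eq_zero_iff_even).2 this
  rw [← heq] at hmem
  obtain ⟨g, hg⟩ := hmem
  refine ⟨univ.filter fun φ => g φ = 1, ?_⟩
  ext e
  have h1 := congrFun (show N.mulVec g = _ from hg) e
  rw [hNmul] at h1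
  rw [mem_faceBoundary]
  simp only [mem_filter, mem_univ, true_and]
  have key : ∀ x y : ZMod 2, (¬(x = 1 ↔ y = 1)) ↔ x + y = 1 := by decide
  rw [key, h1]
  by_cases he : e ∈ D <;> simp [he]

/-- The faces on one side of a circuit form a connected graph under adjacency across edges off the
circuit, and a connected graph has at least one edge less than it has vertices. Connectedness comes
from the minimality of the circuit, since the boundary of a component is an even subset of it. -/
theorem card_le_inner (h : IsPlaneMap inc l r) {D : Finset E} (hD : IsCircuit inc D)
    {X : Finset Φ} (hX : faceBoundary l r X = D) :
    X.card ≤ (univ.filter fun e => l e ∈ X ∧ r e ∈ X).card + 1 := by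
  classical
  let G : SimpleGraph X := SimpleGraph.fromRel fun a b => ∃ e, l e = a ∧ r e = b
  have hne : Nonempty X := by
    by_contra hno
    rw [not_nonempty_iff, isEmpty_coe_sort] at hno
    subst hno
    have : D = ∅ := by rw [← hX]; ext e; simp [mem_faceBoundary]
    exact hD.nonempty.ne_empty this
  have hconn : G.Connected := by
    refine ⟨fun a b => ?_⟩
    let Y : Finset Φ := (univ.filter fun c : X => G.Reachable a c).map (Function.Embedding.subtype _)
    have hY : ∀ φ, φ ∈ Y ↔ ∃ h : φ ∈ X, G.Reachable a ⟨φ, h⟩ := by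
      intro φ; simp [Y]
    have hYX : ∀ φ ∈ Y, φ ∈ X := fun φ hφ => ((hY φ).1 hφ).1
    have hstep : ∀ e, l e ∈ X → r e ∈ X → (l e ∈ Y ↔ r e ∈ Y) := by
      intro e hl hr
      by_cases heq : l e = r e
      · rw [heq]
      have hadj : G.Adj ⟨l e, hl⟩ ⟨r e, hr⟩ := by
        rw [SimpleGraph.fromRel_adj]
        exact ⟨by simpa using heq, Or.inl ⟨e, rfl, rfl⟩⟩
      rw [hY, hY]
      exact ⟨fun ⟨_, p⟩ => ⟨hr, p.trans hadj.reachable⟩,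
        fun ⟨_, p⟩ => ⟨hl, p.trans hadj.symm.reachable⟩⟩
    have hsub : faceBoundary l r Y ⊆ D := by
      intro e he
      rw [← hX, mem_faceBoundary]
      rw [mem_faceBoundary] at he
      intro hiff
      by_cases hl : l e ∈ X
      · exact he (hstep e hl (hiff.1 hl))
      · have hr : r e ∉ X := fun hr => hl (hiff.2 hr)
        exact he ⟨fun hh => absurd (hYX _ hh) hl, fun hh => absurd (hYX _ hh) hr⟩
    have haY : (a : Φ) ∈ Y := (hY a).2 ⟨a.2, SimpleGraph.Reachable.refl _⟩
    -- The component `Y` of `a` has boundary empty or `D`. In the first case it contains all faces;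
    -- in the second `X` and `Y` have the same boundary, so `X \ Y` has none and is empty, as it
    -- does not contain `a`.
    have hXY : X ⊆ Y := by
      by_cases hemp : faceBoundary l r Y = ∅
      · rcases eq_empty_or_univ h hemp with h0 | h0
        · rw [h0] at haY; exact absurd haY (notMem_empty _)
        · rw [h0]; exact subset_univ X
      · have hDY := hD.minimal _ hsub (nonempty_iff_ne_empty.2 hemp) (isEven_faceBoundary h Y)
        have hdiff : faceBoundary l r (X \ Y) = ∅ := by
          ext e
          simp only [notMem_empty, iff_false, mem_faceBoundary, not_not, mem_sdiff]
          have e1 : e ∈ faceBoundary l r X ↔ e ∈ faceBoundary l r Y := by rw [hX, hDY]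
          rw [mem_faceBoundary, mem_faceBoundary] at e1
          have e2 := hYX (l e)
          have e3 := hYX (r e)
          tauto
        rcases eq_empty_or_univ h hdiff with h0 | h0
        · exact sdiff_eq_empty_iff_subset.1 h0
        · have : (a : Φ) ∈ X \ Y := by rw [h0]; exact mem_univ _
          exact absurd haY (mem_sdiff.1 this).2
    exact ((hY b).1 (hXY b.2)).2
  have h1 := hconn.card_vert_le_card_edgeSet_add_one
  rw [Nat.card_eq_fintype_card, Fintype.card_coe] at h1
  refine h1.trans (Nat.add_le_add_right ?_ 1)
  have hs : ∀ s ∈ G.edgeSet, ∃ e, ∃ h1 : l e ∈ X, ∃ h2 : r e ∈ X,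
      s = s((⟨l e, h1⟩ : X), ⟨r e, h2⟩) := by
    intro s hs
    induction s using Sym2.ind with
    | h a b =>
      rw [SimpleGraph.mem_edgeSet, SimpleGraph.fromRel_adj] at hs
      rcases hs.2 with ⟨e, h1, h2⟩ | ⟨e, h1, h2⟩
      · exact ⟨e, by rw [h1]; exact a.2, by rw [h2]; exact b.2, by simp [h1, h2]⟩
      · exact ⟨e, by rw [h1]; exact b.2, by rw [h2]; exact a.2, by
          rw [Sym2.eq_swap]; simp [h1, h2]⟩
  let f : {e // l e ∈ X ∧ r e ∈ X} → Sym2 X := fun e => s(⟨l e, e.2.1⟩, ⟨r e, e.2.2⟩)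
  have hsub : G.edgeSet ⊆ Set.range f := by
    intro s hs'
    obtain ⟨e, h1, h2, rfl⟩ := hs s hs'
    exact ⟨⟨e, h1, h2⟩, rfl⟩
  calc Nat.card G.edgeSet ≤ Nat.card (Set.range f) := Nat.card_mono (Set.toFinite _) hsub
    _ ≤ Nat.card {e // l e ∈ X ∧ r e ∈ X} := Finite.card_range_le f
    _ = _ := by rw [Nat.card_eq_fintype_card, Fintype.card_subtype]

/-- **Grinberg's criterion**, for a circuit through all vertices. -/
theorem grinberg (h : IsPlaneMap inc l r) {D : Finset E} (hD : IsCircuit inc D)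
    (hc : D.card = Fintype.card V) :
    ∃ X : Finset Φ, (∀ e, e ∈ D ↔ ¬(l e ∈ X ↔ r e ∈ X)) ∧
      2 + ∑ φ ∈ X, faceSize l r φ = Fintype.card V + 2 * X.card ∧
      2 + ∑ φ ∈ Xᶜ, faceSize l r φ = Fintype.card V + 2 * Xᶜ.card := by
  have hpos : 0 < Fintype.card V := by rw [← hc]; exact hD.nonempty.card_pos
  obtain ⟨X, hX⟩ := exists_faceBoundary h hpos hD.even
  refine ⟨X, fun e => by rw [← hX, mem_faceBoundary], ?_⟩
  have hsize : ∀ Y : Finset Φ, faceBoundary l r Y = D → ∑ φ ∈ Y, faceSize l r φ =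
      D.card + 2 * (univ.filter fun e => l e ∈ Y ∧ r e ∈ Y).card := by
    intro Y hY
    simp only [faceSize, sum_add_distrib, sum_filter_eq_mem]
    rw [← hY, faceBoundary, card_filter, card_filter, card_filter, card_filter, mul_sum,
      ← sum_add_distrib, ← sum_add_distrib]
    refine sum_congr rfl fun e _ => ?_
    by_cases h1 : l e ∈ Y <;> by_cases h2 : r e ∈ Y <;> simp [h1, h2]
  have hXc : faceBoundary l r Xᶜ = D := by rw [faceBoundary_compl, hX]
  -- As |D| = |V|, Euler's formula says that exactly |Φ| - 2 edges lie off `D`. The two sides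
  -- together need at least that many, so both inequalities are equalities, and each side is a tree
  -- of faces.
  have h1 := card_le_inner h hD hX
  have h2 := card_le_inner h hD hXc
  have h3 : Fintype.card E = D.card + (univ.filter fun e => l e ∈ X ∧ r e ∈ X).card +
      (univ.filter fun e => l e ∈ Xᶜ ∧ r e ∈ Xᶜ).card := by
    rw [← card_univ, card_eq_sum_ones, ← hX, faceBoundary, card_filter, card_filter, card_filter,
      ← sum_add_distrib, ← sum_add_distrib]
    refine sum_congr rfl fun e _ => ?_
    by_cases h1 : l e ∈ X <;> by_cases h2 : r e ∈ X <;> simp [h1, h2]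
  have h4 := h.euler
  have h5 := card_add_card_compl X
  rw [hsize X hX, hsize Xᶜ hXc]
  omega

/-- A face surrounded by four faces such that these five, and no other ones, have size `1` modulo
three instead of `2`. -/
structure IsRing (inc : V → Finset E) (l r : E → Φ) (exc : Fin 5 → Φ) (ed : Fin 4 → E) : Prop where
  inj : Function.Injective exc
  left : ∀ i, l (ed i) = exc 0
  right : ∀ i, r (ed i) = exc i.succ
  size : ∀ φ, faceSize l r φ % 3 = if φ ∈ univ.image exc then 1 else 2
  even : IsEven inc (univ.image ed)
  corner : ∀ i, ∃ v, (inc v \ (univ.image ed).erase (ed i)).card < 2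

/-- Modulo three each ordinary face contributes nothing to the sum of (size - 2) over one side of a
Hamiltonian circuit, and each exceptional face contributes -1. The sum is |V| - 2, which is -1, so
the number of exceptional faces on that side is 1 modulo 3. -/
theorem IsRing.card_lt (h : IsPlaneMap inc l r) {exc : Fin 5 → Φ} {ed : Fin 4 → E}
    (hR : IsRing inc l r exc ed) (hV : Fintype.card V % 3 = 1) (hV4 : 4 < Fintype.card V)
    {D : Finset E} (hD : IsCircuit inc D) : D.card < Fintype.card V := by
  refine lt_of_le_of_ne (hD.card_le h.ends) fun hc => ?_
  obtain ⟨X, hX, h1, -⟩ := grinberg h hD hc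
  have hsz : ∀ φ, (faceSize l r φ : ZMod 3) = 2 - if φ ∈ univ.image exc then 1 else 0 := by
    intro φ
    rw [← ZMod.natCast_mod, hR.size φ]
    split_ifs <;> norm_num
  have h2 := congrArg (Nat.cast : ℕ → ZMod 3) h1
  push_cast at h2
  rw [sum_congr rfl fun φ _ => hsz φ, sum_sub_distrib, sum_const, nsmul_eq_mul, sum_boole,
    ← ZMod.natCast_mod (Fintype.card V), hV] at h2
  have h3 : (X.filter fun φ => φ ∈ univ.image exc).card =
      (univ.filter fun i => decide (exc i ∈ X) = true).card := by
    rw [← card_image_of_injective _ hR.inj]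
    congr 1
    ext φ
    simp only [mem_filter, mem_image, mem_univ, true_and, decide_eq_true_eq]
    constructor
    · rintro ⟨h, i, rfl⟩; exact ⟨i, h, rfl⟩
    · rintro ⟨i, h, rfl⟩; exact ⟨h, i, rfl⟩
  rw [h3] at h2
  have h4 : (univ.filter fun i => decide (exc i ∈ X) = true).card % 3 = 1 := by
    have : ((univ.filter fun i => decide (exc i ∈ X) = true).card : ZMod 3) = (1 : ℕ) := by
      push_cast at h2 ⊢
      linear_combination -h2
    rw [ZMod.natCast_eq_natCast_iff] at this
    exact this
  -- Among five faces the count is then 1 or 4; either way one exceptional face is separated by the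
  -- circuit from the other four.
  have key : ∀ b : Fin 5 → Bool, (univ.filter fun i => b i = true).card % 3 = 1 →
      ∃ i, ∀ j, j ≠ i → b j ≠ b i := by decide
  obtain ⟨i, hi⟩ := key _ h4
  have hi' : ∀ j, j ≠ i → ¬(exc j ∈ X ↔ exc i ∈ X) := by
    intro j hj
    have := hi j hj
    simpa using this
  have hmem : ∀ j, ed j ∈ D ↔ ¬(exc 0 ∈ X ↔ exc j.succ ∈ X) := by
    intro j
    rw [hX, hR.left, hR.right]
  -- If the middle face is alone, all ring edges lie in `D`; they form an even set, so `D` has at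
  -- most four edges. If an outer face is alone, the ring edges other than its own are off `D`, and
  -- a corner where such edges meet has fewer than two edges left for `D`.
  refine Fin.cases ?_ ?_ i hi'
  · intro hz
    have hs : univ.image ed ⊆ D := by
      intro e he
      obtain ⟨j, -, rfl⟩ := mem_image.1 he
      have := hz j.succ (Fin.succ_ne_zero j)
      rw [hmem]
      tauto
    have h5 := hD.minimal _ hs ⟨ed 0, mem_image_of_mem _ (mem_univ _)⟩ hR.even
    have h6 : (univ.image ed).card ≤ 4 := card_image_le
    rw [h5] at h6
    omega
  · intro i hz
    obtain ⟨v, hv⟩ := hR.corner i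
    have hd := hD.deg_eq_two h.ends hc v
    have : D ∩ inc v ⊆ inc v \ (univ.image ed).erase (ed i) := by
      intro e he
      rw [mem_inter] at he
      refine mem_sdiff.2 ⟨he.2, fun hm => ?_⟩
      obtain ⟨hne, hm⟩ := mem_erase.1 hm
      obtain ⟨j, -, rfl⟩ := mem_image.1 hm
      have hji : j ≠ i := fun h => hne (by rw [h])
      have h6 := (hmem j).1 he.1
      have h7 := hz j.succ (fun h => hji (Fin.succ_injective _ h))
      have h8 := hz 0 (Fin.succ_ne_zero i).symm
      tauto
    have := card_le_card this
    unfold deg at hd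
    omega

end Grinberg

/-! ### Paths of the gadget as circuits of the closed gadget -/

section ClosedGadget

open EdgeSet

variable {I EB : Type*} [Fintype I] [Fintype EB] [DecidableEq I] [DecidableEq EB]

/-- The closed gadget: a new vertex is joined to the three terminals. -/
def closedEnds (en : EB → (Fin 3 ⊕ I) × (Fin 3 ⊕ I)) :
    EB ⊕ Fin 3 → Option (Fin 3 ⊕ I) × Option (Fin 3 ⊕ I)
  | Sum.inl e => (some (en e).1, some (en e).2)
  | Sum.inr k => (none, some (Sum.inl k))

variable {en : EB → (Fin 3 ⊕ I) × (Fin 3 ⊕ I)}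

theorem deg_closed_none (D : Finset (EB ⊕ Fin 3)) :
    deg (incEdges (closedEnds en)) D none = D.toRight.card := by
  unfold deg
  rw [← card_map Function.Embedding.inr (s := D.toRight)]
  congr 1
  ext (e | k) <;> simp [mem_incEdges, edgePair, closedEnds]

theorem deg_closed_some (D : Finset (EB ⊕ Fin 3)) (a : Fin 3 ⊕ I) :
    deg (incEdges (closedEnds en)) D (some a) = deg (incEdges en) D.toLeft a +
      (D.toRight.filter fun k => a = Sum.inl k).card := by
  unfold deg
  rw [← card_map Function.Embedding.inl (s := D.toLeft ∩ _),
    ← card_map Function.Embedding.inr (s := D.toRight.filter _), ← card_union_of_disjoint]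
  · congr 1
    ext (e | k) <;> simp [mem_incEdges, edgePair, closedEnds]
  · rw [disjoint_left]; simp

/-- An acyclic set with two odd terminals is completed to a circuit by the new vertex. -/
theorem isCircuit_closed {P : Finset EB} (hac : IsAcyclic (incEdges en) P)
    (hdeg : ∀ a, deg (incEdges en) P a ≤ 2) {i j : Fin 3} (hij : i ≠ j)
    (hodd : oddVerts (incEdges en) P = {Sum.inl i, Sum.inl j}) :
    IsCircuit (incEdges (closedEnds en)) (P.disjSum {i, j}) := by
  have hmem : ∀ a, Odd (deg (incEdges en) P a) ↔ a = Sum.inl i ∨ a = Sum.inl j := by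
    intro a
    have := congrArg (a ∈ ·) hodd
    simpa [oddVerts] using this
  -- An even subset that avoids the new vertex is an even subset of the acyclic set `P`.
  have hrest : ∀ X ⊆ P.disjSum {i, j}, IsEven (incEdges (closedEnds en)) X → X.toRight = ∅ →
      X = ∅ := by
    intro X hX hE hR
    have hL : X.toLeft = ∅ := by
      refine hac _ ?_ fun a => ?_
      · intro e he
        have := hX (mem_toLeft.1 he)
        simpa using this
      · have := hE (some a)
        rwa [deg_closed_some, hR, filter_empty, card_empty, add_zero] at this
    ext (e | k)
    · rw [← mem_toLeft, hL]; simp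
    · rw [← mem_toRight, hR]; simp
  have heven : IsEven (incEdges (closedEnds en)) (P.disjSum {i, j}) := by
    rintro (_ | a)
    · rw [deg_closed_none, toRight_disjSum, card_pair hij]; decide
    · rw [deg_closed_some, toRight_disjSum, toLeft_disjSum]
      by_cases ha : a = Sum.inl i ∨ a = Sum.inl j
      · have h1 : (({i, j} : Finset (Fin 3)).filter fun k => a = Sum.inl k).card = 1 := by
          rw [card_eq_one]
          rcases ha with rfl | rfl
          · exact ⟨i, by ext k; simp; grind⟩
          · exact ⟨j, by ext k; simp; grind⟩
        rw [h1]
        exact ((hmem a).2 ha).add_odd odd_one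
      · have h1 : (({i, j} : Finset (Fin 3)).filter fun k => a = Sum.inl k) = ∅ := by
          ext k; simp; grind
        rw [h1, card_empty, add_zero]
        exact Nat.not_odd_iff_even.1 fun h => ha ((hmem a).1 h)
  refine ⟨⟨Sum.inr i, by simp⟩, heven, ?_, ?_⟩
  · rintro (_ | a)
    · rw [deg_closed_none, toRight_disjSum, card_pair hij]
    · have h1 := heven (some a)
      rw [deg_closed_some, toRight_disjSum, toLeft_disjSum] at h1 ⊢
      have h2 : (({i, j} : Finset (Fin 3)).filter fun k => a = Sum.inl k).card ≤ 1 := by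
        rw [card_le_one]
        intro k hk k' hk'
        have h3 := (mem_filter.1 hk).2.symm.trans (mem_filter.1 hk').2
        exact Sum.inl_injective h3
      have := hdeg a
      rcases h1 with ⟨m, hm⟩
      omega
  · intro X hX hne hE
    have h0 := hE none
    rw [deg_closed_none] at h0
    have hR : X.toRight ⊆ {i, j} := by
      intro k hk
      have := hX (mem_toRight.1 hk)
      simpa using this
    by_cases hem : X.toRight = ∅
    · exact absurd (hrest X hX hE hem) hne.ne_empty
    · have hcard : 2 ≤ X.toRight.card := by
        have := card_pos.2 (nonempty_iff_ne_empty.2 hem)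
        rcases h0 with ⟨m, hm⟩
        omega
      have hRe : X.toRight = {i, j} := eq_of_subset_of_card_le hR (by rwa [card_pair hij])
      -- A nonempty even subset uses both edges at the new vertex, so its complement uses neither.
      have h1 := hrest (P.disjSum {i, j} \ X) sdiff_subset (hE.sdiff hX heven) (by
        ext k
        simp only [mem_toRight, mem_sdiff, inr_mem_disjSum, notMem_empty, iff_false, not_and,
          not_not]
        intro hk
        rwa [← mem_toRight, hRe])
      exact subset_antisymm hX (sdiff_eq_empty_iff_subset.1 h1)

/-- If the closed gadget is not Hamiltonian, a path of the gadget joining two terminals misses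
some vertex. -/
theorem card_le_of_oddVerts_eq_pair
    (hB : ∀ D, IsCircuit (incEdges (closedEnds en)) D → D.card ≤ Fintype.card I + 3)
    {P : Finset EB} (hac : IsAcyclic (incEdges en) P)
    (hdeg : ∀ a, deg (incEdges en) P a ≤ 2) {i j : Fin 3} (hij : i ≠ j)
    (hodd : oddVerts (incEdges en) P = {Sum.inl i, Sum.inl j}) :
    P.card ≤ Fintype.card I + 1 := by
  -- The closed gadget has |I| + 4 vertices, so `hB` says that it is not Hamiltonian; the circuit
  -- has two more edges than `P`.
  have := hB _ (isCircuit_closed hac hdeg hij hodd)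
  rw [card_disjSum, card_pair hij] at this
  omega

/-- If moreover all odd vertices are terminals, an acyclic set of edges is small. -/
theorem card_le_of_even_internal (hen : IsSimpleList en)
    (hB : ∀ D, IsCircuit (incEdges (closedEnds en)) D → D.card ≤ Fintype.card I + 3)
    {P : Finset EB} (hac : IsAcyclic (incEdges en) P)
    (hdeg : ∀ a, deg (incEdges en) P a ≤ 2)
    (heven : ∀ k, Even (deg (incEdges en) P (Sum.inr k))) :
    P = ∅ ∨ (∃ i j : Fin 3, i ≠ j ∧ oddVerts (incEdges en) P = {Sum.inl i, Sum.inl j}) ∧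
      P.card ≤ Fintype.card I + 1 := by
  by_cases hP : P = ∅
  · exact Or.inl hP
  right
  have hO : oddVerts (incEdges en) P ≠ ∅ := by
    rw [Ne, ← isEven_iff_oddVerts]
    exact fun h => hP (hac P subset_rfl h)
  have hsub : oddVerts (incEdges en) P ⊆ univ.map Function.Embedding.inl := by
    rintro (k | k) hk
    · simp
    · have := (mem_filter.1 hk).2
      exact absurd (heven k) (Nat.not_even_iff_odd.2 this)
  -- The number of odd vertices is even, positive, and at most the number three of terminals, hence
  -- two.
  have h3 := card_le_card hsub
  rw [card_map, card_univ, Fintype.card_fin] at h3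
  have h0 := card_pos.2 (nonempty_iff_ne_empty.2 hO)
  have he := even_card_oddVerts (card_ends hen) P
  have h2 : (oddVerts (incEdges en) P).card = 2 := by
    rcases he with ⟨m, hm⟩; omega
  obtain ⟨a, b, hab, hOab⟩ := card_eq_two.1 h2
  obtain ⟨i, -, rfl⟩ := mem_map.1 (hsub (hOab ▸ mem_insert_self a _))
  obtain ⟨j, -, rfl⟩ := mem_map.1 (hsub (hOab ▸ mem_insert_of_mem (mem_singleton_self b)))
  have hij : i ≠ j := fun h => hab (by rw [h])
  exact ⟨⟨i, j, hij, hOab⟩, card_le_of_oddVerts_eq_pair hB hac hdeg hij hOab⟩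

end ClosedGadget

/-! ### The vertices of a blow-up -/

section BlowVert

variable {I ι T : Type*}

/-- The vertex of the blow-up that corresponds to a vertex in the gadget at `u`. -/
def blowVert (term : ι → Fin 3 → T) (u : ι) : Fin 3 ⊕ I → T ⊕ ι × I :=
  Sum.map (term u) (Prod.mk u)

theorem blowVert_injective {term : ι → Fin 3 → T} (h : ∀ u, Function.Injective (term u)) (u : ι) :
    Function.Injective (blowVert (I := I) term u) :=
  (Sum.map_injective).2 ⟨h u, Prod.mk_right_injective u⟩

end BlowVert

/-! ### Circuits in the blow-up of a cubic graph -/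

section Blowup

open EdgeSet

variable {I EB ι T : Type*} [Fintype I] [Fintype EB] [DecidableEq I] [DecidableEq EB]
  [Fintype ι] [DecidableEq ι] [Fintype T] [DecidableEq T]

/-- A cubic graph, given by the three edges at each vertex. -/
structure IsCubicIncidence (term : ι → Fin 3 → T) : Prop where
  inj : ∀ u, Function.Injective (term u)
  two : ∀ t, (univ.filter fun p : ι × Fin 3 => term p.1 p.2 = t).card = 2
  share : ∀ u v i i' j j', u ≠ v → term u i = term v j → term u i' = term v j' → i = i'

/-- The edges of the blow-up: every vertex of a cubic graph is replaced by a copy of the gadget,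
and the terminals are identified along the edges. -/
def blowEnds (en : EB → (Fin 3 ⊕ I) × (Fin 3 ⊕ I)) (term : ι → Fin 3 → T) :
    ι × EB → (T ⊕ ι × I) × (T ⊕ ι × I) :=
  fun p => (blowVert term p.1 (en p.2).1, blowVert term p.1 (en p.2).2)

/-- The part of an edge set in the gadget at `u`. -/
def gadgetPart (D : Finset (ι × EB)) (u : ι) : Finset EB := univ.filter fun e => (u, e) ∈ D

/-- The edges at a vertex of the cubic graph. -/
def cubicInc (term : ι → Fin 3 → T) (u : ι) : Finset T := univ.image (term u)

variable {en : EB → (Fin 3 ⊕ I) × (Fin 3 ⊕ I)} {term : ι → Fin 3 → T}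

theorem mem_gadgetPart {D : Finset (ι × EB)} {u : ι} {e : EB} : e ∈ gadgetPart D u ↔ (u, e) ∈ D := by
  simp [gadgetPart]

theorem gadgetPart_mono {D D' : Finset (ι × EB)} (h : D ⊆ D') (u : ι) : gadgetPart D u ⊆ gadgetPart D' u :=
  fun _ he => mem_gadgetPart.2 (h (mem_gadgetPart.1 he))

theorem card_eq_sum_gadgetPart (D : Finset (ι × EB)) : D.card = ∑ u, (gadgetPart D u).card := by
  rw [← card_sigma]
  refine card_bij (fun p _ => ⟨p.1, p.2⟩) ?_ ?_ ?_
  · rintro ⟨u, e⟩ h; simpa [mem_gadgetPart] using h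
  · rintro ⟨u, e⟩ _ ⟨u', e'⟩ _ h; simpa using h
  · rintro ⟨u, e⟩ h; exact ⟨(u, e), by simpa [mem_gadgetPart] using h, rfl⟩

theorem edgePair_blowEnds (p : ι × EB) :
    edgePair (blowEnds en term) p = (edgePair en p.2).map (blowVert term p.1) := rfl

/-- Two gadgets have at most one terminal in common, so they cannot have a common edge. The
hypothesis that every edge has two ends is left out on purpose: the lemma also serves for the cubic
graph with three dangling edges. -/
theorem isSimpleList_blowEnds (hinj : ∀ u, Function.Injective (term u))
    (hshare : ∀ u v i i' j j', u ≠ v → term u i = term v j → term u i' = term v j' → i = i')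
    (hen : IsSimpleList en) : IsSimpleList (blowEnds en term) := by
  refine ⟨fun p => (blowVert_injective hinj p.1).ne (hen.ne p.2), ?_⟩
  rintro ⟨u, e⟩ ⟨v, f⟩ hef
  rw [edgePair_blowEnds, edgePair_blowEnds] at hef
  by_cases huv : u = v
  · subst huv
    have : e = f := hen.inj (Sym2.map.injective (blowVert_injective hinj u) hef)
    rw [this]
  · exfalso
    have key : ∀ a b : Fin 3 ⊕ I, blowVert term u a = blowVert term v b →
        ∃ i j, a = Sum.inl i ∧ b = Sum.inl j ∧ term u i = term v j := by
      rintro (i | k) (j | l) hab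
      · exact ⟨i, j, rfl, rfl, by simpa [blowVert] using hab⟩
      · simp [blowVert] at hab
      · simp [blowVert] at hab
      · simp [blowVert, huv] at hab
    have hne := hen.ne e
    simp only [edgePair, Sym2.map_mk] at hef
    rcases Sym2.eq_iff.1 hef with ⟨h1, h2⟩ | ⟨h1, h2⟩ <;>
    · obtain ⟨i, j, hi, -, hij⟩ := key _ _ h1
      obtain ⟨i', j', hi', -, hij'⟩ := key _ _ h2
      rw [hi, hi', hshare u v i i' j j' huv hij hij'] at hne
      exact hne rfl

theorem IsCubicIncidence.isSimpleList (h : IsCubicIncidence term) (hen : IsSimpleList en) :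
    IsSimpleList (blowEnds en term) :=
  isSimpleList_blowEnds h.inj h.share hen

/-- A vertex of the blow-up may be represented in several gadgets, namely when it is an identified
terminal, and its degree is the sum over the representatives. -/
theorem deg_blow (hinj : ∀ u, Function.Injective (term u)) (D : Finset (ι × EB))
    (w : T ⊕ ι × I) : deg (incEdges (blowEnds en term)) D w =
      ∑ p : ι × (Fin 3 ⊕ I) with blowVert term p.1 p.2 = w,
        deg (incEdges en) (gadgetPart D p.1) p.2 := by
  unfold deg
  have hmap : ∀ p : ι × (Fin 3 ⊕ I), (gadgetPart D p.1 ∩ incEdges en p.2).card =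
      ((gadgetPart D p.1 ∩ incEdges en p.2).image (Prod.mk p.1)).card := fun p =>
    (card_image_of_injective _ (Prod.mk_right_injective _)).symm
  rw [sum_congr rfl fun p _ => hmap p, ← card_biUnion]
  · congr 1
    ext ⟨u, e⟩
    simp only [mem_inter, mem_incEdges, mem_biUnion, mem_filter, mem_univ, true_and, mem_image,
      Prod.mk.injEq, edgePair_blowEnds, Sym2.mem_map, mem_gadgetPart]
    constructor
    · rintro ⟨hD, a, ha, hw⟩
      exact ⟨(u, a), hw, e, ⟨hD, ha⟩, rfl, rfl⟩
    · rintro ⟨⟨u', a⟩, hw, e', ⟨hD, ha⟩, h1, h2⟩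
      simp only at h1 h2 hw hD ha
      subst h1 h2
      exact ⟨hD, a, ha, hw⟩
  · rintro ⟨u, a⟩ hp ⟨v, b⟩ hq hpq
    rw [Function.onFun, disjoint_left]
    intro x hx hy
    obtain ⟨e, -, rfl⟩ := mem_image.1 hx
    obtain ⟨e', -, h'⟩ := mem_image.1 hy
    simp only [Prod.mk.injEq] at h'
    obtain ⟨rfl, -⟩ := h'
    simp only [coe_filter, mem_univ, true_and, Set.mem_ofPred_eq] at hp hq
    exact hpq (by rw [blowVert_injective hinj v (hp.trans hq.symm)])

theorem deg_blow_inr (hinj : ∀ u, Function.Injective (term u)) (D : Finset (ι × EB)) (u : ι)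
    (k : I) : deg (incEdges (blowEnds en term)) D (Sum.inr (u, k)) =
      deg (incEdges en) (gadgetPart D u) (Sum.inr k) := by
  rw [deg_blow hinj]
  have : (univ.filter fun p : ι × (Fin 3 ⊕ I) => blowVert term p.1 p.2 = Sum.inr (u, k)) =
      {(u, Sum.inr k)} := by
    ext ⟨v, a | a⟩ <;> simp only [mem_filter, mem_univ, true_and] <;> simp [blowVert]
  rw [this, sum_singleton]

theorem deg_blow_inl (hinj : ∀ u, Function.Injective (term u)) (D : Finset (ι × EB)) (t : T) :
    deg (incEdges (blowEnds en term)) D (Sum.inl t) =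
      ∑ p : ι × Fin 3 with term p.1 p.2 = t, deg (incEdges en) (gadgetPart D p.1) (Sum.inl p.2) := by
  rw [deg_blow hinj]
  symm
  refine sum_bij (fun p _ => (p.1, Sum.inl p.2)) ?_ ?_ ?_ ?_
  · rintro ⟨u, i⟩ h
    simp only [mem_filter, mem_univ, true_and] at h ⊢
    simpa [blowVert] using h
  · rintro ⟨u, i⟩ _ ⟨v, j⟩ _ h; simpa using h
  · rintro ⟨u, i | k⟩ h <;> simp only [mem_filter, mem_univ, true_and] at h
    · exact ⟨(u, i), by simpa [blowVert] using h, rfl⟩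
    · simp [blowVert] at h
  · intros; rfl

theorem deg_gadgetPart_le (hinj : ∀ u, Function.Injective (term u)) (D : Finset (ι × EB)) (u : ι)
    (a : Fin 3 ⊕ I) : deg (incEdges en) (gadgetPart D u) a ≤
      deg (incEdges (blowEnds en term)) D (blowVert term u a) := by
  rw [deg_blow hinj]
  exact single_le_sum (f := fun p : ι × (Fin 3 ⊕ I) => deg (incEdges en) (gadgetPart D p.1) p.2)
    (fun _ _ => Nat.zero_le _) (a := (u, a)) (by simp)

theorem IsCubicIncidence.exists_pair (h : IsCubicIncidence term) (t : T) :
    ∃ u i v j, u ≠ v ∧ term u i = t ∧ term v j = t ∧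
      (univ.filter fun p : ι × Fin 3 => term p.1 p.2 = t) = {(u, i), (v, j)} := by
  obtain ⟨⟨u, i⟩, ⟨v, j⟩, hne, heq⟩ := card_eq_two.1 (h.two t)
  have h1 : (u, i) ∈ univ.filter fun p : ι × Fin 3 => term p.1 p.2 = t := by rw [heq]; simp
  have h2 : (v, j) ∈ univ.filter fun p : ι × Fin 3 => term p.1 p.2 = t := by rw [heq]; simp
  simp only [mem_filter, mem_univ, true_and] at h1 h2
  refine ⟨u, i, v, j, ?_, h1, h2, heq⟩
  rintro rfl
  exact hne (by rw [h.inj u (h1.trans h2.symm)])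

theorem IsCubicIncidence.card_ends (h : IsCubicIncidence term) (t : T) :
    (univ.filter fun u => t ∈ cubicInc term u).card = 2 := by
  obtain ⟨u, i, v, j, huv, hu, hv, heq⟩ := h.exists_pair t
  have : (univ.filter fun u => t ∈ cubicInc term u) = {u, v} := by
    ext x
    simp only [cubicInc, mem_filter, mem_univ, true_and, mem_image, mem_insert, mem_singleton]
    constructor
    · rintro ⟨k, hk⟩
      have : (x, k) ∈ univ.filter fun p : ι × Fin 3 => term p.1 p.2 = t := by simpa using hk
      rw [heq] at this
      simp only [mem_insert, mem_singleton, Prod.mk.injEq] at this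
      tauto
    · rintro (rfl | rfl)
      · exact ⟨i, hu⟩
      · exact ⟨j, hv⟩
  rw [this, card_pair huv]

/-- The part of `D` in the gadgets at vertices satisfying a condition. -/
def restrictTo (D : Finset (ι × EB)) (p : ι → Prop) [DecidablePred p] : Finset (ι × EB) :=
  D.filter fun x => p x.1

theorem gadgetPart_restrictTo (D : Finset (ι × EB)) (p : ι → Prop) [DecidablePred p] (u : ι) :
    gadgetPart (restrictTo D p) u = if p u then gadgetPart D u else ∅ := by
  ext e
  split_ifs with h <;> simp [mem_gadgetPart, restrictTo, h]

/-- Circuits of the blow-up are either contained in a gadget or follow a circuit of the cubic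
graph. -/
theorem card_circuit_blow_le (h : IsCubicIncidence term) (hen : IsSimpleList en)
    (hB : ∀ D, IsCircuit (incEdges (closedEnds en)) D → D.card ≤ Fintype.card I + 3) {m : ℕ}
    (hm : ∀ C, IsCircuit (cubicInc term) C → C.card ≤ m) {D : Finset (ι × EB)}
    (hD : IsCircuit (incEdges (blowEnds en term)) D) :
    D.card ≤ Fintype.card I + 3 ∨ D.card ≤ m * (Fintype.card I + 1) := by
  classical
  have hdeg : ∀ u a, deg (incEdges en) (gadgetPart D u) a ≤ 2 := fun u a =>
    (deg_gadgetPart_le h.inj D u a).trans (hD.deg_le _)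
  -- A nonempty even set inside one gadget is even in the blow-up, so by minimality it is all of
  -- `D`, and it has at most as many edges as the gadget has vertices.
  by_cases hac : ∀ u, IsAcyclic (incEdges en) (gadgetPart D u)
  swap
  · left
    simp only [IsAcyclic, not_forall] at hac
    obtain ⟨u, X, hX, hE, hne⟩ := hac
    have hs : ∀ v, gadgetPart (X.image (Prod.mk u)) v = if v = u then X else ∅ := by
      intro v
      ext e
      split_ifs with hv
      · simp [mem_gadgetPart, hv]
      · simp [mem_gadgetPart, Ne.symm hv]
    have h1 := hD.minimal (X.image (Prod.mk u)) (by
      intro p hp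
      obtain ⟨e, he, rfl⟩ := mem_image.1 hp
      exact mem_gadgetPart.1 (hX he)) ((nonempty_iff_ne_empty.2 hne).image _) (by
      intro w
      rw [deg_blow h.inj]
      refine Finset.even_sum _ fun p _ => ?_
      rw [hs]
      split_ifs
      · exact hE _
      · exact isEven_empty _ _)
    rw [← h1, card_image_of_injective _ (Prod.mk_right_injective u)]
    have h2 := two_mul_card_add_oddVerts_le (card_ends hen) (D := X) fun a =>
      (deg_mono _ hX a).trans (hdeg u a)
    simp only [Fintype.card_sum, Fintype.card_fin] at h2
    omega
  right
  have hkey : ∀ u, gadgetPart D u = ∅ ∨ (∃ i j : Fin 3, i ≠ j ∧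
      oddVerts (incEdges en) (gadgetPart D u) = {Sum.inl i, Sum.inl j}) ∧
        (gadgetPart D u).card ≤ Fintype.card I + 1 := fun u =>
    card_le_of_even_internal hen hB (hac u) (hdeg u) fun k => by
      rw [← deg_blow_inr h.inj]; exact hD.even _
  -- Only two gadgets meet at a terminal and the total degree of `D` there is even, so the two
  -- contributions have the same parity. This makes the trace of `D` on the cubic graph well
  -- defined.
  have hpar : ∀ u i v j, u ≠ v → term u i = term v j →
      Odd (deg (incEdges en) (gadgetPart D u) (Sum.inl i)) →
      Odd (deg (incEdges en) (gadgetPart D v) (Sum.inl j)) := by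
    intro u i v j huv huvt ho
    have he := hD.even (Sum.inl (term u i))
    rw [deg_blow_inl h.inj] at he
    have hset : (univ.filter fun p : ι × Fin 3 => term p.1 p.2 = term u i) = {(u, i), (v, j)} := by
      symm
      apply eq_of_subset_of_card_le
      · intro p hp
        simp only [mem_insert, mem_singleton] at hp
        rcases hp with rfl | rfl <;> simp [huvt]
      · rw [h.two, card_pair (by simp [huv])]
    rw [hset, sum_pair (by simp [huv])] at he
    by_contra hno
    exact Nat.not_even_iff_odd.2 (ho.add_even (Nat.not_odd_iff_even.1 hno)) he
  -- The edges of the cubic graph along which `D` passes from one gadget to another.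
  let C : Finset T := univ.filter fun t =>
    ∃ u i, term u i = t ∧ Odd (deg (incEdges en) (gadgetPart D u) (Sum.inl i))
  have hC : ∀ u i, term u i ∈ C ↔ Odd (deg (incEdges en) (gadgetPart D u) (Sum.inl i)) := by
    intro u i
    simp only [C, mem_filter, mem_univ, true_and]
    constructor
    · rintro ⟨v, j, hvj, ho⟩
      by_cases huv : v = u
      · subst huv
        rwa [h.inj v hvj] at ho
      · exact hpar v j u i huv hvj ho
    · exact fun ho => ⟨u, i, rfl, ho⟩
  have hdegC : ∀ X ⊆ C, ∀ u, deg (cubicInc term) X u =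
      (univ.filter fun i => term u i ∈ X).card := by
    intro X _ u
    rw [deg, ← card_image_of_injective _ (h.inj u)]
    congr 1
    ext t
    simp only [cubicInc, mem_inter, mem_image, mem_filter, mem_univ, true_and]
    constructor
    · rintro ⟨hX, i, rfl⟩; exact ⟨i, hX, rfl⟩
    · rintro ⟨i, hX, rfl⟩; exact ⟨hX, i, rfl⟩
  have hodd : ∀ u, gadgetPart D u = ∅ ∧ (∀ i, term u i ∉ C) ∨ (gadgetPart D u).Nonempty ∧
      ∃ i j : Fin 3, i ≠ j ∧ ∀ k, term u k ∈ C ↔ k = i ∨ k = j := by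
    intro u
    rcases hkey u with h0 | ⟨⟨i, j, hij, ho⟩, -⟩
    · left
      refine ⟨h0, fun i hi => ?_⟩
      rw [hC, h0] at hi
      simp [deg] at hi
    · right
      constructor
      · rw [nonempty_iff_ne_empty]
        intro h0
        rw [h0] at ho
        have : (Sum.inl i : Fin 3 ⊕ I) ∈ oddVerts (incEdges en) ∅ := by rw [ho]; simp
        simp [oddVerts, deg] at this
      · refine ⟨i, j, hij, fun k => ?_⟩
        rw [hC]
        have := congrArg ((Sum.inl k : Fin 3 ⊕ I) ∈ ·) ho
        simpa [oddVerts] using this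
  have hdegC2 : ∀ u, deg (cubicInc term) C u = if gadgetPart D u = ∅ then 0 else 2 := by
    intro u
    rw [hdegC C subset_rfl u]
    rcases hodd u with ⟨h0, h1⟩ | ⟨h0, i, j, hij, h1⟩
    · simp [h0, h1]
    · rw [if_neg h0.ne_empty, ← card_pair hij]
      congr 1
      ext k; simp [h1]
  have hcirc : IsCircuit (cubicInc term) C := by
    refine ⟨?_, ?_, ?_, ?_⟩
    · obtain ⟨⟨u, e⟩, hue⟩ := hD.nonempty
      rcases hodd u with ⟨h0, -⟩ | ⟨-, i, j, -, h1⟩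
      · have := mem_gadgetPart.2 hue
        rw [h0] at this
        exact absurd this (notMem_empty e)
      · exact ⟨term u i, (h1 i).2 (Or.inl rfl)⟩
    · intro u; rw [hdegC2]; split_ifs <;> decide
    · intro u; rw [hdegC2]; split_ifs <;> decide
    · intro X hX hne hE
      have hfull : ∀ u i j, term u i ∈ X → term u j ∈ C → term u j ∈ X := by
        intro u i j hi hj
        have he := hE u
        rw [hdegC X hX] at he
        rcases hodd u with ⟨-, h1⟩ | ⟨-, a, b, hab, h1⟩
        · exact absurd hj (h1 j)
        · have hsub : (univ.filter fun k => term u k ∈ X) ⊆ {a, b} := by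
            intro k hk
            have := (h1 k).1 (hX (mem_filter.1 hk).2)
            simpa using this
          have hpos : 0 < (univ.filter fun k => term u k ∈ X).card :=
            card_pos.2 ⟨i, by simpa using hi⟩
          have heq : (univ.filter fun k => term u k ∈ X) = {a, b} := by
            refine eq_of_subset_of_card_le hsub ?_
            rw [card_pair hab]
            rcases he with ⟨r, hr⟩
            omega
          have : j ∈ univ.filter fun k => term u k ∈ X := by
            rw [heq]
            simpa using (h1 j).1 hj
          exact (mem_filter.1 this).2
      -- Minimality of `C` is inherited from `D`: an even part `X` of `C` selects gadgets, and the
      -- part of `D` in these is even and nonempty, hence everything.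
      have hD' := hD.minimal (restrictTo D fun u => ∃ i, term u i ∈ X) (filter_subset _ _) (by
          obtain ⟨t, ht⟩ := hne
          obtain ⟨u, i, v, j, -, hu, -, -⟩ := h.exists_pair t
          rcases hodd u with ⟨-, h1⟩ | ⟨⟨e, he⟩, -⟩
          · exact absurd (hX ht) (hu ▸ h1 i)
          · exact ⟨(u, e), mem_filter.2 ⟨mem_gadgetPart.1 he, i, by rwa [hu]⟩⟩) (by
          rintro (t | ⟨u, k⟩)
          · rw [deg_blow_inl h.inj]
            by_cases htC : t ∈ C
            · by_cases htX : t ∈ X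
              · have := hD.even (Sum.inl t)
                rw [deg_blow_inl h.inj] at this
                convert this using 2 with p hp
                rw [gadgetPart_restrictTo, if_pos ⟨p.2, by rw [(mem_filter.1 hp).2]; exact htX⟩]
              · refine Finset.even_sum _ fun p hp => ?_
                have hpt := (mem_filter.1 hp).2
                rw [gadgetPart_restrictTo, if_neg]
                · exact isEven_empty _ _
                · rintro ⟨i, hi⟩
                  exact htX (hpt ▸ hfull p.1 i p.2 hi (hpt ▸ htC))
            · refine Finset.even_sum _ fun p hp => ?_
              have hpt := (mem_filter.1 hp).2
              rw [gadgetPart_restrictTo]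
              split_ifs
              · rw [← hpt, hC] at htC
                exact Nat.not_odd_iff_even.1 htC
              · exact isEven_empty _ _
          · rw [deg_blow_inr h.inj, gadgetPart_restrictTo]
            split_ifs
            · rw [← deg_blow_inr h.inj]; exact hD.even _
            · exact isEven_empty _ _)
      refine subset_antisymm hX fun t ht => ?_
      obtain ⟨u, i, v, j, -, hu, -, -⟩ := h.exists_pair t
      rcases hodd u with ⟨-, h1⟩ | ⟨⟨e, he⟩, -⟩
      · exact absurd ht (hu ▸ h1 i)
      · have := mem_gadgetPart.1 he
        rw [← hD', restrictTo, mem_filter] at this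
        obtain ⟨-, i', hi'⟩ := this
        have := hfull u i' i hi' (hu ▸ ht)
        rwa [hu] at this
  have hcard := hm C hcirc
  rw [← hcirc.card_touched h.card_ends] at hcard
  rw [card_eq_sum_gadgetPart]
  -- A circuit touches as many vertices as it has edges, and each touched gadget holds a path
  -- between two terminals.
  calc ∑ u, (gadgetPart D u).card
      ≤ ∑ u, if deg (cubicInc term) C u ≠ 0 then Fintype.card I + 1 else 0 := by
        refine sum_le_sum fun u _ => ?_
        rw [hdegC2]
        rcases hkey u with h0 | ⟨-, h1⟩
        · simp [h0]
        · by_cases h2 : gadgetPart D u = ∅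
          · simp [h2]
          · simpa [h2] using h1
    _ = (univ.filter fun u => deg (cubicInc term) C u ≠ 0).card * (Fintype.card I + 1) := by
        rw [← sum_filter, sum_const, smul_eq_mul]
    _ ≤ m * (Fintype.card I + 1) := Nat.mul_le_mul_right _ hcard

end Blowup

/-! ### Restricting edge sets to a family of gadgets -/

section Embedding

open EdgeSet

variable {I EB ι T ι' T' : Type*} [Fintype I] [Fintype EB] [DecidableEq I] [DecidableEq EB]
  [Fintype ι] [DecidableEq ι] [Fintype T] [DecidableEq T]
  [Fintype ι'] [DecidableEq ι'] [Fintype T'] [DecidableEq T']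

/-- The edges of a set in the gadgets selected by `f`. -/
def pullEdges (f : ι → ι') (D : Finset (ι' × EB)) : Finset (ι × EB) :=
  univ.filter fun p => (f p.1, p.2) ∈ D

/-- The image of a set of edges under an injection of gadgets. -/
def pushEdges (f : ι → ι') (D : Finset (ι × EB)) : Finset (ι' × EB) :=
  D.image fun p => (f p.1, p.2)

variable {en : EB → (Fin 3 ⊕ I) × (Fin 3 ⊕ I)} {term : ι → Fin 3 → T} {term' : ι' → Fin 3 → T'}
  {f : ι → ι'} {g : T → T'}

theorem gadgetPart_pullEdges (D : Finset (ι' × EB)) (u : ι) :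
    gadgetPart (pullEdges f D) u = gadgetPart D (f u) := by
  ext e; simp [mem_gadgetPart, pullEdges]

theorem gadgetPart_pushEdges (hf : Function.Injective f) (D : Finset (ι × EB)) (u : ι) :
    gadgetPart (pushEdges f D) (f u) = gadgetPart D u := by
  ext e; simp [mem_gadgetPart, pushEdges, hf.eq_iff]

theorem gadgetPart_pushEdges_of_notMem (D : Finset (ι × EB)) {u' : ι'} (hu : u' ∉ Set.range f) :
    gadgetPart (pushEdges f D) u' = ∅ := by
  ext e
  simp only [mem_gadgetPart, pushEdges, mem_image, notMem_empty, iff_false]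
  rintro ⟨p, -, hp⟩
  exact hu ⟨p.1, (Prod.ext_iff.1 hp).1⟩

theorem blowVert_map (hfg : ∀ u i, term' (f u) i = g (term u i)) (u : ι) (a : Fin 3 ⊕ I) :
    blowVert term' (f u) a = Sum.map g (Prod.map f id) (blowVert term u a) := by
  cases a <;> simp [blowVert, hfg]

/-- Gadgets outside the image of `f` may still share terminals with those inside; the extra sum is
their contribution, and it vanishes at vertices interior to the family. -/
theorem deg_pullEdges_add (hf : Function.Injective f) (hg : Function.Injective g)
    (hfg : ∀ u i, term' (f u) i = g (term u i)) (hinj : ∀ u, Function.Injective (term u))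
    (hinj' : ∀ u, Function.Injective (term' u)) (D : Finset (ι' × EB)) (w : T ⊕ ι × I) :
    deg (incEdges (blowEnds en term')) D (Sum.map g (Prod.map f id) w) =
      deg (incEdges (blowEnds en term)) (pullEdges f D) w +
      ∑ p : ι' × (Fin 3 ⊕ I) with blowVert term' p.1 p.2 = Sum.map g (Prod.map f id) w ∧
        p.1 ∉ univ.image f, deg (incEdges en) (gadgetPart D p.1) p.2 := by
  rw [deg_blow hinj, deg_blow hinj',
    ← sum_filter_add_sum_filter_not _ fun p : ι' × (Fin 3 ⊕ I) => p.1 ∈ univ.image f]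
  congr 1
  · symm
    refine sum_bij (fun p _ => (f p.1, p.2)) ?_ ?_ ?_ ?_
    · rintro ⟨u, a⟩ h
      simp only [mem_filter, mem_univ, true_and] at h ⊢
      exact ⟨by rw [blowVert_map hfg, h], mem_image_of_mem _ (mem_univ _)⟩
    · rintro ⟨u, a⟩ _ ⟨v, b⟩ _ h
      simpa [hf.eq_iff] using h
    · rintro ⟨u', a⟩ h
      simp only [mem_filter, mem_univ, true_and] at h
      obtain ⟨h1, h2⟩ := h
      obtain ⟨u, -, rfl⟩ := mem_image.1 h2
      refine ⟨(u, a), ?_, rfl⟩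
      rw [blowVert_map hfg] at h1
      simp only [mem_filter, mem_univ, true_and]
      exact (Sum.map_injective.2 ⟨hg, hf.prodMap Function.injective_id⟩) h1
    · rintro ⟨u, a⟩ _
      rw [gadgetPart_pullEdges]
  · rw [filter_filter]

theorem deg_pullEdges_le (hf : Function.Injective f) (hg : Function.Injective g)
    (hfg : ∀ u i, term' (f u) i = g (term u i)) (hinj : ∀ u, Function.Injective (term u))
    (hinj' : ∀ u, Function.Injective (term' u)) (D : Finset (ι' × EB)) (w : T ⊕ ι × I) :
    deg (incEdges (blowEnds en term)) (pullEdges f D) w ≤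
      deg (incEdges (blowEnds en term')) D (Sum.map g (Prod.map f id) w) := by
  rw [deg_pullEdges_add hf hg hfg hinj hinj']
  exact Nat.le_add_right _ _

theorem deg_pullEdges_eq (hf : Function.Injective f) (hg : Function.Injective g)
    (hfg : ∀ u i, term' (f u) i = g (term u i)) (hinj : ∀ u, Function.Injective (term u))
    (hinj' : ∀ u, Function.Injective (term' u)) (D : Finset (ι' × EB)) (w : T ⊕ ι × I)
    (hw : ∀ (u' : ι') (a : Fin 3 ⊕ I), blowVert term' u' a = Sum.map g (Prod.map f id) w →
      u' ∉ Set.range f → gadgetPart D u' = ∅) :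
    deg (incEdges (blowEnds en term)) (pullEdges f D) w =
      deg (incEdges (blowEnds en term')) D (Sum.map g (Prod.map f id) w) := by
  rw [deg_pullEdges_add hf hg hfg hinj hinj', sum_eq_zero, add_zero]
  rintro ⟨u', a⟩ h
  simp only [mem_filter, mem_univ, true_and, mem_image, not_exists] at h
  rw [hw u' a h.1 fun ⟨u, hu⟩ => h.2 u hu]
  simp [deg]

theorem isEven_pushEdges (hf : Function.Injective f) (hg : Function.Injective g)
    (hfg : ∀ u i, term' (f u) i = g (term u i)) (hinj : ∀ u, Function.Injective (term u))
    (hinj' : ∀ u, Function.Injective (term' u)) {X : Finset (ι × EB)}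
    (hX : IsEven (incEdges (blowEnds en term)) X) :
    IsEven (incEdges (blowEnds en term')) (pushEdges f X) := by
  intro w'
  have hpp : pullEdges f (pushEdges f X) = X := by
    ext ⟨u, e⟩
    simp [pullEdges, pushEdges, hf.eq_iff]
  by_cases hw : ∃ w, Sum.map g (Prod.map f id) w = w'
  · obtain ⟨w, rfl⟩ := hw
    rw [← deg_pullEdges_eq hf hg hfg hinj hinj' _ w fun u' a _ hu' =>
      gadgetPart_pushEdges_of_notMem X hu', hpp]
    exact hX w
  · rw [deg_blow hinj', sum_eq_zero]
    · exact Even.zero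
    · rintro ⟨u', a⟩ h
      simp only [mem_filter, mem_univ, true_and] at h
      have hu' : u' ∉ Set.range f := by
        rintro ⟨u, rfl⟩
        exact hw ⟨_, (blowVert_map hfg u a).symm.trans h⟩
      rw [gadgetPart_pushEdges_of_notMem X hu']
      simp [deg]

theorem isAcyclic_pullEdges (hf : Function.Injective f) (hg : Function.Injective g)
    (hfg : ∀ u i, term' (f u) i = g (term u i)) (hinj : ∀ u, Function.Injective (term u))
    (hinj' : ∀ u, Function.Injective (term' u)) {D : Finset (ι' × EB)}
    (hD : IsAcyclic (incEdges (blowEnds en term')) D) :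
    IsAcyclic (incEdges (blowEnds en term)) (pullEdges f D) := by
  intro X hX hE
  have := hD (pushEdges f X) (by
    intro p hp
    obtain ⟨q, hq, rfl⟩ := mem_image.1 hp
    exact (mem_filter.1 (hX hq)).2) (isEven_pushEdges hf hg hfg hinj hinj' hE)
  simpa [pushEdges] using this

theorem isAcyclic_gadgetPart (hinj : ∀ u, Function.Injective (term u)) {D : Finset (ι × EB)}
    (hD : IsAcyclic (incEdges (blowEnds en term)) D) (u : ι) :
    IsAcyclic (incEdges en) (gadgetPart D u) := by
  intro X hX hE
  have := hD (X.image (Prod.mk u)) (by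
    intro p hp
    obtain ⟨e, he, rfl⟩ := mem_image.1 hp
    exact mem_gadgetPart.1 (hX he)) (by
    intro w
    rw [deg_blow hinj]
    refine Finset.even_sum _ fun p _ => ?_
    have : gadgetPart (X.image (Prod.mk u)) p.1 = if p.1 = u then X else ∅ := by
      ext e
      split_ifs with hv
      · simp [mem_gadgetPart, hv]
      · simp [mem_gadgetPart, Ne.symm hv]
    rw [this]
    split_ifs
    · exact hE _
    · exact isEven_empty _ _)
  simpa using this

/-- In an acyclic edge set of maximum degree two, a gadget contains few edges unless the set has
an end inside the gadget. -/
theorem card_gadgetPart_le (hen : IsSimpleList en)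
    (hB : ∀ D, IsCircuit (incEdges (closedEnds en)) D → D.card ≤ Fintype.card I + 3)
    (hinj : ∀ u, Function.Injective (term u)) {P : Finset (ι × EB)}
    (hP : IsAcyclic (incEdges (blowEnds en term)) P)
    (hdeg : ∀ w, deg (incEdges (blowEnds en term)) P w ≤ 2) (u : ι) :
    (gadgetPart P u).card ≤ Fintype.card I + 1 + (univ.filter fun k : I =>
      Sum.inr (u, k) ∈ oddVerts (incEdges (blowEnds en term)) P).card := by
  have hac := isAcyclic_gadgetPart hinj hP u
  have hd : ∀ a, deg (incEdges en) (gadgetPart P u) a ≤ 2 := fun a =>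
    (deg_gadgetPart_le hinj P u a).trans (hdeg _)
  by_cases hev : ∀ k, Even (deg (incEdges en) (gadgetPart P u) (Sum.inr k))
  · rcases card_le_of_even_internal hen hB hac hd hev with h0 | ⟨-, h1⟩
    · simp [h0]
    · omega
  -- With one odd vertex there are at least two, so the degree sum leaves at most |I| + 2 edges; the
  -- allowance for the odd internal vertex covers the one edge beyond |I| + 1.
  · rw [not_forall] at hev
    obtain ⟨k, hk⟩ := hev
    have hpos : 0 < (univ.filter fun k : I =>
        Sum.inr (u, k) ∈ oddVerts (incEdges (blowEnds en term)) P).card := by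
      refine card_pos.2 ⟨k, ?_⟩
      simp only [mem_filter, mem_univ, true_and, oddVerts]
      rw [deg_blow_inr hinj]
      exact Nat.not_even_iff_odd.1 hk
    have h1 := two_mul_card_add_oddVerts_le (card_ends hen) hd
    have h2 := even_card_oddVerts (card_ends hen) (gadgetPart P u)
    have h3 : 0 < (oddVerts (incEdges en) (gadgetPart P u)).card :=
      card_pos.2 ⟨Sum.inr k, by simpa [oddVerts] using hk⟩
    simp only [Fintype.card_sum, Fintype.card_fin] at h1
    rcases h2 with ⟨r, hr⟩
    omega

end Embedding

/-! ### Four copies of a cubic graph minus a vertex: bounds for paths -/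

section FourCopies

open EdgeSet

variable {I EB ι T : Type*} [Fintype I] [Fintype EB] [DecidableEq I] [DecidableEq EB]
  [Fintype ι] [DecidableEq ι] [Fintype T] [DecidableEq T]

/-- Three dangling edges are joined to a new vertex. -/
def termOne (loc : ι → Fin 3 → T ⊕ Fin 3) : Option ι → Fin 3 → T ⊕ Fin 3
  | none, k => Sum.inr k
  | some u, i => loc u i

/-- The edge of the complete graph on four vertices with colour `k` at `c`. -/
def link (c : Fin 4) (k : Fin 3) : Fin 3 × Fin 2 := (k, if c = 0 ∨ c = k.succ then 0 else 1)

/-- The name in copy `c` of an edge; dangling edges become links between the copies. -/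
def copyEdge (c : Fin 4) : T ⊕ Fin 3 → (Fin 4 × T) ⊕ (Fin 3 × Fin 2) :=
  Sum.map (Prod.mk c) (link c)

/-- Four copies are joined along the edges of the complete graph on four vertices. -/
def termFour (loc : ι → Fin 3 → T ⊕ Fin 3) :
    Fin 4 × ι → Fin 3 → (Fin 4 × T) ⊕ (Fin 3 × Fin 2) :=
  fun p i => copyEdge p.1 (loc p.2 i)

theorem termOne_none (loc : ι → Fin 3 → T ⊕ Fin 3) (k : Fin 3) :
    termOne loc none k = Sum.inr k := rfl

theorem termOne_some (loc : ι → Fin 3 → T ⊕ Fin 3) (u : ι) : termOne loc (some u) = loc u := rfl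

theorem link_injective (c : Fin 4) : Function.Injective (link c) :=
  fun _ _ h => (Prod.ext_iff.1 h).1

theorem copyEdge_injective (c : Fin 4) : Function.Injective (copyEdge (T := T) c) :=
  Sum.map_injective.2 ⟨Prod.mk_right_injective c, link_injective c⟩

variable {en : EB → (Fin 3 ⊕ I) × (Fin 3 ⊕ I)} {loc : ι → Fin 3 → T ⊕ Fin 3}

/-- An inner edge keeps both its ends in its own copy. A dangling edge has one end apart from the
new vertex, so a link has one end in each of the two copies that it joins. Different copies share
just one link, and this excludes parallel edges between them. -/
theorem IsCubicIncidence.termFour (h : IsCubicIncidence (termOne loc)) :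
    IsCubicIncidence (termFour loc) := by
  have hloc : ∀ u, Function.Injective (loc u) := fun u => h.inj (some u)
  refine ⟨fun p => (copyEdge_injective p.1).comp (hloc p.2), ?_, ?_⟩
  · rintro (⟨c, t⟩ | ⟨k, s⟩)
    · refine Eq.trans ?_ (h.two (Sum.inl t))
      refine card_bij (fun p _ => (some p.1.2, p.2)) ?_ ?_ ?_
      · rintro ⟨⟨d, u⟩, i⟩ hp
        simp only [mem_filter, mem_univ, true_and] at hp ⊢
        simp only [_root_.termFour, copyEdge, termOne_some] at hp ⊢
        rcases hl : loc u i with t' | k' <;> simp [hl] at hp ⊢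
        exact hp.2
      · rintro ⟨⟨d, u⟩, i⟩ hp ⟨⟨d', u'⟩, i'⟩ hp' heq
        simp only [mem_filter, mem_univ, true_and] at hp hp'
        simp only [_root_.termFour, copyEdge] at hp hp'
        simp only [Prod.mk.injEq, Option.some.injEq] at heq
        obtain ⟨rfl, rfl⟩ := heq
        rcases hl : loc u i with t' | k' <;> simp [hl] at hp hp'
        simp [hp.1, hp'.1]
      · rintro ⟨_ | u, i⟩ hp
        · simp [termOne_none] at hp
        · simp only [mem_filter, mem_univ, true_and, termOne_some] at hp
          refine ⟨((c, u), i), ?_, rfl⟩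
          simp only [mem_filter, mem_univ, true_and]
          simp [_root_.termFour, copyEdge, hp]
    · obtain ⟨u, i, v, j, huv, hu, hv, heq⟩ := h.exists_pair (Sum.inr k)
      -- One of the two incidences of the edge is at the new vertex, so exactly one remains in
      -- `loc`.
      have hex : ∃ u₀ i₀, loc u₀ i₀ = Sum.inr k ∧ ∀ u i, loc u i = Sum.inr k → u = u₀ ∧ i = i₀ := by
        have hn : ((none : Option ι), k) ∈ univ.filter fun p : Option ι × Fin 3 =>
          termOne loc p.1 p.2 = Sum.inr k := by
            simp [termOne_none]
        have huniq : ∀ x l, termOne loc x l = Sum.inr k → (x, l) = (u, i) ∨ (x, l) = (v, j) := by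
          intro x l hx
          have : (x, l) ∈ univ.filter fun p : Option ι × Fin 3 =>
            termOne loc p.1 p.2 = Sum.inr k := by simpa using hx
          rw [heq] at this
          simpa using this
        rw [heq] at hn
        simp only [mem_insert, mem_singleton, Prod.mk.injEq] at hn
        rcases hn with ⟨rfl, -⟩ | ⟨rfl, -⟩
        · cases v with
          | none => exact absurd rfl huv
          | some v =>
            refine ⟨v, j, hv, fun x l hx => ?_⟩
            rcases huniq (some x) l hx with h' | h'
            · simp at h'
            · simpa using h'
        · cases u with
          | none => exact absurd rfl huv
          | some u =>
            refine ⟨u, i, hu, fun x l hx => ?_⟩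
            rcases huniq (some x) l hx with h' | h'
            · simpa using h'
            · simp at h'
      obtain ⟨u₀, i₀, h0, huniq⟩ := hex
      have hc2 : (univ.filter fun c : Fin 4 => link c k = (k, s)).card = 2 := by
        clear hu hv heq h0 huniq
        revert k s; decide
      refine Eq.trans ?_ hc2
      refine card_bij (fun p _ => p.1.1) ?_ ?_ ?_
      · rintro ⟨⟨d, u⟩, i⟩ hp
        simp only [mem_filter, mem_univ, true_and] at hp ⊢
        simp only [_root_.termFour, copyEdge] at hp
        rcases hl : loc u i with t' | k'
        · simp [hl] at hp
        · rw [hl, Sum.map_inr] at hp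
          have h1 := Sum.inr_injective hp
          have h2 : k' = k := (Prod.ext_iff.1 h1).1
          rwa [h2] at h1
      · rintro ⟨⟨d, u⟩, i⟩ hp ⟨⟨d', u'⟩, i'⟩ hp' heq
        have key : ∀ d u i, _root_.termFour loc (d, u) i = Sum.inr (k, s) → u = u₀ ∧ i = i₀ := by
          intro d u i hp
          simp only [_root_.termFour, copyEdge] at hp
          rcases hl : loc u i with t' | k'
          · simp [hl] at hp
          · rw [hl, Sum.map_inr] at hp
            have h2 : k' = k := (Prod.ext_iff.1 (Sum.inr_injective hp)).1
            exact huniq u i (h2 ▸ hl)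
        simp only [mem_filter, mem_univ, true_and] at hp hp'
        obtain ⟨rfl, rfl⟩ := key _ _ _ hp
        obtain ⟨rfl, rfl⟩ := key _ _ _ hp'
        simp only at heq
        rw [heq]
      · intro c hc
        refine ⟨((c, u₀), i₀), ?_, rfl⟩
        simp only [mem_filter, mem_univ, true_and] at hc ⊢
        simp [_root_.termFour, copyEdge, h0, hc]
  · rintro ⟨c, u⟩ ⟨d, v⟩ i i' j j' hne h1 h2
    by_cases hcd : c = d
    · subst hcd
      have huv : (some u : Option ι) ≠ some v := by
        intro h'; exact hne (by rw [Option.some.inj h'])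
      exact h.share (some u) (some v) i i' j j' huv (copyEdge_injective c h1)
        (copyEdge_injective c h2)
    · have key : ∀ i j, _root_.termFour loc (c, u) i = _root_.termFour loc (d, v) j →
          ∃ k, loc u i = Sum.inr k ∧ link c k = link d k := by
        intro i j h1
        simp only [_root_.termFour, copyEdge] at h1
        rcases hl : loc u i with t | k <;> rcases hl' : loc v j with t' | k' <;>
          simp [hl, hl', hcd] at h1
        have : k = k' := (Prod.ext_iff.1 h1).1
        exact ⟨k, rfl, this ▸ h1⟩
      obtain ⟨k, hk, hl⟩ := key _ _ h1
      obtain ⟨k', hk', hl'⟩ := key _ _ h2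
      have hdec : ∀ c d : Fin 4, c ≠ d → ∀ k k', link c k = link d k → link c k' = link d k' →
          k = k' := by decide
      have := hdec c d hcd k k' hl hl'
      exact hloc u (by rw [hk, hk', this])

/-- A path through the three dangling terminals is completed to a circuit by a path of a further
gadget. -/
theorem isCircuit_complete (h : IsCubicIncidence (termOne loc)) (hen : IsSimpleList en)
    {P : Finset (ι × EB)} (hac : IsAcyclic (incEdges (blowEnds en loc)) P)
    (hdeg : ∀ w, deg (incEdges (blowEnds en loc)) P w ≤ 2) {i j : Fin 3} (hij : i ≠ j)
    (hodd : oddVerts (incEdges (blowEnds en loc)) P =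
      {Sum.inl (Sum.inr i), Sum.inl (Sum.inr j)})
    {Q : Finset EB} (hQac : IsAcyclic (incEdges en) Q) (hQdeg : ∀ a, deg (incEdges en) Q a ≤ 2)
    (hQodd : oddVerts (incEdges en) Q = {Sum.inl i, Sum.inl j})
    (hQ0 : ∀ k, k ≠ i → k ≠ j → deg (incEdges en) Q (Sum.inl k) = 0) :
    ∃ D : Finset (Option ι × EB), IsCircuit (incEdges (blowEnds en (termOne loc))) D ∧
      D.card = P.card + Q.card := by
  have hloc : ∀ u, Function.Injective (loc u) := fun u => h.inj (some u)
  have hsome : Function.Injective (some : ι → Option ι) := Option.some_injective ι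
  have hidi : Function.Injective (id : T ⊕ Fin 3 → T ⊕ Fin 3) := Function.injective_id
  have hfg : ∀ u i, termOne loc (some u) i = id (loc u i) := fun _ _ => rfl
  have hnr : ∀ o : Option ι, o ∉ Set.range (some : ι → Option ι) → o = none := by
    intro o ho
    cases o with
    | none => rfl
    | some u => exact absurd ⟨u, rfl⟩ ho
  let A : Finset (Option ι × EB) := pushEdges some P
  let B : Finset (Option ι × EB) := Q.image (Prod.mk none)
  have hAs : ∀ u, gadgetPart A (some u) = gadgetPart P u := gadgetPart_pushEdges hsome P
  have hAn : gadgetPart A none = ∅ := gadgetPart_pushEdges_of_notMem P (by simp)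
  have hBs : ∀ u, gadgetPart B (some u) = ∅ := by
    intro u; ext e; simp [mem_gadgetPart, B]
  have hBn : gadgetPart B none = Q := by
    ext e; simp [mem_gadgetPart, B]
  have hdisj : Disjoint A B := by
    rw [disjoint_left]
    rintro ⟨o, e⟩ hA hB
    cases o with
    | none =>
      have := mem_gadgetPart.2 hA
      rw [hAn] at this
      exact notMem_empty _ this
    | some u =>
      have := mem_gadgetPart.2 hB
      rw [hBs] at this
      exact notMem_empty _ this
  have hpullA : pullEdges some A = P := by
    ext ⟨u, e⟩
    rw [← mem_gadgetPart, gadgetPart_pullEdges, hAs, mem_gadgetPart]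
  have hdegA : ∀ w, deg (incEdges (blowEnds en (termOne loc))) A
      (Sum.map id (Prod.map some id) w) = deg (incEdges (blowEnds en loc)) P w := by
    intro w
    rw [← deg_pullEdges_eq hsome hidi hfg hloc h.inj A w (fun u' a _ hu' => by
      rw [hnr u' hu', hAn]), hpullA]
  have hdegBr : ∀ k, deg (incEdges (blowEnds en (termOne loc))) B (Sum.inl (Sum.inr k)) =
      deg (incEdges en) Q (Sum.inl k) := by
    intro k
    rw [deg_blow_inl h.inj, sum_eq_single ((none : Option ι), k)]
    · rw [hBn]
    · rintro ⟨_ | u, l⟩ hp hne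
      · simp only [mem_filter, mem_univ, true_and, termOne_none] at hp
        exact absurd (by rw [Sum.inr_injective hp]) hne
      · rw [hBs]; simp [deg]
    · intro hno
      simp [termOne_none] at hno
  have hdegBl : ∀ t, deg (incEdges (blowEnds en (termOne loc))) B (Sum.inl (Sum.inl t)) = 0 := by
    intro t
    rw [deg_blow_inl h.inj, sum_eq_zero]
    rintro ⟨_ | u, l⟩ hp
    · simp [termOne_none] at hp
    · rw [hBs]; simp [deg]
  have hPodd : ∀ w, Odd (deg (incEdges (blowEnds en loc)) P w) ↔
      w = Sum.inl (Sum.inr i) ∨ w = Sum.inl (Sum.inr j) := by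
    intro w
    have := congrArg (w ∈ ·) hodd
    simpa [oddVerts] using this
  have hQodd' : ∀ a, Odd (deg (incEdges en) Q a) ↔ a = Sum.inl i ∨ a = Sum.inl j := by
    intro w
    have := congrArg (w ∈ ·) hQodd
    simpa [oddVerts] using this
  have hD : ∀ w, deg (incEdges (blowEnds en (termOne loc))) (A ∪ B) w =
      deg (incEdges (blowEnds en (termOne loc))) A w +
      deg (incEdges (blowEnds en (termOne loc))) B w := deg_union _ hdisj
  -- `P` and `Q` meet only in dangling terminals. At `i` and `j` both are odd and hence of degree
  -- one; at the third terminal `Q` has degree zero, so nothing is added there to the degree of `P`.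
  have hall : ∀ w, Even (deg (incEdges (blowEnds en (termOne loc))) (A ∪ B) w) ∧
      deg (incEdges (blowEnds en (termOne loc))) (A ∪ B) w ≤ 2 := by
    rintro ((t | k) | ⟨_ | u, k⟩)
    · have h1 := hdegA (Sum.inl (Sum.inl t))
      rw [Sum.map_inl, id] at h1
      rw [hD, h1, hdegBl, add_zero]
      refine ⟨Nat.not_odd_iff_even.1 fun ho => ?_, hdeg _⟩
      rcases (hPodd _).1 ho with h' | h' <;> simp at h'
    · have h1 := hdegA (Sum.inl (Sum.inr k))
      rw [Sum.map_inl, id] at h1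
      rw [hD, h1, hdegBr]
      have o1 := hPodd (Sum.inl (Sum.inr k))
      have o2 := hQodd' (Sum.inl k)
      have l1 := hdeg (Sum.inl (Sum.inr k))
      have l2 := hQdeg (Sum.inl k)
      have z := hQ0 k
      simp only [Sum.inl.injEq, Sum.inr.injEq] at o1 o2
      by_cases hk : k = i ∨ k = j
      · have o1 := o1.2 hk
        have o2 := o2.2 hk
        refine ⟨o1.add_odd o2, ?_⟩
        rcases o1 with ⟨r, hr⟩
        rcases o2 with ⟨r', hr'⟩
        omega
      · rw [z (fun h => hk (Or.inl h)) (fun h => hk (Or.inr h)), add_zero]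
        exact ⟨Nat.not_odd_iff_even.1 fun ho => hk (o1.1 ho), l1⟩
    · rw [hD, deg_blow_inr h.inj, deg_blow_inr h.inj, hAn, hBn]
      have : deg (incEdges en) ∅ (Sum.inr k) = 0 := by simp [deg]
      rw [this, zero_add]
      refine ⟨Nat.not_odd_iff_even.1 fun ho => ?_, hQdeg _⟩
      rcases (hQodd' _).1 ho with h' | h' <;> simp at h'
    · have h1 := hdegA (Sum.inr (u, k))
      rw [Sum.map_inr, Prod.map_apply, id] at h1
      rw [hD, h1, deg_blow_inr h.inj, hBs]
      have : deg (incEdges en) ∅ (Sum.inr k) = 0 := by simp [deg]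
      rw [this, add_zero]
      refine ⟨Nat.not_odd_iff_even.1 fun ho => ?_, hdeg _⟩
      rcases (hPodd _).1 ho with h' | h' <;> simp at h'
  have hparts : ∀ u, gadgetPart (A ∪ B) (some u) = gadgetPart P u := by
    intro u
    ext e
    rw [mem_gadgetPart, mem_union, ← mem_gadgetPart, ← mem_gadgetPart, hAs, hBs]
    simp
  have hpartn : gadgetPart (A ∪ B) none = Q := by
    ext e
    rw [mem_gadgetPart, mem_union, ← mem_gadgetPart, ← mem_gadgetPart, hAn, hBn]
    simp
  have hrest : ∀ Y ⊆ A ∪ B, IsEven (incEdges (blowEnds en (termOne loc))) Y →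
      gadgetPart Y none = ∅ → Y = ∅ := by
    intro Y hY hE h0
    have h1 : pullEdges some Y = ∅ := by
      refine hac _ ?_ fun w => ?_
      · rintro ⟨u, e⟩ hue
        rw [← mem_gadgetPart, gadgetPart_pullEdges] at hue
        have := gadgetPart_mono hY (some u) hue
        rwa [hparts, mem_gadgetPart] at this
      · rw [deg_pullEdges_eq hsome hidi hfg hloc h.inj Y w (fun u' a _ hu' => by
          rw [hnr u' hu', h0])]
        exact hE _
    ext ⟨o, e⟩
    rw [← mem_gadgetPart]
    cases o with
    | none => rw [h0]; simp
    | some u =>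
      rw [← gadgetPart_pullEdges, h1]
      simp [mem_gadgetPart]
  refine ⟨A ∪ B, ⟨?_, fun w => (hall w).1, fun w => (hall w).2, ?_⟩, ?_⟩
  · have : Q ≠ ∅ := by
      rintro rfl
      have := (hQodd' (Sum.inl i)).2 (Or.inl rfl)
      simp [deg] at this
    exact ((nonempty_iff_ne_empty.2 this).image _).mono subset_union_right
  · intro X hX hne hE
    have hXz : gadgetPart X none ⊆ Q := hpartn ▸ gadgetPart_mono hX none
    have hsub : oddVerts (incEdges en) (gadgetPart X none) ⊆ {Sum.inl i, Sum.inl j} := by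
      rintro (k | k) hk
      · by_contra hno
        simp only [mem_insert, mem_singleton, Sum.inl.injEq, not_or] at hno
        have h1 := deg_mono (incEdges en) hXz (Sum.inl k)
        rw [hQ0 k hno.1 hno.2, Nat.le_zero] at h1
        simp [oddVerts, h1] at hk
      · have h1 := hE (Sum.inr (none, k))
        rw [deg_blow_inr h.inj] at h1
        simp only [oddVerts, mem_filter, mem_univ, true_and] at hk
        exact absurd h1 (Nat.not_even_iff_odd.2 hk)
    by_cases hem : oddVerts (incEdges en) (gadgetPart X none) = ∅
    · exact absurd (hrest X hX hE (hQac _ hXz ((isEven_iff_oddVerts _ _).2 hem))) hne.ne_empty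
    · have hcard := even_card_oddVerts (card_ends hen) (gadgetPart X none)
      have hpos := card_pos.2 (nonempty_iff_ne_empty.2 hem)
      have hpair : ({Sum.inl i, Sum.inl j} : Finset (Fin 3 ⊕ I)).card = 2 :=
        card_pair (by simpa using hij)
      have heq := eq_of_subset_of_card_le hsub (by
        rw [hpair]; rcases hcard with ⟨r, hr⟩; omega)
      -- The part of `X` in the additional gadget has the same odd vertices as `Q`, so the
      -- difference is even and therefore empty. Thus the complement of `X` avoids this gadget, and
      -- `hrest` applies to it.
      have hQX : Q \ gadgetPart X none = ∅ := by
        refine hQac _ sdiff_subset fun a => ?_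
        have h1 := deg_sdiff_add (incEdges en) hXz a
        have h2 : Odd (deg (incEdges en) (gadgetPart X none) a) ↔ Odd (deg (incEdges en) Q a) := by
          have e1 := congrArg (a ∈ ·) heq
          have e2 := congrArg (a ∈ ·) hQodd
          simp only [oddVerts, mem_filter, mem_univ, true_and] at e1 e2
          rw [e1, e2]
        rw [← h1] at h2
        have h3 : Even (deg (incEdges en) (Q \ gadgetPart X none) a) := by
          by_contra h4
          rw [Nat.not_even_iff_odd] at h4
          rw [Nat.odd_add'] at h2
          rw [← Nat.not_odd_iff_even] at h2
          tauto
        exact h3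
      have h1 := hrest ((A ∪ B) \ X) sdiff_subset
        (hE.sdiff hX fun w => (hall w).1) (by
          rw [← hQX]
          ext e
          simp only [mem_gadgetPart, mem_sdiff]
          rw [← mem_gadgetPart, hpartn])
      exact subset_antisymm hX (sdiff_eq_empty_iff_subset.1 h1)
  · have hinj : Function.Injective fun p : ι × EB => (some p.1, p.2) := by
      rintro ⟨u, e⟩ ⟨v, f⟩ huv
      simpa using huv
    rw [card_union_of_disjoint hdisj, card_image_of_injective _ (Prod.mk_right_injective _)]
    simp only [A, pushEdges, card_image_of_injective _ hinj]

/-- Whether a vertex of the blow-up of four copies lies inside copy `c`. -/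
def insideCopy (c : Fin 4) : ((Fin 4 × T) ⊕ (Fin 3 × Fin 2)) ⊕ (Fin 4 × ι) × I → Bool
  | Sum.inl (Sum.inl (d, _)) => d = c
  | Sum.inl (Sum.inr _) => false
  | Sum.inr ((d, _), _) => d = c

theorem sum_card_insideCopy_le (O : Finset (((Fin 4 × T) ⊕ (Fin 3 × Fin 2)) ⊕ (Fin 4 × ι) × I)) :
    ∑ c, (O.filter fun w => insideCopy c w).card ≤ O.card := by
  rw [← card_biUnion]
  · exact card_le_card (biUnion_subset.2 fun c _ => filter_subset _ _)
  · intro c _ d _ hcd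
    rw [Function.onFun, disjoint_filter]
    rintro ((⟨a, t⟩ | x) | ⟨⟨a, u⟩, k⟩) _ h1 h2 <;> simp [insideCopy] at h1 h2 <;>
      exact hcd (h1.symm.trans h2)

/-- A set of edges as it arises from a path meets a copy in few edges unless it has an end inside
this copy. -/
theorem card_copy_le (h : IsCubicIncidence (termOne loc)) (hen : IsSimpleList en)
    (hB : ∀ D, IsCircuit (incEdges (closedEnds en)) D → D.card ≤ Fintype.card I + 3)
    (hm : ∀ C, IsCircuit (cubicInc (termOne loc)) C → C.card ≤ Fintype.card ι)
    (hι : 3 ≤ Fintype.card ι)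
    (hQ : ∀ i j : Fin 3, i ≠ j → ∃ Q, IsAcyclic (incEdges en) Q ∧
      (∀ a, deg (incEdges en) Q a ≤ 2) ∧ oddVerts (incEdges en) Q = {Sum.inl i, Sum.inl j} ∧
      (∀ k, k ≠ i → k ≠ j → deg (incEdges en) Q (Sum.inl k) = 0) ∧ Q.card = Fintype.card I + 1)
    {P : Finset ((Fin 4 × ι) × EB)} (hP : IsAcyclic (incEdges (blowEnds en (termFour loc))) P)
    (hdeg : ∀ w, deg (incEdges (blowEnds en (termFour loc))) P w ≤ 2) (c : Fin 4)
    (hfree : ∀ w ∈ oddVerts (incEdges (blowEnds en (termFour loc))) P, insideCopy c w = false) :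
    (pullEdges (Prod.mk c) P).card ≤ (Fintype.card ι - 1) * (Fintype.card I + 1) := by
  have hloc : ∀ u, Function.Injective (loc u) := fun u => h.inj (some u)
  have hlocs : ∀ u v i i' j j', u ≠ v → loc u i = loc v j → loc u i' = loc v j' → i = i' :=
    fun u v i i' j j' huv => h.share (some u) (some v) i i' j j' (by simpa using huv)
  have hc : Function.Injective (Prod.mk c : ι → Fin 4 × ι) := Prod.mk_right_injective c
  have hfg : ∀ u i, termFour loc (c, u) i = copyEdge c (loc u i) := fun _ _ => rfl
  have h4 := h.termFour
  have hac := isAcyclic_pullEdges hc (copyEdge_injective c) hfg hloc h4.inj hP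
  have hd : ∀ w, deg (incEdges (blowEnds en loc)) (pullEdges (Prod.mk c) P) w ≤ 2 := fun w =>
    (deg_pullEdges_le hc (copyEdge_injective c) hfg hloc h4.inj P w).trans (hdeg _)
  -- At vertices inside the copy the restricted degree is the full degree, which is even since no
  -- odd vertex lies inside the copy. Only the three dangling terminals can be odd.
  have hsub : oddVerts (incEdges (blowEnds en loc)) (pullEdges (Prod.mk c) P) ⊆
      univ.image fun k : Fin 3 => Sum.inl (Sum.inr k) := by
    intro w hw
    by_contra hno
    have hin : insideCopy c (Sum.map (copyEdge c) (Prod.map (Prod.mk c) id) w :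
        ((Fin 4 × T) ⊕ (Fin 3 × Fin 2)) ⊕ (Fin 4 × ι) × I) = true := by
      rcases w with (t | k) | ⟨u, k⟩
      · simp [copyEdge, insideCopy]
      · simp at hno
      · simp [insideCopy]
    have heq := deg_pullEdges_eq (en := en) hc (copyEdge_injective c) hfg hloc h4.inj P w (by
      rintro ⟨d, u⟩ a hda hu
      have hdc : d ≠ c := by rintro rfl; exact hu ⟨u, rfl⟩
      exfalso
      rw [← hda] at hin
      rcases a with i | k
      · simp only [blowVert, Sum.map_inl, termFour, copyEdge] at hin
        rcases hl : loc u i with t | k <;> simp [hl, insideCopy, hdc] at hin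
      · simp [blowVert, insideCopy, hdc] at hin)
    simp only [oddVerts, mem_filter, mem_univ, true_and] at hw
    rw [heq] at hw
    have := hfree _ (by simpa [oddVerts] using hw)
    rw [hin] at this
    exact absurd this (by decide)
  have heven := even_card_oddVerts (card_ends (isSimpleList_blowEnds hloc hlocs hen))
    (pullEdges (Prod.mk c) P)
  by_cases hem : oddVerts (incEdges (blowEnds en loc)) (pullEdges (Prod.mk c) P) = ∅
  · rw [hac _ subset_rfl ((isEven_iff_oddVerts _ _).2 hem)]
    simp
  have hcard3 := (card_le_card hsub).trans card_image_le
  rw [card_univ, Fintype.card_fin] at hcard3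
  have hpos := card_pos.2 (nonempty_iff_ne_empty.2 hem)
  have h2 : (oddVerts (incEdges (blowEnds en loc)) (pullEdges (Prod.mk c) P)).card = 2 := by
    rcases heven with ⟨r, hr⟩; omega
  obtain ⟨a, b, hab, hOab⟩ := card_eq_two.1 h2
  obtain ⟨i, -, rfl⟩ := mem_image.1 (hsub (hOab ▸ mem_insert_self a _))
  obtain ⟨j, -, rfl⟩ := mem_image.1 (hsub (hOab ▸ mem_insert_of_mem (mem_singleton_self b)))
  have hij : i ≠ j := fun h => hab (by rw [h])
  obtain ⟨Q, hQac, hQdeg, hQodd, hQ0, hQc⟩ := hQ i j hij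
  -- The completed circuit lives in the blow-up of the cubic graph with its vertex restored and has
  -- |I| + 1 more edges. Since a circuit of that cubic graph has at most |ι| edges, the part in the
  -- copy is left with |ι| - 1 gadgets' worth.
  obtain ⟨D, hD, hDc⟩ := isCircuit_complete h hen hac hd hij hOab hQac hQdeg hQodd hQ0
  obtain ⟨m, hm'⟩ : ∃ m, Fintype.card ι = m + 3 := ⟨_, (Nat.sub_add_cancel hι).symm⟩
  have hbound := card_circuit_blow_le h hen hB hm hD
  rw [hm'] at hbound ⊢
  rw [hDc, hQc] at hbound
  rw [show m + 3 - 1 = m + 2 by omega]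
  rcases hbound with hb | hb <;> nlinarith

-- A copy without an odd vertex inside is worth (|ι| - 1)(|I| + 1) edges. A copy with some gains at
-- most one more gadget, |I| + 1 edges, and one edge for each odd vertex inside a gadget, hence at
-- most |I| + 2 edges for each odd vertex. There are at most two such vertices, and 4(|ι| - 1)(|I| +
-- 1) + 2(|I| + 2) is the bound.
set_option synthInstance.maxSize 1000 in
theorem card_path_four_le (h : IsCubicIncidence (termOne loc)) (hen : IsSimpleList en)
    (hB : ∀ D, IsCircuit (incEdges (closedEnds en)) D → D.card ≤ Fintype.card I + 3)
    (hm : ∀ C, IsCircuit (cubicInc (termOne loc)) C → C.card ≤ Fintype.card ι)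
    (hι : 3 ≤ Fintype.card ι)
    (hQ : ∀ i j : Fin 3, i ≠ j → ∃ Q, IsAcyclic (incEdges en) Q ∧
      (∀ a, deg (incEdges en) Q a ≤ 2) ∧ oddVerts (incEdges en) Q = {Sum.inl i, Sum.inl j} ∧
      (∀ k, k ≠ i → k ≠ j → deg (incEdges en) Q (Sum.inl k) = 0) ∧ Q.card = Fintype.card I + 1)
    {P : Finset ((Fin 4 × ι) × EB)} (hP : IsAcyclic (incEdges (blowEnds en (termFour loc))) P)
    (hdeg : ∀ w, deg (incEdges (blowEnds en (termFour loc))) P w ≤ 2)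
    (hends : (oddVerts (incEdges (blowEnds en (termFour loc))) P).card ≤ 2) :
    P.card ≤ (4 * Fintype.card ι - 2) * (Fintype.card I + 1) + 2 := by
  set O := oddVerts (incEdges (blowEnds en (termFour loc))) P with hO
  have h4 := h.termFour
  have hsplit : P.card = ∑ c, (pullEdges (Prod.mk c) P).card := by
    rw [card_eq_sum_gadgetPart, Fintype.sum_prod_type]
    refine sum_congr rfl fun c _ => ?_
    rw [card_eq_sum_gadgetPart]
    exact sum_congr rfl fun u _ => by rw [gadgetPart_pullEdges]
  obtain ⟨m, hm'⟩ : ∃ m, Fintype.card ι = m + 3 := ⟨_, (Nat.sub_add_cancel hι).symm⟩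
  have hcopy : ∀ c, (pullEdges (Prod.mk c) P).card ≤ (m + 2) * (Fintype.card I + 1) +
      (Fintype.card I + 2) * (O.filter fun w => insideCopy c w).card := by
    intro c
    by_cases hfree : ∀ w ∈ O, insideCopy c w = false
    · have := card_copy_le h hen hB hm hι hQ hP hdeg c hfree
      rw [hm', show m + 3 - 1 = m + 2 by omega] at this
      omega
    · have hpos : 1 ≤ (O.filter fun w => insideCopy c w).card := by
        push Not at hfree
        obtain ⟨w, hw, hwc⟩ := hfree
        exact card_pos.2 ⟨w, mem_filter.2 ⟨hw, by simpa using hwc⟩⟩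
      have hint : ∑ u : ι, (univ.filter fun k : I => (Sum.inr ((c, u), k) :
          ((Fin 4 × T) ⊕ (Fin 3 × Fin 2)) ⊕ (Fin 4 × ι) × I) ∈ O).card ≤
          (O.filter fun w => insideCopy c w).card := by
        rw [← card_sigma]
        refine card_le_card_of_injOn (fun x => Sum.inr ((c, x.1), x.2)) ?_ ?_
        · rintro ⟨u, k⟩ hx
          simp only [coe_sigma, Set.mem_sigma_iff, mem_coe, mem_univ, true_and, mem_filter] at hx ⊢
          exact ⟨hx, by simp [insideCopy]⟩
        · rintro ⟨u, k⟩ _ ⟨v, l⟩ _ hx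
          simpa using hx
      have hsum : (pullEdges (Prod.mk c) P).card ≤ ∑ u : ι, (Fintype.card I + 1 +
          (univ.filter fun k : I => (Sum.inr ((c, u), k) :
          ((Fin 4 × T) ⊕ (Fin 3 × Fin 2)) ⊕ (Fin 4 × ι) × I) ∈ O).card) := by
        rw [card_eq_sum_gadgetPart]
        refine sum_le_sum fun u _ => ?_
        rw [gadgetPart_pullEdges]
        exact card_gadgetPart_le hen hB h4.inj hP hdeg (c, u)
      rw [sum_add_distrib, sum_const, card_univ, hm', smul_eq_mul] at hsum
      nlinarith
  have hin := (sum_card_insideCopy_le O).trans hends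
  have hfin : P.card ≤ ∑ c : Fin 4, ((m + 2) * (Fintype.card I + 1) +
      (Fintype.card I + 2) * (O.filter fun w => insideCopy c w).card) := by
    rw [hsplit]; exact sum_le_sum fun c _ => hcopy c
  rw [sum_add_distrib, sum_const, card_univ, Fintype.card_fin, smul_eq_mul, ← mul_sum] at hfin
  rw [hm', show 4 * (m + 3) - 2 = 4 * m + 10 by omega]
  nlinarith

end FourCopies

/-! ### Four linked gadgets: bounds for paths -/

section LinkedGadgets

open EdgeSet

variable {I EB : Type*} [Fintype I] [Fintype EB] [DecidableEq I] [DecidableEq EB]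

/-- The ends of an edge of the complete graph on four vertices. -/
def linkCopies : Fin 3 × Fin 2 → Fin 4 × Fin 4
  | (k, 0) => (0, k.succ)
  | (0, 1) => (2, 3)
  | (1, 1) => (1, 3)
  | (2, 1) => (1, 2)

/-- Four copies of the gadget, any two of them joined by an edge. -/
def linkedEnds (en : EB → (Fin 3 ⊕ I) × (Fin 3 ⊕ I)) :
    (Fin 4 × EB) ⊕ (Fin 3 × Fin 2) → (Fin 4 × (Fin 3 ⊕ I)) × (Fin 4 × (Fin 3 ⊕ I))
  | Sum.inl (c, e) => ((c, (en e).1), (c, (en e).2))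
  | Sum.inr x => (((linkCopies x).1, Sum.inl x.1), ((linkCopies x).2, Sum.inl x.1))

/-- Reconciles the two descriptions of the complete graph on four vertices: by the ends of its
edges, and by the edge of each colour at a vertex. -/
theorem eq_link_of_mem_linkCopies : ∀ (x : Fin 3 × Fin 2) (c : Fin 4),
    (c = (linkCopies x).1 ∨ c = (linkCopies x).2) ↔ link c x.1 = x := by decide

variable {en : EB → (Fin 3 ⊕ I) × (Fin 3 ⊕ I)}

theorem isSimpleList_linkedEnds (hen : IsSimpleList en) : IsSimpleList (linkedEnds en) := by
  have hne : ∀ x : Fin 3 × Fin 2, (linkCopies x).1 ≠ (linkCopies x).2 := by decide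
  refine ⟨?_, ?_⟩
  · rintro (⟨c, e⟩ | x)
    · simpa [linkedEnds] using hen.ne e
    · simpa [linkedEnds] using hne x
  · rintro (⟨c, e⟩ | x) (⟨d, f⟩ | y) hxy
    · have h0 : (edgePair en e).map (Prod.mk c) = (edgePair en f).map (Prod.mk d) := hxy
      have hcd : c = d := by
        have h1 : (c, (en e).1) ∈ (edgePair en f).map (Prod.mk d) := by
          rw [← h0]; simp [edgePair]
        rw [Sym2.mem_map] at h1
        obtain ⟨a, -, ha⟩ := h1
        exact (Prod.ext_iff.1 ha).1.symm
      subst hcd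
      rw [hen.inj (Sym2.map.injective (Prod.mk_right_injective c) h0)]
    · exfalso
      have h0 := Sym2.eq_iff.1 hxy
      simp only [linkedEnds, Prod.mk.injEq] at h0
      have := hne y
      rcases h0 with ⟨⟨h1, -⟩, h2, -⟩ | ⟨⟨h1, -⟩, h2, -⟩
      · exact this (h1.symm.trans h2)
      · exact this (h2.symm.trans h1)
    · exfalso
      have h0 := Sym2.eq_iff.1 hxy
      simp only [linkedEnds, Prod.mk.injEq] at h0
      have := hne x
      rcases h0 with ⟨⟨h1, -⟩, h2, -⟩ | ⟨⟨h1, -⟩, h2, -⟩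
      · exact this (h1.trans h2.symm)
      · exact this (h1.trans h2.symm)
    · have h0 := Sym2.eq_iff.1 hxy
      simp only [linkedEnds, Prod.mk.injEq, Sum.inl.injEq] at h0
      have hdec : ∀ x y : Fin 3 × Fin 2,
          (((linkCopies x).1 = (linkCopies y).1 ∧ x.1 = y.1) ∧
            (linkCopies x).2 = (linkCopies y).2 ∧ x.1 = y.1 ∨
          ((linkCopies x).1 = (linkCopies y).2 ∧ x.1 = y.1) ∧
            (linkCopies x).2 = (linkCopies y).1 ∧ x.1 = y.1) → x = y := by decide
      rw [hdec x y h0]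

/-- The edges of a set in copy `c`. -/
def copyPart (D : Finset ((Fin 4 × EB) ⊕ (Fin 3 × Fin 2))) (c : Fin 4) : Finset EB :=
  univ.filter fun e => Sum.inl (c, e) ∈ D

theorem deg_linked_inl (D : Finset ((Fin 4 × EB) ⊕ (Fin 3 × Fin 2))) (c : Fin 4) (k : Fin 3) :
    deg (incEdges (linkedEnds en)) D (c, Sum.inl k) =
      deg (incEdges en) (copyPart D c) (Sum.inl k) + if Sum.inr (link c k) ∈ D then 1 else 0 := by
  have hset : D ∩ incEdges (linkedEnds en) (c, Sum.inl k) =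
      (copyPart D c ∩ incEdges en (Sum.inl k)).image (fun e => Sum.inl (c, e)) ∪
        if Sum.inr (link c k) ∈ D then {Sum.inr (link c k)} else ∅ := by
    ext (⟨d, e⟩ | x)
    · have hno : (Sum.inl (d, e) : (Fin 4 × EB) ⊕ (Fin 3 × Fin 2)) ∉
          (if Sum.inr (link c k) ∈ D then {Sum.inr (link c k)} else ∅ : Finset _) := by
        split_ifs <;> simp
      simp only [mem_union, hno, or_false, mem_inter, mem_incEdges, edgePair, linkedEnds, mem_image,
        Sym2.mem_iff, copyPart, mem_filter, mem_univ, true_and, Prod.mk.injEq, Sum.inl.injEq]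
      constructor
      · rintro ⟨hD, ⟨rfl, h⟩ | ⟨rfl, h⟩⟩
        · exact ⟨e, ⟨hD, Or.inl h⟩, rfl, rfl⟩
        · exact ⟨e, ⟨hD, Or.inr h⟩, rfl, rfl⟩
      · rintro ⟨e', ⟨hD, h⟩, rfl, rfl⟩
        exact ⟨hD, h.imp (fun h => ⟨rfl, h⟩) fun h => ⟨rfl, h⟩⟩
    · have hx : (Sum.inr x : (Fin 4 × EB) ⊕ (Fin 3 × Fin 2)) ∈ incEdges (linkedEnds en)
          (c, Sum.inl k) ↔ x = link c k := by
        simp only [mem_incEdges, edgePair, linkedEnds, Sym2.mem_iff, Prod.mk.injEq, Sum.inl.injEq]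
        rw [← or_and_right, eq_link_of_mem_linkCopies]
        constructor
        · rintro ⟨h1, rfl⟩; exact h1.symm
        · rintro rfl; exact ⟨rfl, rfl⟩
      rw [mem_inter, hx, mem_union]
      split_ifs with h
      · simp only [mem_image, reduceCtorEq, and_false, exists_false, false_or, mem_singleton,
          Sum.inr.injEq]
        exact ⟨fun h' => h'.2, fun h' => ⟨h' ▸ h, h'⟩⟩
      · simp only [mem_image, reduceCtorEq, and_false, exists_false, notMem_empty, or_false,
          iff_false, not_and]
        rintro h1 rfl; exact h h1
  rw [deg, hset, card_union_of_disjoint, card_image_of_injective, deg]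
  · split_ifs <;> simp
  · intro e f hef; simpa using hef
  · rw [disjoint_left]
    intro x hx hx'
    obtain ⟨e, -, rfl⟩ := mem_image.1 hx
    split_ifs at hx' <;> simp at hx'

theorem deg_linked_inr (D : Finset ((Fin 4 × EB) ⊕ (Fin 3 × Fin 2))) (c : Fin 4) (k : I) :
    deg (incEdges (linkedEnds en)) D (c, Sum.inr k) =
      deg (incEdges en) (copyPart D c) (Sum.inr k) := by
  have hset : D ∩ incEdges (linkedEnds en) (c, Sum.inr k) =
      (copyPart D c ∩ incEdges en (Sum.inr k)).image (fun e => Sum.inl (c, e)) := by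
    ext (⟨d, e⟩ | x)
    · simp only [mem_inter, mem_incEdges, edgePair, linkedEnds, mem_image,
        Sym2.mem_iff, copyPart, mem_filter, mem_univ, true_and, Prod.mk.injEq, Sum.inl.injEq]
      constructor
      · rintro ⟨hD, ⟨rfl, h⟩ | ⟨rfl, h⟩⟩
        · exact ⟨e, ⟨hD, Or.inl h⟩, rfl, rfl⟩
        · exact ⟨e, ⟨hD, Or.inr h⟩, rfl, rfl⟩
      · rintro ⟨e', ⟨hD, h⟩, rfl, rfl⟩
        exact ⟨hD, h.imp (fun h => ⟨rfl, h⟩) fun h => ⟨rfl, h⟩⟩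
    · simp [mem_incEdges, edgePair, linkedEnds]
  rw [deg, hset, card_image_of_injective, deg]
  intro e f hef; simpa using hef

theorem isAcyclic_copyPart {D : Finset ((Fin 4 × EB) ⊕ (Fin 3 × Fin 2))}
    (hD : IsAcyclic (incEdges (linkedEnds en)) D) (c : Fin 4) :
    IsAcyclic (incEdges en) (copyPart D c) := by
  intro X hX hE
  have hpart : ∀ d, copyPart (X.image fun e => (Sum.inl (c, e) : (Fin 4 × EB) ⊕ (Fin 3 × Fin 2))) d =
      if d = c then X else ∅ := by
    intro d
    ext e
    split_ifs with h
    · simp [copyPart, h]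
    · simp [copyPart, Ne.symm h]
  have hev : ∀ d a, Even (deg (incEdges en) (copyPart (X.image fun e =>
      (Sum.inl (c, e) : (Fin 4 × EB) ⊕ (Fin 3 × Fin 2))) d) a) := by
    intro d a
    rw [hpart]
    split_ifs
    · exact hE a
    · exact isEven_empty _ a
  have := hD (X.image fun e => Sum.inl (c, e)) (by
    intro p hp
    obtain ⟨e, he, rfl⟩ := mem_image.1 hp
    exact (mem_filter.1 (hX he)).2) (by
    rintro ⟨d, k | k⟩
    · rw [deg_linked_inl, if_neg (by simp), add_zero]; exact hev d _
    · rw [deg_linked_inr]; exact hev d _)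
  simpa using this

/-- Count degrees copy by copy. A copy without an odd vertex must miss a vertex, since otherwise the
path would contain a Hamiltonian path of the gadget between two terminals; its degree sum is at most
2n + 4. Each odd vertex raises this by at most one, so 2|P| is at most 4(2n + 4) + 2. -/
theorem card_path_linked_le (hen : IsSimpleList en)
    (hB : ∀ D, IsCircuit (incEdges (closedEnds en)) D → D.card ≤ Fintype.card I + 3)
    {P : Finset ((Fin 4 × EB) ⊕ (Fin 3 × Fin 2))} (hP : IsAcyclic (incEdges (linkedEnds en)) P)
    (hdeg : ∀ w, deg (incEdges (linkedEnds en)) P w ≤ 2)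
    (hends : (oddVerts (incEdges (linkedEnds en)) P).card ≤ 2) :
    P.card ≤ 4 * Fintype.card I + 9 := by
  set n := Fintype.card I with hn
  have hVB : Fintype.card (Fin 3 ⊕ I) = n + 3 := by
    rw [Fintype.card_sum, Fintype.card_fin, add_comm]
  have hsum := sum_deg (card_ends (isSimpleList_linkedEnds hen)) P
  rw [Fintype.sum_prod_type] at hsum
  have hodd : ∑ c : Fin 4, (univ.filter fun a =>
      Odd (deg (incEdges (linkedEnds en)) P (c, a))).card ≤ 2 := by
    refine le_trans (le_of_eq ?_) hends
    simp only [oddVerts, card_filter]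
    rw [Fintype.sum_prod_type]
  have hcopy : ∀ c : Fin 4, ∑ a, deg (incEdges (linkedEnds en)) P (c, a) ≤ 2 * n + 4 +
      (univ.filter fun a => Odd (deg (incEdges (linkedEnds en)) P (c, a))).card := by
    intro c
    have hle : ∑ a, deg (incEdges (linkedEnds en)) P (c, a) +
        (univ.filter fun a => Odd (deg (incEdges (linkedEnds en)) P (c, a))).card ≤ 2 * (n + 3) := by
      rw [card_filter, ← sum_add_distrib, ← hVB, mul_comm, ← smul_eq_mul, ← card_univ, ← sum_const]
      refine sum_le_sum fun a _ => ?_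
      have := hdeg (c, a)
      split_ifs with h
      · rcases h with ⟨r, hr⟩; omega
      · omega
    by_cases hfree : (univ.filter fun a =>
        Odd (deg (incEdges (linkedEnds en)) P (c, a))).card = 0
    swap
    · omega
    by_contra hbig
    rw [card_eq_zero, filter_eq_empty_iff] at hfree
    have heven : ∀ a, Even (deg (incEdges (linkedEnds en)) P (c, a)) := fun a =>
      Nat.not_odd_iff_even.1 (hfree (mem_univ a))
    have hall : ∀ a, deg (incEdges (linkedEnds en)) P (c, a) = 2 := by
      by_contra hno
      rw [not_forall] at hno
      obtain ⟨a₀, ha₀⟩ := hno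
      have hz : deg (incEdges (linkedEnds en)) P (c, a₀) = 0 := by
        have := hdeg (c, a₀)
        rcases heven a₀ with ⟨r, hr⟩
        omega
      have : ∑ a, deg (incEdges (linkedEnds en)) P (c, a) ≤ 2 * n + 4 := by
        rw [← add_sum_erase univ _ (mem_univ a₀), hz, zero_add]
        refine (sum_le_card_nsmul _ _ 2 fun a _ => hdeg (c, a)).trans ?_
        rw [card_erase_of_mem (mem_univ _), card_univ, hVB, smul_eq_mul]
        omega
      omega
    have hint : ∀ k, deg (incEdges en) (copyPart P c) (Sum.inr k) = 2 := fun k => by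
      rw [← deg_linked_inr]; exact hall _
    have hter : ∀ k, deg (incEdges en) (copyPart P c) (Sum.inl k) +
        (if Sum.inr (link c k) ∈ P then 1 else 0) = 2 := fun k => by
      rw [← deg_linked_inl]; exact hall _
    have hle2 : ∀ a, deg (incEdges en) (copyPart P c) a ≤ 2 := by
      rintro (k | k)
      · have := hter k; omega
      · rw [hint]
    have hge1 : ∀ a, deg (incEdges en) (copyPart P c) a =
        2 - if Odd (deg (incEdges en) (copyPart P c) a) then 1 else 0 := by
      rintro (k | k)
      · have h1 := hter k
        split_ifs at h1 with h2
        · have : deg (incEdges en) (copyPart P c) (Sum.inl k) = 1 := by omega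
          simp [this]
        · have : deg (incEdges en) (copyPart P c) (Sum.inl k) = 2 := by omega
          rw [this, if_neg (by decide)]
      · rw [hint, if_neg (by decide)]
    have hsumc := sum_deg (card_ends hen) (copyPart P c)
    have hsumc' : ∑ a, deg (incEdges en) (copyPart P c) a +
        (oddVerts (incEdges en) (copyPart P c)).card = 2 * (n + 3) := by
      rw [oddVerts, card_filter, ← sum_add_distrib, ← hVB, mul_comm, ← smul_eq_mul, ← card_univ,
        ← sum_const]
      refine sum_congr rfl fun a _ => ?_
      have := hge1 a
      split_ifs at this ⊢ <;> omega
    -- An empty part leaves degree at most one at a terminal. Otherwise exactly two terminals have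
    -- degree one within the copy and all other vertices degree two, which makes n + 2 edges, one
    -- too many.
    rcases card_le_of_even_internal hen hB (isAcyclic_copyPart hP c) hle2
        (fun k => by rw [hint]; decide) with h0 | ⟨⟨i, j, hij, ho⟩, hc⟩
    · have := hter 0
      rw [h0] at this
      simp only [deg, empty_inter, card_empty] at this
      split_ifs at this <;> omega
    · rw [ho, card_pair (by simpa using hij)] at hsumc'
      omega
  have := sum_le_sum fun c (_ : c ∈ univ) => hcopy c
  rw [hsum, sum_add_distrib, sum_const, card_univ, Fintype.card_fin, smul_eq_mul] at this
  omega

end LinkedGadgets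

/-! ### Paths and cycles from vertex lists -/

section ListWalks

variable {V : Type*} {G : SimpleGraph V}

theorem exists_isPath_of_list {l : List V} (hne : l ≠ []) (hc : l.IsChain G.Adj) (hn : l.Nodup) :
    ∃ (u v : V) (p : G.Walk u v), p.IsPath ∧ p.length + 1 = l.length ∧ p.support = l := by
  refine ⟨_, _, SimpleGraph.Walk.ofSupport l hne hc, ?_, ?_, ?_⟩
  · rw [SimpleGraph.Walk.isPath_def, SimpleGraph.Walk.support_ofSupport]; exact hn
  · rw [SimpleGraph.Walk.length_ofSupport]
    have := List.length_pos_iff.2 hne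
    omega
  · exact SimpleGraph.Walk.support_ofSupport hne hc

theorem exists_isCycle_of_list {a : V} {l : List V} (hc : (a :: (l ++ [a])).IsChain G.Adj)
    (hn : (a :: l).Nodup) (hl : 2 ≤ l.length) :
    ∃ c : G.Walk a a, c.IsCycle ∧ c.length = l.length + 1 ∧ ∀ x, x ∈ c.support → x ∈ a :: l := by
  cases l with
  | nil => simp at hl
  | cons b l =>
    have hadj : G.Adj a b := List.IsChain.rel hc
    have hc' : (b :: (l ++ [a])).IsChain G.Adj := List.IsChain.of_cons hc
    have hne : b :: (l ++ [a]) ≠ [] := by simp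
    obtain ⟨p, hp⟩ : ∃ p : G.Walk b a, p.support = b :: (l ++ [a]) :=
      ⟨(SimpleGraph.Walk.ofSupport _ hne hc').copy (List.head_cons ..) (by simp), by
        rw [SimpleGraph.Walk.support_copy, SimpleGraph.Walk.support_ofSupport]⟩
    have hlen : p.length = l.length + 1 := by
      have := p.length_support
      rw [hp] at this
      simp at this
      omega
    have hpath : p.IsPath := by
      rw [SimpleGraph.Walk.isPath_def, hp, ← List.cons_append]
      have := (List.perm_append_singleton a (b :: l)).nodup_iff.2 hn
      exact this
    refine ⟨SimpleGraph.Walk.cons hadj p, ?_, ?_, ?_⟩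
    · rw [SimpleGraph.Walk.cons_isCycle_iff]
      refine ⟨hpath, fun h => ?_⟩
      have := hpath.length_eq_one_of_mem_edges (Sym2.eq_swap ▸ h)
      simp at hl
      omega
    · simp [hlen]
    · intro x hx
      rw [SimpleGraph.Walk.support_cons, hp] at hx
      simp at hx ⊢
      tauto

end ListWalks

/-! ### Routes in the cubic graph and their lifts to the blow-up -/

section Routes

variable {I EB ι T : Type*}

/-- A route enters the gadgets in turn at the first given terminal and leaves them at the second;
it starts at the edge `x` of the cubic graph and ends at the edge `y`. -/
def IsRoute (term : ι → Fin 3 → T) : T → List (ι × Fin 3 × Fin 3) → T → Prop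
  | x, [], y => x = y
  | x, s :: ps, y => term s.1 s.2.1 = x ∧ s.2.1 ≠ s.2.2 ∧ IsRoute term (term s.1 s.2.2) ps y

/-- The inner vertices of a path of the gadget between two terminals. -/
def IsGadgetPath (en : EB → (Fin 3 ⊕ I) × (Fin 3 ⊕ I)) (i o : Fin 3) (M : List (Fin 3 ⊕ I)) :
    Prop :=
  (Sum.inl i :: (M ++ [Sum.inl o])).IsChain (edgeGraph en).Adj ∧
    (Sum.inl i :: (M ++ [Sum.inl o])).Nodup

/-- The vertices along a route, without the last one. -/
def routeList (term : ι → Fin 3 → T) (g : ι × Fin 3 × Fin 3 → List (Fin 3 ⊕ I))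
    (ps : List (ι × Fin 3 × Fin 3)) : List (T ⊕ ι × I) :=
  ps.flatMap fun s => (Sum.inl s.2.1 :: g s).map (blowVert term s.1)

variable {en : EB → (Fin 3 ⊕ I) × (Fin 3 ⊕ I)} {term : ι → Fin 3 → T}
  {g : ι × Fin 3 × Fin 3 → List (Fin 3 ⊕ I)} {ps : List (ι × Fin 3 × Fin 3)}

theorem routeList_cons (s : ι × Fin 3 × Fin 3) :
    routeList term g (s :: ps) =
      (Sum.inl s.2.1 :: g s).map (blowVert term s.1) ++ routeList term g ps := by
  simp [routeList]

theorem IsGadgetPath.reverse {i o : Fin 3} {M : List (Fin 3 ⊕ I)} (h : IsGadgetPath en i o M) :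
    IsGadgetPath en o i M.reverse := by
  have hr : (Sum.inl i :: (M ++ [Sum.inl o])).reverse =
      Sum.inl o :: (M.reverse ++ [(Sum.inl i : Fin 3 ⊕ I)]) := by simp
  constructor
  · rw [← hr, List.isChain_reverse]
    exact h.1.imp fun _ _ h => h.symm
  · rw [← hr, List.nodup_reverse]
    exact h.2

theorem edgeGraph_blow_adj (hinj : ∀ u, Function.Injective (term u)) {a b : Fin 3 ⊕ I}
    (h : (edgeGraph en).Adj a b) (u : ι) :
    (edgeGraph (blowEnds en term)).Adj (blowVert term u a) (blowVert term u b) := by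
  rw [edgeGraph, SimpleGraph.fromRel_adj] at h ⊢
  refine ⟨(blowVert_injective hinj u).ne h.1, ?_⟩
  rcases h.2 with ⟨e, he⟩ | ⟨e, he⟩
  · exact Or.inl ⟨(u, e), by simp [blowEnds, he]⟩
  · exact Or.inr ⟨(u, e), by simp [blowEnds, he]⟩

theorem exists_routeList_eq_cons : ∀ {ps : List (ι × Fin 3 × Fin 3)} {x y : T},
    IsRoute term x ps y →
    ∃ l, routeList term g ps ++ [(Sum.inl y : T ⊕ ι × I)] = Sum.inl x :: l
  | [], x, y, h => ⟨[], by simp [routeList, show x = y from h]⟩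
  | s :: ps, x, y, h => by
    refine ⟨(g s).map (blowVert term s.1) ++ routeList term g ps ++ [Sum.inl y], ?_⟩
    rw [routeList_cons, List.map_cons, List.cons_append, List.cons_append]
    simp only [blowVert, Sum.map_inl, h.1]

theorem isChain_routeList (hinj : ∀ u, Function.Injective (term u)) :
    ∀ {ps : List (ι × Fin 3 × Fin 3)} {x y : T}, IsRoute term x ps y →
    (∀ s ∈ ps, IsGadgetPath en s.2.1 s.2.2 (g s)) →
    (routeList term g ps ++ [Sum.inl y]).IsChain (edgeGraph (blowEnds en term)).Adj
  | [], x, y, _, _ => by simp [routeList]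
  | s :: ps, x, y, h, hg => by
    have ih := isChain_routeList hinj h.2.2 fun s hs => hg s (List.mem_cons_of_mem _ hs)
    obtain ⟨l, hl⟩ := exists_routeList_eq_cons (g := g) h.2.2
    rw [routeList_cons, List.append_assoc, hl, List.isChain_split]
    rw [hl] at ih
    refine ⟨?_, ih⟩
    have h1 := (hg s List.mem_cons_self).1
    have h2 := List.isChain_map_of_isChain (S := (edgeGraph (blowEnds en term)).Adj)
      (blowVert term s.1) (fun a b hab => edgeGraph_blow_adj hinj hab s.1) h1
    simpa [blowVert] using h2

/-- Each pass contributes its entry terminal and `n` inner vertices; the exit terminal is counted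
with the next pass. -/
theorem length_routeList {n : ℕ} : ∀ {ps : List (ι × Fin 3 × Fin 3)},
    (∀ s ∈ ps, (g s).length = n) → (routeList term g ps).length = ps.length * (n + 1)
  | [], _ => by simp [routeList]
  | s :: ps, h => by
    rw [routeList_cons, List.length_append,
      length_routeList fun s hs => h s (List.mem_cons_of_mem _ hs), List.length_map,
      List.length_cons, h s List.mem_cons_self, List.length_cons]
    ring

theorem inl_mem_routeList {t : T} : (Sum.inl t : T ⊕ ι × I) ∈ routeList term g ps ↔
    ∃ s ∈ ps, term s.1 s.2.1 = t ∨ ∃ k, Sum.inl k ∈ g s ∧ term s.1 k = t := by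
  simp only [routeList, List.mem_flatMap, List.mem_map, List.mem_cons]
  constructor
  · rintro ⟨s, hs, a | a, h1, h2⟩
    · refine ⟨s, hs, ?_⟩
      have h2 : term s.1 a = t := by simpa [blowVert] using h2
      rcases h1 with h1 | h1
      · left; rw [← Sum.inl_injective h1]; exact h2
      · right; exact ⟨a, h1, h2⟩
    · simp [blowVert] at h2
  · rintro ⟨s, hs, h | ⟨k, hk, h⟩⟩
    · exact ⟨s, hs, Sum.inl s.2.1, Or.inl rfl, by simp [blowVert, h]⟩
    · exact ⟨s, hs, Sum.inl k, Or.inr hk, by simp [blowVert, h]⟩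

theorem inr_mem_routeList {u : ι} {y : I} : (Sum.inr (u, y) : T ⊕ ι × I) ∈ routeList term g ps ↔
    ∃ s ∈ ps, s.1 = u ∧ Sum.inr y ∈ g s := by
  simp only [routeList, List.mem_flatMap, List.mem_map, List.mem_cons]
  constructor
  · rintro ⟨s, hs, a | a, h1, h2⟩
    · simp [blowVert] at h2
    · have h2 : s.1 = u ∧ a = y := by simpa [blowVert] using h2
      rcases h1 with h1 | h1
      · simp at h1
      · exact ⟨s, hs, h2.1, h2.2 ▸ h1⟩
  · rintro ⟨s, hs, rfl, h⟩
    exact ⟨s, hs, Sum.inr y, Or.inr h, by simp [blowVert]⟩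

/-- A route passes through every gadget and every terminal at most once. -/
structure IsSimpleRoute (term : ι → Fin 3 → T) (ps : List (ι × Fin 3 × Fin 3)) : Prop where
  blobs : (ps.map Prod.fst).Nodup
  entries : (ps.map fun s => term s.1 s.2.1).Nodup

/-- A terminal at which the route enters a gadget. -/
def RouteUses (term : ι → Fin 3 → T) (ps : List (ι × Fin 3 × Fin 3)) (t : T) : Prop :=
  ∃ s ∈ ps, term s.1 s.2.1 = t

/-- Different gadgets have only terminals in common. A repeated terminal would be an entry twice, or
an entry that some gadget path meets as its third terminal, or the third terminal of two gadget
paths; the hypotheses exclude these in turn. -/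
theorem nodup_routeList (hinj : ∀ u, Function.Injective (term u)) (hps : IsSimpleRoute term ps)
    (hg : ∀ s ∈ ps, (Sum.inl s.2.1 :: g s).Nodup)
    (hthird : ∀ s ∈ ps, ∀ k, Sum.inl k ∈ g s → ¬RouteUses term ps (term s.1 k))
    (hone : ∀ s ∈ ps, ∀ s' ∈ ps, ∀ k k', Sum.inl k ∈ g s → Sum.inl k' ∈ g s' → s.1 = s'.1) :
    (routeList term g ps).Nodup := by
  rw [routeList, List.nodup_flatMap]
  refine ⟨fun s hs => (hg s hs).map (blowVert_injective hinj s.1), ?_⟩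
  have h1 := List.pairwise_map.1 hps.blobs
  have h2 := List.pairwise_map.1 hps.entries
  refine (List.Pairwise.and_mem.1 (h1.and h2)).imp ?_
  rintro s s' ⟨hs, hs', hb, he⟩
  rw [Function.onFun, List.disjoint_left]
  intro w hw hw'
  obtain ⟨a, ha, rfl⟩ := List.mem_map.1 hw
  obtain ⟨b, hb', hab⟩ := List.mem_map.1 hw'
  rcases a with i | y <;> rcases b with j | y' <;> simp [blowVert] at hab
  · simp only [List.mem_cons, Sum.inl.injEq] at ha hb'
    rcases ha with rfl | ha <;> rcases hb' with rfl | hb'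
    · exact he hab.symm
    · exact hthird s' hs' j hb' ⟨s, hs, hab.symm⟩
    · exact hthird s hs i ha ⟨s', hs', hab⟩
    · exact hb (hone s hs s' hs' i j ha hb')
  · exact hb hab.1.symm

/-- The paths of the gadget that are used: default paths miss the third terminal, special ones
miss an internal vertex, and there are Hamiltonian paths ending at each terminal. -/
structure HasGadgetPaths (en : EB → (Fin 3 ⊕ I) × (Fin 3 ⊕ I)) (n : ℕ) : Prop where
  default : ∀ i o : Fin 3, i ≠ o → ∃ M, IsGadgetPath en i o M ∧ M.length = n ∧ ∀ k, Sum.inl k ∉ M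
  special : ∀ (y : I) (i o : Fin 3), i ≠ o → i = 0 ∨ o = 0 →
    ∃ M, IsGadgetPath en i o M ∧ M.length = n ∧ Sum.inr y ∉ M
  full : ∀ o : Fin 3, ∃ M, (M ++ [Sum.inl o]).IsChain (edgeGraph en).Adj ∧
    (M ++ [Sum.inl o]).Nodup ∧ M.length = n + 2

/-- An admissible choice of gadget paths along a route. -/
structure IsChoice (en : EB → (Fin 3 ⊕ I) × (Fin 3 ⊕ I)) (term : ι → Fin 3 → T) (n : ℕ)
    (ps : List (ι × Fin 3 × Fin 3)) (g : ι × Fin 3 × Fin 3 → List (Fin 3 ⊕ I)) : Prop where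
  path : ∀ s ∈ ps, IsGadgetPath en s.2.1 s.2.2 (g s)
  length : ∀ s ∈ ps, (g s).length = n
  nodup : (routeList term g ps).Nodup

/-- The gadget at `v` may be traversed by a special path. -/
def AllowsSpecial (term : ι → Fin 3 → T) (ps : List (ι × Fin 3 × Fin 3)) (v : ι) : Prop :=
  RouteUses term ps (term v 0) ∧ ∃ k, ¬RouteUses term ps (term v k)

/-- Default paths meet no third terminal, so the lifted route contains just the terminals at which
it enters a gadget. -/
theorem exists_default_choice (hinj : ∀ u, Function.Injective (term u)) {n : ℕ}
    (hB : HasGadgetPaths en n) (hps : IsSimpleRoute term ps) (hio : ∀ s ∈ ps, s.2.1 ≠ s.2.2) :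
    ∃ g, IsChoice en term n ps g ∧
      (∀ t, ¬RouteUses term ps t → Sum.inl t ∉ routeList term g ps) ∧
      ∀ u y, u ∉ ps.map Prod.fst → Sum.inr (u, y) ∉ routeList term g ps := by
  choose! M hM hlen hdef using hB.default
  refine ⟨fun s => M s.2.1 s.2.2, ⟨fun s hs => hM _ _ (hio s hs), fun s hs => hlen _ _ (hio s hs),
    nodup_routeList hinj hps ?_ ?_ ?_⟩, ?_, ?_⟩
  · intro s hs
    have := (hM _ _ (hio s hs)).2
    rw [← List.cons_append] at this
    exact this.of_append_left
  · intro s hs k hk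
    exact absurd hk (hdef _ _ (hio s hs) k)
  · intro s hs _ _ k _ hk
    exact absurd hk (hdef _ _ (hio s hs) k)
  · intro t ht hm
    obtain ⟨s, hs, h | ⟨k, hk, -⟩⟩ := inl_mem_routeList.1 hm
    · exact ht ⟨s, hs, h⟩
    · exact hdef _ _ (hio s hs) k hk
  · intro u y hu hm
    obtain ⟨s, hs, h, -⟩ := inr_mem_routeList.1 hm
    exact hu (List.mem_map.2 ⟨s, hs, h⟩)

/-- Exactly the gadget at `v` gets a special path, which misses `y` and instead runs through the
third terminal. That terminal belongs to an edge of the cubic graph unused by the route, so no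
conflict arises, and the length is unchanged. -/
theorem exists_special_choice (hinj : ∀ u, Function.Injective (term u)) {n : ℕ}
    (hB : HasGadgetPaths en n) (hps : IsSimpleRoute term ps) (hio : ∀ s ∈ ps, s.2.1 ≠ s.2.2)
    (hexit : ∀ s ∈ ps, RouteUses term ps (term s.1 s.2.2)) {v : ι} (hv : AllowsSpecial term ps v)
    (y : I) :
    ∃ g, IsChoice en term n ps g ∧ Sum.inr (v, y) ∉ routeList term g ps ∧
      (∀ t, ¬RouteUses term ps t → (∀ i, term v i ≠ t) → Sum.inl t ∉ routeList term g ps) ∧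
      ∀ u y, u ∉ ps.map Prod.fst → Sum.inr (u, y) ∉ routeList term g ps := by
  classical
  choose! M hM hlen hdef using hB.default
  choose! N hN hNlen hNy using hB.special y
  obtain ⟨h0, k₀, hk₀⟩ := hv
  have hthird : ∀ s ∈ ps, s.1 = v → ∀ k, k ≠ s.2.1 → k ≠ s.2.2 → k = k₀ := by
    rintro s hs rfl k h1 h2
    have e1 : k₀ ≠ s.2.1 := by rintro rfl; exact hk₀ ⟨s, hs, rfl⟩
    have e2 : k₀ ≠ s.2.2 := by rintro rfl; exact hk₀ (hexit s hs)
    have e3 := hio s hs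
    omega
  -- Special paths are available only between terminal 0 and another one. Terminal 0 is used, so it
  -- is not the unused third one.
  have hzero : ∀ s ∈ ps, s.1 = v → s.2.1 = 0 ∨ s.2.2 = 0 := by
    intro s hs hsv
    by_contra hno
    push Not at hno
    have := hthird s hs hsv 0 hno.1.symm hno.2.symm
    exact hk₀ (this ▸ h0)
  refine ⟨fun s => if s.1 = v then N s.2.1 s.2.2 else M s.2.1 s.2.2, ⟨?_, ?_,
    nodup_routeList hinj hps ?_ ?_ ?_⟩, ?_, ?_, ?_⟩
  · intro s hs
    split_ifs with h
    · exact hN _ _ (hio s hs) (hzero s hs h)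
    · exact hM _ _ (hio s hs)
  · intro s hs
    split_ifs with h
    · exact hNlen _ _ (hio s hs) (hzero s hs h)
    · exact hlen _ _ (hio s hs)
  · intro s hs
    split_ifs with h
    · have := (hN _ _ (hio s hs) (hzero s hs h)).2
      rw [← List.cons_append] at this
      exact this.of_append_left
    · have := (hM _ _ (hio s hs)).2
      rw [← List.cons_append] at this
      exact this.of_append_left
  · intro s hs k hk
    split_ifs at hk with h
    · have hnd := (hN _ _ (hio s hs) (hzero s hs h)).2
      simp only [List.nodup_cons, List.mem_append, List.mem_singleton, List.nodup_append] at hnd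
      have h1 : k ≠ s.2.1 := by rintro rfl; exact hnd.1 (Or.inl hk)
      have h2 : k ≠ s.2.2 := by
        rintro rfl
        exact hnd.2.2.2 _ hk _ rfl rfl
      rw [hthird s hs h k h1 h2, h]
      exact hk₀
    · exact absurd hk (hdef _ _ (hio s hs) k)
  · intro s hs s' hs' k k' hk hk'
    split_ifs at hk hk' with h h'
    · exact h.trans h'.symm
    · exact absurd hk' (hdef _ _ (hio s' hs') k')
    · exact absurd hk (hdef _ _ (hio s hs) k)
    · exact absurd hk (hdef _ _ (hio s hs) k)
  · intro hm
    obtain ⟨s, hs, h, hm⟩ := inr_mem_routeList.1 hm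
    rw [if_pos h] at hm
    exact hNy _ _ (hio s hs) (hzero s hs h) hm
  · intro t ht htv hm
    obtain ⟨s, hs, h | ⟨k, hk, hkt⟩⟩ := inl_mem_routeList.1 hm
    · exact ht ⟨s, hs, h⟩
    · split_ifs at hk with h
      · exact htv k (h ▸ hkt)
      · exact hdef _ _ (hio s hs) k hk
  · intro u y hu hm
    obtain ⟨s, hs, h, -⟩ := inr_mem_routeList.1 hm
    exact hu (List.mem_map.2 ⟨s, hs, h⟩)

theorem IsRoute.ne : ∀ {ps : List (ι × Fin 3 × Fin 3)} {x y : T}, IsRoute term x ps y →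
    ∀ s ∈ ps, s.2.1 ≠ s.2.2
  | [], _, _, _, s, hs => by simp at hs
  | s :: ps, x, y, h, s', hs' => by
    rcases List.mem_cons.1 hs' with rfl | hs'
    · exact h.2.1
    · exact IsRoute.ne h.2.2 s' hs'

/-- The exit of a pass is the entry of the next one; only the last exit can be the end of the route.
-/
theorem IsRoute.exit : ∀ {ps : List (ι × Fin 3 × Fin 3)} {x y : T}, IsRoute term x ps y →
    ∀ s ∈ ps, RouteUses term ps (term s.1 s.2.2) ∨ term s.1 s.2.2 = y
  | [], _, _, _, s, hs => by simp at hs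
  | s :: ps, x, y, h, s', hs' => by
    have hmono : ∀ t, RouteUses term ps t → RouteUses term (s :: ps) t := fun t ⟨r, hr, e⟩ =>
      ⟨r, List.mem_cons_of_mem _ hr, e⟩
    rcases List.mem_cons.1 hs' with rfl | hs'
    · cases ps with
      | nil => exact Or.inr h.2.2
      | cons r ps => exact Or.inl (hmono _ ⟨r, List.mem_cons_self, h.2.2.1⟩)
    · exact (IsRoute.exit h.2.2 s' hs').imp_left (hmono _)

/-- A closed simple route. -/
structure IsTour (term : ι → Fin 3 → T) (ps : List (ι × Fin 3 × Fin 3)) : Prop where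
  simple : IsSimpleRoute term ps
  route : ∃ x, IsRoute term x ps x

theorem IsTour.exit (h : IsTour term ps) : ∀ s ∈ ps, RouteUses term ps (term s.1 s.2.2) := by
  obtain ⟨x, hx⟩ := h.route
  intro s hs
  rcases hx.exit s hs with h' | h'
  · exact h'
  · cases ps with
    | nil => simp at hs
    | cons r ps => exact ⟨r, List.mem_cons_self, by rw [h', hx.1]⟩

/-- A family of tours `𝒞` is able to avoid two targets, where a target is a terminal or an
internal vertex of a gadget. -/
def Avoidable (𝒞 : List (ι × Fin 3 × Fin 3) → Prop) (term : ι → Fin 3 → T) : T ⊕ ι → T ⊕ ι → Prop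
  | Sum.inl t, Sum.inl t' => ∃ ps, 𝒞 ps ∧ ¬RouteUses term ps t ∧ ¬RouteUses term ps t'
  | Sum.inl t, Sum.inr u => ∃ ps, 𝒞 ps ∧ ¬RouteUses term ps t ∧
      (u ∉ ps.map Prod.fst ∨ (∀ i, term u i ≠ t) ∧ AllowsSpecial term ps u)
  | Sum.inr u, Sum.inl t => ∃ ps, 𝒞 ps ∧ ¬RouteUses term ps t ∧
      (u ∉ ps.map Prod.fst ∨ (∀ i, term u i ≠ t) ∧ AllowsSpecial term ps u)
  | Sum.inr u, Sum.inr v => ∃ ps, 𝒞 ps ∧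
      (u ∉ ps.map Prod.fst ∧ (v ∉ ps.map Prod.fst ∨ AllowsSpecial term ps v) ∨
        v ∉ ps.map Prod.fst ∧ AllowsSpecial term ps u)

/-- Forget the vertex inside a gadget. -/
def targetOf : T ⊕ ι × I → T ⊕ ι := Sum.map id Prod.fst

/-- At most one of the two targets needs a special gadget path. Such a path makes the route visit
one more terminal, which is harmless because a target terminal is required not to belong to that
gadget. -/
theorem exists_choice_avoiding (hinj : ∀ u, Function.Injective (term u)) {n : ℕ}
    (hB : HasGadgetPaths en n) {𝒞 : List (ι × Fin 3 × Fin 3) → Prop}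
    (h𝒞 : ∀ ps, 𝒞 ps → IsTour term ps) {w w' : T ⊕ ι × I}
    (hav : Avoidable 𝒞 term (targetOf w) (targetOf w')) :
    ∃ ps g, 𝒞 ps ∧ IsChoice en term n ps g ∧ w ∉ routeList term g ps ∧
      w' ∉ routeList term g ps := by
  have hmixed : ∀ t u y, (∃ ps, 𝒞 ps ∧ ¬RouteUses term ps t ∧
      (u ∉ ps.map Prod.fst ∨ (∀ i, term u i ≠ t) ∧ AllowsSpecial term ps u)) →
      ∃ ps g, 𝒞 ps ∧ IsChoice en term n ps g ∧ Sum.inl t ∉ routeList term g ps ∧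
        Sum.inr (u, y) ∉ routeList term g ps := by
    rintro t u y ⟨ps, hps, ht, hu | ⟨hut, hu⟩⟩
    · have htour := h𝒞 ps hps
      obtain ⟨x, hx⟩ := htour.route
      obtain ⟨g, hg, h1, h2⟩ := exists_default_choice hinj hB htour.simple hx.ne
      exact ⟨ps, g, hps, hg, h1 t ht, h2 u y hu⟩
    · have htour := h𝒞 ps hps
      obtain ⟨x, hx⟩ := htour.route
      obtain ⟨g, hg, h1, h2, h3⟩ :=
        exists_special_choice hinj hB htour.simple hx.ne htour.exit hu y
      exact ⟨ps, g, hps, hg, h2 t ht hut, h1⟩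
  rcases w with t | ⟨u, y⟩ <;> rcases w' with t' | ⟨v, y'⟩
  · obtain ⟨ps, hps, ht, ht'⟩ := hav
    have htour := h𝒞 ps hps
    obtain ⟨x, hx⟩ := htour.route
    obtain ⟨g, hg, h1, h2⟩ := exists_default_choice hinj hB htour.simple hx.ne
    exact ⟨ps, g, hps, hg, h1 t ht, h1 t' ht'⟩
  · exact hmixed t v y' hav
  · obtain ⟨ps, g, h1, h2, h3, h4⟩ := hmixed t' u y hav
    exact ⟨ps, g, h1, h2, h4, h3⟩
  · obtain ⟨ps, hps, ⟨hu, hv | hv⟩ | ⟨hv, hu⟩⟩ := hav <;> have htour := h𝒞 ps hps <;>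
      obtain ⟨x, hx⟩ := htour.route
    · obtain ⟨g, hg, h1, h2⟩ := exists_default_choice hinj hB htour.simple hx.ne
      exact ⟨ps, g, hps, hg, h2 u y hu, h2 v y' hv⟩
    · obtain ⟨g, hg, h1, h2, h3⟩ :=
        exists_special_choice hinj hB htour.simple hx.ne htour.exit hv y'
      exact ⟨ps, g, hps, hg, h3 u y hu, h1⟩
    · obtain ⟨g, hg, h1, h2, h3⟩ :=
        exists_special_choice hinj hB htour.simple hx.ne htour.exit hu y
      exact ⟨ps, g, hps, hg, h1, h3 v y' hv⟩

/-- The cycle of the blow-up along a tour. -/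
theorem exists_isCycle_of_choice (hinj : ∀ u, Function.Injective (term u)) {n : ℕ}
    (hps : IsTour term ps) (hg : IsChoice en term n ps g) (hlen : 3 ≤ ps.length) :
    ∃ (a : T ⊕ ι × I) (c : (edgeGraph (blowEnds en term)).Walk a a), c.IsCycle ∧
      c.length = ps.length * (n + 1) ∧ ∀ w ∈ c.support, w ∈ routeList term g ps := by
  obtain ⟨x, hx⟩ := hps.route
  have hch := isChain_routeList hinj hx hg.path
  obtain ⟨l, hl⟩ := exists_routeList_eq_cons (g := g) hx
  cases hW : routeList term g ps with
  | nil =>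
    have := length_routeList (term := term) hg.length
    rw [hW, List.length_nil] at this
    nlinarith
  | cons a W =>
    have hlenW := length_routeList (term := term) hg.length
    have hnd := hg.nodup
    rw [hW] at hl hch hnd hlenW
    rw [List.cons_append, List.cons.injEq] at hl
    obtain ⟨rfl, -⟩ := hl
    obtain ⟨c, h1, h2, h3⟩ := exists_isCycle_of_list hch hnd (by
      rw [List.length_cons] at hlenW
      nlinarith)
    exact ⟨_, c, h1, by rw [h2, ← hlenW, List.length_cons], h3⟩

end Routes

/-! ### Paths in a copy of the cubic graph minus a vertex -/

section CopyPaths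

variable {I EB ι T : Type*}

/-- The terminal of a dangling edge. -/
abbrev dangling (k : Fin 3) : (T ⊕ Fin 3) ⊕ ι × I := Sum.inl (Sum.inr k)

/-- The inner vertices of a path joining two dangling terminals. -/
structure IsInner (en : EB → (Fin 3 ⊕ I) × (Fin 3 ⊕ I)) (loc : ι → Fin 3 → T ⊕ Fin 3) (N : ℕ)
    (j k : Fin 3) (M : List ((T ⊕ Fin 3) ⊕ ι × I)) : Prop where
  chain : (dangling j :: (M ++ [dangling k])).IsChain (edgeGraph (blowEnds en loc)).Adj
  nodup : (dangling j :: (M ++ [dangling k])).Nodup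
  length : M.length + 1 = N

/-- A path ending at a dangling terminal and containing no other one. -/
structure IsEndList (en : EB → (Fin 3 ⊕ I) × (Fin 3 ⊕ I)) (loc : ι → Fin 3 → T ⊕ Fin 3) (N : ℕ)
    (j : Fin 3) (M : List ((T ⊕ Fin 3) ⊕ ι × I)) : Prop where
  chain : (M ++ [dangling j]).IsChain (edgeGraph (blowEnds en loc)).Adj
  nodup : M.Nodup
  not_dangling : ∀ k, dangling k ∉ M
  length : M.length = N

variable {en : EB → (Fin 3 ⊕ I) × (Fin 3 ⊕ I)} {loc : ι → Fin 3 → T ⊕ Fin 3}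

theorem IsInner.reverse {N : ℕ} {j k : Fin 3} {M : List ((T ⊕ Fin 3) ⊕ ι × I)}
    (h : IsInner en loc N j k M) : IsInner en loc N k j M.reverse := by
  have hr : (dangling j :: (M ++ [dangling k])).reverse =
      dangling k :: (M.reverse ++ [(dangling j : (T ⊕ Fin 3) ⊕ ι × I)]) := by simp
  refine ⟨?_, ?_, by simpa using h.length⟩
  · rw [← hr, List.isChain_reverse]
    exact h.chain.imp fun _ _ h => h.symm
  · rw [← hr, List.nodup_reverse]
    exact h.nodup

/-- A route away from the new vertex, as a route through all gadgets. -/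
def liftPass (s : ι × Fin 3 × Fin 3) : Option ι × Fin 3 × Fin 3 := (some s.1, s.2)

theorem isRoute_termOne : ∀ {qs : List (ι × Fin 3 × Fin 3)} {x y : T ⊕ Fin 3},
    IsRoute (termOne loc) x (qs.map liftPass) y ↔ IsRoute loc x qs y
  | [], _, _ => Iff.rfl
  | s :: qs, x, y => by
    simp only [List.map_cons, IsRoute, liftPass, termOne_some]
    rw [isRoute_termOne]

theorem routeList_termOne (g : Option ι × Fin 3 × Fin 3 → List (Fin 3 ⊕ I)) :
    ∀ qs : List (ι × Fin 3 × Fin 3), routeList (termOne loc) g (qs.map liftPass) =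
      (routeList loc (fun s => g (liftPass s)) qs).map (Sum.map id (Prod.map some id))
  | [] => rfl
  | s :: qs => by
    rw [List.map_cons, routeList_cons, routeList_cons, routeList_termOne g qs, List.map_append]
    congr 1
    rw [List.map_map]
    refine List.map_congr_left fun a _ => ?_
    cases a <;> rfl

/-- Cutting a tour open at the new vertex leaves a route from the dangling edge by which the tour
leaves it to the one by which it enters it, and the lift of the tour restricts to a lift of this
route. -/
theorem exists_isInner (hinj : ∀ u, Function.Injective (termOne loc u)) {n m : ℕ}
    (hB : HasGadgetPaths en n) {𝒞 : List (Option ι × Fin 3 × Fin 3) → Prop}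
    (h𝒞 : ∀ ps, 𝒞 ps → IsTour (termOne loc) ps ∧
      ∃ i o, ∃ qs : List (ι × Fin 3 × Fin 3), ps = (none, i, o) :: qs.map liftPass ∧ qs.length = m)
    {w w' : (T ⊕ Fin 3) ⊕ ι × I}
    (hav : Avoidable 𝒞 (termOne loc) (targetOf (Sum.map id (Prod.map some id) w))
      (targetOf (Sum.map id (Prod.map some id) w'))) :
    ∃ j k M, j ≠ k ∧ IsInner en loc (m * (n + 1)) j k M ∧
      w ∉ dangling j :: (M ++ [dangling k]) ∧ w' ∉ dangling j :: (M ++ [dangling k]) := by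
  obtain ⟨ps, g, hps, hg, hw, hw'⟩ := exists_choice_avoiding hinj hB (fun ps h => (h𝒞 ps h).1) hav
  obtain ⟨htour, i, o, qs, rfl, hqs⟩ := h𝒞 ps hps
  obtain ⟨x, hx⟩ := htour.route
  have hx1 : Sum.inr i = x := hx.1
  have hio : i ≠ o := hx.2.1
  have hroute : IsRoute loc (Sum.inr o) qs (Sum.inr i) := by
    rw [← isRoute_termOne, hx1]; exact hx.2.2
  set g' : ι × Fin 3 × Fin 3 → List (Fin 3 ⊕ I) := fun s => g (liftPass s) with hg'
  have hpath : ∀ s ∈ qs, IsGadgetPath en s.2.1 s.2.2 (g' s) := fun s hs =>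
    hg.path (liftPass s) (List.mem_cons_of_mem _ (List.mem_map.2 ⟨s, hs, rfl⟩))
  have hlen : ∀ s ∈ qs, (g' s).length = n := fun s hs =>
    hg.length (liftPass s) (List.mem_cons_of_mem _ (List.mem_map.2 ⟨s, hs, rfl⟩))
  have hlift : Function.Injective
      (Sum.map id (Prod.map some id) : (T ⊕ Fin 3) ⊕ ι × I → (T ⊕ Fin 3) ⊕ Option ι × I) :=
    Sum.map_injective.2 ⟨Function.injective_id,
      (Option.some_injective ι).prodMap Function.injective_id⟩
  have hloc : ∀ u, Function.Injective (loc u) := fun u => hinj (some u)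
  have hch := isChain_routeList hloc hroute hpath
  have hnd := hg.nodup
  rw [routeList_cons, routeList_termOne] at hnd hw hw'
  have hnd' := (List.nodup_append.1 hnd).2.1.of_map
  have hlenW := length_routeList (term := loc) hlen
  obtain ⟨l, hl⟩ := exists_routeList_eq_cons (g := g') hroute
  -- The final dangling terminal is the entry of the pass through the new vertex, which precedes the
  -- remaining passes in a list without repetitions.
  have hd : ∀ v ∈ routeList loc g' qs, v ≠ dangling i := by
    rintro v hv rfl
    refine (List.nodup_append.1 hnd).2.2 (Sum.inl (Sum.inr i)) ?_ _
      (List.mem_map.2 ⟨_, hv, rfl⟩) rfl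
    simp [blowVert, termOne_none]
  have hmemi : ∀ v : (T ⊕ Fin 3) ⊕ ι × I, Sum.map id (Prod.map some id) v ∉
      (Sum.inl i :: g (none, i, o)).map (blowVert (termOne loc) none) ++
        (routeList loc g' qs).map (Sum.map id (Prod.map some id)) →
      v ∉ routeList loc g' qs ++ [dangling i] := by
    intro v hv hmem
    apply hv
    rcases List.mem_append.1 hmem with h | h
    · exact List.mem_append_right _ (List.mem_map.2 ⟨v, h, rfl⟩)
    · refine List.mem_append_left _ ?_
      rw [List.mem_singleton] at h
      subst h
      simp [blowVert, termOne_none]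
  cases hW : routeList loc g' qs with
  | nil =>
    rw [hW] at hl
    simp at hl
    exact absurd hl.1 hio
  | cons a M =>
    have hwl := hmemi w hw
    have hwl' := hmemi w' hw'
    rw [hW] at hl hch hnd' hlenW hd hwl hwl'
    rw [List.cons_append, List.cons.injEq] at hl
    obtain ⟨rfl, -⟩ := hl
    refine ⟨o, i, M, hio.symm, ⟨hch, ?_, by simpa [hqs] using hlenW⟩, hwl, hwl'⟩
    rw [← List.cons_append]
    refine List.nodup_append.2 ⟨hnd', List.nodup_singleton _, ?_⟩
    intro v hv v' hv'
    rw [List.mem_singleton] at hv'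
    rw [hv']
    exact hd v hv

/-- A route that starts at a gadget without dangling terminals, passes through the gadgets away
from the new vertex, and ends with a dangling edge. -/
structure IsEndRoute (loc : ι → Fin 3 → T ⊕ Fin 3) (u : ι) (o : Fin 3)
    (qs : List (ι × Fin 3 × Fin 3)) (j : Fin 3) : Prop where
  route : IsRoute loc (loc u o) qs (Sum.inr j)
  simple : IsSimpleRoute loc qs
  start : u ∉ qs.map Prod.fst
  start_uses : ∀ i, i ≠ o → ¬RouteUses loc qs (loc u i)
  start_dangling : ∀ i k, loc u i ≠ Sum.inr k
  not_dangling : ∀ k, ¬RouteUses loc qs (Sum.inr k)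

/-- The path begins with a Hamiltonian path of the gadget at `u`, of n + 2 vertices before the
terminal `o`, and continues along default paths. Since the first piece meets all terminals of `u`,
these must be neither dangling nor, apart from `o`, entries of the route. -/
theorem IsEndRoute.exists_isEndList (hloc : ∀ u, Function.Injective (loc u)) {n : ℕ}
    (hB : HasGadgetPaths en n) {u : ι} {o : Fin 3} {qs : List (ι × Fin 3 × Fin 3)} {j : Fin 3}
    (h : IsEndRoute loc u o qs j) :
    ∃ M, IsEndList en loc (qs.length * (n + 1) + (n + 2)) j M := by
  obtain ⟨g, hg, h1, h2⟩ := exists_default_choice hloc hB h.simple h.route.ne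
  obtain ⟨F, hF1, hF2, hF3⟩ := hB.full o
  have hch := isChain_routeList hloc h.route hg.path
  obtain ⟨l, hl⟩ := exists_routeList_eq_cons (g := g) h.route
  rw [List.nodup_append] at hF2
  refine ⟨F.map (blowVert loc u) ++ routeList loc g qs, ?_, ?_, ?_, ?_⟩
  · rw [List.append_assoc, hl, List.isChain_split]
    rw [hl] at hch
    refine ⟨?_, hch⟩
    have := List.isChain_map_of_isChain (S := (edgeGraph (blowEnds en loc)).Adj)
      (blowVert loc u) (fun a b hab => edgeGraph_blow_adj hloc hab u) hF1
    simpa [blowVert] using this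
  · refine List.nodup_append.2 ⟨hF2.1.map (blowVert_injective hloc u), hg.nodup, ?_⟩
    rintro v hv v' hv' rfl
    obtain ⟨a, ha, rfl⟩ := List.mem_map.1 hv
    rcases a with i | y
    · refine h1 (loc u i) (h.start_uses i ?_) hv'
      rintro rfl
      exact hF2.2.2 _ ha _ List.mem_cons_self rfl
    · exact h2 u y h.start hv'
  · intro k hk
    rcases List.mem_append.1 hk with hk | hk
    · obtain ⟨a, -, ha⟩ := List.mem_map.1 hk
      rcases a with i | y
      · exact h.start_dangling i k (Sum.inl_injective ha)
      · simp [blowVert] at ha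
    · exact h1 _ (h.not_dangling k) hk
  · rw [List.length_append, List.length_map, hF3, length_routeList hg.length]
    ring

end CopyPaths

/-! ### Long paths through four linked copies -/

section FourCopyPath

variable {I EB ι T : Type*}

/-- The vertex of the blow-up of four copies that corresponds to a vertex of copy `c`. -/
def copyVert (c : Fin 4) :
    (T ⊕ Fin 3) ⊕ ι × I → ((Fin 4 × T) ⊕ (Fin 3 × Fin 2)) ⊕ (Fin 4 × ι) × I :=
  Sum.map (copyEdge c) (Prod.map (Prod.mk c) id)

/-- The copy or the link of a vertex. -/
def copyKey : ((Fin 4 × T) ⊕ (Fin 3 × Fin 2)) ⊕ (Fin 4 × ι) × I → Fin 4 ⊕ Fin 3 × Fin 2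
  | Sum.inl (Sum.inl x) => Sum.inl x.1
  | Sum.inl (Sum.inr x) => Sum.inr x
  | Sum.inr x => Sum.inl x.1.1

/-- The other end of the link of colour `k` at `c`. -/
def neighbour (c : Fin 4) (k : Fin 3) : Fin 4 :=
  if (linkCopies (link c k)).1 = c then (linkCopies (link c k)).2 else (linkCopies (link c k)).1

theorem link_neighbour : ∀ (c : Fin 4) (k : Fin 3), link (neighbour c k) k = link c k := by decide

theorem copyVert_injective (c : Fin 4) : Function.Injective (copyVert (T := T) (ι := ι) (I := I) c) :=
  Sum.map_injective.2 ⟨Sum.map_injective.2 ⟨Prod.mk_right_injective c, fun _ _ h =>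
    (Prod.ext_iff.1 h).1⟩, (Prod.mk_right_injective c).prodMap Function.injective_id⟩

theorem copyVert_dangling (c : Fin 4) (k : Fin 3) :
    copyVert c (dangling k : (T ⊕ Fin 3) ⊕ ι × I) = Sum.inl (Sum.inr (link c k)) := rfl

theorem copyKey_copyVert (c : Fin 4) (w : (T ⊕ Fin 3) ⊕ ι × I) :
    (∃ k, w = dangling k ∧ copyKey (copyVert c w) = Sum.inr (link c k)) ∨
      (∀ k, w ≠ dangling k) ∧ copyKey (copyVert c w) = Sum.inl c := by
  rcases w with (t | k) | ⟨u, y⟩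
  · exact Or.inr ⟨fun k h => by simp at h, rfl⟩
  · exact Or.inl ⟨k, rfl, rfl⟩
  · exact Or.inr ⟨fun k h => by simp at h, rfl⟩

variable {en : EB → (Fin 3 ⊕ I) × (Fin 3 ⊕ I)} {loc : ι → Fin 3 → T ⊕ Fin 3}

theorem edgeGraph_copyVert_adj {v w : (T ⊕ Fin 3) ⊕ ι × I}
    (h : (edgeGraph (blowEnds en loc)).Adj v w) (c : Fin 4) :
    (edgeGraph (blowEnds en (termFour loc))).Adj (copyVert c v) (copyVert c w) := by
  have key : ∀ (u : ι) (a : Fin 3 ⊕ I),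
      copyVert c (blowVert loc u a) = blowVert (termFour loc) (c, u) a := by
    intro u a; cases a <;> rfl
  rw [edgeGraph, SimpleGraph.fromRel_adj] at h ⊢
  refine ⟨(copyVert_injective c).ne h.1, ?_⟩
  rcases h.2 with ⟨⟨u, e⟩, he⟩ | ⟨⟨u, e⟩, he⟩ <;> obtain ⟨rfl, rfl⟩ := Prod.mk.inj he
  · exact Or.inl ⟨((c, u), e), by rw [key, key]; rfl⟩
  · exact Or.inr ⟨((c, u), e), by rw [key, key]; rfl⟩

/-- The rows are the seven pieces, in order, of a path that runs through an end copy, a link of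
colour `j`, copy `a`, a link of colour `k`, a second middle copy, another link of colour `j`, and an
end copy. The pieces in the middle copies may also meet the link terminal of the third colour `l`.
-/
theorem link_keys_disjoint (a : Fin 4) (j k l : Fin 3) (hjk : j ≠ k) (hjl : j ≠ l) (hkl : k ≠ l) :
    List.Pairwise (fun x y : List (Fin 4 ⊕ Fin 3 × Fin 2) => ∀ z ∈ x, z ∉ y)
      [[Sum.inl (neighbour a j)], [Sum.inr (link a j)], [Sum.inl a, Sum.inr (link a l)],
        [Sum.inr (link a k)], [Sum.inl (neighbour a k), Sum.inr (link (neighbour a k) l)],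
        [Sum.inr (link (neighbour a k) j)], [Sum.inl (neighbour (neighbour a k) j)]] := by
  have key : ∀ (a : Fin 4) (j k l : Fin 3), j ≠ k → j ≠ l → k ≠ l → List.Pairwise
      (fun x y : List (Fin 4 ⊕ Fin 3 × Fin 2) => 
        (x.all fun z => y.all fun z' => decide (z ≠ z')) = true)
      [[Sum.inl (neighbour a j)], [Sum.inr (link a j)], [Sum.inl a, Sum.inr (link a l)],
        [Sum.inr (link a k)], [Sum.inl (neighbour a k), Sum.inr (link (neighbour a k) l)],
        [Sum.inr (link (neighbour a k) j)], [Sum.inl (neighbour (neighbour a k) j)]] := by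
    decide
  refine (key a j k l hjk hjl hkl).imp fun {x y} h z hz hz' => ?_
  have h1 := List.all_eq_true.1 h z hz
  have h2 := List.all_eq_true.1 h1 z hz'
  simp at h2

/-- Pieces whose keys come from disjoint sets cannot share an element. -/
theorem nodup_flatten_of_keys {α κ : Type*} (key : α → κ) :
    ∀ {Ls : List (List α)} {Ks : List (List κ)}, Ks.Pairwise (fun x y => ∀ z ∈ x, z ∉ y) →
    List.Forall₂ (fun L K => L.Nodup ∧ ∀ x ∈ L, key x ∈ K) Ls Ks → Ls.flatten.Nodup
  | [], _, _, _ => by simp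
  | L :: Ls, [], _, h => by cases h
  | L :: Ls, K :: Ks, hp, h => by
    rw [List.forall₂_cons] at h
    rw [List.pairwise_cons] at hp
    rw [List.flatten_cons, List.nodup_append]
    refine ⟨h.1.1, nodup_flatten_of_keys key hp.2 h.2, ?_⟩
    rintro x hx y hy rfl
    obtain ⟨L', hL', hxL'⟩ := List.mem_flatten.1 hy
    obtain ⟨i, hi, rfl⟩ := List.mem_iff_getElem.1 hL'
    have hlen := h.2.length_eq
    have := (List.forall₂_iff_get.1 h.2).2 i hi (hlen ▸ hi)
    exact hp.1 (Ks[i]'(hlen ▸ hi)) (List.getElem_mem _) (key x) (h.1.2 x hx) (this.2 x hxL')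

/-- The four copies are visited along links of colours `j`, `k`, `j`. The end copies contribute N'
edges each and the middle ones N each; the last end list is traversed backwards. -/
theorem exists_four_path {N N' : ℕ} {a : Fin 4} {j k l : Fin 3} (hjk : j ≠ k) (hjl : j ≠ l)
    (hkl : k ≠ l) {Ma Mb L : List ((T ⊕ Fin 3) ⊕ ι × I)} (hMa : IsInner en loc N j k Ma)
    (hMb : IsInner en loc N k j Mb) (hL : IsEndList en loc N' j L) :
    ∃ (x y : _) (p : (edgeGraph (blowEnds en (termFour loc))).Walk x y), p.IsPath ∧
      p.length = 2 * N' + 2 * N ∧ ∀ v ∈ p.support,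
        copyKey v = Sum.inl (neighbour a j) ∨ copyKey v = Sum.inl (neighbour (neighbour a k) j) ∨
        (∃ w ∈ dangling j :: (Ma ++ [dangling k]), v = copyVert a w) ∨
        ∃ w ∈ dangling k :: (Mb ++ [dangling j]), v = copyVert (neighbour a k) w := by
  set b := neighbour a k with hb
  set D := neighbour a j with hD
  set E := neighbour b j with hE
  have hbk : link b k = link a k := link_neighbour a k
  have hDj : link D j = link a j := link_neighbour a j
  have hEj : link E j = link b j := link_neighbour b j
  have hchain : ∀ (c : Fin 4) {l : List ((T ⊕ Fin 3) ⊕ ι × I)},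
      l.IsChain (edgeGraph (blowEnds en loc)).Adj →
      (l.map (copyVert c)).IsChain (edgeGraph (blowEnds en (termFour loc))).Adj := fun c l h =>
    List.isChain_map_of_isChain _ (fun v w hvw => edgeGraph_copyVert_adj hvw c) h
  have c1 := hchain D hL.chain
  have c2 := hchain a hMa.chain
  have c3 := hchain b hMb.chain
  have c4 := hchain E hL.chain
  have c4' : ((L ++ [dangling j]).map (copyVert E)).reverse.IsChain
      (edgeGraph (blowEnds en (termFour loc))).Adj := by
    rw [List.isChain_reverse]
    exact c4.imp fun _ _ h => h.symm
  have hnotin : ∀ {M : List ((T ⊕ Fin 3) ⊕ ι × I)} {j k l : Fin 3}, j ≠ k → j ≠ l → k ≠ l →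
      IsInner en loc N j k M → ∀ i, dangling i ∈ M → i = l := by
    intro M j k l hjk hjl hkl hM i hi
    have hnd := hM.nodup
    rw [List.nodup_cons, List.mem_append, List.nodup_append] at hnd
    have h1 : i ≠ j := by rintro rfl; exact hnd.1 (Or.inl hi)
    have h2 : i ≠ k := by rintro rfl; exact hnd.2.2.2 _ hi _ List.mem_cons_self rfl
    omega
  have hkeyL : ∀ c, ∀ v ∈ L.map (copyVert c), copyKey v = Sum.inl c := by
    intro c v hv
    obtain ⟨w, hw, rfl⟩ := List.mem_map.1 hv
    rcases copyKey_copyVert c w with ⟨i, rfl, -⟩ | ⟨-, h⟩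
    · exact absurd hw (hL.not_dangling i)
    · exact h
  have hkeyM : ∀ (c : Fin 4) {M : List ((T ⊕ Fin 3) ⊕ ι × I)} {j k l : Fin 3}, j ≠ k → j ≠ l →
      k ≠ l → IsInner en loc N j k M → ∀ v ∈ M.map (copyVert c),
      copyKey v ∈ [Sum.inl c, Sum.inr (link c l)] := by
    intro c M j k l hjk hjl hkl hM v hv
    obtain ⟨w, hw, rfl⟩ := List.mem_map.1 hv
    rcases copyKey_copyVert c w with ⟨i, rfl, h⟩ | ⟨-, h⟩
    · rw [h, hnotin hjk hjl hkl hM i hw]; simp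
    · rw [h]; simp
  have hndM : ∀ (c : Fin 4) {M : List ((T ⊕ Fin 3) ⊕ ι × I)} {j k : Fin 3},
      IsInner en loc N j k M → (M.map (copyVert c)).Nodup := by
    intro c M j k hM
    have := hM.nodup
    rw [List.nodup_cons, List.nodup_append] at this
    exact this.2.1.map (copyVert_injective c)
  let Q : List (((Fin 4 × T) ⊕ (Fin 3 × Fin 2)) ⊕ (Fin 4 × ι) × I) :=
    [L.map (copyVert D), [Sum.inl (Sum.inr (link a j))], Ma.map (copyVert a),
      [Sum.inl (Sum.inr (link a k))], Mb.map (copyVert b), [Sum.inl (Sum.inr (link b j))],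
      (L.map (copyVert E)).reverse].flatten
  have hQ : Q = L.map (copyVert D) ++ Sum.inl (Sum.inr (link a j)) :: (Ma.map (copyVert a) ++
      Sum.inl (Sum.inr (link a k)) :: (Mb.map (copyVert b) ++ Sum.inl (Sum.inr (link b j)) ::
        (L.map (copyVert E)).reverse)) := by simp [Q]
  have hQne : Q ≠ [] := by rw [hQ]; simp
  have hQnd : Q.Nodup := by
    refine nodup_flatten_of_keys copyKey (link_keys_disjoint a j k l hjk hjl hkl) ?_
    refine .cons ⟨hL.nodup.map (copyVert_injective D), fun v hv => by simp [hkeyL D v hv, hD]⟩ ?_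
    refine .cons ⟨List.nodup_singleton _, fun v hv => by simp [List.mem_singleton.1 hv, copyKey]⟩ ?_
    refine .cons ⟨hndM a hMa, hkeyM a hjk hjl hkl hMa⟩ ?_
    refine .cons ⟨List.nodup_singleton _, fun v hv => by simp [List.mem_singleton.1 hv, copyKey]⟩ ?_
    refine .cons ⟨hndM b hMb, hkeyM b hjk.symm hkl hjl hMb⟩ ?_
    refine .cons ⟨List.nodup_singleton _, fun v hv => by
      simp [List.mem_singleton.1 hv, copyKey, hb]⟩ ?_
    refine .cons ⟨List.nodup_reverse.2 (hL.nodup.map (copyVert_injective E)), fun v hv => ?_⟩ .nil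
    rw [List.mem_reverse] at hv
    simp [hkeyL E v hv, hE, hb]
  have hQch : Q.IsChain (edgeGraph (blowEnds en (termFour loc))).Adj := by
    rw [hQ, List.isChain_split, List.isChain_cons_split]
    refine ⟨by simpa [copyVert_dangling, hDj] using c1, by simpa [copyVert_dangling] using c2, ?_⟩
    rw [List.isChain_cons_split]
    refine ⟨?_, ?_⟩
    · simpa [copyVert_dangling, hbk] using c3
    · simpa [copyVert_dangling, hEj] using c4'
  obtain ⟨x, y, p, hp, hlen, hsup⟩ := exists_isPath_of_list hQne hQch hQnd
  refine ⟨x, y, p, hp, ?_, ?_⟩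
  · have h1 := hMa.length
    have h2 := hMb.length
    have h3 := hL.length
    rw [hQ] at hlen
    simp at hlen
    omega
  · intro v hv
    rw [hsup, hQ] at hv
    simp only [List.mem_append, List.mem_cons, List.mem_reverse] at hv
    rcases hv with hv | rfl | hv | rfl | hv | rfl | hv
    · exact Or.inl (hkeyL D v hv)
    · exact Or.inr (Or.inr (Or.inl ⟨dangling j, by simp, rfl⟩))
    · obtain ⟨w, hw, rfl⟩ := List.mem_map.1 hv
      exact Or.inr (Or.inr (Or.inl ⟨w, by simp [hw], rfl⟩))
    · exact Or.inr (Or.inr (Or.inl ⟨dangling k, by simp, rfl⟩))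
    · obtain ⟨w, hw, rfl⟩ := List.mem_map.1 hv
      exact Or.inr (Or.inr (Or.inr ⟨w, by simp [hw], rfl⟩))
    · exact Or.inr (Or.inr (Or.inr ⟨dangling j, by simp, rfl⟩))
    · exact Or.inr (Or.inl (hkeyL E v hv))

/-- Any two vertices of the blow-up of four copies are avoided by a path of the given length. -/
theorem exists_four_path_avoiding {N N' : ℕ}
    (hin : ∀ w w' : (T ⊕ Fin 3) ⊕ ι × I, (∀ k, w ≠ dangling k) ∨ w = w' →
      ∃ j k M, j ≠ k ∧ IsInner en loc N j k M ∧ w ∉ dangling j :: (M ++ [dangling k]) ∧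
        w' ∉ dangling j :: (M ++ [dangling k]))
    (hend : ∀ j, ∃ L, IsEndList en loc N' j L)
    (v v' : ((Fin 4 × T) ⊕ (Fin 3 × Fin 2)) ⊕ (Fin 4 × ι) × I) :
    ∃ (x y : _) (p : (edgeGraph (blowEnds en (termFour loc))).Walk x y), p.IsPath ∧
      p.length = 2 * N' + 2 * N ∧ v ∉ p.support ∧ v' ∉ p.support := by
  have hcases : ∀ v : ((Fin 4 × T) ⊕ (Fin 3 × Fin 2)) ⊕ (Fin 4 × ι) × I,
      (∃ c w, (∀ k, w ≠ dangling k) ∧ v = copyVert c w) ∨ ∃ x, v = Sum.inl (Sum.inr x) := by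
    rintro ((⟨c, t⟩ | x) | ⟨⟨c, u⟩, y⟩)
    · exact Or.inl ⟨c, Sum.inl (Sum.inl t), fun k h => by simp at h, rfl⟩
    · exact Or.inr ⟨x, rfl⟩
    · exact Or.inl ⟨c, Sum.inr (u, y), fun k h => by simp at h, rfl⟩
  -- avoiding a given terminal fixes the two ends
  have hdir : ∀ {w : (T ⊕ Fin 3) ⊕ ι × I} {j k l : Fin 3}, j ≠ k → j ≠ l → k ≠ l →
      ((∀ k, w ≠ dangling k) ∨ w = dangling l) → ∃ M, IsInner en loc N j k M ∧
        w ∉ dangling j :: (M ++ [dangling k]) ∧ dangling l ∉ dangling j :: (M ++ [dangling k]) := by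
    intro w j k l hjk hjl hkl hw
    obtain ⟨j', k', M, hjk', hM, h1, h2⟩ := hin w (dangling l) hw
    have e1 : l ≠ j' := by rintro rfl; simp at h2
    have e2 : l ≠ k' := by rintro rfl; simp at h2
    have : (j = j' ∧ k = k') ∨ (j = k' ∧ k = j') := by omega
    rcases this with ⟨rfl, rfl⟩ | ⟨rfl, rfl⟩
    · exact ⟨M, hM, h1, h2⟩
    · refine ⟨M.reverse, hM.reverse, ?_, ?_⟩
      · simp at h1 ⊢; tauto
      · simp at h2 ⊢; tauto
  -- The end copies are different from both middle copies, so vertices to be avoided only matter for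
  -- the middle pieces once they lie in middle copies or on links.
  have hnbr : ∀ (a : Fin 4) (j k l : Fin 3), j ≠ k → j ≠ l → k ≠ l →
      neighbour a j ≠ a ∧ neighbour (neighbour a k) j ≠ a ∧ neighbour a k ≠ a ∧
      neighbour a j ≠ neighbour a k ∧ neighbour (neighbour a k) j ≠ neighbour a k := by decide
  -- vertices inside the two middle copies
  have hlocal : ∀ {c d : Fin 4} {w : (T ⊕ Fin 3) ⊕ ι × I}, (∀ k, w ≠ dangling k) →
      ∀ {L : List ((T ⊕ Fin 3) ⊕ ι × I)}, (c = d → w ∉ L) → ¬∃ w' ∈ L, copyVert c w = copyVert d w' := by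
    rintro c d w hw L hL ⟨w', hw', heq⟩
    have h1 : copyKey (copyVert c w) = Sum.inl c := by
      rcases copyKey_copyVert c w with ⟨i, rfl, -⟩ | ⟨-, h⟩
      · exact absurd rfl (hw i)
      · exact h
    rcases copyKey_copyVert d w' with ⟨i, rfl, h⟩ | ⟨-, h⟩
    · rw [← heq, h1] at h; simp at h
    · rw [← heq, h1] at h
      obtain rfl := Sum.inl_injective h
      exact hL rfl (copyVert_injective c heq ▸ hw')
  have hlink : ∀ {d : Fin 4} {x : Fin 3 × Fin 2} {L : List ((T ⊕ Fin 3) ⊕ ι × I)},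
      (link d x.1 = x → dangling x.1 ∉ L) →
      ¬∃ w' ∈ L, (Sum.inl (Sum.inr x) : ((Fin 4 × T) ⊕ (Fin 3 × Fin 2)) ⊕ (Fin 4 × ι) × I) =
        copyVert d w' := by
    rintro d x L hL ⟨w', hw', heq⟩
    have h1 := congrArg copyKey heq
    rcases copyKey_copyVert d w' with ⟨i, rfl, h⟩ | ⟨-, h⟩
    · rw [h] at h1
      have h2 : x = link d i := Sum.inr_injective h1
      have h3 : x.1 = i := by rw [h2]; rfl
      refine hL ?_ (h3 ▸ hw')
      rw [h3]; exact h2.symm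
    · rw [h] at h1
      simp [copyKey] at h1
  have hkeyloc : ∀ {c : Fin 4} {w : (T ⊕ Fin 3) ⊕ ι × I}, (∀ k, w ≠ dangling k) →
      copyKey (copyVert c w) = Sum.inl c := by
    intro c w hw
    rcases copyKey_copyVert c w with ⟨i, rfl, -⟩ | ⟨-, h⟩
    · exact absurd rfl (hw i)
    · exact h
  have hmain : ∀ (a : Fin 4) {j k l : Fin 3}, j ≠ k → j ≠ l → k ≠ l → ∀ {Ma Mb},
      IsInner en loc N j k Ma → IsInner en loc N k j Mb →
      (∀ x ∈ [v, v'], (copyKey x ≠ Sum.inl (neighbour a j) ∧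
        copyKey x ≠ Sum.inl (neighbour (neighbour a k) j)) ∧
        (¬∃ w ∈ dangling j :: (Ma ++ [dangling k]), x = copyVert a w) ∧
        ¬∃ w ∈ dangling k :: (Mb ++ [dangling j]), x = copyVert (neighbour a k) w) →
      ∃ (x y : _) (p : (edgeGraph (blowEnds en (termFour loc))).Walk x y), p.IsPath ∧
        p.length = 2 * N' + 2 * N ∧ v ∉ p.support ∧ v' ∉ p.support := by
    intro a j k l hjk hjl hkl Ma Mb hMa hMb hx
    obtain ⟨L, hL⟩ := hend j
    obtain ⟨x, y, p, hp, hlen, hsup⟩ := exists_four_path (a := a) hjk hjl hkl hMa hMb hL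
    refine ⟨x, y, p, hp, hlen, fun h => ?_, fun h => ?_⟩
    · obtain ⟨⟨h1, h2⟩, h3, h4⟩ := hx v (by simp)
      rcases hsup v h with h' | h' | h' | h'
      exacts [h1 h', h2 h', h3 h', h4 h']
    · obtain ⟨⟨h1, h2⟩, h3, h4⟩ := hx v' (by simp)
      rcases hsup v' h with h' | h' | h' | h'
      exacts [h1 h', h2 h', h3 h', h4 h']
  -- Take for `l` the colour of the link to be avoided. The copy containing the other vertex becomes
  -- a middle one, and both middle pieces are chosen to miss their terminals of colour `l`.
  have hmixed : ∀ (a : Fin 4) (w : (T ⊕ Fin 3) ⊕ ι × I), (∀ k, w ≠ dangling k) →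
      ∀ (x : Fin 3 × Fin 2) (v v'), v = copyVert a w → v' = Sum.inl (Sum.inr x) →
      ∃ (j k l : Fin 3) (Ma Mb : List ((T ⊕ Fin 3) ⊕ ι × I)), j ≠ k ∧ j ≠ l ∧ k ≠ l ∧
      IsInner en loc N j k Ma ∧ IsInner en loc N k j Mb ∧
      (∀ x ∈ [v, v'], (copyKey x ≠ Sum.inl (neighbour a j) ∧
        copyKey x ≠ Sum.inl (neighbour (neighbour a k) j)) ∧
        (¬∃ w ∈ dangling j :: (Ma ++ [dangling k]), x = copyVert a w) ∧
        ¬∃ w ∈ dangling k :: (Mb ++ [dangling j]), x = copyVert (neighbour a k) w) := by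
    rintro a w hw x v v' rfl rfl
    obtain ⟨j, k, hjk, hjl, hkl⟩ : ∃ j k : Fin 3, j ≠ k ∧ j ≠ x.1 ∧ k ≠ x.1 := by
      generalize x.1 = l; revert l; decide
    obtain ⟨Ma, hMa, h1, h2⟩ := hdir hjk hjl hkl (Or.inl hw)
    obtain ⟨Mb, hMb, -, h3⟩ := hdir (w := dangling x.1) hjk.symm hkl hjl (Or.inr rfl)
    obtain ⟨n1, n2, n3, n4, n5⟩ := hnbr a j k x.1 hjk hjl hkl
    refine ⟨j, k, x.1, Ma, Mb, hjk, hjl, hkl, hMa, hMb, ?_⟩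
    intro z hz
    simp only [List.mem_cons, List.not_mem_nil, or_false] at hz
    rcases hz with rfl | rfl
    · rw [hkeyloc hw]
      exact ⟨⟨by simpa using n1.symm, by simpa using n2.symm⟩, hlocal hw fun _ => h1,
        hlocal hw fun h => absurd h.symm n3⟩
    · exact ⟨⟨by simp [copyKey], by simp [copyKey]⟩, hlink fun _ => h2, hlink fun _ => h3⟩
  rcases hcases v with ⟨a, w, hw, hv⟩ | ⟨x, hv⟩ <;>
    rcases hcases v' with ⟨b, w', hw', hv'⟩ | ⟨x', hv'⟩
  · by_cases hab : b = a
    · subst hab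
      obtain ⟨j, k, Ma, hjk, hMa, h1, h2⟩ := hin w w' (Or.inl hw)
      obtain ⟨l, hjl, hkl⟩ : ∃ l : Fin 3, j ≠ l ∧ k ≠ l := by
        clear h1 h2 hMa
        revert j k; decide
      obtain ⟨Mb, hMb, -, -⟩ := hdir (w := dangling l) hjk.symm hkl hjl (Or.inr rfl)
      obtain ⟨n1, n2, n3, n4, n5⟩ := hnbr b j k l hjk hjl hkl
      refine hmain b hjk hjl hkl hMa hMb ?_
      intro z hz
      simp only [List.mem_cons, List.not_mem_nil, or_false] at hz
      rcases hz with rfl | rfl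
      · rw [hv, hkeyloc hw]
        exact ⟨⟨by simpa using n1.symm, by simpa using n2.symm⟩, hlocal hw fun _ => h1,
          hlocal hw fun h => absurd h.symm n3⟩
      · rw [hv', hkeyloc hw']
        exact ⟨⟨by simpa using n1.symm, by simpa using n2.symm⟩, hlocal hw' fun _ => h2,
          hlocal hw' fun h => absurd h.symm n3⟩
    -- Two vertices inside different copies: make these the two middle copies, joined by their
    -- common link.
    · obtain ⟨j, k, l, hjk, hjl, hkl, rfl⟩ : ∃ j k l : Fin 3, j ≠ k ∧ j ≠ l ∧ k ≠ l ∧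
          neighbour a k = b := by
        clear hv hv'
        revert a b; decide
      obtain ⟨Ma, hMa, h1, -⟩ := hdir hjk hjl hkl (Or.inl hw)
      obtain ⟨Mb, hMb, h2, -⟩ := hdir hjk.symm hkl hjl (Or.inl hw')
      obtain ⟨n1, n2, n3, n4, n5⟩ := hnbr a j k l hjk hjl hkl
      refine hmain a hjk hjl hkl hMa hMb ?_
      intro z hz
      simp only [List.mem_cons, List.not_mem_nil, or_false] at hz
      rcases hz with rfl | rfl
      · rw [hv, hkeyloc hw]
        exact ⟨⟨by simpa using n1.symm, by simpa using n2.symm⟩, hlocal hw fun _ => h1,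
          hlocal hw fun h => absurd h.symm n3⟩
      · rw [hv', hkeyloc hw']
        exact ⟨⟨by simpa using n4.symm, by simpa using n5.symm⟩,
          hlocal hw' fun h => absurd h n3, hlocal hw' fun _ => h2⟩
  · obtain ⟨j, k, l, Ma, Mb, hjk, hjl, hkl, hMa, hMb, hx⟩ := hmixed a w hw x' v v' hv hv'
    exact hmain a hjk hjl hkl hMa hMb hx
  · obtain ⟨j, k, l, Ma, Mb, hjk, hjl, hkl, hMa, hMb, hx⟩ := hmixed b w' hw' x v' v hv' hv
    exact hmain b hjk hjl hkl hMa hMb fun z hz => hx z (by simp at hz ⊢; tauto)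
  -- Two links: the first gets the colour `l`, off the three links traversed. If the second has
  -- another colour it becomes `k`, and `a` is chosen such that the middle link is the other link of
  -- this colour.
  · obtain ⟨a, j, k, l, hjk, hjl, hkl, hxl, hx'⟩ : ∃ (a : Fin 4) (j k l : Fin 3), j ≠ k ∧ j ≠ l ∧
        k ≠ l ∧ x.1 = l ∧ (x'.1 = l ∨ x'.1 = k ∧ link a k ≠ x') := by
      clear hv hv'
      revert x x'; decide
    obtain ⟨Ma, hMa, -, h1⟩ := hdir (w := dangling l) hjk hjl hkl (Or.inr rfl)
    obtain ⟨Mb, hMb, -, h2⟩ := hdir (w := dangling l) hjk.symm hkl hjl (Or.inr rfl)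
    refine hmain a hjk hjl hkl hMa hMb ?_
    intro z hz
    simp only [List.mem_cons, List.not_mem_nil, or_false] at hz
    rcases hz with rfl | rfl
    · rw [hv]
      exact ⟨⟨by simp [copyKey], by simp [copyKey]⟩, hlink fun _ => hxl ▸ h1,
        hlink fun _ => hxl ▸ h2⟩
    · rw [hv']
      refine ⟨⟨by simp [copyKey], by simp [copyKey]⟩, hlink fun h => ?_, hlink fun h => ?_⟩
      · rcases hx' with e | ⟨e, e'⟩
        · rw [e]; exact h1
        · rw [e] at h; exact absurd h e'
      · rcases hx' with e | ⟨e, e'⟩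
        · rw [e]; exact h2
        · rw [e, link_neighbour] at h; exact absurd h e'

end FourCopyPath

/-! ### Long paths through four linked gadgets -/

section LinkedPath

variable {I EB : Type*} {en : EB → (Fin 3 ⊕ I) × (Fin 3 ⊕ I)}

theorem edgeGraph_linked_adj {a b : Fin 3 ⊕ I} (h : (edgeGraph en).Adj a b) (c : Fin 4) :
    (edgeGraph (linkedEnds en)).Adj (c, a) (c, b) := by
  rw [edgeGraph, SimpleGraph.fromRel_adj] at h ⊢
  refine ⟨fun h' => h.1 (Prod.ext_iff.1 h').2, ?_⟩
  rcases h.2 with ⟨e, he⟩ | ⟨e, he⟩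
  · exact Or.inl ⟨Sum.inl (c, e), by simp [linkedEnds, he]⟩
  · exact Or.inr ⟨Sum.inl (c, e), by simp [linkedEnds, he]⟩

theorem edgeGraph_link_adj (c : Fin 4) (k : Fin 3) :
    (edgeGraph (linkedEnds en)).Adj (c, Sum.inl k) (neighbour c k, Sum.inl k) := by
  have h1 : ∀ (c : Fin 4) (k : Fin 3), c ≠ neighbour c k := by decide
  have h2 : ∀ (c : Fin 4) (k : Fin 3), linkCopies (link c k) = (c, neighbour c k) ∨
      linkCopies (link c k) = (neighbour c k, c) := by decide
  rw [edgeGraph, SimpleGraph.fromRel_adj]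
  refine ⟨fun h' => h1 c k (Prod.ext_iff.1 h').1, ?_⟩
  rcases h2 c k with h | h
  · exact Or.inl ⟨Sum.inr (link c k), by simp only [linkedEnds, h]; rfl⟩
  · exact Or.inr ⟨Sum.inr (link c k), by simp only [linkedEnds, h]; rfl⟩

/-- The end gadgets are traversed by Hamiltonian paths with n + 3 vertices and the middle ones by
paths with n + 2 vertices between terminals. The gadget of the given vertex is made a middle one, so
that its path can miss that vertex. -/
theorem exists_linked_path {n : ℕ} (hB : HasGadgetPaths en n) (v : Fin 4 × (Fin 3 ⊕ I)) :
    ∃ (x y : _) (p : (edgeGraph (linkedEnds en)).Walk x y), p.IsPath ∧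
      p.length = 4 * n + 9 ∧ v ∉ p.support := by
  obtain ⟨a, w⟩ := v
  -- A terminal is missed by the default path between the other two, an internal vertex by a special
  -- path from 0 to 1.
  obtain ⟨j, k, l, M, hjk, hjl, hkl, hM, hMlen, hw⟩ : ∃ (j k l : Fin 3) (M : List (Fin 3 ⊕ I)),
      j ≠ k ∧ j ≠ l ∧ k ≠ l ∧ IsGadgetPath en j k M ∧ M.length = n ∧
        w ∉ Sum.inl j :: (M ++ [Sum.inl k]) := by
    rcases w with l | y
    · obtain ⟨j, k, hjk, hjl, hkl⟩ : ∃ j k : Fin 3, j ≠ k ∧ j ≠ l ∧ k ≠ l := by revert l; decide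
      obtain ⟨M, h1, h2, h3⟩ := hB.default j k hjk
      exact ⟨j, k, l, M, hjk, hjl, hkl, h1, h2, by simp [h3, hjl.symm, hkl.symm]⟩
    · obtain ⟨M, h1, h2, h3⟩ := hB.special y 0 1 (by decide) (Or.inl rfl)
      exact ⟨0, 1, 2, M, by decide, by decide, by decide, h1, h2, by simp [h3]⟩
  obtain ⟨M', hM', hMlen', -⟩ := hB.default k j hjk.symm
  obtain ⟨F, hF1, hF2, hF3⟩ := hB.full j
  set b := neighbour a k with hb
  set D := neighbour a j with hD
  set E := neighbour b j with hE
  have hchain : ∀ (c : Fin 4) {l : List (Fin 3 ⊕ I)}, l.IsChain (edgeGraph en).Adj →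
      (l.map (Prod.mk c)).IsChain (edgeGraph (linkedEnds en)).Adj := fun c l h =>
    List.isChain_map_of_isChain _ (fun v w hvw => edgeGraph_linked_adj hvw c) h
  have hdist : ∀ (a : Fin 4) (j k l : Fin 3), j ≠ k → j ≠ l → k ≠ l →
      List.Pairwise (fun x y : List (Fin 4) => ∀ z ∈ x, z ∉ y)
        [[neighbour a j], [a], [neighbour a k], [neighbour (neighbour a k) j]] := by
    have key : ∀ (a : Fin 4) (j k l : Fin 3), j ≠ k → j ≠ l → k ≠ l →
        neighbour a j ≠ a ∧ neighbour a j ≠ neighbour a k ∧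
        neighbour a j ≠ neighbour (neighbour a k) j ∧ a ≠ neighbour a k ∧
        a ≠ neighbour (neighbour a k) j ∧ neighbour a k ≠ neighbour (neighbour a k) j := by decide
    intro a j k l hjk hjl hkl
    have := key a j k l hjk hjl hkl
    simp
    tauto
  let Q : List (Fin 4 × (Fin 3 ⊕ I)) := [(F ++ [Sum.inl j]).map (Prod.mk D),
    (Sum.inl j :: (M ++ [Sum.inl k])).map (Prod.mk a),
    (Sum.inl k :: (M' ++ [Sum.inl j])).map (Prod.mk b),
    ((F ++ [Sum.inl j]).map (Prod.mk E)).reverse].flatten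
  have hkey : ∀ (c : Fin 4) (L : List (Fin 3 ⊕ I)), ∀ x ∈ L.map (Prod.mk c), x.1 ∈ [c] := by
    intro c L x hx
    obtain ⟨y, -, rfl⟩ := List.mem_map.1 hx
    simp
  have hinj : ∀ c : Fin 4, Function.Injective (Prod.mk c : Fin 3 ⊕ I → _) :=
    fun c => Prod.mk_right_injective c
  have hQnd : Q.Nodup := by
    refine nodup_flatten_of_keys Prod.fst (hdist a j k l hjk hjl hkl) ?_
    refine .cons ⟨hF2.map (hinj D), hkey D _⟩ (.cons ⟨hM.2.map (hinj a), hkey a _⟩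
      (.cons ⟨hM'.2.map (hinj b), hkey b _⟩ (.cons ⟨List.nodup_reverse.2 (hF2.map (hinj E)),
        fun x hx => hkey E _ x (List.mem_reverse.1 hx)⟩ .nil)))
  have hQ : Q = (F.map (Prod.mk D) ++ (D, Sum.inl j) :: (a, Sum.inl j) ::
      (M.map (Prod.mk a) ++ (a, Sum.inl k) :: (b, Sum.inl k) :: (M'.map (Prod.mk b) ++
        (b, Sum.inl j) :: (E, Sum.inl j) :: (F.map (Prod.mk E)).reverse))) := by
    simp [Q]
  have hQch : Q.IsChain (edgeGraph (linkedEnds en)).Adj := by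
    rw [hQ, List.isChain_append_cons_cons]
    refine ⟨by simpa using hchain D hF1, (edgeGraph_link_adj a j).symm, ?_⟩
    rw [List.isChain_cons_append_cons_cons]
    refine ⟨by simpa using hchain a hM.1, edgeGraph_link_adj a k, ?_⟩
    rw [List.isChain_cons_append_cons_cons]
    refine ⟨by simpa using hchain b hM'.1, edgeGraph_link_adj b j, ?_⟩
    have := hchain E hF1
    have h2 : ((F ++ [Sum.inl j]).map (Prod.mk E)).reverse.IsChain
        (edgeGraph (linkedEnds en)).Adj := by
      rw [List.isChain_reverse]
      exact this.imp fun _ _ h => h.symm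
    simpa using h2
  obtain ⟨x, y, p, hp, hlen, hsup⟩ := exists_isPath_of_list (by rw [hQ]; simp) hQch hQnd
  refine ⟨x, y, p, hp, ?_, ?_⟩
  · rw [hQ] at hlen
    simp at hlen
    omega
  · rw [hsup]
    intro hmem
    have hne : ∀ (a : Fin 4) (j k l : Fin 3), j ≠ k → j ≠ l → k ≠ l → a ≠ neighbour a j ∧
        a ≠ neighbour a k ∧ a ≠ neighbour (neighbour a k) j := by decide
    obtain ⟨n1, n2, n3⟩ := hne a j k l hjk hjl hkl
    simp only [Q, List.flatten_cons, List.flatten_nil, List.append_nil, List.mem_append,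
      List.mem_reverse] at hmem
    rcases hmem with h | h | h | h
    · exact n1 (by simpa using hkey D _ _ h)
    · obtain ⟨w', hw', heq⟩ := List.mem_map.1 h
      obtain rfl : w' = w := (Prod.ext_iff.1 heq).2
      exact hw hw'
    · exact n2 (by simpa using hkey b _ _ h)
    · exact n3 (by simpa using hkey E _ _ h)

end LinkedPath

/-! ### Connectedness after deleting two vertices -/

section Connectivity

variable {V : Type*}

/-- Every function that is constant along the edges outside `S` is constant outside `S`. -/
def ConnOff (G : SimpleGraph V) (S : Finset V) : Prop :=
  ∀ f : V → Prop, (∀ a b, G.Adj a b → a ∉ S → b ∉ S → (f a ↔ f b)) →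
    ∀ a b, a ∉ S → b ∉ S → (f a ↔ f b)

/-- Apply the hypothesis to the predicate of being reachable, outside `S`, from a fixed vertex. -/
theorem isKConnected_of_connOff [Fintype V] {G : SimpleGraph V} {k : ℕ}
    (hk : k < Fintype.card V) (h : ∀ S : Finset V, S.card < k → ConnOff G S) :
    IsKConnected k G := by
  refine ⟨hk, fun S hS => ?_⟩
  have hex : ∃ a, a ∉ S := by
    by_contra hno
    push Not at hno
    have : S = univ := eq_univ_iff_forall.2 hno
    rw [this, card_univ] at hS
    omega
  obtain ⟨a, ha⟩ := hex
  have hconn : ∀ b (hb : b ∉ S), (G.induce {v : V | v ∉ S}).Reachable ⟨a, ha⟩ ⟨b, hb⟩ := by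
    intro b hb
    have := h S hS (fun x => ∃ hx : x ∉ S, (G.induce {v : V | v ∉ S}).Reachable ⟨a, ha⟩ ⟨x, hx⟩)
      (by
        intro x y hxy hx hy
        have hadj : (G.induce {v : V | v ∉ S}).Adj ⟨x, hx⟩ ⟨y, hy⟩ := hxy
        exact ⟨fun ⟨_, r⟩ => ⟨hy, r.trans hadj.reachable⟩,
          fun ⟨_, r⟩ => ⟨hx, r.trans hadj.symm.reachable⟩⟩) a b ha hb
    exact (this.1 ⟨ha, SimpleGraph.Reachable.refl _⟩).2
  have : Nonempty {v : V | v ∉ S} := ⟨⟨a, ha⟩⟩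
  exact ⟨fun x y => (hconn x.1 x.2).symm.trans (hconn y.1 y.2)⟩

theorem const_of_isChain {G : SimpleGraph V} {S : Finset V} {f : V → Prop}
    (hf : ∀ a b, G.Adj a b → a ∉ S → b ∉ S → (f a ↔ f b)) :
    ∀ {l : List V}, l.IsChain G.Adj → (∀ x ∈ l, x ∉ S) → ∀ a ∈ l, ∀ b ∈ l, (f a ↔ f b)
  | [], _, _, a, ha, _, _ => by simp at ha
  | [x], _, _, a, ha, b, hb => by
    rw [List.mem_singleton] at ha hb
    rw [ha, hb]
  | x :: y :: l, hc, hS, a, ha, b, hb => by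
    have ih := const_of_isChain hf hc.of_cons fun z hz => hS z (List.mem_cons_of_mem _ hz)
    have hxy := hf x y hc.rel (hS x (by simp)) (hS y (by simp))
    have key : ∀ z ∈ x :: y :: l, (f z ↔ f y) := by
      intro z hz
      rcases List.mem_cons.1 hz with rfl | hz
      · exact hxy
      · exact ih z hz y (by simp)
    rw [key a ha, key b hb]

/-- If all vertex-deleted subgraphs are Hamiltonian, deleting two vertices leaves a connected
graph. -/
theorem connOff_of_hamiltonian [Fintype V] [DecidableEq V] {G : SimpleGraph V}
    (hV : 3 < Fintype.card V)
    (hham : ∀ v, ∃ a l, (a :: (l ++ [a])).IsChain G.Adj ∧ (a :: l).Nodup ∧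
      ∀ x, x ∈ a :: l ↔ x ≠ v)
    {S : Finset V} (hS : S.card < 3) : ConnOff G S := by
  intro f hf a b ha hb
  have main : ∀ v w, S ⊆ {v, w} → a ≠ v → a ≠ w → b ≠ v → b ≠ w → (f a ↔ f b) := by
    intro v w hSvw hav haw hbv hbw
    obtain ⟨h, l, hc, hnd, hmem⟩ := hham v
    have hout : ∀ x, x ≠ v → x ≠ w → x ∉ S := by
      intro x h1 h2 hx
      have := hSvw hx
      simp [h1, h2] at this
    by_cases hw : w ∈ h :: l
    · obtain ⟨p, q, hpq⟩ := List.append_of_mem hw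
      -- The Hamiltonian cycle of the graph without `v`, cut at `w`: the part after `w` is followed
      -- by the part before it, and this is a path through all remaining vertices.
      have hex : ∃ L : List V, L.IsChain G.Adj ∧ ∀ x, x ∈ L ↔ x ∈ p ∨ x ∈ q := by
        rw [← List.cons_append, hpq, List.append_assoc, List.cons_append, List.isChain_split] at hc
        obtain ⟨hc1, hc2⟩ := hc
        cases p with
        | nil =>
          exact ⟨q, (List.isChain_append.1 hc2.of_cons).1, by simp⟩
        | cons h' p =>
          have hh : h = h' := (List.cons.inj hpq).1
          subst hh
          refine ⟨q ++ h :: p, ?_, fun x => by simp; tauto⟩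
          rw [List.isChain_split]
          exact ⟨hc2.of_cons, (List.isChain_append.1 hc1).1⟩
      obtain ⟨L, hL, hLm⟩ := hex
      have hmemL : ∀ x, x ≠ v → x ≠ w → x ∈ L := by
        intro x h1 h2
        have := (hmem x).2 h1
        rw [hpq] at this
        rw [hLm]
        simp [h2] at this
        tauto
      have hwL : w ∉ L := by
        rw [hpq, List.nodup_append, List.nodup_cons] at hnd
        rw [hLm]
        rintro (h' | h')
        · exact hnd.2.2 w h' w (by simp) rfl
        · exact hnd.2.1.1 h'
      refine const_of_isChain hf hL (fun x hx => hout x ?_ ?_) a (hmemL a hav haw) b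
        (hmemL b hbv hbw)
      · refine (hmem x).1 ?_
        rw [hpq]
        have := (hLm x).1 hx
        simp; tauto
      · rintro rfl; exact hwL hx
    · have hc' : (h :: l).IsChain G.Adj := by
        rw [← List.cons_append] at hc
        exact (List.isChain_append.1 hc).1
      refine const_of_isChain hf hc' (fun x hx => hout x ((hmem x).1 hx) ?_) a ((hmem a).2 hav) b
        ((hmem b).2 hbv)
      rintro rfl
      exact hw hx
  -- When nothing is deleted, a third vertex is sacrificed so that a vertex-deleted subgraph
  -- contains both `a` and `b`.
  obtain ⟨v, hv⟩ : ∃ v, v ≠ a ∧ v ≠ b := by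
    by_contra hno
    push Not at hno
    have : (univ : Finset V) ⊆ {a, b} := by
      intro v _
      have := hno v
      simp
      tauto
    have h1 := (card_le_card this).trans card_le_two
    rw [card_univ] at h1
    omega
  have h3 : S.card = 0 ∨ S.card = 1 ∨ S.card = 2 := by omega
  rcases h3 with h | h | h
  · rw [card_eq_zero] at h
    exact main v v (by simp [h]) hv.1.symm hv.1.symm hv.2.symm hv.2.symm
  · obtain ⟨s, rfl⟩ := card_eq_one.1 h
    simp only [mem_singleton] at ha hb
    exact main s s (by simp) ha ha hb hb
  · obtain ⟨s, t, -, rfl⟩ := card_eq_two.1 h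
    simp only [mem_insert, mem_singleton, not_or] at ha hb
    exact main s t subset_rfl ha.1 ha.2 hb.1 hb.2

end Connectivity

/-! ### Connectedness of the gadget and of four linked gadgets -/

section GadgetConnectivity

variable {I EB : Type*} [Fintype I] [DecidableEq I]
  {en : EB → (Fin 3 ⊕ I) × (Fin 3 ⊕ I)}

theorem adj_closed_some {a b : Fin 3 ⊕ I} :
    (edgeGraph (closedEnds en)).Adj (some a) (some b) ↔ (edgeGraph en).Adj a b := by
  rw [edgeGraph, edgeGraph, SimpleGraph.fromRel_adj, SimpleGraph.fromRel_adj]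
  refine and_congr (by simp) (or_congr ?_ ?_)
  · constructor
    · rintro ⟨e | k, he⟩
      · simp only [closedEnds, Prod.mk.injEq, Option.some.injEq] at he
        exact ⟨e, Prod.ext he.1 he.2⟩
      · simp [closedEnds] at he
    · rintro ⟨e, he⟩
      exact ⟨Sum.inl e, by simp [closedEnds, he]⟩
  · constructor
    · rintro ⟨e | k, he⟩
      · simp only [closedEnds, Prod.mk.injEq, Option.some.injEq] at he
        exact ⟨e, Prod.ext he.1 he.2⟩
      · simp [closedEnds] at he
    · rintro ⟨e, he⟩
      exact ⟨Sum.inl e, by simp [closedEnds, he]⟩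

theorem adj_closed_none {a : Fin 3 ⊕ I} :
    (edgeGraph (closedEnds en)).Adj none (some a) ↔ ∃ k, a = Sum.inl k := by
  rw [edgeGraph, SimpleGraph.fromRel_adj]
  constructor
  · rintro ⟨-, ⟨e | k, he⟩ | ⟨e | k, he⟩⟩ <;> simp [closedEnds] at he
    exact ⟨k, he.symm⟩
  · rintro ⟨k, rfl⟩
    exact ⟨by simp, Or.inl ⟨Sum.inr k, rfl⟩⟩

/-- Deleting one vertex does not disconnect the gadget. -/
theorem connOff_gadget (h : ∀ S : Finset (Option (Fin 3 ⊕ I)), S.card < 3 →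
    ConnOff (edgeGraph (closedEnds en)) S) {S : Finset (Fin 3 ⊕ I)} (hS : S.card ≤ 1) :
    ConnOff (edgeGraph en) S := by
  intro f hf a b ha hb
  -- The gadget minus one vertex is the closed gadget minus two, the new vertex being the second.
  have := h (insert none (S.map Function.Embedding.some)) (by
      refine (card_insert_le _ _).trans_lt ?_
      rw [card_map]; omega) (fun x => ∃ a, x = some a ∧ f a) (by
    rintro (_ | x) (_ | y) hxy hx hy
    · simp at hx
    · simp at hx
    · simp at hy
    · have := hf x y (adj_closed_some.1 hxy) (by simpa using hx) (by simpa using hy)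
      simpa using this) (some a) (some b) (by simpa using ha) (by simpa using hb)
  simpa using this

/-- After the deletion of two vertices, every vertex of the gadget is joined to a terminal. -/
theorem const_gadget (h : ∀ S : Finset (Option (Fin 3 ⊕ I)), S.card < 3 →
    ConnOff (edgeGraph (closedEnds en)) S) {S : Finset (Fin 3 ⊕ I)} (hS : S.card ≤ 2)
    {f : Fin 3 ⊕ I → Prop} (hf : ∀ a b, (edgeGraph en).Adj a b → a ∉ S → b ∉ S → (f a ↔ f b))
    {P : Prop} (hP : ∀ k, Sum.inl k ∉ S → (f (Sum.inl k) ↔ P)) {a : Fin 3 ⊕ I} (ha : a ∉ S) :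
    f a ↔ P := by
  -- Giving the new vertex the common value of the terminals extends `f` to a locally constant
  -- function on the closed gadget.
  let f' : Option (Fin 3 ⊕ I) → Prop := fun x => x.elim P f
  exact h (S.map Function.Embedding.some) (by rw [card_map]; omega) f' (by
    rintro (_ | x) (_ | y) hxy hx hy
    · rfl
    · obtain ⟨k, rfl⟩ := adj_closed_none.1 hxy
      exact (hP k (by simpa using hy)).symm
    · obtain ⟨k, rfl⟩ := adj_closed_none.1 hxy.symm
      exact hP k (by simpa using hx)
    · exact hf x y (adj_closed_some.1 hxy) (by simpa using hx) (by simpa using hy))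
    (some a) none (by simpa using ha) (by simp)

/-- The complete graph on four vertices stays connected after the deletion of two edges; booleans
make this decidable. -/
theorem complete_four_minus_two : ∀ (x y : Fin 3 × Fin 2) (f : Fin 4 → Bool),
    (∀ c k, link c k ≠ x → link c k ≠ y → f c = f (neighbour c k)) → ∀ c d, f c = f d := by
  decide

theorem exists_subset_pair {V : Type*} [DecidableEq V] [Nonempty V] {S : Finset V}
    (hS : S.card < 3) : ∃ s t, S ⊆ {s, t} := by
  have h3 : S.card = 0 ∨ S.card = 1 ∨ S.card = 2 := by omega
  rcases h3 with h | h | h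
  · rw [card_eq_zero] at h
    exact ⟨Classical.arbitrary V, Classical.arbitrary V, by simp [h]⟩
  · obtain ⟨s, rfl⟩ := card_eq_one.1 h
    exact ⟨s, s, by simp⟩
  · obtain ⟨s, t, -, rfl⟩ := card_eq_two.1 h
    exact ⟨s, t, subset_rfl⟩

theorem const_four {x y : Fin 3 × Fin 2} {f : Fin 4 → Prop}
    (h : ∀ c k, link c k ≠ x → link c k ≠ y → (f c ↔ f (neighbour c k))) (c d : Fin 4) :
    f c ↔ f d := by
  classical
  have := complete_four_minus_two x y (fun c => decide (f c)) (fun c k h1 h2 => by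
    simp [h c k h1 h2]) c d
  simpa using this

/-- If no gadget loses two vertices, each stays connected, at most two links are destroyed, and the
complete graph on four vertices survives that. If a gadget loses two, the other three are intact and
mutually linked, and every remaining vertex of the damaged one is still joined to a terminal and
thereby to another gadget. -/
theorem connOff_linked (h : ∀ S : Finset (Option (Fin 3 ⊕ I)), S.card < 3 →
    ConnOff (edgeGraph (closedEnds en)) S) {S : Finset (Fin 4 × (Fin 3 ⊕ I))} (hS : S.card < 3) :
    ConnOff (edgeGraph (linkedEnds en)) S := by
  intro f hf
  let Sc : Fin 4 → Finset (Fin 3 ⊕ I) := fun c => univ.filter fun a => (c, a) ∈ S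
  have hSc : ∀ c a, a ∉ Sc c ↔ (c, a) ∉ S := by intro c a; simp [Sc]
  have hfc : ∀ c a b, (edgeGraph en).Adj a b → a ∉ Sc c → b ∉ Sc c → (f (c, a) ↔ f (c, b)) :=
    fun c a b hab ha hb => hf _ _ (edgeGraph_linked_adj hab c) ((hSc c a).1 ha) ((hSc c b).1 hb)
  have hcard : ∀ c, (Sc c).card = (S.filter fun x => x.1 = c).card := by
    intro c
    refine card_bij (fun a _ => (c, a)) ?_ ?_ ?_
    · intro a ha; simpa [Sc] using ha
    · intro a _ b _ hab; simpa using hab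
    · rintro ⟨d, a⟩ hx
      simp only [mem_filter] at hx
      obtain ⟨hx, rfl⟩ := hx
      exact ⟨a, by simpa [Sc] using hx, rfl⟩
  have hle : ∀ c, (Sc c).card ≤ 2 := fun c => by
    rw [hcard]; exact (card_le_card (filter_subset _ _)).trans (by omega)
  have hval : ∀ c, (Sc c).card ≤ 1 → ∃ P : Prop, ∀ a, (c, a) ∉ S → (f (c, a) ↔ P) := by
    intro c hc
    by_cases hex : ∃ a, (c, a) ∉ S
    · obtain ⟨a₀, ha₀⟩ := hex
      exact ⟨f (c, a₀), fun a ha => connOff_gadget h hc (fun a => f (c, a)) (hfc c) a a₀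
        ((hSc c a).2 ha) ((hSc c a₀).2 ha₀)⟩
    · push Not at hex
      exact ⟨True, fun a ha => absurd (hex a) ha⟩
  by_cases hall : ∀ c, (Sc c).card ≤ 1
  · choose P hP using fun c => hval c (hall c)
    obtain ⟨s, t, hst⟩ := exists_subset_pair hS
    -- The link destroyed by a vertex. An internal vertex destroys none, but giving up the link (0,
    -- 0) in that case does no harm.
    let lk : Fin 4 × (Fin 3 ⊕ I) → Fin 3 × Fin 2 := fun x => x.2.elim (link x.1) fun _ => (0, 0)
    have hconst := const_four (x := lk s) (y := lk t) (f := P) (by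
      intro c k h1 h2
      have hn : ∀ d, link d k = link c k → (d, Sum.inl k) ∉ S := by
        intro d hd hmem
        rcases mem_insert.1 (hst hmem) with rfl | h'
        · exact h1 hd.symm
        · rw [mem_singleton] at h'
          subst h'
          exact h2 hd.symm
      have e1 := hn c rfl
      have e2 := hn (neighbour c k) (link_neighbour c k)
      rw [← hP c _ e1, ← hP _ _ e2]
      exact hf _ _ (edgeGraph_link_adj c k) e1 e2)
    rintro ⟨c, a⟩ ⟨d, b⟩ ha hb
    rw [hP c a ha, hP d b hb]
    exact hconst c d
  · push Not at hall
    obtain ⟨c, hc⟩ := hall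
    have hSc1 : ∀ x ∈ S, x.1 = c := by
      have h1 : (S.filter fun x => x.1 = c) = S :=
        eq_of_subset_of_card_le (filter_subset _ _) (by rw [← hcard]; omega)
      intro x hx
      rw [← h1] at hx
      exact (mem_filter.1 hx).2
    have hnot : ∀ d a, d ≠ c → (d, a) ∉ S := fun d a hd hx => hd (hSc1 _ hx)
    have hone : ∀ d, d ≠ c → (Sc d).card ≤ 1 := by
      intro d hd
      have : Sc d = ∅ := by
        ext a; simp only [Sc, mem_filter, mem_univ, true_and, notMem_empty, iff_false]
        exact hnot d a hd
      simp [this]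
    choose! P hP using fun d hd => hval d (hone d hd)
    have hPP : ∀ d e, d ≠ c → e ≠ c → (P d ↔ P e) := by
      intro d e hd he
      by_cases hde : d = e
      · rw [hde]
      · obtain ⟨k, rfl⟩ : ∃ k, neighbour d k = e := by
          clear hd he
          revert d e; decide
        rw [← hP d hd (Sum.inl k) (hnot _ _ hd), ← hP _ he (Sum.inl k) (hnot _ _ he)]
        exact hf _ _ (edgeGraph_link_adj d k) (hnot _ _ hd) (hnot _ _ he)
    obtain ⟨d₀, hd₀⟩ : ∃ d, d ≠ c := by clear hP hPP hone hnot hSc1 hc; revert c; decide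
    have hfin : ∀ x, x ∉ S → (f x ↔ P d₀) := by
      rintro ⟨d, a⟩ hx
      by_cases hd : d = c
      · subst hd
        refine const_gadget h (hle d) (hfc d) (P := P d₀) (fun k hk => ?_) ((hSc d a).2 hx)
        have hn : ∀ (c : Fin 4) k, neighbour c k ≠ c := by decide
        rw [hf _ _ (edgeGraph_link_adj d k) ((hSc d _).1 hk) (hnot _ _ (hn d k)),
          hP _ (hn d k) _ (hnot _ _ (hn d k))]
        exact hPP _ _ (hn d k) hd₀
      · rw [hP d hd a hx]
        exact hPP d d₀ hd hd₀
    intro a b ha hb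
    rw [hfin a ha, hfin b hb]

end GadgetConnectivity

/-! ### Connectedness of the blow-up and of four linked cubic copies -/

section BlowConnectivity

variable {I EB ι T : Type*} [Fintype I] [DecidableEq I]
  [Fintype ι] [DecidableEq ι] [Fintype T] [DecidableEq T]
  {en : EB → (Fin 3 ⊕ I) × (Fin 3 ⊕ I)} {term : ι → Fin 3 → T}

/-- The cubic graph is connected after the deletion of the edges in `X` and the vertices in `U`. -/
def CubicConn (term : ι → Fin 3 → T) (X : Finset T) (U : Finset ι) : Prop :=
  ∀ f : ι → Prop, (∀ u v i j, u ∉ U → v ∉ U → term u i = term v j → term u i ∉ X → (f u ↔ f v)) →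
    ∀ u v, u ∉ U → v ∉ U → (f u ↔ f v)

theorem exists_blowVert (ht : IsCubicIncidence term) (w : T ⊕ ι × I) :
    ∃ u a, blowVert term u a = w := by
  rcases w with t | ⟨u, y⟩
  · obtain ⟨u, i, -, -, -, hu, -⟩ := ht.exists_pair t
    exact ⟨u, Sum.inl i, by simp [blowVert, hu]⟩
  · exact ⟨u, Sum.inr y, rfl⟩

theorem IsCubicIncidence.eq_of_three (ht : IsCubicIncidence term) {u v w : ι} {i j k : Fin 3}
    (h1 : term u i = term v j) (h2 : term u i = term w k) (huv : u ≠ v) (huw : u ≠ w) : v = w := by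
  obtain ⟨a, p, b, q, -, -, -, heq⟩ := ht.exists_pair (term u i)
  have key : ∀ x l, term x l = term u i → x = a ∨ x = b := by
    intro x l hx
    have : (x, l) ∈ univ.filter fun p : ι × Fin 3 => term p.1 p.2 = term u i := by simpa using hx
    rw [heq] at this
    simp at this
    tauto
  have e1 := key u i rfl
  have e2 := key v j h1.symm
  have e3 := key w k h2.symm
  grind

/-- Deleted terminals are deleted edges of the cubic graph. If every gadget loses at most one
vertex, each stays connected and at most two edges are lost. Otherwise one gadget contains all
deleted vertices; the rest is held together by the cubic graph minus one vertex, and the remains of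
that gadget hang on to it through terminals. -/
theorem connOff_blow (ht : IsCubicIncidence term)
    (h : ∀ S : Finset (Option (Fin 3 ⊕ I)), S.card < 3 → ConnOff (edgeGraph (closedEnds en)) S)
    (hk1 : ∀ X : Finset T, X.card < 3 → CubicConn term X ∅)
    (hk2 : ∀ u, CubicConn term ∅ {u}) {S : Finset (T ⊕ ι × I)} (hS : S.card < 3) :
    ConnOff (edgeGraph (blowEnds en term)) S := by
  intro f hf
  let Su : ι → Finset (Fin 3 ⊕ I) := fun u => univ.filter fun a => blowVert term u a ∈ S
  have hSu : ∀ u a, a ∉ Su u ↔ blowVert term u a ∉ S := by intro u a; simp [Su]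
  have hfu : ∀ u a b, (edgeGraph en).Adj a b → a ∉ Su u → b ∉ Su u →
      (f (blowVert term u a) ↔ f (blowVert term u b)) := fun u a b hab ha hb =>
    hf _ _ (edgeGraph_blow_adj ht.inj hab u) ((hSu u a).1 ha) ((hSu u b).1 hb)
  have himg : ∀ u, (Su u).image (blowVert term u) ⊆ S := by
    intro u w hw
    obtain ⟨a, ha, rfl⟩ := mem_image.1 hw
    simpa [Su] using ha
  have hcard : ∀ u, (Su u).card = ((Su u).image (blowVert term u)).card := fun u =>
    (card_image_of_injective _ (blowVert_injective ht.inj u)).symm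
  have hle : ∀ u, (Su u).card ≤ 2 := fun u => by
    rw [hcard]; exact (card_le_card (himg u)).trans (by omega)
  have hval : ∀ u, (Su u).card ≤ 1 → ∃ P : Prop, ∀ a, blowVert term u a ∉ S →
      (f (blowVert term u a) ↔ P) := by
    intro u hu
    by_cases hex : ∃ a, blowVert term u a ∉ S
    · obtain ⟨a₀, ha₀⟩ := hex
      exact ⟨f (blowVert term u a₀), fun a ha => connOff_gadget h hu
        (fun a => f (blowVert term u a)) (hfu u) a a₀ ((hSu u a).2 ha) ((hSu u a₀).2 ha₀)⟩
    · push Not at hex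
      exact ⟨True, fun a ha => absurd (hex a) ha⟩
  by_cases hall : ∀ u, (Su u).card ≤ 1
  · choose P hP using fun u => hval u (hall u)
    have hconst := hk1 (univ.filter fun t => Sum.inl t ∈ S) (by
        refine lt_of_le_of_lt ?_ hS
        rw [← card_image_of_injective _ (Sum.inl_injective (α := T) (β := ι × I))]
        refine card_le_card fun w hw => ?_
        obtain ⟨t, ht, rfl⟩ := mem_image.1 hw
        exact (mem_filter.1 ht).2) P (by
      intro u v i j _ _ huv hX
      have hX' : Sum.inl (term u i) ∉ S := by simpa using hX
      rw [← hP u (Sum.inl i) hX', ← hP v (Sum.inl j) (by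
        simpa [blowVert, ← huv] using hX')]
      simp [blowVert, huv])
    intro w w' hw hw'
    obtain ⟨u, a, rfl⟩ := exists_blowVert ht w
    obtain ⟨v, b, rfl⟩ := exists_blowVert ht w'
    rw [hP u a hw, hP v b hw']
    exact hconst u v (by simp) (by simp)
  · push Not at hall
    obtain ⟨u, hu⟩ := hall
    have hSeq : (Su u).image (blowVert term u) = S :=
      eq_of_subset_of_card_le (himg u) (by rw [← hcard]; omega)
    have hcommon : ∀ v, v ≠ u → ∀ a, blowVert term v a ∈ S → ∃ i j, a = Sum.inl i ∧
        term v i = term u j := by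
      intro v hv a ha
      rw [← hSeq] at ha
      obtain ⟨b, -, hb⟩ := mem_image.1 ha
      rcases a with i | y <;> rcases b with j | y' <;> simp [blowVert] at hb
      · exact ⟨i, j, rfl, hb.symm⟩
      · exact absurd hb.1.symm hv
    have hone : ∀ v, v ≠ u → (Su v).card ≤ 1 := by
      intro v hv
      rw [card_le_one]
      intro a ha b hb
      obtain ⟨i, j, rfl, h1⟩ := hcommon v hv a (by simpa [Su] using ha)
      obtain ⟨i', j', rfl, h2⟩ := hcommon v hv b (by simpa [Su] using hb)
      rw [ht.share v u i i' j j' hv h1 h2]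
    choose! P hP using fun v hv => hval v (hone v hv)
    have hPP : ∀ v w, v ≠ u → w ≠ u → (P v ↔ P w) := by
      intro v w hv hw
      refine hk2 u P ?_ v w (by simpa using hv) (by simpa using hw)
      intro v w i j hv hw hvw _
      rw [mem_singleton] at hv hw
      by_cases heq : v = w
      · rw [heq]
      -- A deleted terminal belongs to the gadget at `u`, and a terminal cannot belong to three
      -- gadgets.
      have hno : (Sum.inl (term v i) : T ⊕ ι × I) ∉ S := by
        intro hmem
        obtain ⟨i', j', hi', hj'⟩ := hcommon v hv (Sum.inl i) hmem
        obtain rfl := Sum.inl_injective hi'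
        exact hw (ht.eq_of_three hvw hj' heq hv)
      rw [← hP v hv (Sum.inl i) hno, ← hP w hw (Sum.inl j) (by
        simpa [blowVert, ← hvw] using hno)]
      simp [blowVert, hvw]
    obtain ⟨v₀, hv₀⟩ : ∃ v, v ≠ u := by
      obtain ⟨a, i, b, j, hab, -⟩ := ht.exists_pair (term u 0)
      by_cases hau : a = u
      · exact ⟨b, by rw [← hau]; exact hab.symm⟩
      · exact ⟨a, hau⟩
    have hfin : ∀ w, w ∉ S → (f w ↔ P v₀) := by
      intro w hw
      obtain ⟨v, a, rfl⟩ := exists_blowVert ht w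
      by_cases hv : v = u
      · subst hv
        refine const_gadget h (hle v) (hfu v) (P := P v₀) (fun k hk => ?_) ((hSu v a).2 hw)
        obtain ⟨x, j, hx, hxj⟩ : ∃ x j, x ≠ v ∧ term x j = term v k := by
          obtain ⟨a, i, b, j, hab, ha, hb, -⟩ := ht.exists_pair (term v k)
          by_cases hav : a = v
          · exact ⟨b, j, by rw [← hav]; exact hab.symm, hb⟩
          · exact ⟨a, i, hav, ha⟩
        have hk' := (hSu v _).1 hk
        have e : (blowVert term v (Sum.inl k) : T ⊕ ι × I) = blowVert term x (Sum.inl j) := by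
          simp [blowVert, hxj]
        rw [e] at hk' ⊢
        rw [hP x hx _ hk']
        exact hPP x v₀ hx hv₀
      · rw [hP v hv a hw]
        exact hPP v v₀ hv hv₀
    intro a b ha hb
    rw [hfin a ha, hfin b hb]

variable {loc : ι → Fin 3 → T ⊕ Fin 3}

theorem exists_dangling (h : IsCubicIncidence (termOne loc)) (k : Fin 3) :
    ∃ u i, loc u i = Sum.inr k := by
  obtain ⟨u, i, v, j, huv, hu, hv, -⟩ := h.exists_pair (Sum.inr k)
  cases u with
  | some u => exact ⟨u, i, hu⟩
  | none =>
    cases v with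
    | some v => exact ⟨v, j, hv⟩
    | none => exact absurd rfl huv

/-- An edge has only two ends, and one end of a dangling edge is the new vertex. -/
theorem dangling_unique (h : IsCubicIncidence (termOne loc)) {u v : ι} {i j k : Fin 3}
    (hu : loc u i = Sum.inr k) (hv : loc v j = Sum.inr k) : u = v := by
  have := h.eq_of_three (u := none) (v := some u) (w := some v) (i := k) (j := i) (k := j)
    (by rw [termOne_none, termOne_some, hu]) (by rw [termOne_none, termOne_some, hv])
    (by simp) (by simp)
  simpa using this

theorem termFour_link {f : Fin 4 × ι → Prop}
    {X : Finset ((Fin 4 × T) ⊕ (Fin 3 × Fin 2))} {U : Finset (Fin 4 × ι)}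
    (hf : ∀ p q i j, p ∉ U → q ∉ U → termFour loc p i = termFour loc q j →
      termFour loc p i ∉ X → (f p ↔ f q)) {u : ι} {i k : Fin 3} (hu : loc u i = Sum.inr k)
    {c d : Fin 4} (hcd : link c k = link d k) (hX : Sum.inr (link c k) ∉ X)
    (hc : (c, u) ∉ U) (hd : (d, u) ∉ U) : f (c, u) ↔ f (d, u) := by
  refine hf (c, u) (d, u) i i hc hd ?_ ?_
  · simp [termFour, copyEdge, hu, hcd]
  · simpa [termFour, copyEdge, hu] using hX

/-- Connectedness of four linked copies. -/
theorem cubicConn_termFour (h : IsCubicIncidence (termOne loc))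
    (hk1 : ∀ X : Finset (T ⊕ Fin 3), X.card < 3 → CubicConn (termOne loc) X ∅)
    (hk2 : ∀ u, CubicConn (termOne loc) ∅ {u})
    (hk3 : ∀ X : Finset (T ⊕ Fin 3), X.card < 2 → CubicConn (termOne loc) X {none}) :
    (∀ X : Finset ((Fin 4 × T) ⊕ (Fin 3 × Fin 2)), X.card < 3 → CubicConn (termFour loc) X ∅) ∧
      ∀ p, CubicConn (termFour loc) ∅ {p} := by
  have hnb : ∀ (c : Fin 4) k, neighbour c k ≠ c := by decide
  have hjoin : ∀ d e : Fin 4, d ≠ e → ∃ k, neighbour d k = e := by decide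
  choose ud id' hud using exists_dangling h
  -- a copy from which one edge is deleted
  have hcopy : ∀ (f : Fin 4 × ι → Prop) (X : Finset ((Fin 4 × T) ⊕ (Fin 3 × Fin 2)))
      (U : Finset (Fin 4 × ι)), (∀ p q i j, p ∉ U → q ∉ U → termFour loc p i = termFour loc q j →
      termFour loc p i ∉ X → (f p ↔ f q)) → ∀ c, (∀ u, (c, u) ∉ U) →
      (univ.filter fun t => Sum.inl (c, t) ∈ X).card < 2 → ∀ u v, f (c, u) ↔ f (c, v) := by
    intro f X U hf c hU hX u v
    have := hk3 ((univ.filter fun t => Sum.inl (c, t) ∈ X).map Function.Embedding.inl)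
      (by rwa [card_map]) (fun o => ∃ u, o = some u ∧ f (c, u)) (by
      rintro (_ | u) (_ | v) i j hu hv huv hX
      · simp at hu
      · simp at hu
      · simp at hv
      · rw [termOne_some, termOne_some] at huv
        rw [termOne_some] at hX
        simp only [Option.some.injEq, exists_eq_left']
        rcases hl : loc u i with t | k
        · refine hf (c, u) (c, v) i j (hU u) (hU v) ?_ ?_
          · simp [termFour, huv]
          · simpa [termFour, hl, copyEdge] using hX
        · rw [dangling_unique h hl (huv ▸ hl)]) (some u) (some v) (by simp) (by simp)
    simpa using this
  -- all other copies agree, and so does the given one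
  have hrest : ∀ (f : Fin 4 × ι → Prop) (X : Finset ((Fin 4 × T) ⊕ (Fin 3 × Fin 2)))
      (U : Finset (Fin 4 × ι)), (∀ p q i j, p ∉ U → q ∉ U → termFour loc p i = termFour loc q j →
      termFour loc p i ∉ X → (f p ↔ f q)) → ∀ c, (∀ p ∈ U, p.1 = c) →
      (∀ x ∈ X, ∃ t, x = Sum.inl (c, t)) →
      CubicConn (termOne loc) ((univ.filter fun t => Sum.inl (c, t) ∈ X).map Function.Embedding.inl)
        ((univ.filter fun u => (c, u) ∈ U).map Function.Embedding.some) →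
      ∀ p q, p ∉ U → q ∉ U → (f p ↔ f q) := by
    intro f X U hf c hU hX hconn
    have hlinkX : ∀ x, Sum.inr x ∉ X := fun x hx => by
      obtain ⟨t, ht⟩ := hX _ hx
      simp at ht
    have hUd : ∀ d u, d ≠ c → (d, u) ∉ U := fun d u hd hu => hd (hU _ hu)
    have hconst : ∀ d, d ≠ c → ∀ u v, f (d, u) ↔ f (d, v) := by
      intro d hd
      refine hcopy f X U hf d (fun u => hUd d u hd) ?_
      have : (univ.filter fun t => Sum.inl (d, t) ∈ X) = ∅ := by
        ext t
        simp only [mem_filter, mem_univ, true_and, notMem_empty, iff_false]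
        intro ht
        obtain ⟨t', ht'⟩ := hX _ ht
        simp only [Sum.inl.injEq, Prod.mk.injEq] at ht'
        exact hd ht'.1
      simp [this]
    have hall : ∀ d e, d ≠ c → e ≠ c → ∀ u v, f (d, u) ↔ f (e, v) := by
      intro d e hd he u v
      by_cases hde : d = e
      · subst hde; exact hconst d hd u v
      · obtain ⟨k, rfl⟩ := hjoin d e hde
        rw [hconst d hd u (ud k), hconst _ he v (ud k)]
        exact termFour_link hf (hud k) (link_neighbour d k).symm (hlinkX _) (hUd _ _ hd)
          (hUd _ _ he)
    obtain ⟨d₀, hd₀⟩ : ∃ d, d ≠ c := ⟨neighbour c 0, hnb c 0⟩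
    have hdang : ∀ {u i k}, loc u i = Sum.inr k → (c, u) ∉ U → (f (c, u) ↔ f (d₀, u)) := by
      intro u i k hu hcu
      rw [termFour_link hf hu (link_neighbour c k).symm (hlinkX _) hcu (hUd _ _ (hnb c k))]
      exact hall _ _ (hnb c k) hd₀ u u
    have hfin : ∀ p, p ∉ U → (f p ↔ f (d₀, ud 0)) := by
      rintro ⟨d, u⟩ hp
      by_cases hd : d = c
      · subst hd
        -- All other copies carry one value, so they can be contracted to the new vertex; the
        -- contracted graph is the original cubic graph.
        let f' : Option ι → Prop := fun o => o.elim (f (d₀, ud 0)) fun u => f (d, u)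
        refine hconn f' ?_ (some u) none (by simpa using hp) (by simp)
        rintro (_ | x) (_ | y) i j hx hy hxy hX'
        · rfl
        · rw [termOne_none, termOne_some] at hxy
          refine (((hdang hxy.symm (by simpa using hy))).trans ?_).symm
          exact hconst d₀ hd₀ _ _
        · rw [termOne_none, termOne_some] at hxy
          refine ((hdang hxy (by simpa using hx))).trans ?_
          exact hconst d₀ hd₀ _ _
        · rw [termOne_some, termOne_some] at hxy
          rw [termOne_some] at hX'
          rcases hl : loc x i with t | k
          · refine hf (d, x) (d, y) i j (by simpa using hx) (by simpa using hy) ?_ ?_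
            · simp [termFour, hxy]
            · simpa [termFour, hl, copyEdge] using hX'
          · rw [dangling_unique h hl (hxy ▸ hl)]
      · exact hall d d₀ hd hd₀ _ _
    intro p q hp hq
    rw [hfin p hp, hfin q hq]
  refine ⟨fun X hX f hf => ?_, fun p f hf => ?_⟩
  · have hcard : ∀ c, (univ.filter fun t => Sum.inl (c, t) ∈ X).card =
        ((univ.filter fun t => Sum.inl (c, t) ∈ X).image fun t =>
          (Sum.inl (c, t) : (Fin 4 × T) ⊕ (Fin 3 × Fin 2))).card := fun c =>
      (card_image_of_injective _ fun a b hab => by simpa using hab).symm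
    have himg : ∀ c, ((univ.filter fun t => Sum.inl (c, t) ∈ X).image fun t =>
          (Sum.inl (c, t) : (Fin 4 × T) ⊕ (Fin 3 × Fin 2))) ⊆ X := by
      intro c x hx
      obtain ⟨t, ht, rfl⟩ := mem_image.1 hx
      exact (mem_filter.1 ht).2
    -- If each copy loses at most one inner edge, the copies stay connected and at most two links
    -- are lost. Otherwise both deleted edges lie in one copy and the contraction argument `hrest`
    -- applies.
    by_cases hall : ∀ c, (univ.filter fun t => Sum.inl (c, t) ∈ X).card < 2
    · have hconst : ∀ c u v, f (c, u) ↔ f (c, v) := fun c =>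
        hcopy f X ∅ hf c (fun u => by simp) (hall c)
      have : Nonempty ((Fin 4 × T) ⊕ (Fin 3 × Fin 2)) := ⟨Sum.inr (0, 0)⟩
      obtain ⟨s, t, hst⟩ := exists_subset_pair hX
      let lk : (Fin 4 × T) ⊕ (Fin 3 × Fin 2) → Fin 3 × Fin 2 := fun x => x.elim (fun _ => (0, 0)) id
      have hfour := const_four (x := lk s) (y := lk t) (f := fun c => f (c, ud 0)) (by
        intro c k h1 h2
        have hno : Sum.inr (link c k) ∉ X := by
          intro hmem
          rcases mem_insert.1 (hst hmem) with h' | h'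
          · exact h1 (by rw [← h']; rfl)
          · rw [mem_singleton] at h'
            exact h2 (by rw [← h']; rfl)
        rw [hconst c (ud 0) (ud k), hconst _ (ud 0) (ud k)]
        exact termFour_link hf (hud k) (link_neighbour c k).symm hno (by simp) (by simp))
      rintro ⟨c, u⟩ ⟨d, v⟩ - -
      rw [hconst c u (ud 0), hconst d v (ud 0)]
      exact hfour c d
    · push Not at hall
      obtain ⟨c, hc⟩ := hall
      have hXeq := eq_of_subset_of_card_le (himg c) (by rw [← hcard]; omega)
      refine hrest f X ∅ hf c (by simp) ?_ ?_
      · intro x hx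
        rw [← hXeq] at hx
        obtain ⟨t, -, rfl⟩ := mem_image.1 hx
        exact ⟨t, rfl⟩
      · have hz : ((univ.filter fun u => (c, u) ∈ (∅ : Finset (Fin 4 × ι))).map
            Function.Embedding.some) = ∅ := by simp
        rw [hz]
        refine hk1 _ ?_
        rw [card_map, hcard]
        exact (card_le_card (himg c)).trans_lt hX
  · obtain ⟨c, u⟩ := p
    refine hrest f ∅ {(c, u)} hf c (by simp) (by simp) ?_
    have e1 : ((univ.filter fun t => Sum.inl (c, t) ∈
        (∅ : Finset ((Fin 4 × T) ⊕ (Fin 3 × Fin 2)))).map (Function.Embedding.inl :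
          T ↪ T ⊕ Fin 3)) = ∅ := by simp
    have e2 : ((univ.filter fun v => (c, v) ∈ ({(c, u)} : Finset (Fin 4 × ι))).map
        Function.Embedding.some) = {some u} := by
      ext o
      cases o <;> simp [eq_comm]
    rw [e1, e2]
    exact hk2 (some u)

end BlowConnectivity

/-! ### Complexes of triangles and straight line drawings -/

section Planarity

/-- Membership in the convex hull of three points. -/
def InHull (p : Fin 3 → ℝ × ℝ) (x : ℝ × ℝ) : Prop :=
  ∃ a b c : ℝ, 0 ≤ a ∧ 0 ≤ b ∧ 0 ≤ c ∧ a + b + c = 1 ∧ x = a • p 0 + b • p 1 + c • p 2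

theorem inHull_apply (p : Fin 3 → ℝ × ℝ) (i : Fin 3) : InHull p (p i) := by
  fin_cases i
  · exact ⟨1, 0, 0, by simp⟩
  · exact ⟨0, 1, 0, by simp⟩
  · exact ⟨0, 0, 1, by simp⟩

/-- The triple of corners of an edge, viewed as a degenerate triangle. -/
def segCell {E V : Type*} (en : E → V × V) (e : E) : Fin 3 → V :=
  ![(en e).1, (en e).2, (en e).2]

theorem inHull_of_mem_segment {V E : Type*} {pos : V → ℝ × ℝ} {en : E → V × V} {e : E}
    {x : ℝ × ℝ} (hx : x ∈ segment ℝ (pos (en e).1) (pos (en e).2)) :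
    InHull (pos ∘ segCell en e) x := by
  obtain ⟨a, b, ha, hb, hab, rfl⟩ := hx
  exact ⟨a, b, 0, ha, hb, le_rfl, by simpa using hab, by simp [segCell]⟩

theorem segCell_mem {V E : Type*} {en : E → V × V} {e : E} (i : Fin 3) :
    segCell en e i ∈ edgePair en e := by
  fin_cases i <;> simp [segCell, edgePair]

/-- Points in the plane with triangles (possibly degenerate) spanned by them, any two of which
meet only in common corners. -/
structure IsComplex {V κ : Type*} (pos : V → ℝ × ℝ) (cell : κ → Fin 3 → V) : Prop where
  inj : Function.Injective pos
  covers : ∀ v, ∃ k i, cell k i = v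
  sep : ∀ k l, k ≠ l → ∀ x, InHull (pos ∘ cell k) x → InHull (pos ∘ cell l) x →
    ∃ i j, cell k i = cell l j ∧ pos (cell k i) = x

/-- Every vertex is a corner of some cell, and two cells meet only in common corners; so a vertex
lying in a cell is one of its corners. -/
theorem IsComplex.eq_corner {V κ : Type*} {pos : V → ℝ × ℝ} {cell : κ → Fin 3 → V}
    (h : IsComplex pos cell) {v : V} {k : κ} (hv : InHull (pos ∘ cell k) (pos v)) :
    ∃ i, cell k i = v := by
  obtain ⟨l, j, rfl⟩ := h.covers v
  by_cases hkl : k = l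
  · exact ⟨j, by rw [hkl]⟩
  · obtain ⟨i, j', -, h2⟩ := h.sep k l hkl _ hv (inHull_apply (pos ∘ cell l) j)
    exact ⟨i, h.inj h2⟩

theorem IsComplex.comap {V κ V' κ' : Type*} {pos : V → ℝ × ℝ} {cell : κ → Fin 3 → V}
    (h : IsComplex pos cell) {φ : V' → V} {ψ : κ' → κ} {cell' : κ' → Fin 3 → V'}
    (hφ : Function.Injective φ) (hψ : Function.Injective ψ)
    (hcell : ∀ k i, φ (cell' k i) = cell (ψ k) i) (hcov : ∀ v, ∃ k i, cell' k i = v) :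
    IsComplex (pos ∘ φ) cell' := by
  have he : ∀ k, (pos ∘ φ) ∘ cell' k = pos ∘ cell (ψ k) := fun k => by
    funext i
    simp [hcell]
  refine ⟨h.inj.comp hφ, hcov, fun k l hkl x hk hl => ?_⟩
  rw [he] at hk hl
  obtain ⟨i, j, h1, h2⟩ := h.sep _ _ (hψ.ne hkl) x hk hl
  exact ⟨i, j, hφ (by rw [hcell, hcell, h1]), by rw [← h2, ← hcell]; rfl⟩

/-- A complex of segments is a plane drawing. -/
theorem IsComplex.isPlanarGraph {V E : Type*} {en : E → V × V} (hen : IsSimpleList en)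
    {pos : V → ℝ × ℝ} (h : IsComplex pos (segCell en)) : IsPlanarGraph (edgeGraph en) := by
  have hedge : ∀ s ∈ (edgeGraph en).edgeSet, ∃ e, edgePair en e = s := by
    intro s
    induction s with | _ a b
    exact fun hs => (edgeGraph_adj hen).1 hs
  let arc : Sym2 V → Set (ℝ × ℝ) :=
    Sym2.lift ⟨fun a b => segment ℝ (pos a) (pos b), fun a b => segment_symm _ _ _⟩
  have harc : ∀ e x, x ∈ arc (edgePair en e) → InHull (pos ∘ segCell en e) x :=
    fun e x hx => inHull_of_mem_segment hx
  refine ⟨⟨pos, arc, h.inj, ?_, ?_, ?_⟩⟩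
  · intro u v huv
    exact ⟨Path.segment _ _, Path.segment_injective_of_ne (h.inj.ne huv.ne), Path.range_segment _ _⟩
  · intro s hs w hw
    obtain ⟨e, rfl⟩ := hedge s hs
    obtain ⟨i, rfl⟩ := h.eq_corner (harc e _ hw)
    exact segCell_mem i
  · intro s hs t ht hst x hx
    obtain ⟨e, rfl⟩ := hedge s hs
    obtain ⟨f, rfl⟩ := hedge t ht
    obtain ⟨i, j, h1, h2⟩ := h.sep e f (fun h' => hst (h' ▸ rfl)) x (harc e x hx.1) (harc f x hx.2)
    exact ⟨_, segCell_mem i, h1 ▸ segCell_mem j, h2⟩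

/-- The doubled signed area of a triangle. -/
def cross (p q r : ℝ × ℝ) : ℝ :=
  p.1 * q.2 + q.1 * r.2 + r.1 * p.2 - (p.2 * q.1 + q.2 * r.1 + r.2 * p.1)

/-- The affine map taking the triangle `(0,0)`, `(s,0)`, `(0,s)` to the triangle `p`. -/
noncomputable def triMap (s : ℝ) (p : Fin 3 → ℝ × ℝ) (x : ℝ × ℝ) : ℝ × ℝ :=
  (1 - x.1 / s - x.2 / s) • p 0 + (x.1 / s) • p 1 + (x.2 / s) • p 2

/-- The triangle `(0,0)`, `(s,0)`, `(0,s)`. -/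
def stdCorner (s : ℝ) : Fin 3 → ℝ × ℝ := ![(0, 0), (s, 0), (0, s)]

/-- The closed triangle `(0,0)`, `(s,0)`, `(0,s)`. -/
def InStd (s : ℝ) (x : ℝ × ℝ) : Prop := 0 ≤ x.1 ∧ 0 ≤ x.2 ∧ x.1 + x.2 ≤ s

theorem inStd_of_inHull {s : ℝ} {p : Fin 3 → ℝ × ℝ} (hp : ∀ i, InStd s (p i)) {x : ℝ × ℝ}
    (hx : InHull p x) : InStd s x := by
  obtain ⟨a, b, c, ha, hb, hc, habc, rfl⟩ := hx
  obtain ⟨h0, h0', h0''⟩ := hp 0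
  obtain ⟨h1, h1', h1''⟩ := hp 1
  obtain ⟨h2, h2', h2''⟩ := hp 2
  refine ⟨?_, ?_, ?_⟩ <;> simp only [Prod.fst_add, Prod.snd_add, Prod.smul_fst, Prod.smul_snd,
    smul_eq_mul]
  · positivity
  · positivity
  · calc _ = a * ((p 0).1 + (p 0).2) + b * ((p 1).1 + (p 1).2) + c * ((p 2).1 + (p 2).2) := by ring
      _ ≤ a * s + b * s + c * s := by gcongr
      _ = s := by rw [← add_mul, ← add_mul, habc, one_mul]

theorem triMap_stdCorner {s : ℝ} (hs : 0 < s) (p : Fin 3 → ℝ × ℝ) (i : Fin 3) :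
    triMap s p (stdCorner s i) = p i := by
  fin_cases i <;> simp [triMap, stdCorner, hs.ne']

theorem inHull_triMap {s : ℝ} (hs : 0 < s) (p : Fin 3 → ℝ × ℝ) {x : ℝ × ℝ} (hx : InStd s x) :
    InHull p (triMap s p x) := by
  obtain ⟨h1, h2, h3⟩ := hx
  refine ⟨_, _, _, ?_, ?_, ?_, ?_, rfl⟩
  · rw [sub_sub, ← add_div, sub_nonneg, div_le_one hs]
    exact h3
  · positivity
  · positivity
  · ring

theorem triMap_injective {s : ℝ} (hs : 0 < s) {p : Fin 3 → ℝ × ℝ}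
    (hp : cross (p 0) (p 1) (p 2) ≠ 0) : Function.Injective (triMap s p) := by
  intro x y hxy
  have h1 := congrArg Prod.fst hxy
  have h2 := congrArg Prod.snd hxy
  simp only [triMap, Prod.fst_add, Prod.snd_add, Prod.smul_fst, Prod.smul_snd, smul_eq_mul] at h1 h2
  have e1 : cross (p 0) (p 1) (p 2) * (x.1 / s - y.1 / s) = 0 := by
    unfold cross
    linear_combination ((p 2).2 - (p 0).2) * h1 - ((p 2).1 - (p 0).1) * h2
  have e2 : cross (p 0) (p 1) (p 2) * (x.2 / s - y.2 / s) = 0 := by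
    unfold cross
    linear_combination ((p 1).1 - (p 0).1) * h2 - ((p 1).2 - (p 0).2) * h1
  have f1 := sub_eq_zero.1 ((mul_eq_zero.1 e1).resolve_left hp)
  have f2 := sub_eq_zero.1 ((mul_eq_zero.1 e2).resolve_left hp)
  rw [div_left_inj' hs.ne'] at f1 f2
  exact Prod.ext f1 f2

theorem exists_of_inHull_triMap {s : ℝ} {p q : Fin 3 → ℝ × ℝ} {x : ℝ × ℝ}
    (hx : InHull (triMap s p ∘ q) x) : ∃ y, InHull q y ∧ triMap s p y = x := by
  obtain ⟨a, b, c, ha, hb, hc, habc, rfl⟩ := hx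
  refine ⟨_, ⟨a, b, c, ha, hb, hc, habc, rfl⟩, ?_⟩
  obtain rfl : c = 1 - a - b := by linarith
  ext <;> simp only [triMap, Function.comp, Prod.fst_add, Prod.snd_add, Prod.smul_fst,
    Prod.smul_snd, smul_eq_mul] <;> ring

/-- An affine map multiplies areas by its determinant, so nondegenerate triangles stay nondegenerate
under substitution. -/
theorem cross_triMap {s : ℝ} (p : Fin 3 → ℝ × ℝ) (x y z : ℝ × ℝ) :
    cross (triMap s p x) (triMap s p y) (triMap s p z) =
      cross (p 0) (p 1) (p 2) * (cross x y z / (s * s)) := by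
  simp only [triMap, cross, Prod.fst_add, Prod.snd_add, Prod.smul_fst, Prod.smul_snd, smul_eq_mul]
  ring

/-- The positions obtained by drawing a copy of a gadget in every triangle. -/
noncomputable def blowPos {T ι I : Type*} (s : ℝ) (P : T → ℝ × ℝ) (term : ι → Fin 3 → T)
    (q : Fin 3 ⊕ I → ℝ × ℝ) : T ⊕ ι × I → ℝ × ℝ
  | Sum.inl t => P t
  | Sum.inr w => triMap s (P ∘ term w.1) (q (Sum.inr w.2))

/-- The gadget drawn in every triangle of a complex again gives a complex. -/
theorem IsComplex.blow {T ι X I κ : Type*} {s : ℝ} (hs : 0 < s) {P : T → ℝ × ℝ}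
    {term : ι → Fin 3 → T} {xc : X → Fin 3 → T} (hP : IsComplex P (Sum.elim term xc))
    (hnd : ∀ u, cross (P (term u 0)) (P (term u 1)) (P (term u 2)) ≠ 0)
    {q : Fin 3 ⊕ I → ℝ × ℝ} {g : κ → Fin 3 → Fin 3 ⊕ I} (hq : IsComplex q g)
    (hcorner : ∀ i, q (Sum.inl i) = stdCorner s i) (hstd : ∀ v, InStd s (q v)) :
    IsComplex (blowPos s P term q)
      (Sum.elim (fun (p : ι × κ) i => blowVert term p.1 (g p.2 i))
        (fun x i => Sum.inl (xc x i))) := by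
  have hpos : ∀ u v, blowPos s P term q (blowVert term u v) = triMap s (P ∘ term u) (q v) := by
    rintro u (i | y)
    · simp [blowPos, blowVert, hcorner, triMap_stdCorner hs]
    · rfl
  have hinj : ∀ u, Function.Injective (triMap s (P ∘ term u)) := fun u =>
    triMap_injective hs (hnd u)
  have hcellpos : ∀ u k, (blowPos s P term q ∘ fun i => blowVert term u (g k i)) =
      triMap s (P ∘ term u) ∘ (q ∘ g k) := fun u k => funext fun i => hpos u _
  have hsub : ∀ u k x, InHull (triMap s (P ∘ term u) ∘ (q ∘ g k)) x → InHull (P ∘ term u) x := by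
    intro u k x hx
    obtain ⟨y, hy, rfl⟩ := exists_of_inHull_triMap hx
    exact inHull_triMap hs _ (inStd_of_inHull (fun i => hstd _) hy)
  have hin : ∀ u v, InHull (P ∘ term u) (triMap s (P ∘ term u) (q v)) := fun u v =>
    inHull_triMap hs _ (hstd v)
  -- A gadget vertex drawn at the place of an outer vertex lies in the outer triangle, so that outer
  -- vertex is a corner of it, and the gadget vertex is the corresponding terminal.
  have hmeet : ∀ u v t, triMap s (P ∘ term u) (q v) = P t → ∃ i, term u i = t ∧ v = Sum.inl i := by
    intro u v t h
    obtain ⟨i, hi⟩ := hP.eq_corner (k := Sum.inl u) (v := t) (h ▸ hin u v)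
    refine ⟨i, hi, hq.inj (hinj u ?_)⟩
    rw [h, hcorner, triMap_stdCorner hs, ← hi]
    rfl
  -- A point where an outer triangle meets another outer cell is a corner of the triangle. If an
  -- inner cell contains this corner, then the corresponding terminal is a corner of the inner cell.
  have hcross : ∀ u k (c : Fin 3 → T) x, InHull (triMap s (P ∘ term u) ∘ (q ∘ g k)) x →
      (∃ i j, term u i = c j ∧ P (term u i) = x) →
      ∃ i j, blowVert term u (g k i) = Sum.inl (c j) ∧ P (c j) = x := by
    rintro u k c x hx ⟨i, j, h1, h2⟩
    obtain ⟨y, hy, hyx⟩ := exists_of_inHull_triMap hx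
    have : y = q (Sum.inl i) := hinj u (by
      rw [hyx, hcorner, triMap_stdCorner hs, ← h2]
      rfl)
    obtain ⟨i', hi'⟩ := hq.eq_corner (this ▸ hy)
    exact ⟨i', j, by rw [hi', ← h1]; rfl, by rw [← h1, h2]⟩
  refine ⟨?_, ?_, ?_⟩
  · rintro (t | ⟨u, y⟩) (t' | ⟨u', y'⟩) h
    · exact congrArg _ (hP.inj h)
    · obtain ⟨i, -, h'⟩ := hmeet u' (Sum.inr y') t h.symm
      cases h'
    · obtain ⟨i, -, h'⟩ := hmeet u (Sum.inr y) t' h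
      cases h'
    · by_cases huu : u = u'
      · subst huu
        have := hq.inj (hinj u h)
        simp_all
      · obtain ⟨i, j, -, h'⟩ := hP.sep (Sum.inl u) (Sum.inl u') (by simpa using huu) _
          (hin u (Sum.inr y)) (by
            change InHull (P ∘ term u') (blowPos s P term q (Sum.inr (u, y)))
            rw [h]
            exact hin u' (Sum.inr y'))
        obtain ⟨i', -, h''⟩ := hmeet u (Sum.inr y) _ h'.symm
        cases h''
  · rintro (t | ⟨u, y⟩)
    · obtain ⟨u | x, i, h⟩ := hP.covers t
      · obtain ⟨k, j, hk⟩ := hq.covers (Sum.inl i)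
        refine ⟨Sum.inl (u, k), j, ?_⟩
        simp only [Sum.elim_inl] at h ⊢
        rw [hk, ← h]
        rfl
      · exact ⟨Sum.inr x, i, congrArg _ h⟩
    · obtain ⟨k, j, hk⟩ := hq.covers (Sum.inr y)
      exact ⟨Sum.inl (u, k), j, by simp only [Sum.elim_inl, hk]; rfl⟩
  · have hmix : ∀ u k x z, InHull (blowPos s P term q ∘ fun i => blowVert term u (g k i)) z →
        InHull (blowPos s P term q ∘ fun i => Sum.inl (xc x i)) z →
        ∃ i j, blowVert term u (g k i) = Sum.inl (xc x j) ∧ P (xc x j) = z := by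
      intro u k x z h1 h2
      rw [hcellpos] at h1
      exact hcross u k _ z h1 (hP.sep (Sum.inl u) (Sum.inr x) (by simp) z (hsub u k z h1) h2)
    rintro (⟨u, k⟩ | x) (⟨v, l⟩ | x') hne z h1 h2
    · simp only [Sum.elim_inl] at h1 h2 ⊢
      rw [hcellpos] at h1 h2
      by_cases huv : u = v
      · subst huv
        obtain ⟨y, hy, rfl⟩ := exists_of_inHull_triMap h1
        obtain ⟨y', hy', hyy⟩ := exists_of_inHull_triMap h2
        obtain rfl := hinj u hyy
        obtain ⟨i, j, hi, hj⟩ := hq.sep k l (by simpa using hne) _ hy hy'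
        exact ⟨i, j, by rw [hi], by rw [hpos, hj]⟩
      · have hsep := hP.sep (Sum.inl u) (Sum.inl v) (by simpa using huv) z (hsub u k z h1)
          (hsub v l z h2)
        obtain ⟨i, j, hi, hj⟩ := hcross u k _ z h1 hsep
        obtain ⟨a, b, hab, ha⟩ := hsep
        obtain ⟨i', j', hi', hj'⟩ := hcross v l (term u) z h2 
          ⟨b, a, hab.symm, (congrArg P hab).symm.trans ha⟩
        have : term v j = term u j' := hP.inj (hj.trans hj'.symm)
        exact ⟨i, i', by rw [hi, hi', ← this]; rfl, by rw [hi]; exact hj⟩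
    · obtain ⟨i, j, hi, hj⟩ := hmix u k x' z h1 h2
      exact ⟨i, j, hi, by simp only [Sum.elim_inl, hi]; exact hj⟩
    · obtain ⟨i, j, hi, hj⟩ := hmix v l x z h2 h1
      exact ⟨j, i, hi.symm, hj⟩
    · obtain ⟨i, j, hi, hj⟩ := hP.sep (Sum.inr x) (Sum.inr x') (by simpa using hne) z h1 h2
      exact ⟨i, j, congrArg _ hi, hj⟩

/-! ### Separation tests with natural coordinates -/

section Tests

/-- The first sum in the doubled area of a triangle with natural coordinates. -/
def crossPos (p q r : ℕ × ℕ) : ℕ := p.1 * q.2 + q.1 * r.2 + r.1 * p.2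

/-- The second sum in the doubled area of a triangle with natural coordinates. -/
def crossNeg (p q r : ℕ × ℕ) : ℕ := p.2 * q.1 + q.2 * r.1 + r.2 * p.1

/-- A point with natural coordinates as a point of the plane. -/
def natPoint (p : ℕ × ℕ) : ℝ × ℝ := (p.1, p.2)

theorem cross_natPoint (p q r : ℕ × ℕ) :
    cross (natPoint p) (natPoint q) (natPoint r) = (crossPos p q r : ℝ) - crossNeg p q r := by
  simp [cross, natPoint, crossPos, crossNeg]

theorem cross_natPoint_ne {p q r : ℕ × ℕ} (h : crossPos p q r ≠ crossNeg p q r) :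
    cross (natPoint p) (natPoint q) (natPoint r) ≠ 0 := by
  rw [cross_natPoint, sub_ne_zero]
  exact_mod_cast h

/-- The line through `p` and `q` separates the triangle `b` from `a`, but for a common corner. -/
def lineTest (a b : List (ℕ × ℕ)) (p q : ℕ × ℕ) : Bool :=
  (a.all fun r => Nat.ble (crossNeg p q r) (crossPos p q r)) &&
    a.any fun m => b.all fun r => (Nat.ble (crossPos p q r + 1) (crossNeg p q r)) ||
      (Nat.beq r.1 m.1 && Nat.beq r.2 m.2 && Nat.beq (crossPos p q r) (crossNeg p q r))

/-- Two triangles are separated by a line through two corners of the first one. -/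
def sideTest (a b : List (ℕ × ℕ)) : Bool := a.any fun p => a.any fun q => lineTest a b p q

/-- Two triangles meet at most in a common corner. -/
def sepTest (a b : List (ℕ × ℕ)) : Bool := sideTest a b || sideTest b a

/-- The signed area with respect to the separating line is an affine function, nonnegative on the
first triangle and negative at the corners of the second, except where they equal one common corner.
At a common point it must vanish, so only that corner has a positive weight. -/
theorem sep_of_sideTest {V : Type*} {pt : V → ℕ × ℕ} (hinj : Function.Injective pt)
    {a b : Fin 3 → V} (h : sideTest [pt (a 0), pt (a 1), pt (a 2)] [pt (b 0), pt (b 1), pt (b 2)])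
    {x : ℝ × ℝ} (ha : InHull (natPoint ∘ pt ∘ a) x) (hb : InHull (natPoint ∘ pt ∘ b) x) :
    ∃ i j, a i = b j ∧ natPoint (pt (a i)) = x := by
  have hmem : ∀ (c : Fin 3 → V) (i : Fin 3), pt (c i) ∈ [pt (c 0), pt (c 1), pt (c 2)] := by
    intro c i
    fin_cases i <;> simp
  simp only [sideTest, List.any_eq_true, lineTest, Bool.and_eq_true, List.all_eq_true] at h
  obtain ⟨p, -, q, -, h1, m, hm, h2⟩ := h
  obtain ⟨i, rfl⟩ : ∃ i, pt (a i) = m := by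
    simp only [List.mem_cons, List.not_mem_nil, or_false] at hm
    rcases hm with h | h | h
    exacts [⟨0, h.symm⟩, ⟨1, h.symm⟩, ⟨2, h.symm⟩]
  set f : ℝ × ℝ → ℝ := fun z => cross (natPoint p) (natPoint q) z with hf
  have haff : ∀ (u v w : ℝ) (y : Fin 3 → ℝ × ℝ), u + v + w = 1 →
      f (u • y 0 + v • y 1 + w • y 2) = u * f (y 0) + v * f (y 1) + w * f (y 2) := by
    intro u v w y h
    obtain rfl : w = 1 - u - v := by linarith
    simp only [hf, cross, Prod.fst_add, Prod.snd_add, Prod.smul_fst, Prod.smul_snd, smul_eq_mul]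
    ring
  have hA : ∀ i, 0 ≤ f (natPoint (pt (a i))) := by
    intro i
    have := Nat.le_of_ble_eq_true (h1 _ (hmem a i))
    simp only [hf, cross_natPoint, sub_nonneg]
    exact_mod_cast this
  have hB : ∀ j, f (natPoint (pt (b j))) < 0 ∨
      b j = a i ∧ f (natPoint (pt (b j))) = 0 := by
    intro j
    have := h2 _ (hmem b j)
    simp only [Bool.or_eq_true, Bool.and_eq_true] at this
    rcases this with h | ⟨⟨h, h'⟩, h''⟩
    · left
      have := Nat.le_of_ble_eq_true h
      simp only [hf, cross_natPoint, sub_neg]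
      exact_mod_cast this
    · right
      refine ⟨hinj (Prod.ext (Nat.eq_of_beq_eq_true h) (Nat.eq_of_beq_eq_true h')), ?_⟩
      simp only [hf, cross_natPoint, Nat.eq_of_beq_eq_true h'', sub_self]
  have hxA : 0 ≤ f x := by
    obtain ⟨u, v, w, hu, hv, hw, huvw, rfl⟩ := ha
    rw [haff _ _ _ _ huvw]
    have := hA 0
    have := hA 1
    have := hA 2
    simp only [Function.comp]
    positivity
  obtain ⟨u, v, w, hu, hv, hw, huvw, rfl⟩ := hb
  rw [haff _ _ _ _ huvw] at hxA
  simp only [Function.comp] at hxA ⊢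
  have hle : ∀ j, f (natPoint (pt (b j))) ≤ 0 := fun j => (hB j).elim le_of_lt fun h => h.2.le
  -- A corner that carries weight without making the sum negative is the common one.
  have key : ∀ (t : ℝ) (j : Fin 3), 0 ≤ t → 0 ≤ t * f (natPoint (pt (b j))) →
      t = 0 ∨ b j = a i := by
    intro t j ht h
    rcases hB j with h' | h'
    · left
      nlinarith
    · exact Or.inr h'.1
  have m0 := mul_nonpos_of_nonneg_of_nonpos hu (hle 0)
  have m1 := mul_nonpos_of_nonneg_of_nonpos hv (hle 1)
  have m2 := mul_nonpos_of_nonneg_of_nonpos hw (hle 2)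
  have k0 := key u 0 hu (by linarith)
  have k1 := key v 1 hv (by linarith)
  have k2 := key w 2 hw (by linarith)
  have hj : ∃ j, b j = a i := by
    rcases k0 with k0 | k0
    · rcases k1 with k1 | k1
      · rcases k2 with k2 | k2
        · exact absurd huvw (by simp [k0, k1, k2])
        · exact ⟨2, k2⟩
      · exact ⟨1, k1⟩
    · exact ⟨0, k0⟩
  obtain ⟨j, hj⟩ := hj
  refine ⟨i, j, hj.symm, ?_⟩
  have e0 : u • natPoint (pt (b 0)) = u • natPoint (pt (a i)) := by
    rcases k0 with k | k <;> simp [k]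
  have e1 : v • natPoint (pt (b 1)) = v • natPoint (pt (a i)) := by
    rcases k1 with k | k <;> simp [k]
  have e2 : w • natPoint (pt (b 2)) = w • natPoint (pt (a i)) := by
    rcases k2 with k | k <;> simp [k]
  rw [e0, e1, e2, ← add_smul, ← add_smul, huvw, one_smul]

theorem natPoint_injective : Function.Injective natPoint := by
  rintro ⟨a, b⟩ ⟨c, d⟩ h
  simpa [natPoint] using h

/-- The injective code orders the cells, so that each unordered pair is tested just once. Edges are
included as triangles with a repeated corner. -/
theorem isComplex_of_sepTest {V κ : Type*} {pt : V → ℕ × ℕ} (hinj : Function.Injective pt)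
    {cell : κ → Fin 3 → V} (hcov : ∀ v, ∃ k i, cell k i = v) {code : κ → ℕ}
    (hcode : Function.Injective code)
    (h : ∀ k l, code k < code l → sepTest [pt (cell k 0), pt (cell k 1), pt (cell k 2)]
      [pt (cell l 0), pt (cell l 1), pt (cell l 2)] = true) :
    IsComplex (natPoint ∘ pt) cell := by
  refine ⟨natPoint_injective.comp hinj, hcov, fun k l hkl x hk hl => ?_⟩
  have : sepTest [pt (cell k 0), pt (cell k 1), pt (cell k 2)]
      [pt (cell l 0), pt (cell l 1), pt (cell l 2)] = true := by
    rcases lt_or_gt_of_ne (hcode.ne hkl) with hlt | hlt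
    · exact h k l hlt
    · rw [sepTest, Bool.or_comm]
      exact h l k hlt
  rw [sepTest, Bool.or_eq_true] at this
  rcases this with h | h
  · exact sep_of_sideTest hinj h hk hl
  · obtain ⟨i, j, h1, h2⟩ := sep_of_sideTest hinj h hl hk
    exact ⟨j, i, h1.symm, by rw [← h2, h1]; rfl⟩

end Tests

/-- A straight line drawing of a gadget in a triangle, with its terminals at the corners. -/
structure IsGadgetDrawing {I EB : Type*} (en : EB → (Fin 3 ⊕ I) × (Fin 3 ⊕ I)) (s : ℝ)
    (q : Fin 3 ⊕ I → ℝ × ℝ) : Prop where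
  pos : 0 < s
  complex : IsComplex q (segCell en)
  corner : ∀ i, q (Sum.inl i) = stdCorner s i
  std : ∀ v, InStd s (q v)

/-! ### Drawings of the four composite graphs -/

section Drawings

variable {I EB T ι : Type*} {en : EB → (Fin 3 ⊕ I) × (Fin 3 ⊕ I)} {s : ℝ}
  {q : Fin 3 ⊕ I → ℝ × ℝ}

/-- `IsComplex.blow` allows for additional cells that are not blown up; here there are none. -/
theorem IsComplex.addEmpty {κ : Type*} {P : T → ℝ × ℝ} {cell : κ → Fin 3 → T}
    (h : IsComplex P cell) : IsComplex P (Sum.elim cell (fun x : Empty => x.elim)) := by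
  refine ⟨h.inj, fun v => ?_, ?_⟩
  · obtain ⟨k, i, hk⟩ := h.covers v
    exact ⟨Sum.inl k, i, hk⟩
  · rintro (k | ⟨⟨⟩⟩) (l | ⟨⟨⟩⟩) hkl x hk hl
    exact h.sep k l (by simpa using hkl) x hk hl

theorem IsComplex.blow_cells {κ : Type*} (hs : 0 < s) {P : T → ℝ × ℝ} {term : ι → Fin 3 → T}
    (hP : IsComplex P term)
    (hnd : ∀ u, cross (P (term u 0)) (P (term u 1)) (P (term u 2)) ≠ 0)
    {g : κ → Fin 3 → Fin 3 ⊕ I} (hq : IsComplex q g)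
    (hcorner : ∀ i, q (Sum.inl i) = stdCorner s i) (hstd : ∀ v, InStd s (q v)) :
    IsComplex (blowPos s P term q) (fun (p : ι × κ) i => blowVert term p.1 (g p.2 i)) := by
  have h := hP.addEmpty.blow hs hnd hq hcorner hstd
  refine h.comap (φ := id) (ψ := Sum.inl) Function.injective_id Sum.inl_injective
    (fun _ _ => rfl) fun v => ?_
  obtain ⟨k | ⟨⟨⟩⟩, i, hk⟩ := h.covers v
  exact ⟨k, i, hk⟩

/-- The edges of the blow-up are the segments of the gadget drawings placed in the triangles of the
outer complex. -/
theorem isPlanarGraph_blow (hd : IsGadgetDrawing en s q) {P : T → ℝ × ℝ} {term : ι → Fin 3 → T}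
    (hP : IsComplex P term)
    (hnd : ∀ u, cross (P (term u 0)) (P (term u 1)) (P (term u 2)) ≠ 0)
    (hen : IsSimpleList (blowEnds en term)) : IsPlanarGraph (edgeGraph (blowEnds en term)) := by
  refine IsComplex.isPlanarGraph hen (pos := blowPos s P term q) ?_
  have h := hP.blow_cells hd.pos hnd hd.complex hd.corner hd.std
  have e : segCell (blowEnds en term) =
      fun (p : ι × EB) i => blowVert term p.1 (segCell en p.2 i) := by
    funext p i
    fin_cases i <;> rfl
  rw [e]
  exact h

theorem isPlanarGraph_closed (hd : IsGadgetDrawing en s q) (hen : IsSimpleList (closedEnds en)) :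
    IsPlanarGraph (edgeGraph (closedEnds en)) := by
  -- The gadget is drawn in the triangle (1, 1), (2, 1), (1, 2), and the new vertex at the origin
  -- sees its three corners.
  let pt : Option (Fin 3) → ℕ × ℕ
    | none => (0, 0)
    | some k => ![(1, 1), (2, 1), (1, 2)] k
  let term : Unit → Fin 3 → Option (Fin 3) := fun _ k => some k
  let ex : Fin 3 → Option (Fin 3) × Option (Fin 3) := fun k => (none, some k)
  have hP : IsComplex (natPoint ∘ pt) (Sum.elim term (segCell ex)) :=
    isComplex_of_sepTest (by decide) (by decide)
      (code := Sum.elim (fun _ => 0) fun k => k + 1) (by decide) (by decide)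
  have h := hP.blow hd.pos (fun u => cross_natPoint_ne (by revert u; decide)) hd.complex
    hd.corner hd.std
  let φ : Option (Fin 3 ⊕ I) → Option (Fin 3) ⊕ Unit × I
    | none => Sum.inl none
    | some (Sum.inl k) => Sum.inl (some k)
    | some (Sum.inr y) => Sum.inr ((), y)
  let ψ : EB ⊕ Fin 3 → (Unit × EB) ⊕ Fin 3 := Sum.map (Prod.mk ()) id
  have hφ : ∀ w, φ (some w) = blowVert term () w := by rintro (i | y) <;> rfl
  refine IsComplex.isPlanarGraph hen (pos := _ ∘ φ) (h.comap (φ := φ) (ψ := ψ) ?_ ?_ ?_ ?_)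
  · clear hφ
    rintro (_ | _ | _) (_ | _ | _) h <;> simp_all [φ]
  · exact Sum.map_injective.2 ⟨Prod.mk_right_injective _, Function.injective_id⟩
  · rintro (e | k) i
    · fin_cases i <;> exact hφ _
    · fin_cases i <;> rfl
  · rintro (_ | w)
    · exact ⟨Sum.inr 0, 0, rfl⟩
    · obtain ⟨e, i, rfl⟩ := hd.complex.covers w
      exact ⟨Sum.inl e, i, by fin_cases i <;> rfl⟩

theorem isPlanarGraph_linked (hd : IsGadgetDrawing en s q) (hen : IsSimpleList (linkedEnds en)) :
    IsPlanarGraph (edgeGraph (linkedEnds en)) := by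
  -- Four disjoint triangles, one inside the hollow left by the others, such that the six links can
  -- be drawn as segments between corners of equal number.
  let pt : Fin 4 × Fin 3 → ℕ × ℕ := fun v =>
    ![![(56, 56), (20, 56), (56, 20)], ![(62, 62), (125, 17), (17, 125)],
      ![(1, 17), (10, 62), (1, 125)], ![(17, 1), (125, 1), (62, 10)]] v.1 v.2
  let ex : Fin 3 × Fin 2 → (Fin 4 × Fin 3) × (Fin 4 × Fin 3) := fun x =>
    (((linkCopies x).1, x.1), ((linkCopies x).2, x.1))
  have hP : IsComplex (natPoint ∘ pt) (Sum.elim Prod.mk (segCell ex)) :=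
    isComplex_of_sepTest (by decide) (by decide)
      (code := Sum.elim (fun c => c) fun x => 4 + 2 * x.1 + x.2) (by decide) (by decide +kernel)
  have h := hP.blow hd.pos (fun u => cross_natPoint_ne (by revert u; decide)) hd.complex
    hd.corner hd.std
  let φ : Fin 4 × (Fin 3 ⊕ I) → (Fin 4 × Fin 3) ⊕ Fin 4 × I := fun v => blowVert Prod.mk v.1 v.2
  have hφ : Function.Injective φ := by
    rintro ⟨c, k | y⟩ ⟨c', k' | y'⟩ h <;> simp_all [φ, blowVert]
  refine IsComplex.isPlanarGraph hen (pos := _ ∘ φ) (h.comap (φ := φ) (ψ := id) hφ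
    Function.injective_id ?_ ?_)
  · rintro (e | k) i
    · fin_cases i <;> rfl
    · fin_cases i <;> rfl
  · rintro ⟨c, w⟩
    obtain ⟨e, i, rfl⟩ := hd.complex.covers w
    exact ⟨Sum.inl (c, e), i, by fin_cases i <;> rfl⟩

/-- A complex in a triangle yields a complex for four linked copies. -/
theorem exists_isComplex_termFour {loc : ι → Fin 3 → T ⊕ Fin 3} (hs : 0 < s)
    {P : T ⊕ Fin 3 → ℝ × ℝ} (hP : IsComplex P loc)
    (hnd : ∀ u, cross (P (loc u 0)) (P (loc u 1)) (P (loc u 2)) ≠ 0)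
    (hcorner : ∀ i, P (Sum.inr i) = stdCorner s i) (hstd : ∀ v, InStd s (P v)) :
    ∃ P' : (Fin 4 × T) ⊕ (Fin 3 × Fin 2) → ℝ × ℝ, IsComplex P' (termFour loc) ∧
      ∀ p, cross (P' (termFour loc p 0)) (P' (termFour loc p 1)) (P' (termFour loc p 2)) ≠ 0 := by
  -- The links are the six vertices of an octahedron, and the four copies are drawn in four faces of
  -- it, any two of which share just one vertex.
  let pt : Fin 3 × Fin 2 → ℕ × ℕ := fun x =>
    ![![(5, 5), (0, 0)], ![(1, 5), (12, 0)], ![(5, 1), (0, 12)]] x.1 x.2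
  have hO : IsComplex (natPoint ∘ pt) link :=
    isComplex_of_sepTest (by decide) (by decide) Fin.val_injective (by decide)
  have hOnd : ∀ c, cross ((natPoint ∘ pt) (link c 0)) ((natPoint ∘ pt) (link c 1))
      ((natPoint ∘ pt) (link c 2)) ≠ 0 := fun c =>
    cross_natPoint_ne (by revert c; decide)
  -- The drawing of one copy plays the role of a gadget whose terminals are its dangling edges, so
  -- these have to come first.
  have hQ : IsComplex (P ∘ Sum.swap) (fun u i => (loc u i).swap) :=
    hP.comap (φ := Sum.swap) (ψ := id) Sum.swap_leftInverse.injective Function.injective_id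
      (fun u i => Sum.swap_swap _) fun v => by
        obtain ⟨k, i, hk⟩ := hP.covers v.swap
        exact ⟨k, i, by rw [hk, Sum.swap_swap]⟩
  have h := hO.blow_cells hs hOnd hQ hcorner fun v => hstd v.swap
  have hsw : ∀ c (v : T ⊕ Fin 3), (copyEdge c v).swap = blowVert link c (Sum.swap v) := by
    rintro c (t | k) <;> rfl
  have h' := h.comap (φ := Sum.swap) (ψ := id) (cell' := termFour loc)
    Sum.swap_leftInverse.injective Function.injective_id (fun p i => hsw _ _) fun v => by
      obtain ⟨k, i, hk⟩ := h.covers v.swap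
      refine ⟨k, i, ?_⟩
      rw [termFour, ← Sum.swap_swap (copyEdge _ _), hsw, hk, Sum.swap_swap]
  refine ⟨_, h', fun p => ?_⟩
  have hpos : ∀ c v, blowPos s (natPoint ∘ pt) link (P ∘ Sum.swap) (copyEdge c v).swap =
      triMap s ((natPoint ∘ pt) ∘ link c) (P v) := by
    rintro c (t | k)
    · rfl
    · rw [hcorner, triMap_stdCorner hs]
      rfl
  simp only [Function.comp_apply, termFour, hpos]
  rw [cross_triMap]
  exact mul_ne_zero (hOnd p.1) (div_ne_zero (hnd p.2) (by positivity))

end Drawings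

end Planarity

/-! ### The 40-vertex graph and its certificates -/

section Gadget

/-- The edges of the gadget, with its terminals numbered `0`, `1`, `2`. -/
def gadgetEdges : List (ℕ × ℕ) :=
  [(0, 3), (0, 4), (1, 5), (1, 6), (1, 7), (2, 8), (2, 9), (2, 10), (3, 5), (3, 11), (4, 10),
    (4, 12), (5, 13), (6, 14), (6, 15), (7, 8), (7, 16), (8, 17), (9, 18), (9, 19), (10, 20),
    (11, 12), (11, 21), (12, 22), (12, 23), (13, 14), (13, 21), (14, 24), (15, 16), (15, 25),
    (16, 26), (16, 27), (17, 18), (17, 26), (17, 28), (18, 29), (19, 20), (19, 30), (20, 23),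
    (21, 31), (22, 31), (22, 32), (22, 33), (23, 34), (24, 25), (24, 31), (25, 32), (26, 35),
    (27, 32), (27, 35), (27, 36), (28, 35), (28, 36), (28, 37), (29, 30), (29, 37), (30, 34),
    (32, 38), (33, 34), (33, 37), (36, 38), (37, 38)]

/-- The adjacency matrix of the closed gadget, with its new vertex numbered `39`, as a binary
number. -/
def gadgetMatrix : ℕ :=
  290808475022902302447265182288749827908094451938594974337260503434938398161517351888226386012847012319778591545377385702433564130795553418628669725131627862471154762265620636896035496032672350585681751670217241789194507080102817904489332538005514954799851683259002924038933660342276686440844019964076704637110707580820368960583093093636473205197255853298352125574440595517669875114309305026592780672815954792076238820062479166192603547540634583442144373422338398058709016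

/-- The pairs of faces at the edges of the closed gadget. -/
def gadgetFaces : List (ℕ × ℕ) :=
  [(24, 26), (23, 26), (17, 24), (9, 17), (9, 16), (14, 16), (14, 22), (22, 23), (24, 25),
    (25, 26), (20, 23), (20, 26), (17, 25), (10, 17), (9, 10), (8, 16), (8, 9), (8, 14),
    (14, 15), (15, 22), (20, 22), (19, 26), (19, 25), (12, 19), (12, 20), (17, 18), (18, 25),
    (10, 18), (5, 9), (5, 10), (4, 8), (4, 5), (7, 14), (3, 8), (3, 7), (7, 15), (21, 22),
    (15, 21), (20, 21), (18, 19), (11, 19), (6, 11), (6, 12), (12, 21), (10, 11), (11, 18),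
    (5, 11), (3, 4), (1, 5), (0, 4), (0, 1), (0, 3), (0, 2), (2, 7), (13, 15), (7, 13), (13, 21),
    (1, 6), (12, 13), (6, 13), (1, 2), (2, 6), (23, 24), (16, 24), (16, 23)]

/-- The coordinates of the vertices of the gadget. -/
def gadgetPoints : List (ℕ × ℕ) :=
  [(0, 0), (80, 0), (0, 80), (26, 5), (7, 26), (53, 4), (64, 10), (52, 26), (26, 52), (9, 65),
    (5, 53), (27, 16), (19, 26), (47, 11), (53, 13), (53, 19), (45, 28), (28, 46), (19, 54),
    (13, 54), (11, 47), (37, 15), (29, 27), (17, 37), (45, 18), (44, 23), (36, 37), (38, 32),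
    (31, 39), (22, 46), (18, 47), (37, 21), (37, 28), (26, 35), (20, 40), (35, 36), (34, 35),
    (27, 39), (32, 34)]

/-- Codes of the paths from `0` to `1` that miss just one of the vertices `3`, `4`, .... -/
def gadgetPathsOne : List ℕ :=
  [7288302145550650977172663009970066633215862651209215852843717140736,
    7504207975509872637482294129190417449652174702291352122976420253888,
    7490785310400573325947295329317250274832666694266135421739397853376,
    7271775979335900629936836805118573534953499876012390498727253295360,
    7288302144672657272401828533473896519274438588246737157393510346944,
    7504209682765153684503912410535657501950404152673289018288125530304,
    7271775979307933655578966870924656838921346318287139763925242659072,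
    7271775979307930186767087727731607562965508152662000841733139382528,
    7395524683909999035464118989752453471672293268990857528331702915264,
    7490391904806350085860909740786011179994018003568927420056538751232,
    7271776093089792565120456627768426595318622694672149398592854991104,
    7396957225364591228313912501888169889396215447355517521734915084480,
    7395524792824964885356323313353438505841572737069333089495395377408,
    7490391904806350085860909740807489400006375772640117067041939411136,
    7271775979307933655578966921129803694636295743762369829196439273728,
    7490785302914291625227478402639046596595531871552573095818437087424,
    7395233752330377049984383437440829249011759007243736586004588437760,
    7397195491166989449603297211322042074574011444923285558934578438400,
    7288302145550651482222472876787429755554827172494612824221809684672,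
    7288492221361456938601080119849361081814549917499784833876293103808,
    7504209620294111328191192825591053299077454304234584051686642569408,
    7271772427077114754188108717472706972658686832384845659635200860416,
    7490391904806350084106122575584185872733922944395971620337175777472,
    7271775979307930186788700986643552363219814254562840601123383460096,
    7288302144641323265518952836084437944314378730855134514952388522176,
    7395233752330377049984383437528594231293008748657703413020196913408,
    7397195491166989449603748463339103903175162152982954142455576707328,
    7490392311708440668732599240406791680084237609123960374917448122624,
    7490391904806350097749856881811288999567129022090963679495142527168,
    7271775979307933655578493705512957856411119411685439316527856787712,
    7395524683909993322364328213198974577673799413017115948258472009984,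
    7490391904806350084106122575087182098081805975707040988383623028992,
    7397195491166989449603297211322229689014384919845271479004813107456,
    7490784380307557972664520080246275673735997760914494479763532980480,
    7490785302914291625223607878195119116525427647016852320948845826240,
    7288302144641323260958986303915698985070719679051123321943260180672]

/-- Codes of the paths from `0` to `2` that miss just one of the vertices `3`, `4`, .... -/
def gadgetPathsTwo : List ℕ :=
  [14459833743767861518873655243775210542734426437965246650769745158400,
    14566498582062310843748298757728704261695662324669908630364002496704,
    14458160833153937028668521766527154493388015396550464601972251340992,
    14334018001519112097616207515730586965984764101023535484433276907712,
    14351127970681266491900235867726767882718144291694428482412625547456,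
    14457851606090855801353153501068836426760270108778679357155948142848,
    14334017938435424970683477226351879773190905550387682291261757235456,
    14459572221658085093027754914552572202207731403102667922383241265408,
    14539996167908207971337644867804732173357005410612949927246345556160,
    14334017938448970336743032355168935963829334911807233324788128719104,
    14351179378134627044666667105852860263460075924054681984454280388864,
    14539996167908207971359506932491346493115101406392307101001850335424,
    14334412644071524786741913043135256239612139049978641046935595692224,
    14458160833153937028668185116338412212321886037978045624958028394688,
    14334018409402999505609740751591285201267333555776328139859234431232,
    14459831760798590796363009302594520589372266889675304433279711617280,
    14458160927620167770600998683087067868797709403445743763826486300864,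
    14539996256881619075440892864032822290724453573505519703490838180032,
    14351120202424182227964732148009618731030535364701433645741089267968,
    14458160833153937028668521766502825553382381321819262388075052183744,
    14566498582062314732808235630892328560091003106648189606918513803520,
    14457843385693773613354915604157626468748966279262891958124487418112,
    14539996167908212592195137933889999627454802425329414333634622828736,
    14350911780418247504212566546454909327596883612100416182976208195776,
    14566498580850990308921412875402669292523119738022714497997530251520,
    14458160833153937028668521766442058191792032510931976526505128014016,
    14334018410512815518774952409331453005620766452916805725987194052864,
    14459566809022148547651506644172985239323831271860606851194488664256,
    14458160833153937028668185104395979738400438844621718088792770130112,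
    14334018409402999505609740751676330105338184547194433665272413987072,
    14539995843404024929392538132331585639372582618637294021393421480128,
    14459831640411122793421209141870302687294225923029956197798005219584,
    14458160833153937028668184749641168649230447600948316826916294537408,
    14458160833153937028668184749641168649230447298716861923259000860864,
    14539996167908212592195137507231302268210533356981522496488603955392,
    14351127964388961808814220070871605758944988120754769549161489539328]

/-- Codes of the paths from `0` to `1`, from `0` to `2` and from `1` to `2` that miss just the third
terminal. -/
def gadgetDefaults : List ℕ :=
  [7395233752330377049984383520577603900284874247194642960399404671232,
    14334412128552066999593366181494558158081484605409292877822728360128,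
    14334412626446293125566346379875857741000236632061372274644819390785]

/-- The code of a Hamiltonian cycle of the gadget. -/
def gadgetCycle : ℕ :=
  1793062362173870344265083386556632345038845121288741934896427448971456

/-- The vertex of the gadget with a given number. -/
def gadgetVert (v : ℕ) : Fin 3 ⊕ Fin 36 :=
  if h : v < 3 then Sum.inl ⟨v, h⟩ else Sum.inr (Fin.ofNat 36 (v - 3))

/-- The number of a vertex of the gadget. -/
def gadgetCode : Fin 3 ⊕ Fin 36 → ℕ
  | Sum.inl k => k
  | Sum.inr y => y + 3

/-- The edge list of the gadget. -/
def gadgetEnds (e : Fin 62) : (Fin 3 ⊕ Fin 36) × (Fin 3 ⊕ Fin 36) :=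
  Prod.map gadgetVert gadgetVert (gadgetEdges.getD e 0)

theorem isSimpleList_gadgetEnds : IsSimpleList gadgetEnds :=
  ⟨by decide +kernel, by decide +kernel⟩

theorem isSimpleList_closedGadget : IsSimpleList (closedEnds gadgetEnds) :=
  ⟨by decide +kernel, by decide +kernel⟩

/-- The left face of an edge of the closed gadget. -/
def gadgetLeft (e : Fin 62 ⊕ Fin 3) : Fin 27 :=
  Fin.ofNat 27 (gadgetFaces.getD (finSumFinEquiv e) 0).1

/-- The right face of an edge of the closed gadget. -/
def gadgetRight (e : Fin 62 ⊕ Fin 3) : Fin 27 :=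
  Fin.ofNat 27 (gadgetFaces.getD (finSumFinEquiv e) 0).2

theorem gadget_face_even : ∀ (v : Option (Fin 3 ⊕ Fin 36)) (φ : Fin 27),
    Even (((incEdges (closedEnds gadgetEnds) v).filter fun e => gadgetLeft e = φ).card +
      ((incEdges (closedEnds gadgetEnds) v).filter fun e => gadgetRight e = φ).card) := by
  decide +kernel

/-- Face 0 is the quadrilateral 27, 35, 28, 36. Its opposite corners 35 and 36 have degree three,
and every ring edge misses one of them; that one serves as the corner. -/
theorem isRing_gadget : IsRing (incEdges (closedEnds gadgetEnds)) gadgetLeft gadgetRight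
    (fun i => Fin.castLE (by decide) i) (fun i => Sum.inl (![50, 52, 51, 49] i)) :=
  ⟨by decide +kernel, by decide +kernel, by decide +kernel, by decide +kernel,
    fun v => by revert v; decide +kernel, by decide +kernel⟩

/-- The faces are connected through edges if every face but the first has an edge to an earlier
one. -/
theorem dual_connected_of_lt {E : Type*} {n : ℕ} [NeZero n] {l r : E → Fin n}
    (hlt : ∀ e, l e < r e) (hex : ∀ φ, φ ≠ 0 → ∃ e, r e = φ) (g : Fin n → ZMod 2)
    (hg : ∀ e, g (l e) = g (r e)) (a b : Fin n) : g a = g b := by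
  have key : ∀ k (φ : Fin n), φ.val = k → g φ = g 0 := by
    intro k
    induction k using Nat.strong_induction_on with
    | _ k ih =>
      intro φ hφ
      by_cases h0 : φ = 0
      · rw [h0]
      · obtain ⟨e, rfl⟩ := hex φ h0
        rw [← hg, ih _ (hφ ▸ hlt e) _ rfl]
  rw [key _ a rfl, key _ b rfl]

/-- The digits of a number in base `64`. -/
def unpack : ℕ → ℕ → List ℕ
  | 0, _ => []
  | n + 1, x => x % 64 :: unpack n (x / 64)

/-- Adjacency of vertices of the closed gadget. -/
def gadgetAdj (a b : ℕ) : Bool := gadgetMatrix.testBit (40 * a + b)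

/-- Consecutive vertices are adjacent. -/
def chainTest : List ℕ → Bool
  | a :: b :: l => gadgetAdj a b && chainTest (b :: l)
  | _ => true

/-- The vertex of the closed gadget with a given number. -/
def closedVert (v : ℕ) : Option (Fin 3 ⊕ Fin 36) := if v = 39 then none else some (gadgetVert v)

/-- The set of numbers in a list without repetitions, as a binary number. -/
def scan : ℕ → List ℕ → Option ℕ
  | m, [] => some m
  | m, x :: l => if m.testBit x then none else scan (m ||| 2 ^ x) l

/-- The binary number is the set of elements met so far, so success excludes repetitions, and the
result records membership. -/
theorem scan_spec {l : List ℕ} {m m' : ℕ} (h : scan m l = some m') :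
    l.Nodup ∧ (∀ x ∈ l, m.testBit x = false) ∧ ∀ x, m'.testBit x ↔ m.testBit x ∨ x ∈ l := by
  induction l generalizing m with
  | nil =>
    obtain rfl : m = m' := by simpa [scan] using h
    simp
  | cons a l ih =>
    rw [scan] at h
    split_ifs at h with ha
    obtain ⟨h1, h2, h3⟩ := ih h
    have hor : ∀ x, (m ||| 2 ^ a).testBit x = true ↔ m.testBit x = true ∨ x = a := by
      intro x
      rw [Nat.testBit_or, Nat.testBit_two_pow, Bool.or_eq_true, decide_eq_true_iff, eq_comm (a := a)]
    have hal : a ∉ l := fun hal => by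
      have := (hor a).2 (Or.inr rfl)
      rw [h2 a hal] at this
      cases this
    refine ⟨List.nodup_cons.2 ⟨hal, h1⟩, ?_, fun x => ?_⟩
    · intro x hx
      rcases List.mem_cons.1 hx with rfl | hx
      · simpa using ha
      · have := h2 x hx
        by_contra hc
        rw [(hor x).2 (Or.inl (by simpa using hc))] at this
        cases this
    · rw [h3, hor, List.mem_cons, or_assoc]

/-- The list is a cycle of the closed gadget through all vertices but `y`. -/
def cycleTest (y : ℕ) (l : List ℕ) : Bool :=
  chainTest (l ++ l.take 1) && (l.all fun x => Nat.blt x 40) &&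
    decide (scan 0 l = some (2 ^ 40 - 1 - 2 ^ y))

/-- Only soundness matters: every bit set in the matrix is an edge. Chains can then be tested with
one bit lookup for each step. -/
theorem gadgetMatrix_spec : ∀ a < 40, ∀ b < 40, gadgetAdj a b = true →
    (gadgetEdges.any (fun e => Nat.beq e.1 a && Nat.beq e.2 b || Nat.beq e.1 b && Nat.beq e.2 a) ||
      (Nat.beq a 39 && Nat.blt b 3 || Nat.beq b 39 && Nat.blt a 3)) = true := by
  decide +kernel

theorem testBit_compl_forty : ∀ y < 40, ∀ x < 40,
    (2 ^ 40 - 1 - 2 ^ y).testBit x = true ↔ x ≠ y := by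
  decide +kernel

theorem gadgetEnds_adj {a b : ℕ} (h : gadgetEdges.any (fun e => Nat.beq e.1 a && Nat.beq e.2 b ||
    Nat.beq e.1 b && Nat.beq e.2 a)) :
    (edgeGraph gadgetEnds).Adj (gadgetVert a) (gadgetVert b) := by
  rw [List.any_eq_true] at h
  obtain ⟨⟨c, d⟩, hmem, h⟩ := h
  obtain ⟨i, hi, hget⟩ := List.getElem_of_mem hmem
  have h62 : gadgetEdges.length = 62 := rfl
  rw [edgeGraph_adj isSimpleList_gadgetEnds]
  have hends : gadgetEnds ⟨i, h62 ▸ hi⟩ = (gadgetVert c, gadgetVert d) := by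
    rw [gadgetEnds, List.getD_eq_getElem _ _ hi, hget]
    rfl
  refine ⟨⟨i, h62 ▸ hi⟩, ?_⟩
  rw [edgePair, hends]
  simp only [Bool.or_eq_true, Bool.and_eq_true, Nat.beq_eq] at h
  rcases h with ⟨rfl, rfl⟩ | ⟨rfl, rfl⟩
  · rfl
  · exact Sym2.eq_swap

theorem closedEnds_adj_some {I EB : Type*} {en : EB → (Fin 3 ⊕ I) × (Fin 3 ⊕ I)} {a b : Fin 3 ⊕ I} :
    (edgeGraph (closedEnds en)).Adj (some a) (some b) ↔ (edgeGraph en).Adj a b := by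
  simp [edgeGraph, SimpleGraph.fromRel_adj, closedEnds, Prod.ext_iff]

theorem closedEnds_adj_none {I EB : Type*} {en : EB → (Fin 3 ⊕ I) × (Fin 3 ⊕ I)} (k : Fin 3) :
    (edgeGraph (closedEnds en)).Adj none (some (Sum.inl k)) := by
  rw [edgeGraph, SimpleGraph.fromRel_adj]
  exact ⟨by simp, Or.inl ⟨Sum.inr k, rfl⟩⟩

theorem closedGadget_adj {a b : ℕ} (ha : a < 40) (hb : b < 40) (h : gadgetAdj a b = true) :
    (edgeGraph (closedEnds gadgetEnds)).Adj (closedVert a) (closedVert b) := by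
  have hlt : ∀ e ∈ gadgetEdges, e.1 ≠ 39 ∧ e.2 ≠ 39 := by decide +kernel
  have hterm : ∀ k < 3, closedVert k = some (Sum.inl (Fin.ofNat 3 k)) := by decide
  replace h := gadgetMatrix_spec a ha b hb h
  rw [Bool.or_eq_true] at h
  rcases h with h | h
  · have hne : a ≠ 39 ∧ b ≠ 39 := by
      rw [List.any_eq_true] at h
      obtain ⟨e, he, h⟩ := h
      simp only [Bool.or_eq_true, Bool.and_eq_true, Nat.beq_eq] at h
      have := hlt e he
      rcases h with ⟨rfl, rfl⟩ | ⟨rfl, rfl⟩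
      · exact this
      · exact this.symm
    rw [closedVert, closedVert, if_neg hne.1, if_neg hne.2]
    exact closedEnds_adj_some.2 (gadgetEnds_adj h)
  · have h39 : closedVert 39 = none := rfl
    simp only [Bool.or_eq_true, Bool.and_eq_true, Nat.beq_eq, Nat.blt_eq] at h
    rcases h with ⟨rfl, h⟩ | ⟨rfl, h⟩
    · rw [hterm b h, h39]
      exact closedEnds_adj_none _
    · rw [hterm a h, h39]
      exact (closedEnds_adj_none _).symm

theorem isChain_of_chainTest : ∀ {l : List ℕ}, (∀ x ∈ l, x < 40) → chainTest l = true →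
    (l.map closedVert).IsChain (edgeGraph (closedEnds gadgetEnds)).Adj
  | [], _, _ => .nil
  | [_], _, _ => .singleton _
  | a :: b :: l, hl, h => by
    rw [chainTest, Bool.and_eq_true] at h
    refine .cons_cons (closedGadget_adj (hl a (by simp)) (hl b (by simp)) h.1) ?_
    exact isChain_of_chainTest (fun x hx => hl x (List.mem_cons_of_mem _ hx)) h.2

theorem closedVert_injOn : ∀ x < 40, ∀ y < 40, closedVert x = closedVert y → x = y := by
  decide +kernel

theorem exists_closedVert : ∀ v, ∃ x, x < 40 ∧ closedVert x = v := by
  have : ∀ v : Option (Fin 3 ⊕ Fin 36), ∃ x : Fin 40, closedVert x = v := by decide +kernel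
  exact fun v => let ⟨x, hx⟩ := this v; ⟨x, x.2, hx⟩

/-- What a successful test says about the closed gadget. -/
theorem cycle_of_cycleTest {y : ℕ} (hy : y < 40) {l : List ℕ} (h : cycleTest y l = true) :
    (∀ x ∈ l, x < 40) ∧ (∀ x, x < 40 → (x ∈ l ↔ x ≠ y)) ∧ (l.map closedVert).Nodup ∧
      ((l ++ l.take 1).map closedVert).IsChain (edgeGraph (closedEnds gadgetEnds)).Adj := by
  simp only [cycleTest, Bool.and_eq_true, List.all_eq_true, decide_eq_true_eq] at h
  obtain ⟨⟨h1, h2⟩, h3⟩ := h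
  obtain ⟨hnd, -, hmem⟩ := scan_spec h3
  have hlt : ∀ x ∈ l, x < 40 := fun x hx => by simpa using h2 x hx
  refine ⟨hlt, fun x hx => ?_, ?_, isChain_of_chainTest ?_ h1⟩
  · rw [← testBit_compl_forty y hy x hx, hmem]
    simp
  · exact hnd.map_on fun x hx y hy' => closedVert_injOn x (hlt x hx) y (hlt y hy')
  · intro x hx
    rcases List.mem_append.1 hx with h | h
    · exact hlt x h
    · exact hlt x (List.mem_of_mem_take h)

/-- The vertices of the cycle of the closed gadget missing a given vertex. -/
def gadgetHamiltonian (y : ℕ) : List ℕ :=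
  if y = 39 then unpack 39 gadgetCycle
  else 39 :: unpack 38
    ((gadgetDefaults.reverse ++ gadgetPathsOne).getD y 0)

/-- The codes are arranged by the missed vertex: missing terminal 0 calls for the path from 1 to 2,
which is the last of `gadgetDefaults`, hence the reversal. For the new vertex 39 the cycle lies in
the gadget itself. -/
theorem gadgetHamiltonian_test : ∀ y < 40, cycleTest y (gadgetHamiltonian y) = true := by
  decide +kernel

theorem gadgetPathsTwo_test : ∀ y < 36,
    cycleTest (y + 3) (39 :: unpack 38 (gadgetPathsTwo.getD y 0)) = true := by
  decide +kernel

/-- All vertex-deleted subgraphs of the closed gadget are Hamiltonian, by the recorded cycles. -/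
theorem connOff_closedGadget {S : Finset (Option (Fin 3 ⊕ Fin 36))} (hS : S.card < 3) :
    ConnOff (edgeGraph (closedEnds gadgetEnds)) S := by
  refine connOff_of_hamiltonian (by decide) (fun v => ?_) hS
  obtain ⟨y, hy, rfl⟩ := exists_closedVert v
  obtain ⟨h1, h2, h3, h4⟩ := cycle_of_cycleTest hy (gadgetHamiltonian_test y hy)
  generalize gadgetHamiltonian y = l at h1 h2 h3 h4
  cases l with
  | nil =>
    exact absurd ((h2 (if y = 0 then 1 else 0) (by split_ifs <;> omega)).2
      (by split_ifs <;> omega)) (by simp)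
  | cons a l =>
    refine ⟨closedVert a, l.map closedVert, by simpa using h4, by simpa using h3, fun x => ?_⟩
    obtain ⟨x, hx, rfl⟩ := exists_closedVert x
    rw [← List.map_cons, List.mem_map]
    constructor
    · rintro ⟨z, hz, hzx⟩ hxy
      obtain rfl := closedVert_injOn z (h1 z hz) x hx hzx
      obtain rfl := closedVert_injOn z (h1 z hz) y hy hxy
      exact (h2 z hx).1 hz rfl
    · intro hxy
      exact ⟨x, (h2 x hx).2 fun h => hxy (h ▸ rfl), rfl⟩

theorem connected_of_connOff {V E : Type*} [Fintype E] [DecidableEq E] [DecidableEq V]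
    {en : E → V × V} (hen : IsSimpleList en) (h : ConnOff (edgeGraph en) ∅) (f : V → ZMod 2)
    (hf : ∀ e u v, e ∈ incEdges en u → e ∈ incEdges en v → f u = f v) (u v : V) : f u = f v := by
  have := h (fun x => f x = f u) (fun a b hab _ _ => by
    obtain ⟨e, he⟩ := (edgeGraph_adj hen).1 hab
    have : f a = f b := hf e a b (mem_incEdges.2 (by simp [he])) (mem_incEdges.2 (by simp [he]))
    rw [this]) u v (by simp) (by simp)
  exact (this.1 rfl).symm

/-- Euler's formula reads 40 + 27 = 65 + 2. The faces are numbered such that each one but the first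
has an edge to an earlier one. -/
theorem isPlaneMap_gadget : IsPlaneMap (incEdges (closedEnds gadgetEnds)) gadgetLeft gadgetRight :=
  ⟨card_ends isSimpleList_closedGadget,
    connected_of_connOff isSimpleList_closedGadget (connOff_closedGadget (by simp)),
    dual_connected_of_lt (by decide +kernel) (by decide +kernel), gadget_face_even, rfl⟩

/-- The closed gadget is not Hamiltonian: it has 40 vertices, which is 1 modulo 3, and a ring of
exceptional faces. -/
theorem card_circuit_gadget_le {D : Finset (Fin 62 ⊕ Fin 3)}
    (hD : EdgeSet.IsCircuit (incEdges (closedEnds gadgetEnds)) D) : D.card ≤ Fintype.card (Fin 36) + 3 :=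
  Nat.le_of_lt_succ (isRing_gadget.card_lt isPlaneMap_gadget (by decide) (by decide) hD)

theorem isChain_gadget {l : List ℕ} (hl : ∀ x ∈ l, x < 39)
    (h : (l.map closedVert).IsChain (edgeGraph (closedEnds gadgetEnds)).Adj) :
    (l.map gadgetVert).IsChain (edgeGraph gadgetEnds).Adj := by
  have e : l.map closedVert = (l.map gadgetVert).map some := by
    rw [List.map_map]
    exact List.map_congr_left fun x hx => if_neg (hl x hx).ne
  rw [e, List.isChain_map] at h
  exact h.imp fun a b hab => closedEnds_adj_some.1 hab

theorem gadgetVert_injOn : ∀ x < 39, ∀ y < 39, gadgetVert x = gadgetVert y → x = y := by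
  decide +kernel

/-- A cycle through the new vertex yields a path of the gadget. -/
theorem gadgetPath_of_cycleTest {y : ℕ} (hy : y < 39) {i o : Fin 3} {M : List ℕ}
    (h : cycleTest y (39 :: i :: (M ++ [o.val])) = true) :
    IsGadgetPath gadgetEnds i o (M.map gadgetVert) ∧ (∀ x ∈ M, x < 39) ∧
      gadgetVert y ∉ Sum.inl i :: (M.map gadgetVert ++ [Sum.inl o]) := by
  obtain ⟨h1, h2, h3, h4⟩ := cycle_of_cycleTest (by omega) h
  have hnd : (39 :: i.val :: (M ++ [o.val])).Nodup := h3.of_map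
  have hlt : ∀ x ∈ i.val :: (M ++ [o.val]), x < 39 := fun x hx => by
    have := h1 x (List.mem_cons_of_mem _ hx)
    have : x ≠ 39 := fun h => (List.nodup_cons.1 hnd).1 (h ▸ hx)
    omega
  have hv : ∀ k : Fin 3, gadgetVert k = Sum.inl k := by decide
  have e : Sum.inl i :: (M.map gadgetVert ++ [Sum.inl o]) =
      (i.val :: (M ++ [o.val])).map gadgetVert := by simp [hv]
  rw [IsGadgetPath, e]
  refine ⟨⟨isChain_gadget hlt ?_, ?_⟩, fun x hx => hlt x (by simp [hx]), ?_⟩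
  · have := h4.tail
    simp only [List.map_append, List.map_cons, List.cons_append, List.tail_cons] at this ⊢
    rw [← List.cons_append, ← List.cons_append] at this
    exact this.left_of_append
  · exact (List.nodup_cons.1 hnd).2.map_on fun x hx y hy =>
      gadgetVert_injOn x (hlt x hx) y (hlt y hy)
  · intro hmem
    obtain ⟨x, hx, hxy⟩ := List.mem_map.1 hmem
    obtain rfl := gadgetVert_injOn x (hlt x hx) y hy hxy
    exact (h2 x (by omega)).1 (List.mem_cons_of_mem _ hx) rfl

/-- The inner vertices of a coded path. -/
def innerCodes (n : ℕ) : List ℕ := ((unpack 38 n).drop 1).dropLast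

theorem gadgetPathsOne_inner : ∀ y < 36, 39 :: unpack 38 (gadgetPathsOne.getD y 0) =
    39 :: 0 :: (innerCodes (gadgetPathsOne.getD y 0) ++ [1]) := by decide +kernel

theorem gadgetPathsTwo_inner : ∀ y < 36, 39 :: unpack 38 (gadgetPathsTwo.getD y 0) =
    39 :: 0 :: (innerCodes (gadgetPathsTwo.getD y 0) ++ [2]) := by decide +kernel

theorem gadgetPathsOne_test : ∀ y < 36,
    cycleTest (y + 3) (39 :: unpack 38 (gadgetPathsOne.getD y 0)) = true := by
  intro y hy
  have h := gadgetHamiltonian_test (y + 3) (by omega)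
  rwa [gadgetHamiltonian, if_neg (by omega), List.getD_append_right _ _ _ _ (by simp [gadgetDefaults])]
    at h

theorem length_unpack (n x : ℕ) : (unpack n x).length = n := by
  induction n generalizing x with
  | zero => rfl
  | succ n ih => simp [unpack, ih]

theorem length_innerCodes (n : ℕ) : (innerCodes n).length = 36 := by
  simp [innerCodes, length_unpack]

theorem gadget_special (y : Fin 36) (o : Fin 3) (ho : o ≠ 0) :
    ∃ M, IsGadgetPath gadgetEnds 0 o M ∧ M.length = 36 ∧ Sum.inr y ∉ M := by
  have hy : gadgetVert (y + 3) = Sum.inr y := by revert y; decide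
  have key : ∀ n, cycleTest (y + 3) (39 :: (0 : Fin 3).val :: (innerCodes n ++ [o.val])) = true →
      ∃ M, IsGadgetPath gadgetEnds 0 o M ∧ M.length = 36 ∧ Sum.inr y ∉ M := by
    intro n h
    obtain ⟨h1, -, h2⟩ := gadgetPath_of_cycleTest (by omega) h
    refine ⟨_, h1, by rw [List.length_map, length_innerCodes], fun h => h2 ?_⟩
    rw [hy]
    simp [h]
  have h12 : ∀ o : Fin 3, o ≠ 0 → o = 1 ∨ o = 2 := by decide
  rcases h12 o ho with rfl | rfl
  · exact key _ (gadgetPathsOne_inner y y.2 ▸ gadgetPathsOne_test y y.2)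
  · exact key _ (gadgetPathsTwo_inner y y.2 ▸ gadgetPathsTwo_test y y.2)

/-- The number `3 - i - o` is that of the third terminal. -/
theorem gadgetDefaults_test : ∀ i o : Fin 3, i < o → ∃ n ∈ gadgetDefaults,
    cycleTest (3 - i - o) (39 :: i.val :: (innerCodes n ++ [o.val])) = true := by
  decide +kernel

theorem gadget_default {i o : Fin 3} (hio : i < o) :
    ∃ M, IsGadgetPath gadgetEnds i o M ∧ M.length = 36 ∧ ∀ k, Sum.inl k ∉ M := by
  obtain ⟨n, -, h⟩ := gadgetDefaults_test i o hio
  obtain ⟨h1, -, h2⟩ := gadgetPath_of_cycleTest (by omega) h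
  refine ⟨_, h1, by rw [List.length_map, length_innerCodes], fun k hk => ?_⟩
  have hcases : ∀ i o : Fin 3, i < o → ∀ k, k = i ∨ k = o ∨ gadgetVert (3 - i - o) = Sum.inl k := by
    decide
  have hnd := h1.2
  rcases hcases i o hio k with rfl | rfl | h
  · simp [hk] at hnd
  · simp only [List.nodup_cons, List.nodup_append] at hnd
    exact hnd.2.2.2 _ hk _ (by simp) rfl
  · rw [h] at h2
    simp [hk] at h2

/-- Rotating the Hamiltonian cycle of the gadget so that it ends at `o` and cutting it there gives a
Hamiltonian path ending at this terminal. -/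
theorem gadgetCycle_test : ∀ o : Fin 3, ∃ s < 39,
    chainTest ((unpack 39 gadgetCycle).rotate s) = true ∧
      ((unpack 39 gadgetCycle).rotate s).dropLast ++ [o.val] =
        (unpack 39 gadgetCycle).rotate s := by
  decide +kernel

theorem hasGadgetPaths_gadgetEnds : HasGadgetPaths gadgetEnds 36 where
  default i o hio := by
    rcases lt_or_gt_of_ne hio with h | h
    · exact gadget_default h
    · obtain ⟨M, h1, h2, h3⟩ := gadget_default h
      exact ⟨M.reverse, h1.reverse, by simpa using h2, by simpa using h3⟩
  special y i o hio h0 := by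
    rcases h0 with rfl | rfl
    · exact gadget_special y o hio.symm
    · obtain ⟨M, h1, h2, h3⟩ := gadget_special y i hio
      exact ⟨M.reverse, h1.reverse, by simpa using h2, by simpa using h3⟩
  full o := by
    obtain ⟨s, -, h1, h2⟩ := gadgetCycle_test o
    have hlt : ∀ x ∈ (unpack 39 gadgetCycle).rotate s, x < 39 := by
      have : ∀ x ∈ unpack 39 gadgetCycle, x < 39 := by decide +kernel
      simpa using this
    have hnd : ((unpack 39 gadgetCycle).rotate s).Nodup :=
      List.nodup_rotate.2 (by decide +kernel)
    have hv : ∀ o : Fin 3, gadgetVert o = Sum.inl o := by decide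
    refine ⟨((unpack 39 gadgetCycle).rotate s).dropLast.map gadgetVert, ?_, ?_, ?_⟩
    · rw [← hv o, ← List.map_singleton, ← List.map_append, h2]
      exact isChain_gadget hlt (isChain_of_chainTest (fun x hx => (hlt x hx).trans (by omega)) h1)
    · rw [← hv o, ← List.map_singleton, ← List.map_append, h2]
      exact hnd.map_on fun x hx y hy => gadgetVert_injOn x (hlt x hx) y (hlt y hy)
    · simp [length_unpack]

/-- The point at a vertex of the gadget. -/
def gadgetPoint (v : Fin 3 ⊕ Fin 36) : ℕ × ℕ := gadgetPoints.getD (gadgetCode v) 0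

theorem isGadgetDrawing_gadget : IsGadgetDrawing gadgetEnds 80 (natPoint ∘ gadgetPoint) where
  pos := by norm_num
  complex := isComplex_of_sepTest (by decide +kernel) (by decide +kernel) Fin.val_injective
    (by decide +kernel)
  corner i := by
    have : ∀ i, gadgetPoint (Sum.inl i) = ![(0, 0), (80, 0), (0, 80)] i := by decide +kernel
    simp only [Function.comp_apply, this]
    fin_cases i <;> simp [natPoint, stdCorner]
  std v := by
    have : ∀ v, (gadgetPoint v).1 + (gadgetPoint v).2 ≤ 80 := by decide +kernel
    refine ⟨Nat.cast_nonneg _, Nat.cast_nonneg _, ?_⟩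
    simp only [Function.comp_apply, natPoint]
    exact_mod_cast this v

end Gadget

/-! ### Connectedness of the cubic graph from tours -/

section TourConnectivity

variable {ι T : Type*} [Fintype ι] [Fintype T] [DecidableEq ι] [DecidableEq T]
  {term : ι → Fin 3 → T}

/-- A locally constant function is constant along a route. -/
theorem IsRoute.const {X : Finset T} {U : Finset ι} {f : ι → Prop}
    (hf : ∀ u v i j, u ∉ U → v ∉ U → term u i = term v j → term u i ∉ X → (f u ↔ f v)) :
    ∀ {ps : List (ι × Fin 3 × Fin 3)} {x y : T}, IsRoute term x ps y → (∀ s ∈ ps, s.1 ∉ U) →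
      (∀ s ∈ ps, term s.1 s.2.1 ∉ X) → ∀ s ∈ ps, ∀ s' ∈ ps, (f s.1 ↔ f s'.1)
  | [], _, _, _, _, _ => by simp
  | [a], _, _, _, _, _ => by simp
  | a :: b :: ps, x, y, h, hU, hX => by
    have hab : f a.1 ↔ f b.1 := by
      refine (hf b.1 a.1 b.2.1 a.2.2 (hU b (by simp)) (hU a (by simp)) h.2.2.1
        (hX b (by simp))).symm
    have ih := IsRoute.const hf h.2.2 (fun s hs => hU s (List.mem_cons_of_mem _ hs))
      (fun s hs => hX s (List.mem_cons_of_mem _ hs))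
    have ha : ∀ s ∈ a :: b :: ps, (f s.1 ↔ f b.1) := by
      intro s hs
      rcases List.mem_cons.1 hs with rfl | hs
      · exact hab
      · exact ih s hs b (by simp)
    exact fun s hs s' hs' => (ha s hs).trans (ha s' hs').symm

/-- A tour through all vertices but `m`. -/
structure IsNearTour (term : ι → Fin 3 → T) (ps : List (ι × Fin 3 × Fin 3)) (m : ι) : Prop where
  tour : IsTour term ps
  mem : ∀ u, u ∈ ps.map Prod.fst ↔ u ≠ m

theorem IsCubicIncidence.exists_other (h : IsCubicIncidence term) (u : ι) (i : Fin 3) :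
    ∃ v j, v ≠ u ∧ term v j = term u i := by
  have h2 := h.two (term u i)
  have hmem : (u, i) ∈ univ.filter fun p : ι × Fin 3 => term p.1 p.2 = term u i := by simp
  obtain ⟨⟨v, j⟩, hp, hne⟩ := exists_mem_ne (by rw [h2]; norm_num) (u, i)
  have hp' : term v j = term u i := by simpa using hp
  refine ⟨v, j, fun hvu => hne ?_, hp'⟩
  subst hvu
  rw [h.inj v hp']

/-- Two deleted edges are avoided by a cycle through all vertices but one. The missed vertex has
three edges, so one of them survives and joins it to the cycle. -/
theorem cubicConn_of_nearTours (h : IsCubicIncidence term)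
    (hA : ∀ t t' : T, ∃ ps m, IsNearTour term ps m ∧ ¬RouteUses term ps t ∧
      ¬RouteUses term ps t') [Nonempty T] {X : Finset T} (hX : X.card < 3) :
    CubicConn term X ∅ := by
  intro f hf
  obtain ⟨t, t', htt⟩ : ∃ t t', X ⊆ {t, t'} := by
    obtain h0 | h1 | h2 : X.card = 0 ∨ X.card = 1 ∨ X.card = 2 := by omega
    · exact ⟨Classical.arbitrary T, Classical.arbitrary T, by simp [card_eq_zero.1 h0]⟩
    · obtain ⟨t, rfl⟩ := card_eq_one.1 h1
      exact ⟨t, t, by simp⟩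
    · obtain ⟨t, t', -, rfl⟩ := card_eq_two.1 h2
      exact ⟨t, t', Subset.rfl⟩
  obtain ⟨ps, m, hps, ht, ht'⟩ := hA t t'
  obtain ⟨x, hx⟩ := hps.tour.route
  have hconst := hx.const hf (by simp) (by
    intro s hs hsX
    have := htt hsX
    rw [mem_insert, mem_singleton] at this
    rcases this with h | h
    · exact ht ⟨s, hs, h⟩
    · exact ht' ⟨s, hs, h⟩)
  have hne : ∀ u v, u ≠ m → v ≠ m → (f u ↔ f v) := by
    intro u v hu hv
    obtain ⟨s, hs, rfl⟩ := List.mem_map.1 ((hps.mem u).2 hu)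
    obtain ⟨s', hs', rfl⟩ := List.mem_map.1 ((hps.mem v).2 hv)
    exact hconst s hs s' hs'
  obtain ⟨i, hi⟩ : ∃ i, term m i ∉ X := by
    by_contra hno
    push Not at hno
    have : (univ.image (term m)).card ≤ X.card :=
      card_le_card (image_subset_iff.2 fun i _ => hno i)
    rw [card_image_of_injective _ (h.inj m), card_univ, Fintype.card_fin] at this
    omega
  obtain ⟨w, j, hw, hwi⟩ := h.exists_other m i
  have hm : f m ↔ f w := hf m w i j (by simp) (by simp) hwi.symm hi
  have all : ∀ u, (f u ↔ f w) := by
    intro u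
    by_cases hu : u = m
    · rw [hu, hm]
    · exact hne u w hu hw
  exact fun u v _ _ => (all u).trans (all v).symm

/-- If the deleted vertex is the one missed by a tour, all others lie on the tour. -/
theorem cubicConn_of_nearTour {ps : List (ι × Fin 3 × Fin 3)} {m : ι}
    (hps : IsNearTour term ps m) : CubicConn term ∅ {m} := by
  intro f hf u v hu hv
  obtain ⟨x, hx⟩ := hps.tour.route
  obtain ⟨s, hs, rfl⟩ := List.mem_map.1 ((hps.mem u).2 (by simpa using hu))
  obtain ⟨s', hs', rfl⟩ := List.mem_map.1 ((hps.mem v).2 (by simpa using hv))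
  exact hx.const hf (fun r hr => by simpa using (hps.mem r.1).1 (List.mem_map.2 ⟨r, hr, rfl⟩))
    (by simp) s hs s' hs'

/-- Connectedness without a vertex and an edge, from tours that begin at that vertex. -/
theorem cubicConn_of_nearTours_through (h : IsCubicIncidence term) {z : ι}
    (hA : ∀ t : T, ∃ i o qs m, IsNearTour term ((z, i, o) :: qs) m ∧
      ¬RouteUses term ((z, i, o) :: qs) t) [Nonempty T] {X : Finset T} (hX : X.card < 2) :
    CubicConn term X {z} := by
  intro f hf
  obtain ⟨t, htt⟩ : ∃ t, X ⊆ {t} := by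
    obtain h0 | h1 : X.card = 0 ∨ X.card = 1 := by omega
    · exact ⟨Classical.arbitrary T, by simp [card_eq_zero.1 h0]⟩
    · obtain ⟨t, rfl⟩ := card_eq_one.1 h1
      exact ⟨t, Subset.rfl⟩
  obtain ⟨a, o, qs, m, hps, ht⟩ := hA t
  obtain ⟨x, hx⟩ := hps.tour.route
  have hnd := hps.tour.simple.blobs
  rw [List.map_cons, List.nodup_cons] at hnd
  have hconst := hx.2.2.const hf (fun s hs => by
      rw [mem_singleton]
      exact fun h => hnd.1 (h ▸ List.mem_map.2 ⟨s, hs, rfl⟩)) (by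
    intro s hs hsX
    exact ht ⟨s, List.mem_cons_of_mem _ hs, mem_singleton.1 (htt hsX)⟩)
  have hne : ∀ u v, u ≠ m → v ≠ m → u ≠ z → v ≠ z → (f u ↔ f v) := by
    intro u v hu hv huz hvz
    have hu' := (hps.mem u).2 hu
    have hv' := (hps.mem v).2 hv
    simp only [List.map_cons, List.mem_cons, huz, hvz, false_or] at hu' hv'
    obtain ⟨s, hs, rfl⟩ := List.mem_map.1 hu'
    obtain ⟨s', hs', rfl⟩ := List.mem_map.1 hv'
    exact hconst s hs s' hs'
  have hzm : z ≠ m := (hps.mem z).1 (by simp)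
  -- Of the three edges at the missed vertex at most one is deleted and at most one leads to `z`;
  -- the third joins it to the rest of the tour.
  obtain ⟨i, hi, hiz⟩ : ∃ i, term m i ∉ X ∧ ∀ j, term z j ≠ term m i := by
    by_contra hno
    push Not at hno
    have hthree : ∀ i j : Fin 3, term m i ∈ X → term m j ∈ X → i = j := fun i j hi hj =>
      h.inj m ((mem_singleton.1 (htt hi)).trans (mem_singleton.1 (htt hj)).symm)
    have hz : ∀ i j : Fin 3, term m i ∉ X → term m j ∉ X → i = j := by
      intro i j hi hj
      obtain ⟨k, hk⟩ := hno i hi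
      obtain ⟨k', hk'⟩ := hno j hj
      exact h.share m z i j k k' hzm.symm hk.symm hk'.symm
    by_cases h0 : term m 0 ∈ X <;> by_cases h1 : term m 1 ∈ X <;> by_cases h2 : term m 2 ∈ X
    all_goals first
      | exact absurd (hthree 0 1 h0 h1) (by decide)
      | exact absurd (hthree 0 2 h0 h2) (by decide)
      | exact absurd (hthree 1 2 h1 h2) (by decide)
      | exact absurd (hz 0 1 h0 h1) (by decide)
      | exact absurd (hz 0 2 h0 h2) (by decide)
      | exact absurd (hz 1 2 h1 h2) (by decide)
  obtain ⟨w, j, hw, hwi⟩ := h.exists_other m i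
  have hwz : w ≠ z := fun hwz => hiz j (hwz ▸ hwi)
  have hm : f m ↔ f w := hf m w i j (by simpa using hzm.symm) (by simpa using hwz) hwi.symm hi
  have all : ∀ u, u ≠ z → (f u ↔ f w) := by
    intro u huz
    by_cases hu : u = m
    · rw [hu, hm]
    · exact hne u w hu hw huz hwz
  exact fun u v hu hv => (all u (by simpa using hu)).trans (all v (by simpa using hv)).symm

end TourConnectivity

/-! ### The cubic graph on 70 vertices and its certificates -/

section CubicGraph

/-- The edges at the vertices of the cubic graph, three for each, in base `128`. The edges numbered
`102`, `103`, `104` are those at the last vertex. -/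
def cubicTable : ℕ :=
  26747941209574230310175515626590175013353113560825387569039009133264129819797443081549010815336349051877381696986841025919411776031870919096517595271832738134887956498221447656902415323883701832683870255295443939317509800096158934074838705126401576217588607947482422007980015283901366248762690152725447390161896898818345202533752232173918147379340566174457546090520371495715926488284786799104152014632715809803319583740982064792193956086136960

/-- For every incidence the other one with the same edge, in base `256`. -/
def partnerTable : ℕ :=
  21418402718703513805932623455363358846053389933219050596397424325562187633957968573301810571731424337255438209414734284899942113594830869614319388311428024615106473565850883219756389247873902520912088993456840141391524741976824149594149224866171842327488528777919553571480996252922494928006079675159996019084470337900653730831629145493313027790432147030784832697537067688855096888967168740091138893893388828099899442440485056005201605050686747166988840229054541934464998638800994571311452739750959896331780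

/-- For every edge one of its incidences, in base `256`. -/
def edgeStateTable : ℕ :=
  2921397969918357270832059303020563787523365254083196441332929066851420271787335754952543105183350115908073093025770564567053867436309646378510212992266022427619928224805639963398532073389775352085489386591190646765950033172929498850781312217450901995776

/-- The pairs of faces at the edges of the cubic graph, in base `64`. -/
def cubicFaceTable : ℕ :=
  625283437209869630582923827519096036463697587800633349674519761661502709355366078946264545725494650287107500473482695681502680298615075708512064952715468494038292854179467732807909068370111589493822983102183814271281866831258803654694166270028529195553813251093001127969660826603679325672827367351924132408399110035484070913011271152241647610160299268858355442489062518875492608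

/-- Coordinates for the edges of the cubic graph, in base `128`. -/
def spherePoints : ℕ :=
  10308372831864574527818401822400797628185595426267296843338651171423297779667274269078087496635567843261444695000765981181225498918818281914052110053096804865172155772437431535867027220847689574775347965497440562454327291966215375154221502501031966342008300474164904611714922109662372380525848720209279186402763725489908803234617959767882872970718539928885176211048760593391143807144772656260795248353511932636945663799405906325989735256790333

/-- Coordinates for the edges of the cubic graph without its last vertex, in base `128`. -/
def patchPoints : ℕ :=
  25520187653703619013019779721742478866957539163223347396879416754724993249013998626140915662492599252458565054519279201345326955954390997350898102097709601439574935349609435232842255148234972969355697246150454796151428548358804643082718583423426418347543670627438188898985672435351138632861402469226985169652982597066906762460247343645386005824525013040877901194295604551452932772351755834648684756788595823407159243936381412946784501596733636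

/-- The cycles of the cubic graph that are used: the missed vertex, the set of edges as a binary
number, the start, and the turns as a binary number. -/
def cubicCycles : List (ℕ × ℕ × ℕ × ℕ) :=
  [(0, 29467198505529233938668591213756, 0, 386459391391609765943),
    (1, 19153208768946156467545522745314, 0, 201528530468892949814),
    (1, 19306283733558997182420679351250, 0, 267221670884368110466),
    (2, 18359535063357135810232296112005, 0, 253798712332511576432),
    (2, 34518399323478364682182907486153, 1, 387011420218891238096),
    (3, 32796484256490721552649932369209, 1, 393125195732251354166),
    (4, 34104587167897585393932932461685, 1, 481861261900909087150),
    (4, 33571371604880563281836200938101, 1, 452582974185328016850),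
    (5, 18359564404203515612696779122862, 0, 389554508786923655910),
    (6, 29033862195180713096089237889755, 0, 572663299340364377555),
    (6, 34384909647432600285900779087262, 1, 215280680111915361856),
    (7, 28481658785541813518380866149783, 0, 266543925563050833515),
    (8, 17539050594370758169571522915189, 0, 202056076344092763048),
    (9, 28481658752248478974722299738843, 0, 589073307565515748545),
    (9, 17538896307477348921655444494942, 0, 297057128353792753362),
    (10, 34936958727967347191452755262878, 1, 207459062215602537584),
    (10, 27871811025061381889392145546459, 0, 556938056186368344807),
    (11, 29033984842495261130755767393111, 0, 144027561695058854319),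
    (12, 34104433181139616834548137670137, 1, 425052071356308883886),
    (12, 35082579205747806599792641791481, 1, 371180088098000315850),
    (13, 29447456815911234033791502888807, 0, 175545058059878717595),
    (14, 28481658752539865264427430039399, 0, 177054985620261813383),
    (15, 19172948155443885780871631711605, 0, 38403428200503105928),
    (16, 30011976731683157217576362900887, 0, 255430098704508694635),
    (16, 27687678203638627028770099623847, 0, 96001918341433609871),
    (17, 27871813443502440979296118750039, 0, 90767495422796217069),
    (18, 17564937737709609727871145457013, 0, 151688051192309508712),
    (19, 17565091687040951466088199060126, 0, 385428254029144678994),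
    (19, 34936927388526634622871713705902, 1, 127686510453598512054),
    (20, 28481658785247506660056082659175, 0, 218219502968772603073),
    (20, 29034324951806522436799806812007, 0, 233723237735128966577),
    (21, 34104927352715699819907820877742, 1, 42463577131317648346),
    (22, 27832990293920091484500498558823, 0, 218285971674604494697),
    (22, 29294413530350605017528824879959, 0, 143978902191661552829),
    (23, 29072653624995979348194825778923, 0, 525561976066997013453),
    (23, 29447796924924099226303164414871, 0, 95950220534018743763),
    (24, 18892628429842712815365678544245, 0, 119550095909770941704),
    (25, 29467044518476957397232443579223, 0, 72313687180465762769),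
    (26, 28481812739598727095060991274919, 0, 247762092041016048775),
    (26, 18892628432202039386367166633333, 0, 98415594870622591736),
    (27, 18924055354440078875918386050421, 0, 200938805183269742504),
    (28, 28500739827163568040387585890151, 0, 143978458573598894269),
    (28, 29314307246815684080604546324327, 0, 266545343570703038135),
    (29, 19306560743240182991947841131381, 0, 268466313834985503224),
    (29, 34143253611890098008056820071326, 1, 240923876649274672760),
    (30, 29072651208915754473642892638939, 0, 576936299156271236729),
    (31, 29447334170658790833381489105751, 0, 62766072358269278929),
    (31, 29033830780226698102654975720791, 0, 691556195307276719),
    (31, 27726035918145231459962320706903, 0, 62790781240152058609),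
    (32, 29314307246520223105547222039259, 0, 589016009514141765441),
    (33, 29072651248701576202207802371819, 0, 548655291007322881915),
    (34, 19325993781574005505194822979182, 0, 319820533108302217686),
    (35, 29033833196307203327780531419867, 0, 588746726965113463661),
    (35, 30011822820101382769672578625447, 0, 176378817872720034143),
    (35, 33552415211002214109941706488734, 1, 289380569415788908736),
    (36, 28481658785542351693899755125655, 0, 176981965779684354835),
    (37, 32942413125878339767336457415673, 1, 415553096685428747816),
    (38, 19870774419090567634022295338142, 0, 434609755771497247194),
    (39, 29072651208876275482936396920555, 0, 523955994645708675559),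
    (39, 29314152957270874965371744137063, 0, 218282708225313565889),
    (40, 29072651246599326574222721332971, 0, 527347331414912038583),
    (40, 17546319112566101415178320672181, 0, 247848832359883317408),
    (41, 18885234590555479486286656105909, 0, 247788633467391249344),
    (42, 29072653664782143353256259861847, 0, 218400693443430905237),
    (43, 29294567895115475686339888199403, 0, 531870036610510040431),
    (43, 32750703472168877844512336182174, 1, 266978624641599825410),
    (44, 17538896304825093519196322360757, 0, 95671371888660574064),
    (44, 34143253949412466084634033867769, 1, 442133497203743491704),
    (45, 29447302795496172996175598434151, 0, 218225839946681116377),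
    (46, 29026439387400067061180117400919, 0, 134750926383262940221),
    (46, 27852100672228812912078625681255, 0, 218293660720665671625),
    (47, 29447334206019857265773117799319, 0, 116779834535662064627),
    (48, 29026439354645041293107169318759, 0, 288853700677148412405),
    (49, 29034016222316257511477362391959, 0, 96761309341862163443),
    (50, 29072651512990456995847651309415, 0, 134750572452447525351),
    (50, 30012285461058313598976262338471, 0, 176395889634288391455),
    (51, 29866478976473111535594016553691, 0, 578242060975720355065),
    (52, 28500737410197065166009591987607, 0, 96761093591354722415),
    (52, 18924052974929994038359846018142, 0, 305221837914377834970),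
    (53, 27725879436844487121507433954647, 0, 134750926384195753437),
    (53, 34104924934273978692685349966841, 1, 441103048638918218228),
    (54, 29072651234829855472349915347863, 0, 253798810469485605875),
    (54, 29314307232353231743621401066203, 0, 581756206914820525889),
    (55, 28481629715893944809897462578519, 0, 199264895162717144405),
    (55, 27687492430731367769761413135255, 0, 46453729214466658745),
    (56, 29072496921691480608363187518295, 0, 218428288610729690745),
    (57, 19870619527847235254029907776885, 0, 98414753471264864760),
    (58, 32922392268665563815067035948025, 1, 370672548071525540594),
    (58, 34142788780173331393183269727737, 1, 424760131619653533750),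
    (59, 30019363285854894509134765309147, 0, 570366380287962173373),
    (59, 35089965686805245196056755239838, 1, 240799656062750019516),
    (60, 30011930808443875011150226568939, 0, 523956099808024195559),
    (60, 27698700396025659247065534543719, 0, 218224756129439788225),
    (61, 33532637495311344790282381811038, 1, 215362893997100236404),
    (61, 18320829990118644252086128987509, 0, 144027420280163976536),
    (62, 19850752920607492117443944369774, 0, 302870324695790913558),
    (62, 19850755299258635836932912116661, 0, 96762087806083949856),
    (63, 29293640460050598945124548292331, 0, 548655291008827692221),
    (63, 19724378792475882538276562466229, 0, 71911181562523727008),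
    (64, 29426675458470440726516675296475, 0, 555191147546492775495),
    (65, 28488401554986638005975354014615, 0, 130343485365540713459),
    (66, 28318873336827160288326135012059, 0, 589074148198249825745),
    (66, 18177668457123331115963117170101, 0, 182991641069521455760),
    (67, 26977018815802046347862284877019, 0, 567589321401992367937),
    (68, 26280806200142030116662612307815, 0, 175516916432358751367),
    (69, 2327089028931725498947518421979, 0, 219561977741140555560)]

/-- Hamiltonian paths of the cubic graph without its last vertex: the start and the turns. -/
def cubicPaths : List (ℕ × ℕ) :=
  [(3, 143976050302928285264), (6, 404928894049923103636), (129, 254370007453694608847)]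

/-- The edge with a given number. -/
def cubicEdge (t : ℕ) : Fin 102 ⊕ Fin 3 :=
  if h : t < 102 then Sum.inl ⟨t, h⟩ else Sum.inr (Fin.ofNat 3 (t - 102))

/-- The number of an edge. -/
def cubicCode : Fin 102 ⊕ Fin 3 → ℕ
  | Sum.inl t => t
  | Sum.inr k => k + 102

/-- The vertex with a given number. -/
def cubicVert (u : ℕ) : Option (Fin 69) :=
  if h : u < 69 then some ⟨u, h⟩ else none

/-- The number of a vertex. -/
def cubicVertCode : Option (Fin 69) → ℕ
  | some u => u
  | none => 69

/-- The number of the edge of an incidence. -/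
def stateCode (s : ℕ) : ℕ := (cubicTable >>> (7 * s)) % 128

/-- The other incidence with the same edge. -/
def statePartner (s : ℕ) : ℕ := (partnerTable >>> (8 * s)) % 256

/-- The edges at the vertices of the cubic graph but the last. -/
def cubicLoc (u : Fin 69) (i : Fin 3) : Fin 102 ⊕ Fin 3 := cubicEdge (stateCode (3 * u + i))

theorem cubicEdge_code (t : Fin 102 ⊕ Fin 3) : cubicEdge (cubicCode t) = t := by
  revert t; decide +kernel

theorem cubicCode_edge : ∀ t < 105, cubicCode (cubicEdge t) = t := by
  decide +kernel

theorem cubicVert_code (u : Option (Fin 69)) : cubicVert (cubicVertCode u) = u := by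
  revert u; decide +kernel

theorem cubicVertCode_vert : ∀ u < 70, cubicVertCode (cubicVert u) = u := by
  decide +kernel

theorem cubicCode_lt (t : Fin 102 ⊕ Fin 3) : cubicCode t < 105 := by
  revert t; decide +kernel

theorem cubicVertCode_lt (u : Option (Fin 69)) : cubicVertCode u < 70 := by
  revert u; decide +kernel

theorem termOne_cubicPass : ∀ s < 210, termOne cubicLoc (cubicVert (s / 3)) (Fin.ofNat 3 s) =
    cubicEdge (stateCode s) := by
  decide +kernel

theorem stateCode_lt : ∀ s < 210, stateCode s < 105 := by
  decide +kernel

theorem termOne_code (u : Option (Fin 69)) (i : Fin 3) :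
    termOne cubicLoc u i = cubicEdge (stateCode (3 * cubicVertCode u + i)) := by
  have h := termOne_cubicPass (3 * cubicVertCode u + i) (by have := cubicVertCode_lt u; omega)
  have h1 : (3 * cubicVertCode u + i) / 3 = cubicVertCode u := by omega
  have h2 : Fin.ofNat 3 (3 * cubicVertCode u + i) = i := by
    apply Fin.ext
    simp only [Fin.ofNat]
    omega
  rw [← h, h1, h2, cubicVert_code]

theorem cubicCode_termOne (u : Option (Fin 69)) (i : Fin 3) :
    cubicCode (termOne cubicLoc u i) = stateCode (3 * cubicVertCode u + i) := by
  rw [termOne_code, cubicCode_edge]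
  exact stateCode_lt _ (by have := cubicVertCode_lt u; omega)

/-- One of the incidences of an edge. -/
def edgeState (t : ℕ) : ℕ := (edgeStateTable >>> (8 * t)) % 256

/-- An incidence is numbered by three times its vertex plus its position. The tables list both
incidences of every edge, so that having exactly two of them is checked by lookup instead of a
search through all pairs. -/
theorem edgeState_spec : ∀ t < 105, edgeState t < 210 ∧ statePartner (edgeState t) < 210 ∧
    edgeState t ≠ statePartner (edgeState t) ∧
    statePartner (statePartner (edgeState t)) = edgeState t ∧
    stateCode (edgeState t) = t ∧ stateCode (statePartner (edgeState t)) = t := by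
  decide +kernel

theorem eq_edgeState : ∀ s < 210, s = edgeState (stateCode s) ∨
    s = statePartner (edgeState (stateCode s)) := by
  decide +kernel

theorem statePartner_div : ∀ u < 70, ∀ i i' : Fin 3,
    statePartner (3 * u + i) / 3 = statePartner (3 * u + i') / 3 → i = i' := by
  decide +kernel

/-- The number of an incidence. -/
def stateOf (p : Option (Fin 69) × Fin 3) : ℕ := 3 * cubicVertCode p.1 + p.2

/-- The incidence with a given number. -/
def ofState (s : ℕ) : Option (Fin 69) × Fin 3 := (cubicVert (s / 3), Fin.ofNat 3 s)

theorem stateOf_lt (p : Option (Fin 69) × Fin 3) : stateOf p < 210 := by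
  have := cubicVertCode_lt p.1
  rw [stateOf]
  omega

theorem ofState_stateOf (p : Option (Fin 69) × Fin 3) : ofState (stateOf p) = p := by
  have h1 : stateOf p / 3 = cubicVertCode p.1 := by
    rw [stateOf]
    omega
  refine Prod.ext ?_ (Fin.ext ?_)
  · rw [ofState, h1, cubicVert_code]
  · simp only [ofState, Fin.ofNat, stateOf]
    omega

theorem stateOf_ofState {s : ℕ} (hs : s < 210) : stateOf (ofState s) = s := by
  rw [stateOf, ofState, cubicVertCode_vert _ (by omega)]
  simp only [Fin.ofNat]
  omega

theorem termOne_eq_iff {p : Option (Fin 69) × Fin 3} {t : Fin 102 ⊕ Fin 3} :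
    termOne cubicLoc p.1 p.2 = t ↔ stateCode (stateOf p) = cubicCode t := by
  rw [stateOf, ← cubicCode_termOne]
  exact ⟨congrArg _, fun h => by rw [← cubicEdge_code t, ← h, cubicEdge_code]⟩

theorem statePartner_of_ne {s s' : ℕ} (hs : s < 210) (hs' : s' < 210) (hne : s ≠ s')
    (h : stateCode s = stateCode s') : statePartner s = s' := by
  have h1 := eq_edgeState s hs
  have h2 := eq_edgeState s' hs'
  have h3 := edgeState_spec _ (stateCode_lt s hs)
  rw [← h] at h2
  rcases h1 with h1 | h1 <;> rcases h2 with h2 | h2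
  · exact absurd (h1.trans h2.symm) hne
  · rw [h2, ← h1]
  · rw [h2]
    conv_lhs => rw [h1]
    exact h3.2.2.2.1
  · exact absurd (h1.trans h2.symm) hne

theorem isCubicIncidence_cubicLoc : IsCubicIncidence (termOne cubicLoc) where
  inj := by decide +kernel
  two t := by
    have hA := edgeState_spec _ (cubicCode_lt t)
    have : (univ.filter fun p : Option (Fin 69) × Fin 3 => termOne cubicLoc p.1 p.2 = t) =
        {ofState (edgeState (cubicCode t)), ofState (statePartner (edgeState (cubicCode t)))} := by
      ext p
      simp only [mem_filter, mem_univ, true_and, mem_insert, mem_singleton, termOne_eq_iff]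
      constructor
      · intro h
        have := eq_edgeState _ (stateOf_lt p)
        rw [h] at this
        rcases this with h | h
        · exact Or.inl (by rw [← h, ofState_stateOf])
        · exact Or.inr (by rw [← h, ofState_stateOf])
      · rintro (rfl | rfl)
        · rw [stateOf_ofState hA.1, hA.2.2.2.2.1]
        · rw [stateOf_ofState hA.2.1, hA.2.2.2.2.2]
    rw [this, card_pair]
    intro h
    have := congrArg stateOf h
    rw [stateOf_ofState hA.1, stateOf_ofState hA.2.1] at this
    exact hA.2.2.1 this
  share u v i i' j j' huv h h' := by
    have key : ∀ i j, termOne cubicLoc u i = termOne cubicLoc v j →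
        statePartner (3 * cubicVertCode u + i) / 3 = cubicVertCode v := by
      intro i j h
      have hne : stateOf (u, i) ≠ stateOf (v, j) := fun h => huv (by
        have := congrArg ofState h
        rw [ofState_stateOf, ofState_stateOf] at this
        exact (Prod.ext_iff.1 this).1)
      have := statePartner_of_ne (stateOf_lt (u, i)) (stateOf_lt (v, j)) hne (by
        rw [termOne_eq_iff (p := (u, i)), cubicCode_termOne] at h
        exact h)
      change statePartner (3 * cubicVertCode u + i) = 3 * cubicVertCode v + j at this
      omega
    exact statePartner_div _ (cubicVertCode_lt u) i i' ((key i j h).trans (key i' j' h').symm)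

/-- The left face of an edge of the cubic graph. -/
def cubicLeft (t : Fin 102 ⊕ Fin 3) : Fin 37 :=
  Fin.ofNat 37 ((cubicFaceTable >>> (12 * cubicCode t)) % 64)

/-- The right face of an edge of the cubic graph. -/
def cubicRight (t : Fin 102 ⊕ Fin 3) : Fin 37 :=
  Fin.ofNat 37 ((cubicFaceTable >>> (12 * cubicCode t + 6)) % 64)

theorem cubic_face_even : ∀ (u : Option (Fin 69)) (φ : Fin 37),
    Even (((cubicInc (termOne cubicLoc) u).filter fun e => cubicLeft e = φ).card +
      ((cubicInc (termOne cubicLoc) u).filter fun e => cubicRight e = φ).card) := by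
  decide +kernel

/-- The ring passes through the last vertex, which contributes two of its four edges. -/
theorem isRing_cubic : IsRing (cubicInc (termOne cubicLoc)) cubicLeft cubicRight
    (fun i => Fin.castLE (by decide) i)
    ![Sum.inr 1, Sum.inr 0, Sum.inl 3, Sum.inl 0] :=
  ⟨by decide +kernel, by decide +kernel, by decide +kernel, by decide +kernel,
    fun v => by revert v; decide +kernel, by decide +kernel⟩

/-- The point for an edge in the drawing of the cubic graph. -/
def spherePoint (t : Fin 102 ⊕ Fin 3) : ℕ × ℕ :=
  ((spherePoints >>> (14 * cubicCode t)) % 128, (spherePoints >>> (14 * cubicCode t + 7)) % 128)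

/-- The point for an edge in the drawing of the cubic graph without its last vertex. -/
def patchPoint (t : Fin 102 ⊕ Fin 3) : ℕ × ℕ :=
  ((patchPoints >>> (14 * cubicCode t)) % 128, (patchPoints >>> (14 * cubicCode t + 7)) % 128)

theorem isComplex_sphere : IsComplex (natPoint ∘ spherePoint) (termOne cubicLoc) :=
  isComplex_of_sepTest (by decide +kernel) (by decide +kernel)
    (Function.LeftInverse.injective cubicVert_code) (by decide +kernel)

theorem isComplex_patch : IsComplex (natPoint ∘ patchPoint) cubicLoc :=
  isComplex_of_sepTest (by decide +kernel) (by decide +kernel) Fin.val_injective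
    (by decide +kernel)

theorem cross_sphere_ne (u : Option (Fin 69)) :
    cross ((natPoint ∘ spherePoint) (termOne cubicLoc u 0))
      ((natPoint ∘ spherePoint) (termOne cubicLoc u 1))
      ((natPoint ∘ spherePoint) (termOne cubicLoc u 2)) ≠ 0 :=
  cross_natPoint_ne (by revert u; decide +kernel)

theorem cross_patch_ne (u : Fin 69) :
    cross ((natPoint ∘ patchPoint) (cubicLoc u 0)) ((natPoint ∘ patchPoint) (cubicLoc u 1))
      ((natPoint ∘ patchPoint) (cubicLoc u 2)) ≠ 0 :=
  cross_natPoint_ne (by revert u; decide +kernel)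

theorem patch_corner (i : Fin 3) : (natPoint ∘ patchPoint) (Sum.inr i) = stdCorner 100 i := by
  have : ∀ i, patchPoint (Sum.inr i) = ![(0, 0), (100, 0), (0, 100)] i := by decide +kernel
  simp only [Function.comp_apply, this]
  fin_cases i <;> simp [natPoint, stdCorner]

theorem patch_std (t : Fin 102 ⊕ Fin 3) : InStd 100 ((natPoint ∘ patchPoint) t) := by
  have : ∀ t, (patchPoint t).1 + (patchPoint t).2 ≤ 100 := by decide +kernel
  refine ⟨Nat.cast_nonneg _, Nat.cast_nonneg _, ?_⟩
  simp only [Function.comp_apply, natPoint]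
  exact_mod_cast this t

end CubicGraph

/-! ### Decoding and testing the recorded cycles -/

section CubicTours

/-- The incidence by which a vertex is left, for a given turn. -/
def stateExit (s b : ℕ) : ℕ := (s % 3 + 1 + b % 2) % 3

/-- The incidence reached next, for a given turn. -/
def stateNext (s b : ℕ) : ℕ := statePartner (3 * (s / 3) + stateExit s b)

/-- The incidences at which the vertices are entered and left, for given turns. -/
def passCodes : ℕ → ℕ → ℕ → List (ℕ × ℕ)
  | 0, _, _ => []
  | n + 1, s, b => (s, stateExit s b) :: passCodes n (stateNext s b) (b / 2)

/-- The incidence reached at the end. -/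
def passEnd : ℕ → ℕ → ℕ → ℕ
  | 0, s, _ => s
  | n + 1, s, b => passEnd n (stateNext s b) (b / 2)

/-- The pass through a vertex with given codes. -/
def cubicPass (p : ℕ × ℕ) : Option (Fin 69) × Fin 3 × Fin 3 :=
  (cubicVert (p.1 / 3), Fin.ofNat 3 p.1, Fin.ofNat 3 p.2)

theorem stateNext_spec : ∀ s < 210, ∀ b < 2, stateNext s b < 210 ∧
    termOne cubicLoc (cubicVert (s / 3)) (Fin.ofNat 3 (stateExit s b)) =
      cubicEdge (stateCode (stateNext s b)) ∧
    Fin.ofNat 3 s ≠ Fin.ofNat 3 (stateExit s b) := by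
  decide +kernel

/-- A turn depends only on the lowest bit of the code, so the finite check in `stateNext_spec`
covers all codes. -/
theorem stateExit_mod (s b : ℕ) : stateExit s (b % 2) = stateExit s b := by
  simp [stateExit]

theorem stateNext_mod (s b : ℕ) : stateNext s (b % 2) = stateNext s b := by
  simp [stateNext, stateExit_mod]

theorem passCodes_lt {s : ℕ} (hs : s < 210) (n b : ℕ) : ∀ p ∈ passCodes n s b, p.1 < 210 := by
  induction n generalizing s b with
  | zero => simp [passCodes]
  | succ n ih =>
    intro p hp
    rcases List.mem_cons.1 hp with rfl | hp
    · exact hs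
    · have := (stateNext_spec s hs (b % 2) (Nat.mod_lt _ (by omega))).1
      rw [stateNext_mod] at this
      exact ih this _ p hp

theorem isRoute_passCodes {s : ℕ} (hs : s < 210) (n b : ℕ) :
    IsRoute (termOne cubicLoc) (cubicEdge (stateCode s)) ((passCodes n s b).map cubicPass)
      (cubicEdge (stateCode (passEnd n s b))) := by
  induction n generalizing s b with
  | zero => rfl
  | succ n ih =>
    obtain ⟨h1, h2, h3⟩ := stateNext_spec s hs (b % 2) (Nat.mod_lt _ (by omega))
    rw [stateNext_mod, stateExit_mod] at h2
    rw [stateNext_mod] at h1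
    rw [stateExit_mod] at h3
    refine ⟨termOne_cubicPass s hs, h3, ?_⟩
    change IsRoute _ (termOne cubicLoc (cubicVert (s / 3)) (Fin.ofNat 3 (stateExit s b))) _ _
    rw [h2]
    exact ih h1 _

/-- Codes without repetitions give a simple route, and tell what it uses. -/
theorem simple_of_scan {P : List (ℕ × ℕ)} (hP : ∀ p ∈ P, p.1 < 210) {blobs edges : ℕ}
    (hb : scan 0 (P.map fun p => p.1 / 3) = some blobs)
    (he : scan 0 (P.map fun p => stateCode p.1) = some edges) :
    IsSimpleRoute (termOne cubicLoc) (P.map cubicPass) ∧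
      (∀ u, u ∈ (P.map cubicPass).map Prod.fst ↔ blobs.testBit (cubicVertCode u)) ∧
      ∀ t, RouteUses (termOne cubicLoc) (P.map cubicPass) t ↔ edges.testBit (cubicCode t) := by
  obtain ⟨hb1, -, hb2⟩ := scan_spec hb
  obtain ⟨he1, -, he2⟩ := scan_spec he
  have hb3 : (P.map cubicPass).map Prod.fst = (P.map fun p => p.1 / 3).map cubicVert := by
    simp [List.map_map, cubicPass, Function.comp_def]
  have he3 : ((P.map cubicPass).map fun s => termOne cubicLoc s.1 s.2.1) =
      (P.map fun p => stateCode p.1).map cubicEdge := by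
    rw [List.map_map, List.map_map]
    exact List.map_congr_left fun p hp => termOne_cubicPass p.1 (hP p hp)
  have hblt : ∀ x ∈ P.map (fun p => p.1 / 3), x < 70 := by
    intro x hx
    obtain ⟨p, hp, rfl⟩ := List.mem_map.1 hx
    have := hP p hp
    omega
  have helt : ∀ x ∈ P.map (fun p => stateCode p.1), x < 105 := by
    intro x hx
    obtain ⟨p, hp, rfl⟩ := List.mem_map.1 hx
    exact stateCode_lt _ (hP p hp)
  refine ⟨⟨?_, ?_⟩, fun u => ?_, fun t => ?_⟩
  · rw [hb3]
    refine hb1.map_on fun x hx y hy hxy => ?_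
    rw [← cubicVertCode_vert x (hblt x hx), hxy, cubicVertCode_vert y (hblt y hy)]
  · rw [he3]
    refine he1.map_on fun x hx y hy hxy => ?_
    rw [← cubicCode_edge x (helt x hx), hxy, cubicCode_edge y (helt y hy)]
  · rw [hb3, hb2, Nat.zero_testBit]
    simp only [Bool.false_eq_true, false_or]
    constructor
    · intro h
      obtain ⟨x, hx, rfl⟩ := List.mem_map.1 h
      rwa [cubicVertCode_vert x (hblt x hx)]
    · exact fun h => List.mem_map.2 ⟨_, h, cubicVert_code u⟩
  · have : RouteUses (termOne cubicLoc) (P.map cubicPass) t ↔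
        t ∈ (P.map cubicPass).map fun s => termOne cubicLoc s.1 s.2.1 := by
      rw [List.mem_map]
      rfl
    rw [this, he3, he2, Nat.zero_testBit]
    simp only [Bool.false_eq_true, false_or]
    constructor
    · intro h
      obtain ⟨x, hx, rfl⟩ := List.mem_map.1 h
      rwa [cubicCode_edge x (helt x hx)]
    · exact fun h => List.mem_map.2 ⟨_, h, cubicEdge_code t⟩

/-- The first incidence of a cycle. -/
def cycleStart (c : ℕ × ℕ × ℕ × ℕ) : ℕ := if c.1 = 69 then 0 else 207 + c.2.2.1 % 3

/-- The passes of a cycle. -/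
def cycleCodes (c : ℕ × ℕ × ℕ × ℕ) : List (ℕ × ℕ) := passCodes 69 (cycleStart c) c.2.2.2

/-- The tour of a cycle. -/
def cycleTour (c : ℕ × ℕ × ℕ × ℕ) : List (Option (Fin 69) × Fin 3 × Fin 3) :=
  (cycleCodes c).map cubicPass

/-- The recorded data of a cycle are correct. -/
def tourTest (c : ℕ × ℕ × ℕ × ℕ) : Bool :=
  Nat.beq (passEnd 69 (cycleStart c) c.2.2.2) (cycleStart c) && Nat.blt c.1 70 &&
    decide (scan 0 ((cycleCodes c).map fun p => p.1 / 3) = some (2 ^ 70 - 1 - 2 ^ c.1)) &&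
    decide (scan 0 ((cycleCodes c).map fun p => stateCode p.1) = some c.2.1) &&
    (List.range 70).all fun u => !(c.2.1.testBit (stateCode (3 * u)) &&
      c.2.1.testBit (stateCode (3 * u + 1)) && c.2.1.testBit (stateCode (3 * u + 2)))

theorem cubicCycles_test : ∀ c ∈ cubicCycles, tourTest c = true := by
  decide +kernel

theorem testBit_compl : ∀ m < 70, ∀ u < 70, (2 ^ 70 - 1 - 2 ^ m).testBit u = true ↔ u ≠ m := by
  decide +kernel

theorem cycleStart_lt (c : ℕ × ℕ × ℕ × ℕ) : cycleStart c < 210 := by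
  rw [cycleStart]
  split_ifs <;> omega

theorem length_passCodes (n s b : ℕ) : (passCodes n s b).length = n := by
  induction n generalizing s b with
  | zero => rfl
  | succ n ih => simp [passCodes, ih]

theorem length_cycleTour (c : ℕ × ℕ × ℕ × ℕ) : (cycleTour c).length = 69 := by
  rw [cycleTour, List.length_map, cycleCodes, length_passCodes]

/-- The properties of the recorded cycles. -/
theorem cycleTour_spec {c : ℕ × ℕ × ℕ × ℕ} (hc : c ∈ cubicCycles) :
    IsNearTour (termOne cubicLoc) (cycleTour c) (cubicVert c.1) ∧ c.1 < 70 ∧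
      (∀ t, RouteUses (termOne cubicLoc) (cycleTour c) t ↔ c.2.1.testBit (cubicCode t)) ∧
      ∀ u, ∃ k, ¬RouteUses (termOne cubicLoc) (cycleTour c) (termOne cubicLoc u k) := by
  have h := cubicCycles_test c hc
  simp only [tourTest, Bool.and_eq_true, decide_eq_true_eq, Nat.beq_eq, Nat.blt_eq] at h
  obtain ⟨⟨⟨⟨h1, h2⟩, h3⟩, h4⟩, h5⟩ := h
  obtain ⟨k1, k2, k3⟩ := simple_of_scan (passCodes_lt (cycleStart_lt c) 69 c.2.2.2) h3 h4
  have hroute := isRoute_passCodes (cycleStart_lt c) 69 c.2.2.2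
  rw [h1] at hroute
  refine ⟨⟨⟨k1, _, hroute⟩, fun u => ?_⟩, h2, k3, fun u => ?_⟩
  · refine (k2 u).trans ((testBit_compl c.1 h2 _ (cubicVertCode_lt u)).trans (not_congr ?_))
    constructor
    · intro h
      rw [← h, cubicVert_code]
    · intro h
      rw [h, cubicVertCode_vert _ h2]
  · by_contra hno
    push Not at hno
    have hb : ∀ k : Fin 3, c.2.1.testBit (stateCode (3 * cubicVertCode u + k)) = true :=
      fun k => by
        have := (k3 _).1 (hno k)
        rwa [cubicCode_termOne] at this
    have := List.all_eq_true.1 h5 _ (List.mem_range.2 (cubicVertCode_lt u))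
    have b0 := hb 0
    have b1 := hb 1
    have b2 := hb 2
    simp only [Fin.val_zero, Fin.val_one, Fin.val_two, Nat.add_zero] at b0 b1 b2
    rw [b0, b1, b2] at this
    cases this

/-- A cycle through the last vertex begins there. -/
theorem cycleTour_through {c : ℕ × ℕ × ℕ × ℕ} (hc : c ∈ cubicCycles) (h69 : c.1 ≠ 69) :
    ∃ i o, ∃ qs : List (Fin 69 × Fin 3 × Fin 3),
      cycleTour c = (none, i, o) :: qs.map liftPass ∧ qs.length = 68 := by
  have hnd := (cycleTour_spec hc).1.tour.simple.blobs
  have hlen := length_cycleTour c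
  obtain ⟨i, o, l, hl⟩ : ∃ i o l, cycleTour c = (none, i, o) :: l := by
    refine ⟨Fin.ofNat 3 (cycleStart c), Fin.ofNat 3 (stateExit (cycleStart c) c.2.2.2),
      (passCodes 68 (stateNext (cycleStart c) c.2.2.2) (c.2.2.2 / 2)).map cubicPass, ?_⟩
    rw [cycleTour, cycleCodes, passCodes, List.map_cons]
    congr 1
    refine Prod.ext ?_ rfl
    have : cycleStart c / 3 = 69 := by
      rw [cycleStart, if_neg h69]
      omega
    simp only [cubicPass, this]
    rfl
  rw [hl] at hnd hlen
  rw [List.map_cons, List.nodup_cons] at hnd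
  obtain ⟨qs, rfl⟩ : ∃ qs : List (Fin 69 × Fin 3 × Fin 3), l = qs.map liftPass := by
    refine ⟨l.map fun s => (s.1.getD 0, s.2), ?_⟩
    rw [List.map_map]
    conv_lhs => rw [← List.map_id l]
    refine List.map_congr_left fun s hs => ?_
    obtain ⟨_ | u, s⟩ := s
    · exact absurd (List.mem_map.2 ⟨_, hs, rfl⟩) hnd.1
    · rfl
  exact ⟨i, o, qs, hl, by simpa using hlen⟩

/-- The tours of a list of cycles. -/
def InTours (L : List (ℕ × ℕ × ℕ × ℕ)) (ps : List (Option (Fin 69) × Fin 3 × Fin 3)) : Prop :=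
  ∃ c ∈ L, ps = cycleTour c

/-- The cycles of a list that avoid an edge. -/
def avoidingCycles (L : List (ℕ × ℕ × ℕ × ℕ)) (t : ℕ) : List (ℕ × ℕ × ℕ × ℕ) :=
  L.filter fun c => !c.2.1.testBit t

/-- The cycles of a list that miss a vertex. -/
def missingCycles (L : List (ℕ × ℕ × ℕ × ℕ)) (u : ℕ) : List (ℕ × ℕ × ℕ × ℕ) :=
  L.filter fun c => Nat.beq c.1 u

/-- A cycle misses a vertex, or the vertex is not on the edge `t` and can be avoided. -/
def edgeVertTest (t u : ℕ) (c : ℕ × ℕ × ℕ × ℕ) : Bool :=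
  Nat.beq c.1 u || c.2.1.testBit (stateCode (3 * u)) &&
    !Nat.beq (stateCode (3 * u)) t && !Nat.beq (stateCode (3 * u + 1)) t &&
      !Nat.beq (stateCode (3 * u + 2)) t

/-- A cycle of a list avoids two given targets. -/
def pairTest (L : List (ℕ × ℕ × ℕ × ℕ)) :
    (Fin 102 ⊕ Fin 3) ⊕ Option (Fin 69) → (Fin 102 ⊕ Fin 3) ⊕ Option (Fin 69) → Bool
  | Sum.inl t, Sum.inl t' => (avoidingCycles L (cubicCode t)).any fun c =>
      !c.2.1.testBit (cubicCode t')
  | Sum.inl t, Sum.inr u => (avoidingCycles L (cubicCode t)).any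
      (edgeVertTest (cubicCode t) (cubicVertCode u))
  | Sum.inr u, Sum.inl t => (avoidingCycles L (cubicCode t)).any
      (edgeVertTest (cubicCode t) (cubicVertCode u))
  | Sum.inr u, Sum.inr v =>
    ((missingCycles L (cubicVertCode u)).any fun c => Nat.beq c.1 (cubicVertCode v) ||
      c.2.1.testBit (stateCode (3 * cubicVertCode v))) ||
    (missingCycles L (cubicVertCode v)).any fun c =>
      c.2.1.testBit (stateCode (3 * cubicVertCode u))

theorem avoidable_of_pairTest {L : List (ℕ × ℕ × ℕ × ℕ)} (hL : L ⊆ cubicCycles)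
    {x y : (Fin 102 ⊕ Fin 3) ⊕ Option (Fin 69)} (h : pairTest L x y = true) :
    Avoidable (InTours L) (termOne cubicLoc) x y := by
  have hout : ∀ c ∈ L, ∀ t, c.2.1.testBit (cubicCode t) = false →
      ¬RouteUses (termOne cubicLoc) (cycleTour c) t := fun c hc t ht hu => by
    have := ((cycleTour_spec (hL hc)).2.2.1 t).1 hu
    rw [ht] at this
    cases this
  have hmiss : ∀ c ∈ L, ∀ u, c.1 = cubicVertCode u → u ∉ (cycleTour c).map Prod.fst :=
    fun c hc u hu hmem => by
      refine ((cycleTour_spec (hL hc)).1.mem u).1 hmem ?_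
      rw [hu, cubicVert_code]
  have hspecial : ∀ c ∈ L, ∀ u, c.2.1.testBit (stateCode (3 * cubicVertCode u)) = true →
      AllowsSpecial (termOne cubicLoc) (cycleTour c) u := fun c hc u hu => by
    refine ⟨((cycleTour_spec (hL hc)).2.2.1 _).2 ?_, (cycleTour_spec (hL hc)).2.2.2 u⟩
    rw [cubicCode_termOne]
    exact hu
  have hmixed : ∀ t u, (avoidingCycles L (cubicCode t)).any (edgeVertTest (cubicCode t) (cubicVertCode u)) = true →
      ∃ ps, InTours L ps ∧ ¬RouteUses (termOne cubicLoc) ps t ∧ (u ∉ ps.map Prod.fst ∨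
        (∀ i, termOne cubicLoc u i ≠ t) ∧ AllowsSpecial (termOne cubicLoc) ps u) := by
    intro t u h
    obtain ⟨c, hc', h⟩ := List.any_eq_true.1 h
    obtain ⟨hc, ht⟩ := List.mem_filter.1 hc'
    simp only [edgeVertTest, Bool.and_eq_true, Bool.or_eq_true, Bool.not_eq_true', Nat.beq_eq,
      Bool.eq_false_iff, ne_eq] at h
    refine ⟨_, ⟨c, hc, rfl⟩, hout c hc t (by simpa using ht), ?_⟩
    rcases h with h2 | ⟨⟨⟨h2, h3⟩, h4⟩, h5⟩
    · exact Or.inl (hmiss c hc u h2)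
    · refine Or.inr ⟨fun i hi => ?_, hspecial c hc u h2⟩
      have := congrArg cubicCode hi
      rw [cubicCode_termOne] at this
      fin_cases i
      exacts [h3 this, h4 this, h5 this]
  rcases x with t | u <;> rcases y with t' | v
  · obtain ⟨c, hc', h⟩ := List.any_eq_true.1 h
    obtain ⟨hc, ht⟩ := List.mem_filter.1 hc'
    exact ⟨_, ⟨c, hc, rfl⟩, hout c hc t (by simpa using ht), hout c hc t' (by simpa using h)⟩
  · exact hmixed t v h
  · exact hmixed t' u h
  · rw [pairTest, Bool.or_eq_true, List.any_eq_true, List.any_eq_true] at h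
    rcases h with ⟨c, hc', h⟩ | ⟨c, hc', h⟩
    · obtain ⟨hc, hu⟩ := List.mem_filter.1 hc'
      have hu' := hmiss c hc u (by simpa using hu)
      rw [Bool.or_eq_true, Nat.beq_eq] at h
      exact ⟨_, ⟨c, hc, rfl⟩, Or.inl ⟨hu', h.imp (hmiss c hc v) (hspecial c hc v)⟩⟩
    · obtain ⟨hc, hv⟩ := List.mem_filter.1 hc'
      exact ⟨_, ⟨c, hc, rfl⟩, Or.inr ⟨hmiss c hc v (by simpa using hv), hspecial c hc u h⟩⟩

/-- The recorded cycles through the last vertex. -/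
def throughCycles : List (ℕ × ℕ × ℕ × ℕ) := cubicCycles.filter fun c => !Nat.beq c.1 69

theorem throughCycles_subset : throughCycles ⊆ cubicCycles :=
  fun _ h => List.mem_of_mem_filter h

/-- A cycle through the last vertex uses two of the three dangling edges, so two different dangling
edges cannot both be avoided; this explains the hypothesis. -/
theorem pairTest_edges : ∀ t t' : Fin 102 ⊕ Fin 3, t.isLeft ∨ t = t' →
    pairTest throughCycles (Sum.inl t) (Sum.inl t') = true := by
  decide +kernel

theorem pairTest_mixed : ∀ (t : Fin 102 ⊕ Fin 3) (u : Fin 69),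
    pairTest throughCycles (Sum.inl t) (Sum.inr (some u)) = true := by
  decide +kernel

theorem pairTest_verts : ∀ u v : Fin 69,
    pairTest throughCycles (Sum.inr (some u)) (Sum.inr (some v)) = true := by
  decide +kernel

/-- The pairs of targets that cycles through the last vertex cannot handle: those with two dangling
edges or with the last vertex itself. -/
theorem pairTest_last : (∀ k k' : Fin 3,
      pairTest cubicCycles (Sum.inl (Sum.inr k)) (Sum.inl (Sum.inr k')) = true) ∧
    (∀ t, pairTest cubicCycles (Sum.inl t) (Sum.inr none) = true) ∧
    ∀ u, pairTest cubicCycles (Sum.inr none) (Sum.inr u) = true ∧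
      pairTest cubicCycles (Sum.inr u) (Sum.inr none) = true := by
  decide +kernel

end CubicTours

/-! ### Consequences for avoidance, connectedness and circuits -/

section CubicConsequences

theorem avoidable_through {w w' : ((Fin 102 ⊕ Fin 3) ⊕ Fin 69 × Fin 36)}
    (h : (∀ k, w ≠ dangling k) ∨ w = w') :
    Avoidable (InTours throughCycles) (termOne cubicLoc)
      (targetOf (Sum.map id (Prod.map some id) w))
      (targetOf (Sum.map id (Prod.map some id) w')) := by
  refine avoidable_of_pairTest throughCycles_subset ?_
  rcases w with t | ⟨u, y⟩ <;> rcases w' with t' | ⟨u', y'⟩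
  · refine pairTest_edges t t' ?_
    rcases h with h | h
    · rcases t with t | k
      · exact Or.inl rfl
      · exact absurd rfl (h k)
    · exact Or.inr (Sum.inl_injective h)
  · exact pairTest_mixed t u'
  · exact pairTest_mixed t' u
  · exact pairTest_verts u u'

theorem Avoidable.mono {ι T : Type*} {𝒞 𝒟 : List (ι × Fin 3 × Fin 3) → Prop} {term : ι → Fin 3 → T}
    (h : ∀ ps, 𝒞 ps → 𝒟 ps) {x y : T ⊕ ι} (hxy : Avoidable 𝒞 term x y) : Avoidable 𝒟 term x y := by
  rcases x with t | u <;> rcases y with t' | v <;> obtain ⟨ps, hps, h'⟩ := hxy <;>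
    exact ⟨ps, h ps hps, h'⟩

/-- Most pairs of targets are handled by cycles through the last vertex, the others by the full
list. -/
theorem avoidable_cubic (x y : (Fin 102 ⊕ Fin 3) ⊕ Option (Fin 69)) :
    Avoidable (InTours cubicCycles) (termOne cubicLoc) x y := by
  have hthr : pairTest throughCycles x y = true →
      Avoidable (InTours cubicCycles) (termOne cubicLoc) x y := fun h =>
    (avoidable_of_pairTest throughCycles_subset h).mono
      fun ps ⟨c, hc, h⟩ => ⟨c, throughCycles_subset hc, h⟩
  have hall : pairTest cubicCycles x y = true →
      Avoidable (InTours cubicCycles) (termOne cubicLoc) x y :=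
    avoidable_of_pairTest fun _ h => h
  rcases x with t | _ | u <;> rcases y with t' | _ | v
  · rcases t with t | k
    · exact hthr (pairTest_edges _ _ (Or.inl rfl))
    · rcases t' with t' | k'
      · obtain ⟨ps, h1, h2, h3⟩ := avoidable_of_pairTest throughCycles_subset
          (pairTest_edges (Sum.inl t') (Sum.inr k) (Or.inl rfl))
        obtain ⟨c, hc, rfl⟩ := h1
        exact ⟨_, ⟨c, throughCycles_subset hc, rfl⟩, h3, h2⟩
      · exact hall (pairTest_last.1 k k')
  · exact hall (pairTest_last.2.1 t)
  · exact hthr (pairTest_mixed t v)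
  · exact hall (pairTest_last.2.1 t')
  · exact hall (pairTest_last.2.2 none).1
  · exact hall (pairTest_last.2.2 (some v)).1
  · exact hthr (pairTest_mixed t' u)
  · exact hall (pairTest_last.2.2 (some u)).2
  · exact hthr (pairTest_verts u v)

theorem cubicConn_edges {X : Finset (Fin 102 ⊕ Fin 3)} (hX : X.card < 3) :
    CubicConn (termOne cubicLoc) X ∅ := by
  refine cubicConn_of_nearTours isCubicIncidence_cubicLoc (fun t t' => ?_) hX
  obtain ⟨ps, ⟨c, hc, rfl⟩, h1, h2⟩ := avoidable_cubic (Sum.inl t) (Sum.inl t')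
  exact ⟨_, _, (cycleTour_spec hc).1, h1, h2⟩

/-- Avoiding the pair (u, u) forces a cycle that misses `u`, since every alternative in the
definition requires one of the two targets to be missed. -/
theorem cubicConn_vert (u : Option (Fin 69)) : CubicConn (termOne cubicLoc) ∅ {u} := by
  obtain ⟨ps, ⟨c, hc, rfl⟩, h⟩ := avoidable_cubic (Sum.inr u) (Sum.inr u)
  have hu : u ∉ (cycleTour c).map Prod.fst := by
    rcases h with h | h <;> exact h.1
  have hn := (cycleTour_spec hc).1
  rw [hn.mem, not_not] at hu
  rw [hu]
  exact cubicConn_of_nearTour hn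

theorem ne_of_mem_throughCycles {c : ℕ × ℕ × ℕ × ℕ} (hc : c ∈ throughCycles) : c.1 ≠ 69 := by
  have := (List.mem_filter.1 hc).2
  intro h
  rw [h] at this
  cases this

theorem cubicConn_last {X : Finset (Fin 102 ⊕ Fin 3)} (hX : X.card < 2) :
    CubicConn (termOne cubicLoc) X {none} := by
  refine cubicConn_of_nearTours_through isCubicIncidence_cubicLoc (fun t => ?_) hX
  obtain ⟨ps, ⟨c, hc, rfl⟩, h1, -⟩ := avoidable_of_pairTest throughCycles_subset
    (pairTest_edges t t (Or.inr rfl))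
  have hc' := throughCycles_subset hc
  obtain ⟨i, o, qs, hqs, -⟩ := cycleTour_through hc' (ne_of_mem_throughCycles hc)
  rw [hqs] at h1
  exact ⟨i, o, _, _, hqs ▸ (cycleTour_spec hc').1, h1⟩

theorem isPlaneMap_cubic : IsPlaneMap (cubicInc (termOne cubicLoc)) cubicLeft cubicRight where
  ends := isCubicIncidence_cubicLoc.card_ends
  connected f hf u v := by
    have := cubicConn_edges (X := ∅) (by simp) (fun x => f x = f u) (fun a b i j _ _ hab _ => by
      have : f a = f b := hf (termOne cubicLoc a i) a b (mem_image_of_mem _ (mem_univ i))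
        (hab ▸ mem_image_of_mem _ (mem_univ j))
      rw [this]) u v (by simp) (by simp)
    exact (this.1 rfl).symm
  dual_connected := dual_connected_of_lt (by decide +kernel) (by decide +kernel)
  face_even := cubic_face_even
  euler := rfl

/-- The cubic graph is not Hamiltonian, again by the ring of exceptional faces; 70 is 1 modulo 3. -/
theorem card_circuit_cubic_le {C : Finset (Fin 102 ⊕ Fin 3)}
    (hC : EdgeSet.IsCircuit (cubicInc (termOne cubicLoc)) C) : C.card ≤ 69 :=
  Nat.le_of_lt_succ (isRing_cubic.card_lt isPlaneMap_cubic (by decide) (by decide) hC)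

/-- The recorded path ends by the dangling edge `j`. -/
def endTest (j : ℕ) (p : ℕ × ℕ) : Bool :=
  match scan 0 ((passCodes 68 (stateNext p.1 p.2) (p.2 / 2)).map fun q => q.1 / 3),
    scan 0 ((passCodes 68 (stateNext p.1 p.2) (p.2 / 2)).map fun q => stateCode q.1) with
  | some blobs, some edges =>
    Nat.blt p.1 207 &&
      Nat.beq (stateCode (passEnd 68 (stateNext p.1 p.2) (p.2 / 2))) (102 + j) &&
      !blobs.testBit 69 && !blobs.testBit (p.1 / 3) && !edges.testBit 102 &&
      !edges.testBit 103 && !edges.testBit 104 && (List.range 3).all fun i =>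
        Nat.blt (stateCode (3 * (p.1 / 3) + i)) 102 && (Nat.beq i (stateExit p.1 p.2) ||
          !edges.testBit (stateCode (3 * (p.1 / 3) + i)))
  | _, _ => false

theorem cubicPaths_test : ∀ j : Fin 3, ∃ p ∈ cubicPaths, endTest j p = true := by
  decide +kernel

theorem routeUses_liftPass {ι T : Type*} {loc : ι → Fin 3 → T ⊕ Fin 3}
    {qs : List (ι × Fin 3 × Fin 3)} {t : T ⊕ Fin 3} :
    RouteUses (termOne loc) (qs.map liftPass) t ↔ RouteUses loc qs t := by
  simp only [RouteUses, List.mem_map, exists_exists_and_eq_and]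
  rfl

theorem exists_liftPass {ι : Type*} {l : List (Option ι × Fin 3 × Fin 3)}
    (h : none ∉ l.map Prod.fst) : ∃ qs : List (ι × Fin 3 × Fin 3), l = qs.map liftPass := by
  induction l with
  | nil => exact ⟨[], rfl⟩
  | cons a l ih =>
    rw [List.map_cons, List.mem_cons, not_or] at h
    obtain ⟨qs, rfl⟩ := ih h.2
    obtain ⟨_ | u, s⟩ := a
    · exact absurd rfl h.1
    · exact ⟨(u, s) :: qs, rfl⟩

/-- A recorded path through all 69 vertices other than the last one. The first vertex is split off,
because its gadget is traversed by a Hamiltonian path; 68 passes remain. -/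
theorem exists_isEndRoute (j : Fin 3) : ∃ u o qs, IsEndRoute cubicLoc u o qs j ∧ qs.length = 68 := by
  obtain ⟨⟨s, b⟩, -, h⟩ := cubicPaths_test j
  rw [endTest] at h
  split at h
  swap
  · cases h
  rename_i blobs edges hb he
  simp only [Bool.and_eq_true, Bool.or_eq_true, Bool.not_eq_true', Nat.beq_eq, Nat.blt_eq,
    List.all_eq_true, List.mem_range] at h
  obtain ⟨⟨⟨⟨⟨⟨⟨h1, h2⟩, h3⟩, h4⟩, h5⟩, h6⟩, h7⟩, h8⟩ := h
  obtain ⟨n1, n2, n3⟩ := stateNext_spec s (by omega) (b % 2) (Nat.mod_lt _ (by omega))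
  rw [stateNext_mod] at n1
  rw [stateNext_mod, stateExit_mod] at n2
  obtain ⟨k1, k2, k3⟩ := simple_of_scan (passCodes_lt n1 68 (b / 2)) hb he
  have hroute := isRoute_passCodes n1 68 (b / 2)
  have hlen : ((passCodes 68 (stateNext s b) (b / 2)).map cubicPass).length = 68 := by
    rw [List.length_map, length_passCodes]
  generalize (passCodes 68 (stateNext s b) (b / 2)).map cubicPass = l at k1 k2 k3 hroute hlen
  obtain ⟨qs, rfl⟩ := exists_liftPass (l := l) (by
    rw [k2]
    change ¬blobs.testBit 69 = true
    rw [h3]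
    simp)
  rw [← n2, h2] at hroute
  have hs3 : s / 3 < 69 := by omega
  have hu : cubicVert (s / 3) = some ⟨s / 3, hs3⟩ := by rw [cubicVert, dif_pos hs3]
  rw [hu, termOne_some] at hroute
  have hj : cubicEdge (102 + j) = Sum.inr j := by clear * -; revert j; decide
  rw [hj, isRoute_termOne] at hroute
  have hloc : ∀ i : Fin 3, cubicCode (cubicLoc ⟨s / 3, hs3⟩ i) = stateCode (3 * (s / 3) + i) :=
    fun i => cubicCode_termOne (some ⟨s / 3, hs3⟩) i
  refine ⟨⟨s / 3, hs3⟩, Fin.ofNat 3 (stateExit s b), qs, ⟨hroute, ⟨?_, ?_⟩, ?_, ?_, ?_, ?_⟩,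
    by simpa using hlen⟩
  · have := k1.blobs
    rw [List.map_map] at this
    have e : (Prod.fst ∘ liftPass : Fin 69 × Fin 3 × Fin 3 → Option (Fin 69)) = some ∘ Prod.fst := rfl
    rw [e, ← List.map_map] at this
    exact this.of_map
  · have := k1.entries
    rwa [List.map_map] at this
  · intro hmem
    have : some (⟨s / 3, hs3⟩ : Fin 69) ∈ (qs.map liftPass).map Prod.fst := by
      obtain ⟨q, hq, hq'⟩ := List.mem_map.1 hmem
      rw [List.map_map]
      exact List.mem_map.2 ⟨q, hq, congrArg some hq'⟩
    rw [k2] at this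
    change blobs.testBit (s / 3) = true at this
    rw [h4] at this
    cases this
  · intro i hi huse
    rw [← routeUses_liftPass, k3, hloc] at huse
    rcases (h8 i i.2).2 with h | h
    · refine hi (Fin.ext ?_)
      have : stateExit s b < 3 := Nat.mod_lt _ (by omega)
      simp only [Fin.ofNat]
      omega
    · rw [huse] at h
      cases h
  · intro i k hik
    have := (h8 i i.2).1
    rw [← hloc, hik] at this
    simp only [cubicCode] at this
    omega
  · intro k huse
    rw [← routeUses_liftPass, k3] at huse
    fin_cases k
    · exact absurd huse (by rw [show cubicCode (Sum.inr _) = 102 from rfl, h5]; simp)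
    · exact absurd huse (by rw [show cubicCode (Sum.inr _) = 103 from rfl, h6]; simp)
    · exact absurd huse (by rw [show cubicCode (Sum.inr _) = 104 from rfl, h7]; simp)

end CubicConsequences

/-! ### From graphs on arbitrary vertex sets to the smallest orders -/

section Orders

variable {V : Type*} {G : SimpleGraph V}

/-- Planarity is invariant under isomorphism. -/
theorem IsPlanarGraph.of_iso {W : Type*} {H : SimpleGraph W} (φ : H ≃g G) (h : IsPlanarGraph G) :
    IsPlanarGraph H := by
  obtain ⟨d⟩ := h
  have hedge : ∀ e ∈ H.edgeSet, e.map φ ∈ G.edgeSet := by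
    intro e
    induction e with | _ a b
    exact fun he => φ.map_adj_iff.2 he
  refine ⟨⟨d.pos ∘ φ, fun e => d.arc (e.map φ), d.pos_injective.comp φ.injective, ?_, ?_, ?_⟩⟩
  · intro u v huv
    exact d.arc_simple _ _ (φ.map_adj_iff.2 huv)
  · intro e he w hw
    obtain ⟨a, ha, haw⟩ := Sym2.mem_map.1 (d.arc_vertex _ (hedge e he) _ hw)
    exact φ.injective haw ▸ ha
  · intro e he f hf hef p hp
    obtain ⟨w, h1, h2, h3⟩ := d.arc_inter _ (hedge e he) _ (hedge f hf)
      ((Sym2.map.injective φ.injective).ne hef) p hp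
    obtain ⟨a, ha, rfl⟩ := Sym2.mem_map.1 h1
    obtain ⟨b, hb, hab⟩ := Sym2.mem_map.1 h2
    exact ⟨a, ha, φ.injective hab ▸ hb, h3⟩

theorem ConnOff.of_iso {W : Type*} {H : SimpleGraph W} (φ : H ≃g G) {S : Finset W}
    (h : ConnOff G (S.map φ.toEquiv.toEmbedding)) : ConnOff H S := by
  intro f hf a b ha hb
  have hS : ∀ x, x ∉ S.map φ.toEquiv.toEmbedding → φ.symm x ∉ S := fun x hx hx' =>
    hx (mem_map.2 ⟨_, hx', φ.apply_symm_apply x⟩)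
  have := h (fun x => f (φ.symm x)) (fun x y hxy hx hy =>
    hf _ _ (φ.symm.map_adj_iff.2 hxy) (hS x hx) (hS y hy)) (φ a) (φ b)
    (fun h => ha ((mem_map' _).1 h)) (fun h => hb ((mem_map' _).1 h))
  simpa using this

theorem isKConnected_of_iso {k n : ℕ} (hk : k < n)
    (h : ∀ S : Finset V, S.card < k → ConnOff G S) {H : SimpleGraph (Fin n)} (φ : H ≃g G) :
    IsKConnected k H :=
  isKConnected_of_connOff (by rwa [Fintype.card_fin]) fun S hS =>
    ConnOff.of_iso φ (h _ (by rwa [card_map]))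

/-- A bound for the smallest order from a graph on an arbitrary vertex set. -/
theorem planarCycleOrder_le [Fintype V] {n i L : ℕ} (hn : Fintype.card V = n) (h3 : 3 < n)
    (hplanar : IsPlanarGraph G) (hconn : ∀ S : Finset V, S.card < 3 → ConnOff G S)
    (hle : ∀ (v : V) (c : G.Walk v v), c.IsCycle → c.length ≤ L)
    (hav : ∀ S : Finset V, S.card = i →
      ∃ (v : V) (c : G.Walk v v), c.IsCycle ∧ c.length = L ∧ ∀ x ∈ S, x ∉ c.support) :
    planarCycleOrder i 3 ≤ n := by
  let e : Fin n ≃ V := (Fintype.equivFinOfCardEq hn).symm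
  let φ : G.comap e ≃g G := SimpleGraph.Iso.comap e G
  -- The length L is an upper bound for all cycles and is attained, so the cycles of length L are
  -- the longest ones.
  refine iInf₂_le n ⟨G.comap e, hplanar.of_iso φ, isKConnected_of_iso h3 hconn φ, ?_⟩
  intro S hS
  obtain ⟨v, c, hc, hlen, hout⟩ := hav (S.map e.toEmbedding) (by rwa [card_map])
  refine ⟨_, c.map φ.symm.toHom, ⟨?_, fun w d hd => ?_⟩, fun x hx hx' => ?_⟩
  · exact (SimpleGraph.Walk.isCycle_map_iff_of_injective φ.symm.injective).2 hc
  · have := hle _ _ ((SimpleGraph.Walk.isCycle_map_iff_of_injective (f := φ.toHom)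
      φ.injective).2 hd)
    rw [SimpleGraph.Walk.length_map] at this
    rw [SimpleGraph.Walk.length_map, hlen]
    exact this
  · rw [SimpleGraph.Walk.support_map] at hx'
    obtain ⟨y, hy, rfl⟩ := List.mem_map.1 hx'
    exact hout y (mem_map.2 ⟨_, hx, φ.apply_symm_apply y⟩) hy

/-- A bound for the smallest order from a graph on an arbitrary vertex set. -/
theorem planarPathOrder_le [Fintype V] {n i L : ℕ} (hn : Fintype.card V = n) (h3 : 3 < n)
    (hplanar : IsPlanarGraph G) (hconn : ∀ S : Finset V, S.card < 3 → ConnOff G S)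
    (hle : ∀ (u v : V) (p : G.Walk u v), p.IsPath → p.length ≤ L)
    (hav : ∀ S : Finset V, S.card = i →
      ∃ (u v : V) (p : G.Walk u v), p.IsPath ∧ p.length = L ∧ ∀ x ∈ S, x ∉ p.support) :
    planarPathOrder i 3 ≤ n := by
  let e : Fin n ≃ V := (Fintype.equivFinOfCardEq hn).symm
  let φ : G.comap e ≃g G := SimpleGraph.Iso.comap e G
  refine iInf₂_le n ⟨G.comap e, hplanar.of_iso φ, isKConnected_of_iso h3 hconn φ, ?_⟩
  intro S hS
  obtain ⟨u, v, p, hp, hlen, hout⟩ := hav (S.map e.toEmbedding) (by rwa [card_map])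
  refine ⟨_, _, p.map φ.symm.toHom, ⟨?_, fun x y q hq => ?_⟩, fun x hx hx' => ?_⟩
  · exact hp.map φ.symm.injective
  · have := hle _ _ _ (hq.map (f := φ.toHom) φ.injective)
    rw [SimpleGraph.Walk.length_map] at this
    rw [SimpleGraph.Walk.length_map, hlen]
    exact this
  · rw [SimpleGraph.Walk.support_map] at hx'
    obtain ⟨y, hy, rfl⟩ := List.mem_map.1 hx'
    exact hout y (mem_map.2 ⟨_, hx, φ.apply_symm_apply y⟩) hy

end Orders

/-! ### The four bounds -/

section Bounds

open EdgeSet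

theorem card_oddVerts_walkEdges_le {V E : Type*} [Fintype V] [Fintype E] [DecidableEq V]
    [DecidableEq E] {en : E → V × V} (hen : IsSimpleList en) {u v : V}
    {p : (edgeGraph en).Walk u v} (hp : p.IsPath) :
    (oddVerts (incEdges en) (walkEdges en p)).card ≤ 2 := by
  refine (card_le_card fun x hx => ?_).trans (card_le_two (a := u) (b := v))
  have hd := deg_walkEdges hen hp x
  simp only [oddVerts, mem_filter, mem_univ, true_and] at hx
  rw [mem_insert, mem_singleton]
  by_contra hno
  push Not at hno
  rw [if_neg hno.1, if_neg hno.2] at hd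
  obtain ⟨k, hk⟩ := hx
  split_ifs at hd <;> omega

theorem deg_walkEdges_le {V E : Type*} [Fintype E] [DecidableEq V]
    [DecidableEq E] {en : E → V × V} (hen : IsSimpleList en) {u v : V}
    {p : (edgeGraph en).Walk u v} (hp : p.IsPath) (x : V) :
    deg (incEdges en) (walkEdges en p) x ≤ 2 := by
  have hd := deg_walkEdges hen hp x
  split_ifs at hd <;> omega

/-- The edge sets of the default paths of a gadget. -/
theorem exists_default_edges {I EB : Type*} [Fintype I] [Fintype EB] [DecidableEq I]
    [DecidableEq EB] {en : EB → (Fin 3 ⊕ I) × (Fin 3 ⊕ I)} (hen : IsSimpleList en) {n : ℕ}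
    (hB : HasGadgetPaths en n) (i j : Fin 3) (hij : i ≠ j) :
    ∃ Q, IsAcyclic (incEdges en) Q ∧ (∀ a, deg (incEdges en) Q a ≤ 2) ∧
      oddVerts (incEdges en) Q = {Sum.inl i, Sum.inl j} ∧
      (∀ k, k ≠ i → k ≠ j → deg (incEdges en) Q (Sum.inl k) = 0) ∧ Q.card = n + 1 := by
  obtain ⟨M, hM, hlen, hk⟩ := hB.default i j hij
  obtain ⟨u, v, p, hp, hplen, hsup⟩ := exists_isPath_of_list (by simp) hM.1 hM.2
  have hu : u = Sum.inl i := by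
    have := p.head_support
    simpa [hsup] using this.symm
  have hv : v = Sum.inl j := by
    have := p.getLast_support
    simp only [hsup] at this
    simpa using this.symm
  subst hu hv
  refine ⟨walkEdges en p, isAcyclic_walkEdges hen hp, deg_walkEdges_le hen hp, ?_, ?_, ?_⟩
  · ext x
    have hd := deg_walkEdges hen hp x
    have hne : (Sum.inl i : Fin 3 ⊕ I) ≠ Sum.inl j := by simpa using hij
    simp only [oddVerts, mem_filter, mem_univ, true_and, mem_insert, mem_singleton]
    by_cases h1 : x = Sum.inl i
    · subst h1
      rw [if_pos rfl, if_neg hne, if_pos p.start_mem_support] at hd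
      simp only [true_or, iff_true]
      exact ⟨0, by omega⟩
    · by_cases h2 : x = Sum.inl j
      · subst h2
        rw [if_neg h1, if_pos rfl, if_pos p.end_mem_support] at hd
        simp only [or_true, iff_true]
        exact ⟨0, by omega⟩
      · rw [if_neg h1, if_neg h2] at hd
        simp only [h1, h2, or_self, iff_false, Nat.not_odd_iff_even]
        split_ifs at hd
        · exact ⟨1, by omega⟩
        · exact ⟨0, by omega⟩
  · intro k hki hkj
    have hd := deg_walkEdges hen hp (Sum.inl k)
    have hout : Sum.inl k ∉ p.support := by
      rw [hsup]
      simp [hki, hkj, hk k]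
    rw [if_neg hout] at hd
    omega
  · rw [card_walkEdges hen hp.isTrail]
    simp only [List.length_cons, List.length_append, List.length_nil, hlen] at hplen
    omega

theorem planarCycleOrder_one_le : planarCycleOrder 1 3 ≤ 40 := by
  refine planarCycleOrder_le (G := edgeGraph (closedEnds gadgetEnds)) (L := 39) rfl (by norm_num)
    (isPlanarGraph_closed isGadgetDrawing_gadget isSimpleList_closedGadget)
    (fun S hS => connOff_closedGadget hS) (fun v c hc => ?_) fun S hS => ?_
  · rw [← card_walkEdges isSimpleList_closedGadget hc.isTrail]
    exact card_circuit_gadget_le (isCircuit_walkEdges isSimpleList_closedGadget hc)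
  · obtain ⟨w, rfl⟩ := card_eq_one.1 hS
    obtain ⟨y, hy, rfl⟩ := exists_closedVert w
    obtain ⟨h1, h2, h3, h4⟩ := cycle_of_cycleTest hy (gadgetHamiltonian_test y hy)
    have hlen : (gadgetHamiltonian y).length = 39 := by
      rw [gadgetHamiltonian]
      split_ifs <;> simp [length_unpack]
    generalize gadgetHamiltonian y = l at h1 h2 h3 h4 hlen
    cases l with
    | nil => simp at hlen
    | cons a l =>
      obtain ⟨c, hc, hclen, hsup⟩ := exists_isCycle_of_list (G := edgeGraph (closedEnds gadgetEnds))
        (a := closedVert a) (l := l.map closedVert) (by simpa using h4) (by simpa using h3)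
        (by simp at hlen ⊢; omega)
      refine ⟨_, c, hc, ?_, ?_⟩
      · rw [hclen]
        simp at hlen ⊢
        omega
      · simp only [mem_singleton, forall_eq]
        intro hmem
        have := hsup _ hmem
        rw [← List.map_cons] at this
        obtain ⟨x, hx, hxy⟩ := List.mem_map.1 this
        obtain rfl := closedVert_injOn x (h1 x hx) y hy hxy
        exact (h2 x hy).1 hx rfl

theorem planarCycleOrder_two_le : planarCycleOrder 2 3 ≤ 2625 := by
  have hsimple := isCubicIncidence_cubicLoc.isSimpleList isSimpleList_gadgetEnds
  -- The longest cycles follow a 69-cycle of the cubic graph, with 37 edges in each gadget; a cycle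
  -- inside one gadget has at most 39 edges and does not matter.
  refine planarCycleOrder_le (G := edgeGraph (blowEnds gadgetEnds (termOne cubicLoc)))
    (L := 69 * 37) (by simp) (by norm_num)
    (isPlanarGraph_blow isGadgetDrawing_gadget isComplex_sphere cross_sphere_ne hsimple)
    (fun S hS => connOff_blow isCubicIncidence_cubicLoc (fun S hS => connOff_closedGadget hS)
      (fun X hX => cubicConn_edges hX) cubicConn_vert hS) (fun v c hc => ?_) fun S hS => ?_
  · rw [← card_walkEdges hsimple hc.isTrail]
    have := card_circuit_blow_le isCubicIncidence_cubicLoc isSimpleList_gadgetEnds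
      (fun D hD => card_circuit_gadget_le hD) (fun C hC => card_circuit_cubic_le hC)
      (isCircuit_walkEdges hsimple hc)
    rw [Fintype.card_fin] at this
    omega
  · obtain ⟨w, w', -, rfl⟩ := card_eq_two.1 hS
    obtain ⟨ps, g, ⟨c, hc, rfl⟩, hg, h1, h2⟩ := exists_choice_avoiding isCubicIncidence_cubicLoc.inj
      hasGadgetPaths_gadgetEnds (𝒞 := InTours cubicCycles)
      (fun ps ⟨c, hc, h⟩ => h ▸ (cycleTour_spec hc).1.tour) (avoidable_cubic (targetOf w)
        (targetOf w'))
    obtain ⟨a, d, hd, hlen, hsup⟩ := exists_isCycle_of_choice isCubicIncidence_cubicLoc.inj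
      (cycleTour_spec hc).1.tour hg (by rw [length_cycleTour]; norm_num)
    refine ⟨a, d, hd, by rw [hlen, length_cycleTour], fun x hx hxd => ?_⟩
    rw [mem_insert, mem_singleton] at hx
    rcases hx with rfl | rfl
    · exact h1 (hsup _ hxd)
    · exact h2 (hsup _ hxd)

theorem planarPathOrder_one_le : planarPathOrder 1 3 ≤ 156 := by
  have hsimple := isSimpleList_linkedEnds isSimpleList_gadgetEnds
  -- The longest paths have 38 edges in each end gadget, 37 in each middle one, and three links.
  refine planarPathOrder_le (G := edgeGraph (linkedEnds gadgetEnds)) (L := 4 * 36 + 9) rfl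
    (by norm_num) (isPlanarGraph_linked isGadgetDrawing_gadget hsimple)
    (fun S hS => connOff_linked (fun S hS => connOff_closedGadget hS) hS)
    (fun u v p hp => ?_) fun S hS => ?_
  · rw [← card_walkEdges hsimple hp.isTrail]
    exact card_path_linked_le isSimpleList_gadgetEnds (fun D hD => card_circuit_gadget_le hD)
      (isAcyclic_walkEdges hsimple hp) (deg_walkEdges_le hsimple hp)
      (card_oddVerts_walkEdges_le hsimple hp)
  · obtain ⟨w, rfl⟩ := card_eq_one.1 hS
    obtain ⟨x, y, p, hp, hlen, hw⟩ := exists_linked_path hasGadgetPaths_gadgetEnds w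
    exact ⟨x, y, p, hp, hlen, by simpa using hw⟩

theorem planarPathOrder_two_le : planarPathOrder 2 3 ≤ 10350 := by
  have hsimple := isCubicIncidence_cubicLoc.termFour.isSimpleList isSimpleList_gadgetEnds
  obtain ⟨P, hP, hnd⟩ := exists_isComplex_termFour (by norm_num) isComplex_patch cross_patch_ne
    patch_corner patch_std
  obtain ⟨hk1, hk2⟩ := cubicConn_termFour isCubicIncidence_cubicLoc (fun X hX => cubicConn_edges hX)
    cubicConn_vert (fun X hX => cubicConn_last hX)
  refine planarPathOrder_le (G := edgeGraph (blowEnds gadgetEnds (termFour cubicLoc)))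
    (L := (4 * 69 - 2) * 37 + 2) (by simp) (by norm_num)
    (isPlanarGraph_blow isGadgetDrawing_gadget hP hnd hsimple)
    (fun S hS => connOff_blow isCubicIncidence_cubicLoc.termFour
      (fun S hS => connOff_closedGadget hS) hk1 hk2 hS) (fun u v p hp => ?_) fun S hS => ?_
  · rw [← card_walkEdges hsimple hp.isTrail]
    have := card_path_four_le isCubicIncidence_cubicLoc isSimpleList_gadgetEnds
      (fun D hD => card_circuit_gadget_le hD) (fun C hC => by
        rw [Fintype.card_fin]
        exact card_circuit_cubic_le hC) (by rw [Fintype.card_fin]; norm_num)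
      (fun i j hij => by
        rw [Fintype.card_fin]
        exact exists_default_edges isSimpleList_gadgetEnds hasGadgetPaths_gadgetEnds i j hij)
      (isAcyclic_walkEdges hsimple hp) (deg_walkEdges_le hsimple hp)
      (card_oddVerts_walkEdges_le hsimple hp)
    simpa only [Fintype.card_fin] using this
  · obtain ⟨w, w', -, rfl⟩ := card_eq_two.1 hS
    -- In a middle copy the path traverses 68 of the 69 gadgets. In an end copy it traverses all of
    -- them, the first by a Hamiltonian path with 38 edges. Twice the sum of both is 274 * 37 + 2.
    obtain ⟨x, y, p, hp, hlen, h1, h2⟩ := exists_four_path_avoiding (en := gadgetEnds)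
      (loc := cubicLoc) (N := 68 * 37) (N' := 68 * 37 + 38)
      (fun w w' h => exists_isInner isCubicIncidence_cubicLoc.inj hasGadgetPaths_gadgetEnds
        (𝒞 := InTours throughCycles) (fun ps ⟨c, hc, hps⟩ => hps ▸
          ⟨(cycleTour_spec (throughCycles_subset hc)).1.tour,
            cycleTour_through (throughCycles_subset hc) (ne_of_mem_throughCycles hc)⟩)
        (avoidable_through h))
      (fun j => by
        obtain ⟨u, o, qs, hqs, hlen⟩ := exists_isEndRoute j
        have := hqs.exists_isEndList (fun u => isCubicIncidence_cubicLoc.inj (some u))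
          hasGadgetPaths_gadgetEnds
        rwa [hlen] at this) w w'
    refine ⟨x, y, p, hp, by rw [hlen], fun z hz hzp => ?_⟩
    rw [mem_insert, mem_singleton] at hz
    rcases hz with rfl | rfl
    · exact h1 hzp
    · exact h2 hzp

end Bounds

end PlanarLongestCycles

theorem mainTheorem6 :
    planarCycleOrder 1 3 ≤ 40 ∧ planarCycleOrder 2 3 ≤ 2625 ∧
      planarPathOrder 1 3 ≤ 156 ∧ planarPathOrder 2 3 ≤ 10350 := by
  exact ⟨planarCycleOrder_one_le, planarCycleOrder_two_le, planarPathOrder_one_le,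
    planarPathOrder_two_le⟩
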